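/- **Setting.** Let $(\mathcal Z,\mathscr Z)$ be a measurable space with a $\sigma$-finite measure $\mu$, and let $\eta$ be a Poisson random measure on it with intensity $\mu$, defined on a probability space with probability $\mathbb P$ and expectation $\mathbb E$, and with values in the $\sigma$-finite measures that take values in $\mathbb N_0\cup\{\infty\}$. For $f\in L^2(\mu^q)$, $I_q(f)$ is the multiple Wiener–Itô integral of $f$ with respect to $\eta-\mu$, and ${\rm sym}(f)(z_1,\dots,z_q)=\frac1{q!}\sum_p f(z_{p(1)},\dots,z_{p(q)})$, the sum being over all permutations $p$ of $[q]=\{1,\dots,q\}$. If $F=\varphi(\eta)$ a.s. with $\varphi$ measurable (a representative of $F$), then $D^+_zF=\varphi(\eta+\delta_z)-\varphi(\eta)$ and $D^{(q)}_{z_1,\dots,z_q}F=D^+_{z_1}\cdots D^+_{z_q}F$. Let $m\ge 2$, $k_1,\dots,k_m\ge 1$, $K=k_1+\dots+k_m$, let $f_i\in L^2(\mu^{k_i})$ be symmetric ($\mu^{k_i}$-a.e.), and set $\Phi=\prod_{i=1}^m I_{k_i}(f_i)$. **Diagrams.** Given integers $k_i\ge0$ and functions $f_i$ of $k_i$ variables,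 $(f_1\otimes\dots\otimes f_m)(v_1,\dots,v_{K})=\prod_i f_i(v_{k_1+\dots+k_{i-1}+1},\dots,v_{k_1+\dots+k_i})$ with $K=\sum_i k_i$, and $\Pi(k_1,\dots,k_m)$ is the set of the partitions $\sigma$ of $[K]$ such that every block of $\sigma$ has at most one element in common with each of the consecutive intervals of $[K]$ of lengths $k_1,\dots,k_m$. Write $\sigma_1$ and $\sigma_{\ge2}$ for the sets of the blocks of $\sigma$ of size one and of size at least two. The function $(f_1\otimes\dots\otimes f_m)_\sigma$ of $|\sigma|$ variables is obtained from $f_1\otimes\dots\otimes f_m$ by identifying the variables $v_j$ whose indices are in the same block of $\sigma$. For $A\subseteq\sigma_{\ge2}$, the function $H(\sigma,A;f_1,\dots,f_m)$ of $|A|+|\sigma_1|$ variables is obtained from it by integrating with respect to $\mu$ the variables of the blocks in $\sigma_{\ge2}\setminus A$ and then symmetrizing in the variables of the blocks in $A\cup\sigma_1$. For $q\ge1$, $$h_q=\sum_{\substack{\sigma\in\Pi(k_1,\dots,k_m),\ A\subseteq\sigma_{\ge2}\\ |A|+|\sigma_1|=q}}H(\sigma,A;f_1,\dots,f_m).\qquad(\ast)$$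 **Condition A-(loc).** Kernels $g_1,\dots,g_m$ in $n_1,\dots,n_m\ge0$ variables satisfy Condition A if either all $n_i$ are $0$, or $g_i\in L^1(\mu^{n_i})$ for all $i$ and $(g_1\otimes\dots\otimes g_m)_\sigma\in L^1(\mu^{|\sigma|})$ for all $\sigma\in\Pi(n_1,\dots,n_m)$. The kernels $f_1,\dots,f_m$ satisfy Condition A-(loc) if, for all $q=1,\dots,K-1$, all non-empty $A_1,\dots,A_q\subseteq[m]$ such that $d_i:=|\{\ell:i\in A_\ell\}|\le k_i$ for all $i$, and $\mu^q$-almost all $(z_1,\dots,z_q)$, Condition A holds for the $m$ kernels in $k_i-d_i$ variables obtained from the $f_i$ by fixing $d_i$ of the arguments of $f_i$ to be the $z_\ell$ with $i\in A_\ell$. **Theorem. Part I.** The random variable $\Phi$ has a representative and, whatever the representative, the following are equivalent: (i) $\Phi\in L^2(\mathbb P)$; (ii) for all $q=1,\dots,K-1$, $D^{(q)}_{z_1,\dots,z_q}\Phi\in L^1(\mathbb P)$ for $\mu^q$-a.e. $(z_1,\dots,z_q)$, and $(z_1,\dots,z_q)\mapsto\mathbb E[D^{(q)}_{z_1,\dots,z_q}\Phi]$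 is in $L^2(\mu^q)$. If they hold, then $\Phi=\mathbb E[\Phi]+\sum_{q=1}^K I_q(g_q)$ a.s. for some symmetric $g_q\in L^2(\mu^q)$ and, in every such expansion, $g_K={\rm sym}(f_1\otimes\dots\otimes f_m)$ $\mu^K$-a.e. **Part II.** Assume Condition A-(loc). Then the integrals that define $H(\sigma,A;f_1,\dots,f_m)$ converge absolutely, almost everywhere, for all $\sigma\in\Pi(k_1,\dots,k_m)$ and $A\subseteq\sigma_{\ge2}$ with $|A|+|\sigma_1|\ge1$, and (i) and (ii) are equivalent to (iii) for all $q=1,\dots,K-1$, the function $h_q$ in $(\ast)$ is in $L^2(\mu^q)$. If these conditions hold then, for $q=1,\dots,K-1$, the kernel $g_q$ in the chaos expansion of $\Phi$ is $\mu^q$-a.e. equal to $h_q$. -/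

import Mathlib

open MeasureTheory ProbabilityTheory Filter Topology
open scoped ENNReal NNReal

noncomputable section

namespace PoissonChaos

/-! ### Poisson random measures and add-one costs -/

/-- `η` is a Poisson random measure on `Z` with intensity `μ`, defined on the probability space
`(Ω, P)`: a random element of the space of `σ`-finite measures with values in `ℕ ∪ {∞}`, whose
values on disjoint sets are independent, and such that `η(B)` has the Poisson law of mean `μ(B)`
(the Dirac mass at `∞` when `μ(B) = ∞`). -/
structure IsPoissonRandomMeasure {Ω Z : Type*} [MeasurableSpace Ω] [MeasurableSpace Z]
    (η : Ω → Measure Z) (μ : Measure Z) (P : Measure Ω) : Prop where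
  measurable : Measurable η
  sigmaFinite : ∀ ω, SigmaFinite (η ω)
  integerValued : ∀ ω (B : Set Z), MeasurableSet B → ∃ n : ℕ∞, η ω B = (n : ℝ≥0∞)
  indep : ∀ (n : ℕ) (B : Fin n → Set Z), (∀ i, MeasurableSet (B i)) →
    Pairwise (Function.onFun Disjoint B) → iIndepFun (fun i ω => η ω (B i)) P
  law_finite : ∀ B : Set Z, MeasurableSet B → μ B ≠ ∞ →
    HasLaw (fun ω => η ω B)
      ((poissonMeasure (μ B).toNNReal).map (fun n : ℕ => (n : ℝ≥0∞))) P
  law_infinite : ∀ B : Set Z, MeasurableSet B → μ B = ∞ → ∀ᵐ ω ∂P, η ω B = ∞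

/-- The product measure `μ^q` on `Z^q`. -/
abbrev power {Z : Type*} [MeasurableSpace Z] (μ : Measure Z) (q : ℕ) : Measure (Fin q → Z) :=
  Measure.pi fun _ : Fin q => μ

/-- `φ` is a representative of the random variable `F`, that is, `F = φ(η)` almost surely. -/
def IsRepresentative {Ω Z : Type*} [MeasurableSpace Ω] [MeasurableSpace Z]
    (η : Ω → Measure Z) (P : Measure Ω) (F : Ω → ℝ) (φ : Measure Z → ℝ) : Prop :=
  Measurable φ ∧ F =ᵐ[P] fun ω => φ (η ω)

/-- The add-one cost operator `D⁺_z`, acting on representatives. -/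
def addOneCost {Z : Type*} [MeasurableSpace Z] (z : Z) (φ : Measure Z → ℝ) : Measure Z → ℝ :=
  fun χ => φ (χ + Measure.dirac z) - φ χ

/-- The iterated add-one cost `D^{(q)}_{z_1,…,z_q} = D⁺_{z_1} ⋯ D⁺_{z_q}`. -/
def iteratedAddOneCost {Z : Type*} [MeasurableSpace Z] (φ : Measure Z → ℝ) :
    (q : ℕ) → (Fin q → Z) → Measure Z → ℝ
  | 0, _ => φ
  | q + 1, z => addOneCost (z 0) (iteratedAddOneCost φ q (Fin.tail z))

/-! ### Multiple Wiener–Itô integrals -/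

/-- The (monic) Charlier polynomial
`C_n(x ; t) = ∑_j (n choose j) (-t)^{n-j} x (x-1) ⋯ (x-j+1)`. -/
def charlier (n : ℕ) (t x : ℝ) : ℝ :=
  ∑ j ∈ Finset.range (n + 1),
    (n.choose j : ℝ) * (-t) ^ (n - j) * ∏ i ∈ Finset.range j, (x - i)

/-- A step kernel in `k` variables: a linear combination of indicators of the boxes
`B_{α(1)} × ⋯ × B_{α(k)}`, where `B_1, …, B_r` are disjoint sets of finite `μ`-measure. Diagonal
boxes are allowed, so that `μ` may have atoms. -/
structure StepKernel {Z : Type*} [MeasurableSpace Z] (μ : Measure Z) (k : ℕ) where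
  r : ℕ
  B : Fin r → Set Z
  measurableSet : ∀ j, MeasurableSet (B j)
  finite : ∀ j, μ (B j) ≠ ∞
  disjoint : Pairwise (Function.onFun Disjoint B)
  coeff : (Fin k → Fin r) → ℝ

/-- The function on `Z^k` given by a step kernel. -/
def StepKernel.toFun {Z : Type*} [MeasurableSpace Z] {μ : Measure Z} {k : ℕ}
    (s : StepKernel μ k) (z : Fin k → Z) : ℝ :=
  ∑ α : Fin k → Fin s.r, s.coeff α * ∏ l, (s.B (α l)).indicator (fun _ => (1 : ℝ)) (z l)

/-- The multiple integral of a step kernel with respect to the compensated measure `χ - μ`,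
evaluated at the point configuration `χ`. The integral of the indicator of a box in which the set
`B_j` is repeated `n_j` times (`j = 1, …, r`) is `∏_j C_{n_j}(χ(B_j) ; μ(B_j))`; this is
`∏_j (χ - μ)(B_j)` if no set is repeated. -/
def StepKernel.integral {Z : Type*} [MeasurableSpace Z] {μ : Measure Z} {k : ℕ}
    (s : StepKernel μ k) (χ : Measure Z) : ℝ :=
  ∑ α : Fin k → Fin s.r, s.coeff α *
    ∏ j, charlier (Finset.univ.filter fun l => α l = j).card (μ (s.B j)).toReal (χ (s.B j)).toReal

/-- `F` is a version of the multiple Wiener–Itô integral `I_k(f)`: it is the limit in `L²(P)` of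
the integrals of step kernels which converge to `f` in `L²(μ^k)`. -/
def IsMultipleIntegral {Ω Z : Type*} [MeasurableSpace Ω] [MeasurableSpace Z]
    (η : Ω → Measure Z) (μ : Measure Z) (P : Measure Ω) {k : ℕ} (f : (Fin k → Z) → ℝ)
    (F : Ω → ℝ) : Prop :=
  MemLp F 2 P ∧ ∃ s : ℕ → StepKernel μ k,
    Tendsto (fun n => eLpNorm (fun z => (s n).toFun z - f z) 2 (power μ k)) atTop (𝓝 0) ∧
    Tendsto (fun n => eLpNorm (fun ω => (s n).integral (η ω) - F ω) 2 P) atTop (𝓝 0)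

/-- The multiple Wiener–Itô integral `I_k(f)` of `f ∈ L²(μ^k)` (a version of it, since it is only
defined up to almost sure equality). -/
def multipleIntegral {Ω Z : Type*} [MeasurableSpace Ω] [MeasurableSpace Z]
    (η : Ω → Measure Z) (μ : Measure Z) (P : Measure Ω) {k : ℕ} (f : (Fin k → Z) → ℝ) : Ω → ℝ :=
  Classical.epsilon (IsMultipleIntegral η μ P f)

/-- The product `Φ = I_{k_1}(f_1) ⋯ I_{k_m}(f_m)`. -/
def productOfIntegrals {Ω Z : Type*} [MeasurableSpace Ω] [MeasurableSpace Z]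
    (η : Ω → Measure Z) (μ : Measure Z) (P : Measure Ω) {m : ℕ} (k : Fin m → ℕ)
    (f : (i : Fin m) → (Fin (k i) → Z) → ℝ) : Ω → ℝ :=
  fun ω => ∏ i, multipleIntegral η μ P (f i) ω

/-! ### Symmetric kernels and chaos expansions -/

/-- `f` is symmetric, `μ^q`-almost everywhere. -/
def IsAESymmetric {Z : Type*} [MeasurableSpace Z] (μ : Measure Z) {q : ℕ}
    (f : (Fin q → Z) → ℝ) : Prop :=
  ∀ p : Equiv.Perm (Fin q), (fun z => f (fun l => z (p l))) =ᵐ[power μ q] f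

/-- The symmetrization of a function of `q` variables. -/
def sym {Z : Type*} {q : ℕ} (f : (Fin q → Z) → ℝ) : (Fin q → Z) → ℝ :=
  fun z => (q.factorial : ℝ)⁻¹ * ∑ p : Equiv.Perm (Fin q), f (fun l => z (p l))

/-- `F = E[F] + ∑_{q=1}^K I_q(h_q)` almost surely, with symmetric kernels `h_q ∈ L²(μ^q)`. -/
def IsChaosExpansion {Ω Z : Type*} [MeasurableSpace Ω] [MeasurableSpace Z]
    (η : Ω → Measure Z) (μ : Measure Z) (P : Measure Ω) (F : Ω → ℝ) (K : ℕ)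
    (h : (q : ℕ) → (Fin q → Z) → ℝ) : Prop :=
  (∀ q, 1 ≤ q → q ≤ K → MemLp (h q) 2 (power μ q) ∧ IsAESymmetric μ (h q)) ∧
  F =ᵐ[P] fun ω => (∫ ω', F ω' ∂P) + ∑ q ∈ Finset.Icc 1 K, multipleIntegral η μ P (h q) ω

/-- For all `q = 1, …, K - 1`, the iterated add-one cost `D^{(q)}_{z_1,…,z_q} F` (where
`F = φ(η)`) is integrable for `μ^q`-almost all `(z_1, …, z_q)`, and its expectation is an element
of `L²(μ^q)` as a function of `(z_1, …, z_q)`. -/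
def HasSquareIntegrableMeanCosts {Ω Z : Type*} [MeasurableSpace Ω] [MeasurableSpace Z]
    (η : Ω → Measure Z) (μ : Measure Z) (P : Measure Ω) (φ : Measure Z → ℝ) (K : ℕ) : Prop :=
  ∀ q, 1 ≤ q → q < K →
    (∀ᵐ z ∂(power μ q), Integrable (fun ω => iteratedAddOneCost φ q z (η ω)) P) ∧
    MemLp (fun z => ∫ ω, iteratedAddOneCost φ q z (η ω) ∂P) 2 (power μ q)

/-! ### Diagrams -/

/-- The tensor product `f_1 ⊗ ⋯ ⊗ f_m`, a function of `K = k_1 + ⋯ + k_m` variables: `f_1` is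
evaluated at the first `k_1` variables, `f_2` at the next `k_2` variables, and so on. -/
def tensor {Z : Type*} {m : ℕ} (k : Fin m → ℕ) (f : (i : Fin m) → (Fin (k i) → Z) → ℝ) :
    (Fin (∑ i, k i) → Z) → ℝ :=
  fun v => ∏ i, f i (fun l => v (finSigmaFinEquiv ⟨i, l⟩))

/-- The partitions of `[K]`, `K = k_1 + ⋯ + k_m`. -/
abbrev Diagram {m : ℕ} (k : Fin m → ℕ) : Type :=
  Finpartition (Finset.univ : Finset (Fin (∑ i, k i)))

/-- `σ ∈ Π(k_1, …, k_m)`: every block of `σ` has at most one element in common with each of the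
consecutive blocks of `[K]` of lengths `k_1, …, k_m`. -/
def IsNonFlat {m : ℕ} (k : Fin m → ℕ) (σ : Diagram k) : Prop :=
  ∀ b ∈ σ.parts, ∀ i : Fin m,
    (b ∩ Finset.univ.image fun l : Fin (k i) => finSigmaFinEquiv ⟨i, l⟩).card ≤ 1

/-- The function `(f_1 ⊗ ⋯ ⊗ f_m)_σ` in `|σ|` variables, indexed by the blocks of `σ`, obtained from
`f_1 ⊗ ⋯ ⊗ f_m` by identifying the variables in the same block of `σ`. -/
def identify {Z : Type*} {m : ℕ} (k : Fin m → ℕ) (f : (i : Fin m) → (Fin (k i) → Z) → ℝ)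
    (σ : Diagram k) (w : {b // b ∈ σ.parts} → Z) : ℝ :=
  tensor k f fun j => w ⟨σ.part j, σ.part_mem.2 (Finset.mem_univ j)⟩

/-- The blocks of size at least two of `σ`. -/
def bigBlocks {m : ℕ} {k : Fin m → ℕ} (σ : Diagram k) : Finset (Finset (Fin (∑ i, k i))) :=
  σ.parts.filter fun b => 2 ≤ b.card

/-- The singletons of `σ`. -/
def singletons {m : ℕ} {k : Fin m → ℕ} (σ : Diagram k) : Finset (Finset (Fin (∑ i, k i))) :=
  σ.parts.filter fun b => b.card = 1

/-- The blocks of `A ∪ σ_1`, whose variables are not integrated in `H(σ, A ; f_1, …, f_m)`. -/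
abbrev FreeBlock {m : ℕ} {k : Fin m → ℕ} (σ : Diagram k)
    (A : Finset (Finset (Fin (∑ i, k i)))) : Type :=
  {b : {b // b ∈ σ.parts} // b.1 ∈ A ∪ singletons σ}

/-- The blocks of `σ_{≥2} \ A`, whose variables are integrated in `H(σ, A ; f_1, …, f_m)`. -/
abbrev IntegratedBlock {m : ℕ} {k : Fin m → ℕ} (σ : Diagram k)
    (A : Finset (Finset (Fin (∑ i, k i)))) : Type :=
  {b : {b // b ∈ σ.parts} // b.1 ∉ A ∪ singletons σ}

/-- The function `(f_1 ⊗ ⋯ ⊗ f_m)_σ`, with its variables split into the free ones (`x`) and those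
to be integrated (`y`). -/
def splitKernel {Z : Type*} {m : ℕ} (k : Fin m → ℕ) (f : (i : Fin m) → (Fin (k i) → Z) → ℝ)
    (σ : Diagram k) (A : Finset (Finset (Fin (∑ i, k i))))
    (x : FreeBlock σ A → Z) (y : IntegratedBlock σ A → Z) : ℝ :=
  identify k f σ fun b => if hb : b.1 ∈ A ∪ singletons σ then x ⟨b, hb⟩ else y ⟨b, hb⟩

open Classical in
/-- The function `H(σ, A ; f_1, …, f_m)` of `q = |A| + |σ_1|` variables: the blocks of
`σ_{≥2} \ A` are integrated, and the result is symmetrized in the variables of the blocks in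
`A ∪ σ_1`, by averaging over all the labellings of these blocks by `1, …, q`. -/
def H {Z : Type*} [MeasurableSpace Z] (μ : Measure Z) {m : ℕ} (k : Fin m → ℕ)
    (f : (i : Fin m) → (Fin (k i) → Z) → ℝ) (σ : Diagram k)
    (A : Finset (Finset (Fin (∑ i, k i)))) (q : ℕ) (z : Fin q → Z) : ℝ :=
  (q.factorial : ℝ)⁻¹ * ∑ e : FreeBlock σ A ≃ Fin q,
    ∫ y, splitKernel k f σ A (fun b => z (e b)) y ∂(Measure.pi fun _ : IntegratedBlock σ A => μ)

open Classical in
/-- The kernel `h_q`: the sum of `H(σ, A ; f_1, …, f_m)` over all `σ ∈ Π(k_1, …, k_m)` and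
`A ⊆ σ_{≥2}` such that `|A| + |σ_1| = q`. -/
def diagramKernel {Z : Type*} [MeasurableSpace Z] (μ : Measure Z) {m : ℕ} (k : Fin m → ℕ)
    (f : (i : Fin m) → (Fin (k i) → Z) → ℝ) (q : ℕ) (z : Fin q → Z) : ℝ :=
  ∑ σ ∈ (Finset.univ : Finset (Diagram k)).filter (IsNonFlat k),
    ∑ A ∈ (bigBlocks σ).powerset.filter fun A => A.card + (singletons σ).card = q,
      H μ k f σ A q z

/-! ### Integrability conditions on the kernels -/

/-- Condition A for kernels `f_i` in `k_i ≥ 0` variables: either all the `k_i` are zero, or each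
`f_i` is integrable, and so is `(f_1 ⊗ ⋯ ⊗ f_m)_σ` for every `σ ∈ Π(k_1, …, k_m)`. -/
def ConditionA {Z : Type*} [MeasurableSpace Z] (μ : Measure Z) {m : ℕ} (k : Fin m → ℕ)
    (f : (i : Fin m) → (Fin (k i) → Z) → ℝ) : Prop :=
  (∀ i, k i = 0) ∨
  ((∀ i, Integrable (f i) (power μ (k i))) ∧
    ∀ σ : Diagram k, IsNonFlat k σ →
      Integrable (identify k f σ) (Measure.pi fun _ : {b // b ∈ σ.parts} => μ))

/-- For a word `W = (A_1, …, A_q)` of subsets of `[m]`, the set of all `l` such that `i ∈ A_l`. -/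
def positions {m q : ℕ} (W : Fin q → Finset (Fin m)) (i : Fin m) : Finset (Fin q) :=
  Finset.univ.filter fun l => i ∈ W l

/-- The section of `g` obtained by fixing its first `|S|` arguments to be the `z_l` with `l ∈ S`. -/
def fixVariables {Z : Type*} {n q : ℕ} (g : (Fin n → Z) → ℝ) (S : Finset (Fin q))
    (z : Fin q → Z) : (Fin (n - S.card) → Z) → ℝ :=
  fun a => g fun l =>
    if h : l.1 < S.card then z (S.orderEmbOfFin rfl ⟨l.1, h⟩)
    else a ⟨l.1 - S.card, by omega⟩

/-- Condition A-(loc): for every `q = 1, …, K - 1` and every word `W = (A_1, …, A_q)` of non-empty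
subsets of `[m]` such that each `i` is in at most `k_i` of the `A_l`, and for `μ^q`-almost all
`(z_1, …, z_q)`, Condition A holds for the kernels obtained by fixing, in each `f_i`, as many
arguments to be the `z_l` with `i ∈ A_l`. -/
def ConditionALoc {Z : Type*} [MeasurableSpace Z] (μ : Measure Z) {m : ℕ} (k : Fin m → ℕ)
    (f : (i : Fin m) → (Fin (k i) → Z) → ℝ) : Prop :=
  ∀ q, 1 ≤ q → q < ∑ i, k i → ∀ W : Fin q → Finset (Fin m), (∀ l, (W l).Nonempty) →
    (∀ i, (positions W i).card ≤ k i) →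
    ∀ᵐ z ∂(power μ q), ConditionA μ (fun i => k i - (positions W i).card)
      (fun i => fixVariables (f i) (positions W i) z)

end PoissonChaos

end

/-! Everything is transferred to the law `Q` of `η`. A functional `ψ` with `ψ(η) = I_k(f)` is
described by its kernel `t`, a function on finite multisets of points: `t(z_1,…,z_k) = k!
sym(f)(z_1,…,z_k)` almost everywhere, and `t = 0` on multisets of any other size (`HasKernel`).
Symmetry is then built in, and iterated add-one costs are indexed by multisets as well.

Part I rests on two facts. First, `φ ↦ (s ↦ E D_s φ)` is an isometry from `L²(Q)` into `L²` of the
measure `∑ μ^n / n!` on finite configurations (`memLp_meanCosts_and_eLpNorm`). It is checked on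
exponential functionals, which are eigenfunctions of the add-one costs and span a dense subspace. It
gives (i) ⇒ (ii), the Poincaré inequality, and the fact that the kernels of a chaos expansion are `E
D^{(q)} / q!`. Second, a measurable `φ` with `∫ E|D_z φ|² dμ < ∞` is in `L²`, with no a priori
integrability (`memLp_of_addOneCost`).

For (ii) ⇒ (i), the product rule `addCosts_prod` writes `D^{(q)} ∏ ψ_i` as a sum over words of
non-empty sets `A_l ⊆ [m]`, where `A_l` says which factors receive the point `z_l`. More than `k_i`
costs kill `ψ_i`, and exactly `k_i` costs make it constant; hence `D^{(K)} Φ` is not random, equals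
`K! sym(f_1 ⊗ ⋯ ⊗ f_m)`, and is square-integrable. The Poincaré inequality applied to `D_s Φ` bounds
`∫ E|D_s Φ|²` at order `q` by `∫ |E D_s Φ|²` plus the same quantity at order `q + 1`. So finiteness
descends from order `K` to order `1` (`lintegral_addCosts_ne_top`), and then `Φ` is in `L²`.

Part II computes `E D^{(q)} Φ`. In every term of the product rule the factors lie again in chaoses,
with kernels `t_i` in which some points are fixed (`HasKernel.addCosts`). What is needed is the
expectation of a product of multiple integrals (`integral_prod`): the sum over `r` of `1/r!` times
the integrals of the products of the kernels along the words of length `r` without singleton letters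
(`moment`). For step kernels both sides satisfy the same recursion: for the expectation it is
integration by parts, that is, the Mecke formula combined with a recurrence of the Charlier
polynomials; for the word sums it is the removal of a letter containing a given row. The formula
extends to bounded kernels by dominated convergence, and to general ones by truncation. Since the
products need not be in `L²`, the limit is taken in `L¹`. The bound comes from the same formula with
`χ + μ` in place of `χ - μ`: the integral of `f` is dominated by that of `|f|` with respect to `χ +
μ`, for which singleton letters have weight `2`, and the local condition makes the resulting sums
finite.

Finally, words become diagrams. A word in which each row `i` occurs `k_i` times comes from `∏ k_i!`
labelled diagrams, a number that cancels the factors `k_i!` of the kernels, and a labelled diagram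
is a partition with numbered blocks. The first `q` letters are the free blocks and the other `r` the
integrated ones; the absence of integrated singletons says that only blocks of `σ_{≥2} \ A` are
integrated. Thus `E D^{(q)} Φ = q! h_q`. -/

noncomputable section

namespace PoissonChaos

set_option linter.unusedSectionVars false

/-! ### Finite-dimensional laws and moments of `Q`. -/

section

/-! ### The law of a Poisson random measure -/

/-- `Q` is the law of a Poisson random measure with intensity `μ`. -/
structure IsPoissonLaw {Z : Type*} [MeasurableSpace Z] (Q : Measure (Measure Z)) (μ : Measure Z) :
    Prop where
  prob : IsProbabilityMeasure Q
  indep : ∀ (n : ℕ) (B : Fin n → Set Z), (∀ i, MeasurableSet (B i)) →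
    Pairwise (Function.onFun Disjoint B) → iIndepFun (fun i (χ : Measure Z) => χ (B i)) Q
  law : ∀ B : Set Z, MeasurableSet B → μ B ≠ ∞ →
    Q.map (fun χ => χ B) = (poissonMeasure (μ B).toNNReal).map (fun n : ℕ => (n : ℝ≥0∞))

variable {Z : Type*} [MeasurableSpace Z] {μ : Measure Z} {Q : Measure (Measure Z)}

lemma IsPoissonRandomMeasure.isPoissonLaw {Ω : Type*} [MeasurableSpace Ω] {P : Measure Ω}
    [IsProbabilityMeasure P] {η : Ω → Measure Z} (hη : IsPoissonRandomMeasure η μ P) :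
    IsPoissonLaw (P.map η) μ where
  prob := Measure.isProbabilityMeasure_map hη.measurable.aemeasurable
  indep n B hB hd := by
    have := hη.indep n B hB hd
    have := Measure.isProbabilityMeasure_map (μ := P) hη.measurable.aemeasurable
    have hm : ∀ i, Measurable fun χ : Measure Z => χ (B i) := fun i =>
      Measure.measurable_coe (hB i)
    rw [iIndepFun_iff_map_fun_eq_pi_map (fun i => (hm i).aemeasurable)]
    have h2 := (iIndepFun_iff_map_fun_eq_pi_map
      (fun i => ((hm i).comp hη.measurable).aemeasurable)).1 (hη.indep n B hB hd)
    rw [Measure.map_map (measurable_pi_lambda _ hm) hη.measurable]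
    refine h2.trans ?_
    congr with i : 1
    rw [Measure.map_map (hm i) hη.measurable]
  law B hB hμ := by
    rw [Measure.map_map (Measure.measurable_coe hB) hη.measurable]
    exact (hη.law_finite B hB hμ).map_eq

lemma measurable_real {B : Set Z} (hB : MeasurableSet B) :
    Measurable fun χ : Measure Z => χ.real B :=
  (Measure.measurable_coe hB).ennreal_toReal

namespace IsPoissonLaw

lemma ae_nat (hQ : IsPoissonLaw Q μ) {B : Set Z} (hB : MeasurableSet B) (hμ : μ B ≠ ∞) :
    ∀ᵐ χ : Measure Z ∂Q, ∃ n : ℕ, χ B = (n : ℝ≥0∞) := by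
  have hS : MeasurableSet (Set.range fun n : ℕ => (n : ℝ≥0∞)) :=
    (Set.countable_range _).measurableSet
  have : ∀ᵐ x ∂(Q.map (fun χ => χ B)), x ∈ Set.range fun n : ℕ => (n : ℝ≥0∞) := by
    rw [hQ.law B hB hμ]
    exact (ae_map_iff (by fun_prop) hS).2 (ae_of_all _ fun n => ⟨n, rfl⟩)
  filter_upwards [(ae_map_iff (Measure.measurable_coe hB).aemeasurable hS).1 this] with χ ⟨n, hn⟩
  exact ⟨n, hn.symm⟩

lemma ae_ne_top (hQ : IsPoissonLaw Q μ) {B : Set Z} (hB : MeasurableSet B) (hμ : μ B ≠ ∞) :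
    ∀ᵐ χ ∂Q, χ B ≠ ∞ := by
  filter_upwards [hQ.ae_nat hB hμ] with χ ⟨n, hn⟩
  simp [hn]

lemma map_real (hQ : IsPoissonLaw Q μ) {B : Set Z} (hB : MeasurableSet B) (hμ : μ B ≠ ∞) :
    Q.map (fun χ => χ.real B) = (poissonMeasure (μ B).toNNReal).map (fun n : ℕ => (n : ℝ)) := by
  have : (fun χ : Measure Z => χ.real B) = ENNReal.toReal ∘ fun χ => χ B := rfl
  rw [this, ← Measure.map_map ENNReal.measurable_toReal (Measure.measurable_coe hB),
    hQ.law B hB hμ, Measure.map_map ENNReal.measurable_toReal (by fun_prop)]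
  rfl

lemma integrable_comp (hQ : IsPoissonLaw Q μ) {B : Set Z} (hB : MeasurableSet B) (hμ : μ B ≠ ∞)
    {g : ℝ → ℝ} (hg : Measurable g) :
    Integrable (fun χ => g (χ.real B)) Q ↔
      Integrable (fun n : ℕ => g n) (poissonMeasure (μ B).toNNReal) := by
  have h1 := integrable_map_measure (μ := Q) (f := fun χ : Measure Z => χ.real B) (g := g)
    hg.aestronglyMeasurable (measurable_real hB).aemeasurable
  rw [hQ.map_real hB hμ, integrable_map_measure hg.aestronglyMeasurable (by fun_prop)] at h1
  exact h1.symm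

lemma integral_comp (hQ : IsPoissonLaw Q μ) {B : Set Z} (hB : MeasurableSet B) (hμ : μ B ≠ ∞)
    {g : ℝ → ℝ} (hg : Measurable g) :
    ∫ χ, g (χ.real B) ∂Q = ∫ n : ℕ, g n ∂(poissonMeasure (μ B).toNNReal) := by
  have h1 := integral_map (μ := Q) (φ := fun χ : Measure Z => χ.real B) (f := g)
    (measurable_real hB).aemeasurable hg.aestronglyMeasurable
  rw [hQ.map_real hB hμ, integral_map (by fun_prop) hg.aestronglyMeasurable] at h1
  exact h1.symm

lemma iIndepFun_real (hQ : IsPoissonLaw Q μ) {κ : Type*} [Fintype κ] {B : κ → Set Z}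
    (hB : ∀ i, MeasurableSet (B i)) (hd : Pairwise (Function.onFun Disjoint B)) :
    iIndepFun (fun i (χ : Measure Z) => χ.real (B i)) Q := by
  let e := Fintype.equivFin κ
  have h1 := hQ.indep _ (fun i => B (e.symm i)) (fun i => hB _)
    (fun i j hij => hd (e.symm.injective.ne hij))
  have h2 := h1.precomp e.injective
  have h3 := h2.comp (g := fun _ => ENNReal.toReal) (fun _ => ENNReal.measurable_toReal)
  convert h3 using 2 with i
  ext χ
  simp [Measure.real]

lemma integral_prod_comp (hQ : IsPoissonLaw Q μ) {κ : Type*} [Fintype κ] {B : κ → Set Z}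
    (hB : ∀ i, MeasurableSet (B i)) (hμ : ∀ i, μ (B i) ≠ ∞)
    (hd : Pairwise (Function.onFun Disjoint B)) {g : κ → ℝ → ℝ} (hg : ∀ i, Measurable (g i)) :
    ∫ χ, ∏ i, g i (χ.real (B i)) ∂Q =
      ∏ i, ∫ n : ℕ, g i n ∂(poissonMeasure (μ (B i)).toNNReal) := by
  rw [(hQ.iIndepFun_real hB hd).integral_fun_prod_comp
    (fun i => (measurable_real (hB i)).aemeasurable) (fun i => (hg i).aestronglyMeasurable)]
  exact Finset.prod_congr rfl fun i _ => hQ.integral_comp (hB i) (hμ i) (hg i)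

end IsPoissonLaw

/-! ### Moments of the Poisson distribution -/

/-- Since `n ^ p ≤ p! e ^ n`, the series is dominated by the exponential series at `r e`. -/
lemma integrable_pow_poisson (r : ℝ≥0) (p : ℕ) :
    Integrable (fun n : ℕ => (n : ℝ) ^ p) (poissonMeasure r) := by
  rw [integrable_poissonMeasure_iff]
  have h1 : Summable fun n : ℕ => Real.exp (-r) * p.factorial * ((r * Real.exp 1) ^ n / n.factorial) :=
    (Real.summable_pow_div_factorial _).mul_left _
  refine h1.of_nonneg_of_le (fun n => by positivity) fun n => ?_
  have h2 : (n : ℝ) ^ p ≤ p.factorial * Real.exp 1 ^ n := by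
    have := Real.pow_div_factorial_le_exp (n : ℝ) (by positivity) p
    rw [div_le_iff₀ (by positivity)] at this
    rw [← Real.exp_nat_mul, mul_one, mul_comm]
    exact this
  rw [Real.norm_of_nonneg (by positivity), mul_pow]
  calc Real.exp (-r) * r ^ n / n.factorial * (n : ℝ) ^ p
      ≤ Real.exp (-r) * r ^ n / n.factorial * (p.factorial * Real.exp 1 ^ n) := by gcongr
    _ = _ := by ring

lemma integral_pow_base_poisson (r : ℝ≥0) (x : ℝ) :
    ∫ n : ℕ, x ^ n ∂(poissonMeasure r) = Real.exp (r * (x - 1)) := by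
  rw [integral_poissonMeasure]
  have : ∀ n : ℕ, (Real.exp (-r) * r ^ n / n.factorial) • x ^ n =
      Real.exp (-r) * ((r * x) ^ n / n.factorial) := fun n => by
    rw [smul_eq_mul, mul_pow]; ring
  simp_rw [this]
  rw [tsum_mul_left]
  have h := (NormedSpace.expSeries_div_hasSum_exp ((r : ℝ) * x)).tsum_eq
  rw [h, ← Real.exp_eq_exp_ℝ, ← Real.exp_add]
  congr 1; ring

namespace IsPoissonLaw

lemma integrable_real_pow (hQ : IsPoissonLaw Q μ) {B : Set Z} (hB : MeasurableSet B)
    (hμ : μ B ≠ ∞) (p : ℕ) : Integrable (fun χ : Measure Z => χ.real B ^ p) Q :=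
  (hQ.integrable_comp hB hμ (g := fun x => x ^ p) (by fun_prop)).2 (integrable_pow_poisson _ p)

lemma lintegral_pow_lt_top (hQ : IsPoissonLaw Q μ) {B : Set Z} (hB : MeasurableSet B)
    (hμ : μ B ≠ ∞) (c : ℝ≥0∞) (hc : c ≠ ∞) (p : ℕ) : ∫⁻ χ, (χ B + c) ^ p ∂Q < ∞ := by
  have h0 := hQ.prob
  have h : ∀ᵐ χ ∂Q, (χ B + c) ^ p ≤ ENNReal.ofReal (2 ^ p * (χ.real B ^ p + c.toReal ^ p)) := by
    filter_upwards [hQ.ae_ne_top hB hμ] with χ hχ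
    rw [← ENNReal.ofReal_toReal (a := (χ B + c) ^ p) (by finiteness)]
    refine ENNReal.ofReal_le_ofReal ?_
    rw [ENNReal.toReal_pow, ENNReal.toReal_add hχ hc]
    refine (add_pow_le (by positivity) (by positivity) p).trans ?_
    refine mul_le_mul_of_nonneg_right ?_ (by positivity)
    exact pow_le_pow_right₀ (by norm_num) (by omega)
  refine (lintegral_mono_ae h).trans_lt ?_
  exact (((hQ.integrable_real_pow hB hμ p).add (integrable_const _)).const_mul _).lintegral_lt_top

end IsPoissonLaw

end

/-! ### The Laplace functional. -/

section

variable {Z : Type*} [MeasurableSpace Z] {μ : Measure Z} {Q : Measure (Measure Z)}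

/-! ### The cells of a finite family of sets -/

/-- The points which belong to `A i` exactly for the indices `i ∈ S`. -/
def cell {Z κ : Type*} (A : κ → Set Z) (S : Finset κ) : Set Z :=
  {z | ∀ i, z ∈ A i ↔ i ∈ S}

section Cells

variable {κ : Type*} {A : κ → Set Z}

lemma measurableSet_cell [Finite κ] (hA : ∀ i, MeasurableSet (A i)) (S : Finset κ) :
    MeasurableSet (cell A S) := by
  have : cell A S = ⋂ i, {z | z ∈ A i ↔ i ∈ S} := by ext; simp [cell]
  rw [this]
  refine MeasurableSet.iInter fun i => ?_
  by_cases hi : i ∈ S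
  · simpa [hi] using hA i
  · simp only [hi, iff_false]; exact (hA i).compl

lemma disjoint_cell {S S' : Finset κ} (h : S ≠ S') : Disjoint (cell A S) (cell A S') := by
  rw [Set.disjoint_left]
  intro z hz hz'
  exact h (Finset.ext fun i => (hz i).symm.trans (hz' i))

lemma cell_subset {S : Finset κ} {i : κ} (hi : i ∈ S) : cell A S ⊆ A i :=
  fun _ hz => (hz i).2 hi

/-- The cell of the empty index is the complement of all the sets and may have infinite measure;
this is why only non-empty indices enter `CellIndex`. -/
lemma measure_cell_ne_top (hμ : ∀ i, μ (A i) ≠ ∞) {S : Finset κ} (hS : S.Nonempty) :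
    μ (cell A S) ≠ ∞ :=
  ((measure_mono (cell_subset hS.choose_spec)).trans_lt (hμ _).lt_top).ne

variable [Fintype κ] [DecidableEq κ]

/-- The non-empty subsets of `κ`, as indices of cells. -/
abbrev CellIndex (κ : Type*) : Type _ := {S : Finset κ // S.Nonempty}

lemma eq_biUnion_cell (A : κ → Set Z) (i : κ) :
    A i = ⋃ S ∈ Finset.univ.filter fun S : CellIndex κ => i ∈ S.1, cell A S := by
  classical
  ext z
  simp only [Finset.mem_filter, Finset.mem_univ, true_and, Set.mem_iUnion, exists_prop]
  refine ⟨fun hz => ⟨⟨Finset.univ.filter fun j => z ∈ A j, ⟨i, by simpa using hz⟩⟩,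
    by simpa using hz, fun j => by simp⟩, ?_⟩
  rintro ⟨S, hi, hz⟩
  exact cell_subset hi hz

lemma pairwise_disjoint_cell :
    Pairwise (Function.onFun Disjoint fun S : CellIndex κ => cell A S.1) :=
  fun _ _ h => disjoint_cell fun h' => h (Subtype.ext h')

lemma real_eq_sum_cell (hA : ∀ i, MeasurableSet (A i)) (χ : Measure Z) (i : κ) (h : χ (A i) ≠ ∞) :
    χ.real (A i) = ∑ S : CellIndex κ, if i ∈ S.1 then χ.real (cell A S) else 0 := by
  rw [← Finset.sum_filter]
  conv_lhs => rw [eq_biUnion_cell A i]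
  refine measureReal_biUnion_finset (fun S _ S' _ hne => pairwise_disjoint_cell hne)
    (fun S _ => measurableSet_cell hA _) fun S hS => ?_
  exact ((measure_mono (cell_subset (Finset.mem_filter.1 hS).2)).trans_lt h.lt_top).ne

lemma indicator_eq_sum_cell (A : κ → Set Z) (i : κ) (z : Z) :
    (A i).indicator (fun _ => (1 : ℝ)) z =
      ∑ S : CellIndex κ, if i ∈ S.1 then (cell A S).indicator (fun _ => (1 : ℝ)) z else 0 := by
  rw [← Finset.sum_filter]
  conv_lhs => rw [eq_biUnion_cell A i]
  rw [Finset.indicator_biUnion_apply]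
  exact fun S _ S' _ hne => pairwise_disjoint_cell hne

end Cells

/-! ### Exponential functionals -/

/-- The measurable sets of finite `μ`-measure. -/
abbrev FiniteSet (μ : Measure Z) : Type _ := {A : Set Z // MeasurableSet A ∧ μ A ≠ ∞}

/-- The step function `∑ t_j 1_{A_j}` encoded by `v`. -/
def expoFun (v : FiniteSet μ →₀ ℝ≥0) (z : Z) : ℝ :=
  v.sum fun A t => t * A.1.indicator (fun _ => (1 : ℝ)) z

/-- The integral `∑ t_j χ(A_j)`. -/
def expoPair (v : FiniteSet μ →₀ ℝ≥0) (χ : Measure Z) : ℝ :=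
  v.sum fun A t => t * χ.real A.1

/-- The exponential functional `exp(-∑ t_j χ(A_j))`. -/
def expo (v : FiniteSet μ →₀ ℝ≥0) (χ : Measure Z) : ℝ := Real.exp (-expoPair v χ)

/-- The function `exp(-v) - 1`. -/
def expoKernel (v : FiniteSet μ →₀ ℝ≥0) (z : Z) : ℝ := Real.exp (-expoFun v z) - 1

lemma expoFun_nonneg (v : FiniteSet μ →₀ ℝ≥0) (z : Z) : 0 ≤ expoFun v z :=
  Finset.sum_nonneg fun A _ => mul_nonneg (by positivity) (Set.indicator_nonneg (by simp) _)

lemma expoPair_nonneg (v : FiniteSet μ →₀ ℝ≥0) (χ : Measure Z) : 0 ≤ expoPair v χ :=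
  Finset.sum_nonneg fun A _ => by positivity

lemma expo_pos (v : FiniteSet μ →₀ ℝ≥0) (χ : Measure Z) : 0 < expo v χ := Real.exp_pos _

lemma expo_le_one (v : FiniteSet μ →₀ ℝ≥0) (χ : Measure Z) : expo v χ ≤ 1 :=
  Real.exp_le_one_iff.2 (neg_nonpos.2 (expoPair_nonneg v χ))

lemma expoFun_add (v w : FiniteSet μ →₀ ℝ≥0) (z : Z) :
    expoFun (v + w) z = expoFun v z + expoFun w z :=
  Finsupp.sum_add_index' (by simp) (by simp [add_mul])

lemma expoPair_add (v w : FiniteSet μ →₀ ℝ≥0) (χ : Measure Z) :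
    expoPair (v + w) χ = expoPair v χ + expoPair w χ :=
  Finsupp.sum_add_index' (by simp) (by simp [add_mul])

lemma expo_add (v w : FiniteSet μ →₀ ℝ≥0) (χ : Measure Z) :
    expo (v + w) χ = expo v χ * expo w χ := by
  rw [expo, expoPair_add, neg_add, Real.exp_add]; rfl

lemma measurable_expoFun (v : FiniteSet μ →₀ ℝ≥0) : Measurable (expoFun v) := by
  unfold expoFun Finsupp.sum
  exact Finset.measurable_fun_sum _ fun A _ =>
    (measurable_const.indicator A.2.1).const_mul _

lemma measurable_expo (v : FiniteSet μ →₀ ℝ≥0) : Measurable (expo v) := by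
  unfold expo expoPair Finsupp.sum
  exact (Finset.measurable_fun_sum _ fun A _ => (measurable_real A.2.1).const_mul _).neg.exp

lemma measurable_expoKernel (v : FiniteSet μ →₀ ℝ≥0) : Measurable (expoKernel v) :=
  (measurable_expoFun v).neg.exp.sub_const 1

lemma expoKernel_mem (v : FiniteSet μ →₀ ℝ≥0) (z : Z) : |expoKernel v z| ≤ 1 := by
  have h1 := Real.exp_pos (-expoFun v z)
  have h2 : Real.exp (-expoFun v z) ≤ 1 :=
    Real.exp_le_one_iff.2 (neg_nonpos.2 (expoFun_nonneg v z))
  rw [expoKernel, abs_le]; constructor <;> linarith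

/-- The union of the sets which occur in `v`. -/
def expoSupport (v : FiniteSet μ →₀ ℝ≥0) : Set Z := ⋃ A ∈ v.support, A.1

lemma measurableSet_expoSupport (v : FiniteSet μ →₀ ℝ≥0) : MeasurableSet (expoSupport v) :=
  Finset.measurableSet_biUnion _ fun A _ => A.2.1

lemma measure_expoSupport_lt_top (v : FiniteSet μ →₀ ℝ≥0) : μ (expoSupport v) < ∞ :=
  measure_biUnion_lt_top v.support.finite_toSet fun A _ => A.2.2.lt_top

lemma expoKernel_eq_zero {v : FiniteSet μ →₀ ℝ≥0} {z : Z} (hz : z ∉ expoSupport v) :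
    expoKernel v z = 0 := by
  have : expoFun v z = 0 := Finset.sum_eq_zero fun A hA => by
    have : z ∉ A.1 := fun h => hz (Set.mem_biUnion hA h)
    simp [this]
  simp [expoKernel, this]

lemma abs_expoKernel_le (v : FiniteSet μ →₀ ℝ≥0) (z : Z) :
    |expoKernel v z| ≤ (expoSupport v).indicator (fun _ => (1 : ℝ)) z := by
  by_cases hz : z ∈ expoSupport v
  · simpa [hz] using expoKernel_mem v z
  · simp [hz, expoKernel_eq_zero hz]

lemma integrable_expoKernel (v : FiniteSet μ →₀ ℝ≥0) : Integrable (expoKernel v) μ := by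
  refine Integrable.mono' (g := (expoSupport v).indicator fun _ => (1 : ℝ)) ?_
    (measurable_expoKernel v).aestronglyMeasurable (ae_of_all _ (abs_expoKernel_le v))
  exact (integrable_indicator_iff (measurableSet_expoSupport v)).2
    (integrableOn_const (measure_expoSupport_lt_top v).ne)

lemma memLp_expoKernel (v : FiniteSet μ →₀ ℝ≥0) : MemLp (expoKernel v) 2 μ := by
  refine MemLp.mono (g := (expoSupport v).indicator fun _ => (1 : ℝ)) ?_
    (measurable_expoKernel v).aestronglyMeasurable (ae_of_all _ fun z => ?_)
  · exact memLp_indicator_const 2 (measurableSet_expoSupport v) 1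
      (Or.inr (measure_expoSupport_lt_top v).ne)
  · rw [Real.norm_eq_abs]
    exact (abs_expoKernel_le v z).trans (le_abs_self _)

/-- The cross term `expoKernel v z * expoKernel w z` is what turns covariances of exponential
functionals into inner products of their kernels. -/
lemma expoKernel_add (v w : FiniteSet μ →₀ ℝ≥0) (z : Z) : expoKernel (v + w) z =
    expoKernel v z + expoKernel w z + expoKernel v z * expoKernel w z := by
  simp only [expoKernel, expoFun_add, neg_add, Real.exp_add]; ring

/-- `Measure.real` is additive only at finite values, hence the assumption on `χ`, which holds
`Q`-almost surely. -/
lemma expo_add_dirac (v : FiniteSet μ →₀ ℝ≥0) {χ : Measure Z}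
    (hχ : ∀ A ∈ v.support, χ A.1 ≠ ∞) (z : Z) :
    expo v (χ + Measure.dirac z) = expo v χ * Real.exp (-expoFun v z) := by
  rw [expo, expo, ← Real.exp_add, ← neg_add]
  congr 2
  unfold expoPair expoFun Finsupp.sum
  rw [← Finset.sum_add_distrib]
  refine Finset.sum_congr rfl fun A hA => ?_
  change (v A : ℝ) * (χ + Measure.dirac z).real A.1 = v A * χ.real A.1 + v A * _
  have h2 := hχ A hA
  rw [measureReal_add_apply h2 (by simp), mul_add, measureReal_def (Measure.dirac z),
    Measure.dirac_apply' _ A.2.1]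
  by_cases hz : z ∈ A.1 <;> simp [hz]

/-- The sets may overlap. On the cell of index `S` the step function has the constant value `∑ i ∈
S, t i`, and the cells are disjoint, so independence factorizes the expectation into Laplace
transforms of Poisson variables. -/
lemma integral_exp_neg_sum (hQ : IsPoissonLaw Q μ) {κ : Type*} [Fintype κ] {A : κ → Set Z}
    (hA : ∀ i, MeasurableSet (A i)) (hμ : ∀ i, μ (A i) ≠ ∞) (t : κ → ℝ) :
    ∫ χ : Measure Z, Real.exp (-∑ i, t i * χ.real (A i)) ∂Q =
      Real.exp (∫ z, (Real.exp (-∑ i, t i * (A i).indicator (fun _ => (1 : ℝ)) z) - 1) ∂μ) := by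
  classical
  let τ : CellIndex κ → ℝ := fun S => ∑ i ∈ S.1, t i
  have h1 : ∀ᵐ χ ∂Q, Real.exp (-∑ i, t i * χ.real (A i)) =
      ∏ S : CellIndex κ, Real.exp (-τ S * χ.real (cell A S)) := by
    filter_upwards [ae_all_iff.2 fun i => hQ.ae_ne_top (hA i) (hμ i)] with χ hχ
    rw [← Real.exp_sum]
    congr 1
    simp_rw [neg_mul, Finset.sum_neg_distrib, neg_inj]
    calc ∑ i, t i * χ.real (A i)
        = ∑ i, ∑ S : CellIndex κ, (if i ∈ S.1 then t i else 0) * χ.real (cell A S) := by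
          refine Finset.sum_congr rfl fun i _ => ?_
          rw [real_eq_sum_cell hA χ i (hχ i), Finset.mul_sum]
          exact Finset.sum_congr rfl fun S _ => by split_ifs <;> simp
      _ = _ := by
          rw [Finset.sum_comm]
          refine Finset.sum_congr rfl fun S _ => ?_
          rw [← Finset.sum_mul]
          simp [τ, Finset.sum_ite_mem]
  rw [integral_congr_ae h1, hQ.integral_prod_comp (κ := CellIndex κ) (B := fun S => cell A S.1)
    (g := fun S x => Real.exp (-τ S * x)) (fun S => measurableSet_cell hA _)
    (fun S => measure_cell_ne_top hμ S.2) pairwise_disjoint_cell (fun S => by fun_prop)]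
  have h2 : ∀ S : CellIndex κ,
      ∫ n : ℕ, Real.exp (-τ S * n) ∂(poissonMeasure (μ (cell A S.1)).toNNReal) =
        Real.exp (μ.real (cell A S.1) * (Real.exp (-τ S) - 1)) := fun S => by
    have := integral_pow_base_poisson (μ (cell A S.1)).toNNReal (Real.exp (-τ S))
    simp_rw [← Real.exp_nat_mul] at this
    simp_rw [mul_comm (-τ S)]
    exact this
  simp_rw [h2]
  rw [← Real.exp_sum]
  congr 1
  have h3 : ∀ z, Real.exp (-∑ i, t i * (A i).indicator (fun _ => (1 : ℝ)) z) - 1 =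
      ∑ S : CellIndex κ, (cell A S.1).indicator (fun _ => Real.exp (-τ S) - 1) z := fun z => by
    by_cases hz : ∃ S : CellIndex κ, z ∈ cell A S.1
    · obtain ⟨S, hS⟩ := hz
      rw [Finset.sum_eq_single S]
      · rw [Set.indicator_of_mem hS]
        congr 3
        simp only [τ]
        rw [← Finset.sum_subset (Finset.subset_univ S.1)]
        · exact Finset.sum_congr rfl fun i hi => by simp [(hS i).2 hi]
        · intro i _ hi
          have : z ∉ A i := fun h => hi ((hS i).1 h)
          simp [this]
      · intro S' _ hne
        exact Set.indicator_of_notMem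
          (fun h => (Set.disjoint_left.1 (pairwise_disjoint_cell hne)) h hS) _
      · simp
    · have h4 : ∀ i, z ∉ A i := fun i hi => by
        rw [eq_biUnion_cell A i] at hi
        simp only [Set.mem_iUnion] at hi
        obtain ⟨S, _, hS⟩ := hi
        exact hz ⟨S, hS⟩
      push Not at hz
      rw [Finset.sum_eq_zero fun S _ => Set.indicator_of_notMem (hz S) _]
      simp [h4]
  simp_rw [h3]
  rw [integral_finsetSum]
  · refine Finset.sum_congr rfl fun S _ => ?_
    rw [integral_indicator_const _ (measurableSet_cell hA _), smul_eq_mul]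
  · intro S _
    exact (integrable_indicator_iff (measurableSet_cell hA _)).2
      (integrableOn_const (measure_cell_ne_top hμ S.2))

/-- The Laplace functional of a Poisson random measure. -/
lemma integral_expo (hQ : IsPoissonLaw Q μ) (v : FiniteSet μ →₀ ℝ≥0) :
    ∫ χ, expo v χ ∂Q = Real.exp (∫ z, expoKernel v z ∂μ) := by
  have := integral_exp_neg_sum hQ (κ := v.support) (A := fun A => A.1.1) (fun A => A.1.2.1)
    (fun A => A.1.2.2) (fun A => v A.1)
  simp only [expoKernel, expo, expoPair, expoFun, Finsupp.sum]
  convert this using 3 with χ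
  · congr 2
    exact (Finset.sum_coe_sort v.support fun A => (v A : ℝ) * χ.real A.1).symm
  · ext z
    congr 3
    exact (Finset.sum_coe_sort v.support
      fun A => (v A : ℝ) * A.1.indicator (fun _ => (1 : ℝ)) z).symm

end

/-! ### Uniqueness and density through Laplace transforms. -/

section

/-! ### Exponential functionals determine finite measures and are total in `L²` -/

section Laplace

variable {ι : Type*} [Fintype ι]

open BoundedContinuousFunction in
/-- The function `x ↦ exp(-∑ t_i x_i)`, as a bounded continuous function. -/
def laplaceFun (t : ι → ℝ≥0) : (ι → ℝ≥0) →ᵇ ℝ :=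
  BoundedContinuousFunction.ofNormedAddCommGroup
    (fun x => Real.exp (-∑ i, (t i : ℝ) * (x i : ℝ))) (by fun_prop) 1 fun x => by
      rw [Real.norm_of_nonneg (Real.exp_pos _).le, Real.exp_le_one_iff, neg_nonpos]
      exact Finset.sum_nonneg fun i _ => by positivity

lemma laplaceFun_apply (t x : ι → ℝ≥0) :
    laplaceFun t x = Real.exp (-∑ i, (t i : ℝ) * (x i : ℝ)) := rfl

open BoundedContinuousFunction in
/-- `laplaceFun` as a monoid homomorphism. -/
def laplaceHom : Multiplicative (ι → ℝ≥0) →* ((ι → ℝ≥0) →ᵇ ℝ) where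
  toFun t := laplaceFun (Multiplicative.toAdd t)
  map_one' := by ext x; simp [laplaceFun_apply]
  map_mul' s t := by
    ext x
    simp [laplaceFun_apply, ← Real.exp_add, add_mul, Finset.sum_add_distrib, add_comm]

/-- The functions `x ↦ exp(-t·x)` generate a point-separating algebra of bounded continuous
functions on a Polish space, and such an algebra determines finite measures. -/
lemma ext_of_integral_laplaceFun {ν₁ ν₂ : Measure (ι → ℝ≥0)} [IsFiniteMeasure ν₁]
    [IsFiniteMeasure ν₂] (h : ∀ t, ∫ x, laplaceFun t x ∂ν₁ = ∫ x, laplaceFun t x ∂ν₂) :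
    ν₁ = ν₂ := by
  classical
  let A : StarSubalgebra ℝ (BoundedContinuousFunction (ι → ℝ≥0) ℝ) :=
    { Algebra.adjoin ℝ (Set.range (laplaceHom (ι := ι))) with
      star_mem' := fun {a} ha => by
        have : star a = a := by ext; simp
        rwa [this] }
  refine ext_of_forall_mem_subalgebra_integral_eq_of_polish (A := A) (𝕜 := ℝ) ?_ ?_
  · intro x y hxy
    obtain ⟨i, hi⟩ := Function.ne_iff.1 hxy
    refine ⟨_, ⟨⟨laplaceFun (Pi.single i 1), ⟨laplaceFun (Pi.single i 1), ?_, rfl⟩, rfl⟩, ?_⟩⟩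
    · exact Algebra.subset_adjoin ⟨Multiplicative.ofAdd (Pi.single i 1), rfl⟩
    · intro hc
      have hc' : laplaceFun (Pi.single i 1) x = laplaceFun (Pi.single i 1) y := hc
      rw [laplaceFun_apply, laplaceFun_apply] at hc'
      have h3 := Real.exp_injective hc'
      have h4 : ∀ w : ι → ℝ≥0, ∑ j, ((Pi.single i 1 : ι → ℝ≥0) j : ℝ) * (w j : ℝ) = w i := by
        intro w
        rw [Finset.sum_eq_single i]
        · simp
        · intro j _ hj; simp [hj]
        · simp
      rw [h4, h4, neg_inj] at h3
      exact hi (NNReal.coe_injective h3)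
  · intro g hg
    -- The exponentials are closed under products, so the algebra that they generate is their linear
    -- span, and linearity of the integral suffices.
    have hg' : g ∈ Submodule.span ℝ (Set.range (laplaceHom (ι := ι))) := by
      have h5 : g ∈ Subalgebra.toSubmodule (Algebra.adjoin ℝ (Set.range (laplaceHom (ι := ι)))) := hg
      rw [Algebra.adjoin_eq_span, ← MonoidHom.coe_mrange, Submonoid.closure_eq] at h5
      exact h5
    clear hg
    induction hg' using Submodule.span_induction with
    | mem x hx => obtain ⟨t, rfl⟩ := hx; exact h _
    | zero => simp
    | add x y _ _ hx hy =>
      simp only [BoundedContinuousFunction.coe_add, Pi.add_apply]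
      rw [integral_add (x.integrable _) (y.integrable _), integral_add (x.integrable _)
        (y.integrable _), hx, hy]
    | smul a x _ hx =>
      simp only [BoundedContinuousFunction.coe_smul, integral_const_mul, smul_eq_mul]
      rw [hx]

end Laplace

variable {Z : Type*} [MeasurableSpace Z] {μ : Measure Z} {Q : Measure (Measure Z)}

/-- The values of a measure on the sets of finite `μ`-measure. -/
def evalFinite (μ : Measure Z) (χ : Measure Z) (A : FiniteSet μ) : ℝ≥0∞ := χ A.1

lemma measurable_evalFinite : Measurable (evalFinite μ) :=
  measurable_pi_lambda _ fun A => Measure.measurable_coe A.2.1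

/-- By continuity from below along the spanning sets of `μ`, the value of a measure on any
measurable set is a countable supremum of its values on sets of finite `μ`-measure; so these
generate the σ-algebra. -/
lemma exists_preimage_evalFinite [SigmaFinite μ] {E : Set (Measure Z)} (hE : MeasurableSet E) :
    ∃ E', MeasurableSet E' ∧ evalFinite μ ⁻¹' E' = E := by
  suffices h : (Measure.instMeasurableSpace : MeasurableSpace (Measure Z)) ≤
      MeasurableSpace.comap (evalFinite μ) inferInstance from h E hE
  refine iSup_le fun s => iSup_le fun hs => ?_
  rw [← measurable_iff_comap_le]
  let S : ℕ → FiniteSet μ := fun n => ⟨s ∩ spanningSets μ n, hs.inter (measurableSet_spanningSets μ n),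
    ((measure_mono Set.inter_subset_right).trans_lt (measure_spanningSets_lt_top μ n)).ne⟩
  have : (fun χ : Measure Z => χ s) = (fun x : FiniteSet μ → ℝ≥0∞ => ⨆ n, x (S n)) ∘ evalFinite μ := by
    ext χ
    have hm : Monotone fun n => s ∩ spanningSets μ n := fun i j hij =>
      Set.inter_subset_inter_right _ (monotone_spanningSets μ hij)
    have h2 := hm.measure_iUnion (μ := χ)
    rw [← Set.inter_iUnion, iUnion_spanningSets, Set.inter_univ] at h2
    exact h2
  rw [this]
  have hm : Measurable fun x : FiniteSet μ → ℝ≥0∞ => ⨆ n, x (S n) :=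
    Measurable.iSup fun n => measurable_pi_apply _
  exact hm.comp (comap_measurable _)

/-- A measure on the space of measures is determined by its finite-dimensional marginals on sets of
finite `μ`-measure, and these by their Laplace transforms. Almost sure finiteness allows the values
in `[0, ∞]` to be read in `ℝ≥0`, where the Laplace transform is available. -/
lemma ext_of_integral_expo [SigmaFinite μ] {ν₁ ν₂ : Measure (Measure Z)} [IsFiniteMeasure ν₁]
    [IsFiniteMeasure ν₂] (h₁ : ∀ A : FiniteSet μ, ∀ᵐ χ ∂ν₁, χ A.1 ≠ ∞)
    (h₂ : ∀ A : FiniteSet μ, ∀ᵐ χ ∂ν₂, χ A.1 ≠ ∞)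
    (h : ∀ v : FiniteSet μ →₀ ℝ≥0, ∫ χ, expo v χ ∂ν₁ = ∫ χ, expo v χ ∂ν₂) : ν₁ = ν₂ := by
  classical
  suffices hev : ν₁.map (evalFinite μ) = ν₂.map (evalFinite μ) by
    ext E hE
    obtain ⟨E', hE', rfl⟩ := exists_preimage_evalFinite (μ := μ) hE
    rw [← Measure.map_apply measurable_evalFinite hE', hev,
      Measure.map_apply measurable_evalFinite hE']
  let R : (I : Finset (FiniteSet μ)) → (FiniteSet μ → ℝ≥0∞) → (I → ℝ≥0∞) := fun I => I.restrict
  have hR : ∀ I, Measurable (R I) := fun I => Finset.measurable_restrict I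
  refine IsProjectiveLimit.unique (P := fun I => (ν₁.map (evalFinite μ)).map (R I))
    (fun I => rfl) fun I => ?_
  change (ν₂.map (evalFinite μ)).map (R I) = (ν₁.map (evalFinite μ)).map (R I)
  let q : Measure Z → (I → ℝ≥0) := fun χ A => (χ A.1.1).toNNReal
  have hq : Measurable q := measurable_pi_lambda _ fun A =>
    (Measure.measurable_coe A.1.2.1).ennreal_toNNReal
  let c : (I → ℝ≥0) → (I → ℝ≥0∞) := fun x A => x A
  have hc : Measurable c := measurable_pi_lambda _ fun A => (measurable_pi_apply A).coe_nnreal_ennreal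
  have key : ∀ ν : Measure (Measure Z), (∀ A : FiniteSet μ, ∀ᵐ χ ∂ν, χ A.1 ≠ ∞) →
      (ν.map (evalFinite μ)).map (R I) = (ν.map q).map c := fun ν hν => by
    rw [Measure.map_map (hR I) measurable_evalFinite, Measure.map_map hc hq]
    refine Measure.map_congr ?_
    filter_upwards [ae_all_iff.2 fun A : I => hν A.1] with χ hχ
    ext A
    simp [R, c, q, evalFinite, ENNReal.coe_toNNReal (hχ A)]
  rw [key ν₁ h₁, key ν₂ h₂]
  congr 1
  refine ext_of_integral_laplaceFun fun t => ?_
  let v : FiniteSet μ →₀ ℝ≥0 := Finsupp.onFinset I (fun A => if hA : A ∈ I then t ⟨A, hA⟩ else 0)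
    fun A hA => by by_contra h'; simp [h'] at hA
  have hv : ∀ χ, laplaceFun t (q χ) = expo v χ := fun χ => by
    rw [laplaceFun_apply, expo, expoPair, Finsupp.onFinset_sum _ (by simp), ← Finset.sum_coe_sort I]
    congr 2
    exact Finset.sum_congr rfl fun A _ => by simp [q, Measure.real, ENNReal.toReal]
  have hm : Measurable (laplaceFun t) := (laplaceFun t).continuous.measurable
  rw [integral_map hq.aemeasurable hm.aestronglyMeasurable,
    integral_map hq.aemeasurable hm.aestronglyMeasurable]
  simp_rw [hv]
  exact (h v).symm

/-- A linear combination of exponential functionals. -/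
def expoPoly (c : (FiniteSet μ →₀ ℝ≥0) →₀ ℝ) (χ : Measure Z) : ℝ :=
  c.sum fun v a => a * expo v χ

lemma memLp_expo [IsFiniteMeasure Q] (v : FiniteSet μ →₀ ℝ≥0) (p : ℝ≥0∞) : MemLp (expo v) p Q :=
  MemLp.of_bound (measurable_expo v).aestronglyMeasurable 1 (ae_of_all _ fun χ => by
    rw [Real.norm_of_nonneg (expo_pos v χ).le]; exact expo_le_one v χ)

lemma measurable_expoPoly (c : (FiniteSet μ →₀ ℝ≥0) →₀ ℝ) : Measurable (expoPoly c) :=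
  Finset.measurable_fun_sum _ fun v _ => (measurable_expo v).const_mul _

lemma memLp_expoPoly [IsFiniteMeasure Q] (c : (FiniteSet μ →₀ ℝ≥0) →₀ ℝ) (p : ℝ≥0∞) :
    MemLp (expoPoly c) p Q :=
  memLp_finsetSum _ fun v _ => (memLp_expo v p).const_mul _

/-- The finite measures with `Q`-densities `g⁺` and `g⁻` have the same Laplace functional, hence
coincide; since at each point one of the two densities vanishes, both do. -/
lemma ae_eq_zero_of_integral_expo [SigmaFinite μ] (hQ : IsPoissonLaw Q μ) {g : Measure Z → ℝ}
    (hg : Measurable g) (hi : Integrable g Q)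
    (h : ∀ v : FiniteSet μ →₀ ℝ≥0, ∫ χ, g χ * expo v χ ∂Q = 0) : g =ᵐ[Q] 0 := by
  have := hQ.prob
  have hfin : ∀ {g : Measure Z → ℝ}, Integrable g Q →
      IsFiniteMeasure (Q.withDensity fun χ => ENNReal.ofReal (g χ)) := fun hg =>
    isFiniteMeasure_withDensity_ofReal hg.2
  have := hfin hi
  have := hfin hi.neg
  have hae : ∀ (f : Measure Z → ℝ≥0∞) (A : FiniteSet μ), ∀ᵐ χ ∂(Q.withDensity f), χ A.1 ≠ ∞ :=
    fun f A => (withDensity_absolutelyContinuous _ _).ae_le (hQ.ae_ne_top A.2.1 A.2.2)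
  have hint : ∀ {g : Measure Z → ℝ}, Measurable g → ∀ v : FiniteSet μ →₀ ℝ≥0,
      ∫ χ, expo v χ ∂(Q.withDensity fun χ => ENNReal.ofReal (g χ)) =
        ∫ χ, max (g χ) 0 * expo v χ ∂Q := fun hg v => by
    rw [integral_withDensity_eq_integral_toReal_smul hg.ennreal_ofReal
      (ae_of_all _ fun _ => ENNReal.ofReal_lt_top)]
    simp [ENNReal.toReal_ofReal']
  have heq : Q.withDensity (fun χ => ENNReal.ofReal (g χ)) =
      Q.withDensity (fun χ => ENNReal.ofReal ((-g) χ)) := by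
    refine ext_of_integral_expo (μ := μ) (hae _) (hae _) fun v => ?_
    rw [hint hg, hint hg.neg, ← sub_eq_zero, ← integral_sub]
    · refine Eq.trans ?_ (h v)
      refine integral_congr_ae (ae_of_all _ fun χ => ?_)
      simp only [Pi.neg_apply]
      rw [← sub_mul, max_zero_sub_eq_self]
    · exact (hi.pos_part).mul_bdd (c := 1) (measurable_expo v).aestronglyMeasurable (ae_of_all _ fun χ => by
        rw [Real.norm_of_nonneg (expo_pos v χ).le]; exact expo_le_one v χ)
    · exact (hi.neg.pos_part).mul_bdd (c := 1) (measurable_expo v).aestronglyMeasurable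
        (ae_of_all _ fun χ => by
        rw [Real.norm_of_nonneg (expo_pos v χ).le]; exact expo_le_one v χ)
  rw [withDensity_eq_iff hg.ennreal_ofReal.aemeasurable hg.neg.ennreal_ofReal.aemeasurable
    hi.lintegral_lt_top.ne] at heq
  filter_upwards [heq] with χ hχ
  simp only [Pi.neg_apply, Pi.zero_apply] at hχ ⊢
  rcases le_total (g χ) 0 with h0 | h0
  · rw [ENNReal.ofReal_of_nonpos h0, eq_comm, ENNReal.ofReal_eq_zero] at hχ
    linarith
  · rw [ENNReal.ofReal_of_nonpos (neg_nonpos.2 h0), ENNReal.ofReal_eq_zero] at hχ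
    linarith

/-- Linear combinations of exponential functionals are dense in `L²(Q)`. -/
lemma exists_seq_expoPoly [SigmaFinite μ] (hQ : IsPoissonLaw Q μ) {φ : Measure Z → ℝ}
    (hφ : MemLp φ 2 Q) : ∃ c : ℕ → (FiniteSet μ →₀ ℝ≥0) →₀ ℝ,
      Tendsto (fun n => eLpNorm (fun χ => φ χ - expoPoly (c n) χ) 2 Q) atTop (𝓝 0) := by
  have := hQ.prob
  let E : (FiniteSet μ →₀ ℝ≥0) → Lp ℝ 2 Q := fun v => (memLp_expo v 2).toLp
  let S : Submodule ℝ (Lp ℝ 2 Q) := Submodule.span ℝ (Set.range E)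
  have hS : Sᗮ = ⊥ := by
    rw [Submodule.eq_bot_iff]
    intro G hG
    have h0 : G =ᵐ[Q] 0 := by
      refine ae_eq_zero_of_integral_expo hQ (Lp.stronglyMeasurable G).measurable
        ((Lp.memLp G).integrable (by norm_num)) fun v => ?_
      have h1 := (Submodule.mem_orthogonal _ _).1 hG (E v) (Submodule.subset_span ⟨v, rfl⟩)
      rw [L2.inner_def] at h1
      rw [← h1]
      refine integral_congr_ae ?_
      filter_upwards [(memLp_expo v 2).coeFn_toLp (μ := Q)] with χ hχ
      simp only [E, hχ]
      simp
    exact (Lp.eq_zero_iff_ae_eq_zero).2 h0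
  have hcl : hφ.toLp ∈ closure (S : Set (Lp ℝ 2 Q)) := by
    have := (Submodule.topologicalClosure_eq_top_iff (K := S)).2 hS
    rw [← Submodule.topologicalClosure_coe, this]
    trivial
  obtain ⟨x, hx, hlim⟩ := mem_closure_iff_seq_limit.1 hcl
  have hx' : ∀ n, ∃ c : (FiniteSet μ →₀ ℝ≥0) →₀ ℝ, x n =ᵐ[Q] expoPoly c := fun n => by
    refine Submodule.span_induction (p := fun (y : Lp ℝ 2 Q) _ => ∃ c : (FiniteSet μ →₀ ℝ≥0) →₀ ℝ,
      y =ᵐ[Q] expoPoly c) ?_ ?_ ?_ ?_ (hx n)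
    · rintro _ ⟨v, rfl⟩
      refine ⟨Finsupp.single v 1, ?_⟩
      filter_upwards [(memLp_expo v 2).coeFn_toLp (μ := Q)] with χ h1
      rw [h1, expoPoly, Finsupp.sum_single_index (by simp), one_mul]
    · refine ⟨0, ?_⟩
      filter_upwards [Lp.coeFn_zero ℝ 2 Q] with χ h1
      simp [expoPoly]
    · rintro y z - - ⟨c, hc⟩ ⟨d, hd⟩
      refine ⟨c + d, ?_⟩
      filter_upwards [hc, hd, Lp.coeFn_add y z] with χ h1 h2 h3
      rw [h3, Pi.add_apply, h1, h2, expoPoly, expoPoly, expoPoly,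
        Finsupp.sum_add_index' (by simp) (by simp [add_mul])]
    · rintro a y - ⟨c, hc⟩
      refine ⟨a • c, ?_⟩
      filter_upwards [hc, Lp.coeFn_smul a y] with χ h1 h3
      rw [h3, Pi.smul_apply, h1, expoPoly, expoPoly, Finsupp.sum_smul_index (by simp),
        Finsupp.smul_sum]
      simp [mul_assoc]
  choose c hc using hx'
  refine ⟨c, ?_⟩
  rw [Lp.tendsto_Lp_iff_tendsto_eLpNorm'] at hlim
  refine hlim.congr fun n => ?_
  rw [← eLpNorm_neg]
  refine eLpNorm_congr_ae ?_
  filter_upwards [hc n, hφ.coeFn_toLp] with χ h1 h2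
  simp [h1, h2]

end

/-! ### Adding points: the Mecke formula and local bounds for add-one costs. -/

section

variable {Z : Type*} [MeasurableSpace Z] {μ : Measure Z} {Q : Measure (Measure Z)}

/-! ### The Mecke formula -/

lemma tendsto_slope_nat {F : ℝ → ℝ} {F' : ℝ} (h : HasDerivAt F F' 0) :
    Tendsto (fun n : ℕ => ((n : ℝ) + 1) * (F (1 / ((n : ℝ) + 1)) - F 0)) atTop (𝓝 F') := by
  rw [hasDerivAt_iff_tendsto_slope_zero] at h
  have h1 : Tendsto (fun n : ℕ => 1 / ((n : ℝ) + 1)) atTop (𝓝[≠] 0) :=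
    tendsto_nhdsWithin_iff.2 ⟨tendsto_one_div_add_atTop_nhds_zero_nat,
      Eventually.of_forall fun n => by simp; positivity⟩
  refine (h.comp h1).congr fun n => ?_
  simp

/-- This is the Mecke formula tested against exponentials. It is the derivative at `s = 0` of the
Laplace functional at `v + s 1_B`, computed along `s = 1/(n+1)`: under the expectation on one side,
on the explicit exponential on the other. -/
lemma integral_real_mul_expo (hQ : IsPoissonLaw Q μ) {B : Set Z} (hB : MeasurableSet B)
    (hμ : μ B ≠ ∞) (v : FiniteSet μ →₀ ℝ≥0) :
    ∫ χ, χ.real B * expo v χ ∂Q =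
      (∫ χ, expo v χ ∂Q) * ∫ z in B, Real.exp (-expoFun v z) ∂μ := by
  have := hQ.prob
  let b : ℝ := ∫ z in B, Real.exp (-expoFun v z) ∂μ
  let a : ℝ := ∫ z, expoKernel v z ∂μ
  let w : ℕ → FiniteSet μ →₀ ℝ≥0 := fun n => Finsupp.single ⟨B, hB, hμ⟩ (1 / ((n : ℝ≥0) + 1))
  have hw : ∀ n χ, expo (w n) χ = Real.exp (-(1 / ((n : ℝ) + 1) * χ.real B)) := fun n χ => by
    simp [w, expo, expoPair]
  have hwf : ∀ n z, expoFun (w n) z = 1 / ((n : ℝ) + 1) * B.indicator (fun _ => (1 : ℝ)) z :=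
    fun n χ => by simp [w, expoFun]
  have h1 : ∀ n, ∫ χ, expo (v + w n) χ ∂Q =
      Real.exp (a + (Real.exp (-(1 / ((n : ℝ) + 1))) - 1) * b) := fun n => by
    rw [integral_expo hQ]
    congr 1
    have : ∀ z, expoKernel (v + w n) z = expoKernel v z +
        B.indicator (fun z => (Real.exp (-(1 / ((n : ℝ) + 1))) - 1) * Real.exp (-expoFun v z)) z := by
      intro z
      simp only [expoKernel, expoFun_add, hwf]
      by_cases hz : z ∈ B
      · simp only [hz, Set.indicator_of_mem, mul_one, neg_add, Real.exp_add]; ring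
      · simp [hz]
    simp_rw [this]
    rw [integral_add (integrable_expoKernel v), integral_indicator hB, integral_const_mul]
    refine (integrable_indicator_iff hB).2 (Integrable.const_mul ?_ _)
    refine Measure.integrableOn_of_bounded hμ (M := 1)
      (measurable_expoFun v).neg.exp.aestronglyMeasurable (ae_of_all _ fun z => ?_)
    rw [Real.norm_of_nonneg (Real.exp_pos _).le, Real.exp_le_one_iff, neg_nonpos]
    exact expoFun_nonneg v z
  -- The difference quotients are dominated by `χ(B)`, because `1 - exp(-x) ≤ x`.
  have hL : Tendsto (fun n : ℕ => ∫ χ, expo v χ *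
      (((n : ℝ) + 1) * (1 - Real.exp (-(1 / ((n : ℝ) + 1) * χ.real B)))) ∂Q) atTop
      (𝓝 (∫ χ, χ.real B * expo v χ ∂Q)) := by
    refine tendsto_integral_of_dominated_convergence (fun χ => χ.real B)
      (fun n => ?_) ?_ (fun n => ae_of_all _ fun χ => ?_) (ae_of_all _ fun χ => ?_)
    · have := measurable_expo v
      have := measurable_real hB
      exact Measurable.aestronglyMeasurable (by fun_prop)
    · simpa using hQ.integrable_real_pow hB hμ 1
    · have hx : 0 ≤ 1 / ((n : ℝ) + 1) * χ.real B := by positivity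
      have h2 := Real.add_one_le_exp (-(1 / ((n : ℝ) + 1) * χ.real B))
      have h3 : 0 ≤ 1 - Real.exp (-(1 / ((n : ℝ) + 1) * χ.real B)) :=
        sub_nonneg.2 (Real.exp_le_one_iff.2 (neg_nonpos.2 hx))
      rw [Real.norm_of_nonneg (mul_nonneg (expo_pos v χ).le (mul_nonneg (by positivity) h3))]
      calc _ ≤ 1 * (((n : ℝ) + 1) * (1 / ((n : ℝ) + 1) * χ.real B)) := by
            refine mul_le_mul (expo_le_one v χ) ?_ (mul_nonneg (by positivity) h3) zero_le_one
            exact mul_le_mul_of_nonneg_left (by linarith) (by positivity)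
        _ = χ.real B := by field_simp
    · have hd : HasDerivAt (fun s : ℝ => -Real.exp (-(s * χ.real B))) (χ.real B) 0 := by
        have := (((hasDerivAt_id (0 : ℝ)).mul_const (χ.real B)).fun_neg.exp).fun_neg
        simpa using this
      have h4 := (tendsto_slope_nat hd).const_mul (expo v χ)
      rw [mul_comm (expo v χ)] at h4
      refine h4.congr fun n => ?_
      rw [zero_mul, neg_zero, Real.exp_zero]
      ring
  have hR : Tendsto (fun n : ℕ => ∫ χ, expo v χ *
      (((n : ℝ) + 1) * (1 - Real.exp (-(1 / ((n : ℝ) + 1) * χ.real B)))) ∂Q) atTop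
      (𝓝 (Real.exp a * b)) := by
    have hd : HasDerivAt (fun s : ℝ => -Real.exp (a + (Real.exp (-s) - 1) * b)) (Real.exp a * b) 0 := by
      have := ((((((hasDerivAt_id (0 : ℝ)).fun_neg.exp).sub_const 1).mul_const b).const_add a).exp).fun_neg
      simpa using this
    refine (tendsto_slope_nat hd).congr fun n => ?_
    have h5 : ∀ χ : Measure Z, expo v χ *
        (((n : ℝ) + 1) * (1 - Real.exp (-(1 / ((n : ℝ) + 1) * χ.real B)))) =
        ((n : ℝ) + 1) * (expo v χ - expo (v + w n) χ) := fun χ => by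
      rw [expo_add, hw]; ring
    simp_rw [h5]
    rw [integral_const_mul, integral_sub ((memLp_expo v 1).integrable le_rfl)
      ((memLp_expo _ 1).integrable le_rfl), h1, integral_expo hQ]
    rw [neg_zero, Real.exp_zero, sub_self, zero_mul, add_zero]
    ring
  rw [tendsto_nhds_unique hL hR, integral_expo hQ]

lemma measurable_add_dirac :
    Measurable fun p : Measure Z × Z => p.1 + Measure.dirac p.2 :=
  measurable_fst.add (Measure.measurable_dirac.comp measurable_snd)

/-- The Mecke formula, for sets of finite measure. -/
lemma map_add_dirac [SigmaFinite μ] (hQ : IsPoissonLaw Q μ) {B : Set Z} (hB : MeasurableSet B)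
    (hμ : μ B ≠ ∞) :
    (Q.prod (μ.restrict B)).map (fun p => p.1 + Measure.dirac p.2) =
      Q.withDensity fun χ => χ B := by
  have := hQ.prob
  have : IsFiniteMeasure (μ.restrict B) := isFiniteMeasure_restrict.2 hμ
  have : IsFiniteMeasure (Q.withDensity fun χ => χ B) := by
    refine isFiniteMeasure_withDensity ?_
    simpa using (hQ.lintegral_pow_lt_top hB hμ 0 (by simp) 1).ne
  have hfin : ∀ A : FiniteSet μ, ∀ᵐ p ∂(Q.prod (μ.restrict B)), p.1 A.1 ≠ ∞ := fun A =>
    Measure.quasiMeasurePreserving_fst.ae (hQ.ae_ne_top A.2.1 A.2.2)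
  -- Both sides are finite measures, so it is enough to compare Laplace functionals; adding `δ_z`
  -- multiplies the exponential functional by `exp(-v(z))`, which reduces the claim to
  -- `integral_real_mul_expo`.
  refine ext_of_integral_expo (μ := μ) (fun A => ?_) (fun A => ?_) fun v => ?_
  · refine (ae_map_iff measurable_add_dirac.aemeasurable ?_).2 ?_
    · exact (Measure.measurable_coe A.2.1) (measurableSet_singleton ∞).compl
    · filter_upwards [hfin A] with p hp
      simp [hp]
  · exact (withDensity_absolutelyContinuous _ _).ae_le (hQ.ae_ne_top A.2.1 A.2.2)
  · rw [integral_withDensity_eq_integral_toReal_smul (Measure.measurable_coe hB)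
      ((hQ.ae_ne_top hB hμ).mono fun χ h => h.lt_top)]
    refine Eq.trans ?_ (integral_real_mul_expo hQ hB hμ v).symm
    rw [integral_map measurable_add_dirac.aemeasurable (measurable_expo v).aestronglyMeasurable,
      ← integral_prod_mul]
    refine integral_congr_ae ?_
    filter_upwards [(ae_ball_iff v.support.countable_toSet).2 fun A _ => hfin A] with p hp
    exact expo_add_dirac v hp p.2

lemma lintegral_add_dirac [SigmaFinite μ] (hQ : IsPoissonLaw Q μ) {B : Set Z}
    (hB : MeasurableSet B) (hμ : μ B ≠ ∞) {G : Measure Z → ℝ≥0∞} (hG : Measurable G) :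
    ∫⁻ z in B, ∫⁻ χ, G (χ + Measure.dirac z) ∂Q ∂μ = ∫⁻ χ, χ B * G χ ∂Q := by
  have := hQ.prob
  have h1 := lintegral_map (μ := Q.prod (μ.restrict B)) hG measurable_add_dirac
  rw [map_add_dirac hQ hB hμ, lintegral_withDensity_eq_lintegral_mul _ (Measure.measurable_coe hB)
    hG, lintegral_prod_symm' (fun p => G (p.1 + Measure.dirac p.2))
      (hG.comp measurable_add_dirac)] at h1
  exact h1.symm

/-! ### Configurations and iterated add-one costs -/

/-- The configuration of the points `z_l`, as a multiset. -/
def config {ι : Type*} [Fintype ι] (z : ι → Z) : Multiset Z := ∑ l, {z l}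

@[simp] lemma config_empty {Y : Type*} (z : Fin 0 → Y) : config z = 0 := by simp [config]

lemma config_succ {Y : Type*} {n : ℕ} (z : Fin (n + 1) → Y) :
    config z = z 0 ::ₘ config (Fin.tail z) := by
  simp [config, Fin.sum_univ_succ, Fin.tail]

@[simp] lemma config_cons {Y : Type*} {n : ℕ} (z : Y) (w : Fin n → Y) :
    config (Fin.cons z w : Fin (n + 1) → Y) = z ::ₘ config w := by
  rw [config_succ]; simp

@[simp] lemma card_config {Y ι : Type*} [Fintype ι] (z : ι → Y) :
    Multiset.card (config z) = Fintype.card ι := by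
  simp [config]

lemma config_comp_equiv {Y ι κ : Type*} [Fintype ι] [Fintype κ] (e : ι ≃ κ) (z : κ → Y) :
    config (z ∘ e) = config z :=
  e.sum_comp fun l => ({z l} : Multiset Y)

/-- A configuration whose points depend measurably on a parameter. -/
def MeasurableConfig {α : Type*} [MeasurableSpace α] (c : α → Multiset Z) : Prop :=
  ∃ (n : ℕ) (g : α → Fin n → Z), Measurable g ∧ ∀ a, c a = config (g a)

namespace MeasurableConfig

variable {α : Type*} [MeasurableSpace α] {c d : α → Multiset Z}

lemma zero : MeasurableConfig fun _ : α => (0 : Multiset Z) :=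
  ⟨0, fun _ i => i.elim0, measurable_pi_lambda _ fun i => i.elim0, by simp⟩

lemma cons {g : α → Z} (hg : Measurable g) (hc : MeasurableConfig c) :
    MeasurableConfig fun a => g a ::ₘ c a := by
  obtain ⟨n, h, hh, hc⟩ := hc
  refine ⟨n + 1, fun a => Fin.cons (g a) (h a), ?_, fun a => by simp [hc]⟩
  refine measurable_pi_lambda _ fun i => ?_
  refine Fin.cases ?_ (fun j => ?_) i
  · simpa using hg
  · simpa [Function.comp_def] using (measurable_pi_apply j).comp hh

lemma add (hc : MeasurableConfig c) (hd : MeasurableConfig d) :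
    MeasurableConfig fun a => c a + d a := by
  obtain ⟨n, g, hg, hc⟩ := hc
  obtain ⟨m, h, hh, hd⟩ := hd
  refine ⟨n + m, fun a => Fin.append (g a) (h a), ?_, fun a => ?_⟩
  · refine measurable_pi_lambda _ fun i => ?_
    refine Fin.addCases (fun j => ?_) (fun j => ?_) i
    · simpa [Function.comp_def] using (measurable_pi_apply j).comp hg
    · simpa [Function.comp_def] using (measurable_pi_apply j).comp hh
  · simp [config, Fin.sum_univ_add, hc, hd]

lemma sum {ι : Type*} (s : Finset ι) {c : ι → α → Multiset Z}
    (hc : ∀ i ∈ s, MeasurableConfig (c i)) : MeasurableConfig fun a => ∑ i ∈ s, c i a := by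
  classical
  induction s using Finset.induction_on with
  | empty => simpa using zero
  | insert i s hi ih =>
    simp_rw [Finset.sum_insert hi]
    exact (hc i (Finset.mem_insert_self i s)).add
      (ih fun j hj => hc j (Finset.mem_insert_of_mem hj))

lemma config {n : ℕ} {g : α → Fin n → Z} (hg : Measurable g) :
    MeasurableConfig fun a => config (g a) := ⟨n, g, hg, fun _ => rfl⟩

lemma const (s : Multiset Z) : MeasurableConfig fun _ : α => s := by
  induction s using Multiset.induction_on with
  | empty => exact zero
  | cons z s ih => exact ih.cons measurable_const

end MeasurableConfig

/-- A function of finite configurations is measurable if it is measurable as a function of the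
points. -/
def KernelMeasurable (t : Multiset Z → ℝ) : Prop := ∀ n, Measurable fun z : Fin n → Z => t (config z)

lemma KernelMeasurable.comp {t : Multiset Z → ℝ} (ht : KernelMeasurable t) {α : Type*}
    [MeasurableSpace α] {c : α → Multiset Z} (hc : MeasurableConfig c) :
    Measurable fun a => t (c a) := by
  obtain ⟨n, g, hg, hc⟩ := hc
  simp_rw [hc]
  exact (ht n).comp hg

lemma KernelMeasurable.add_left {t : Multiset Z → ℝ} (ht : KernelMeasurable t) (s : Multiset Z) :
    KernelMeasurable fun s' => t (s + s') := fun _ =>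
  ht.comp ((MeasurableConfig.const s).add (.config measurable_id))

/-- Add-one costs commute; this makes costs over a multiset of points well defined, and spares all
later bookkeeping of the order of the points. -/
instance : LeftCommutative (addOneCost : Z → (Measure Z → ℝ) → Measure Z → ℝ) where
  left_comm z w φ := by
    ext χ
    simp only [addOneCost]
    rw [add_right_comm]
    ring

/-- The add-one costs iterated over the points of a configuration. -/
def addCosts (s : Multiset Z) (φ : Measure Z → ℝ) : Measure Z → ℝ := s.foldr addOneCost φ

@[simp] lemma addCosts_zero (φ : Measure Z → ℝ) : addCosts 0 φ = φ := rfl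

lemma addCosts_cons (z : Z) (s : Multiset Z) (φ : Measure Z → ℝ) :
    addCosts (z ::ₘ s) φ = addOneCost z (addCosts s φ) := Multiset.foldr_cons _ _ _ _

lemma addCosts_add (s s' : Multiset Z) (φ : Measure Z → ℝ) :
    addCosts (s + s') φ = addCosts s (addCosts s' φ) := by
  induction s using Multiset.induction_on with
  | empty => simp
  | cons z s ih => rw [Multiset.cons_add, addCosts_cons, addCosts_cons, ih]

lemma addCosts_singleton (z : Z) (φ : Measure Z → ℝ) : addCosts {z} φ = addOneCost z φ := rfl

lemma addCosts_cons' (z : Z) (s : Multiset Z) (φ : Measure Z → ℝ) :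
    addCosts (z ::ₘ s) φ = addCosts s (addOneCost z φ) := by
  rw [← Multiset.singleton_add, add_comm, addCosts_add, addCosts_singleton]

lemma iteratedAddOneCost_eq (φ : Measure Z → ℝ) (q : ℕ) (z : Fin q → Z) :
    iteratedAddOneCost φ q z = addCosts (config z) φ := by
  induction q with
  | zero => simp [iteratedAddOneCost]
  | succ q ih => rw [iteratedAddOneCost, config_succ, addCosts_cons, ih]

lemma addCosts_linear (a b : ℝ) (φ ψ : Measure Z → ℝ) (s : Multiset Z) (χ : Measure Z) :
    addCosts s (fun χ => a * φ χ + b * ψ χ) χ = a * addCosts s φ χ + b * addCosts s ψ χ := by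
  induction s using Multiset.induction_on generalizing χ with
  | empty => simp
  | cons z s ih => simp only [addCosts_cons, addOneCost, ih]; ring

lemma addCosts_sub (φ ψ : Measure Z → ℝ) (s : Multiset Z) (χ : Measure Z) :
    addCosts s (fun χ => φ χ - ψ χ) χ = addCosts s φ χ - addCosts s ψ χ := by
  simpa [sub_eq_add_neg] using addCosts_linear 1 (-1) φ ψ s χ

lemma measurable_addOneCost {φ : Measure Z → ℝ} (hφ : Measurable φ) :
    Measurable fun p : Z × Measure Z => addOneCost p.1 φ p.2 :=
  (hφ.comp (measurable_add_dirac.comp measurable_swap)).sub (hφ.comp measurable_snd)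

lemma measurable_addCosts_config {φ : Measure Z → ℝ} (hφ : Measurable φ) (n : ℕ) :
    Measurable fun p : (Fin n → Z) × Measure Z => addCosts (config p.1) φ p.2 := by
  induction n with
  | zero => simpa [Function.comp_def] using hφ.comp measurable_snd
  | succ n ih =>
    simp only [config_succ, addCosts_cons, addOneCost]
    have h1 : Measurable fun p : (Fin (n + 1) → Z) × Measure Z => Fin.tail p.1 :=
      measurable_pi_lambda _ fun i => (measurable_pi_apply _).comp measurable_fst
    refine (ih.comp (h1.prodMk ?_)).sub (ih.comp (h1.prodMk measurable_snd))
    exact measurable_snd.add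
      (Measure.measurable_dirac.comp ((measurable_pi_apply 0).comp measurable_fst))

lemma measurable_addCosts {φ : Measure Z → ℝ} (hφ : Measurable φ) {α : Type*}
    [MeasurableSpace α] {c : α → Multiset Z} (hc : MeasurableConfig c) :
    Measurable fun p : α × Measure Z => addCosts (c p.1) φ p.2 := by
  obtain ⟨n, g, hg, hc⟩ := hc
  simp_rw [hc]
  exact (measurable_addCosts_config hφ n).comp ((hg.comp measurable_fst).prodMk measurable_snd)

lemma measurable_addCosts_right {φ : Measure Z → ℝ} (hφ : Measurable φ) (s : Multiset Z) :
    Measurable (addCosts s φ) :=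
  (measurable_addCosts hφ (α := Unit) (MeasurableConfig.const s)).comp
    (measurable_const (a := ()).prodMk measurable_id)

/-- The mean `E D_s φ(η)` of the iterated add-one costs. -/
def meanCosts (Q : Measure (Measure Z)) (φ : Measure Z → ℝ) (s : Multiset Z) : ℝ :=
  ∫ χ, addCosts s φ χ ∂Q

lemma kernelMeasurable_meanCosts [SFinite Q] {φ : Measure Z → ℝ} (hφ : Measurable φ) :
    KernelMeasurable (meanCosts Q φ) := fun n =>
  (measurable_addCosts_config hφ n).stronglyMeasurable.integral_prod_right.measurable

lemma meanCosts_cons (φ : Measure Z → ℝ) (z : Z) (s : Multiset Z) :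
    meanCosts Q φ (z ::ₘ s) = meanCosts Q (addOneCost z φ) s := by
  simp only [meanCosts, addCosts_cons']

/-! ### Product measures -/

lemma measurePreserving_cons (ν : Measure Z) [SigmaFinite ν] (n : ℕ) :
    MeasurePreserving (fun p : Z × (Fin n → Z) => (Fin.cons p.1 p.2 : Fin (n + 1) → Z))
      (ν.prod (power ν n)) (power ν (n + 1)) := by
  have := (measurePreserving_piFinSuccAbove (fun _ : Fin (n + 1) => ν) 0).symm
  convert this using 1
  ext p i
  simp [MeasurableEquiv.piFinSuccAbove, Fin.insertNthEquiv]

lemma lintegral_power_succ (ν : Measure Z) [SigmaFinite ν] (n : ℕ) {f : (Fin (n + 1) → Z) → ℝ≥0∞}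
    (hf : Measurable f) : ∫⁻ z, f z ∂(power ν (n + 1)) =
      ∫⁻ z, ∫⁻ w, f (Fin.cons z w) ∂(power ν n) ∂ν := by
  rw [← (measurePreserving_cons ν n).lintegral_comp hf,
    lintegral_prod (fun p => f (Fin.cons p.1 p.2))
      (hf.comp (measurePreserving_cons ν n).measurable).aemeasurable]

lemma integral_power_succ (ν : Measure Z) [SigmaFinite ν] (n : ℕ) {f : (Fin (n + 1) → Z) → ℝ}
    (hf : Measurable f) (hi : Integrable f (power ν (n + 1))) : ∫ z, f z ∂(power ν (n + 1)) =
      ∫ z, ∫ w, f (Fin.cons z w) ∂(power ν n) ∂ν := by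
  have h := measurePreserving_cons ν n
  rw [← integral_prod (fun p => f (Fin.cons p.1 p.2))
    ((h.integrable_comp hf.aestronglyMeasurable).2 hi), ← h.map_eq,
    integral_map h.measurable.aemeasurable (by exact hf.aestronglyMeasurable)]

lemma power_restrict (ν : Measure Z) [SigmaFinite ν] (B : Set Z) (n : ℕ) :
    power (ν.restrict B) n = (power ν n).restrict (Set.univ.pi fun _ => B) :=
  (Measure.restrict_pi_pi (fun _ : Fin n => ν) fun _ => B).symm

lemma iUnion_pi_spanningSets (μ : Measure Z) [SigmaFinite μ] (n : ℕ) :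
    ⋃ N, (Set.univ.pi fun _ : Fin n => spanningSets μ N) = Set.univ := by
  refine Set.eq_univ_of_forall fun z => Set.mem_iUnion.2 ⟨∑ i, spanningSetsIndex μ (z i), ?_⟩
  exact fun i _ => monotone_spanningSets μ
    (Finset.single_le_sum (f := fun i => spanningSetsIndex μ (z i)) (fun _ _ => Nat.zero_le _)
      (Finset.mem_univ i)) (mem_spanningSetsIndex μ (z i))

lemma ae_power_of_forall_restrict [SigmaFinite μ] {n : ℕ} {p : (Fin n → Z) → Prop}
    (h : ∀ N, ∀ᵐ z ∂(power (μ.restrict (spanningSets μ N)) n), p z) : ∀ᵐ z ∂(power μ n), p z := by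
  rw [← Measure.restrict_univ (μ := power μ n), ← iUnion_pi_spanningSets μ n,
    ae_restrict_iUnion_iff]
  intro N
  rw [← power_restrict]
  exact h N

/-! ### Bounds for add-one costs -/

/-- No integrability of `φ` is required. One cost is bounded by `|φ(χ + δ_z)| + |φ(χ)|`; the weight
`(χ(B) + μ(B))^n` only grows when a point is added, so it can be moved to `χ + δ_z`. The Mecke
formula then produces the factor `χ(B)`, and integration over `B` the factor `μ(B)`. -/
lemma lintegral_addCosts_le [SigmaFinite μ] (hQ : IsPoissonLaw Q μ) {B : Set Z}
    (hB : MeasurableSet B) (hμ : μ B ≠ ∞) (n : ℕ) {φ : Measure Z → ℝ} (hφ : Measurable φ) :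
    ∫⁻ z, ∫⁻ χ, ‖addCosts (config z) φ χ‖ₑ ∂Q ∂(power (μ.restrict B) n) ≤
      ∫⁻ χ, ‖φ χ‖ₑ * (χ B + μ B) ^ n ∂Q := by
  have := hQ.prob
  have : IsFiniteMeasure (μ.restrict B) := isFiniteMeasure_restrict.2 hμ
  have hmB := Measure.measurable_coe hB
  induction n generalizing φ with
  | zero => simp [power]
  | succ n ih =>
    rw [lintegral_power_succ]
    swap
    · exact (measurable_addCosts_config hφ _).enorm.lintegral_prod_right'
    simp only [config_cons, addCosts_cons']
    let G : Measure Z → ℝ≥0∞ := fun χ => ‖φ χ‖ₑ * (χ B + μ B) ^ n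
    have hG : Measurable G := hφ.enorm.mul ((hmB.add_const _).pow_const n)
    calc _ ≤ ∫⁻ z in B, ∫⁻ χ, ‖addOneCost z φ χ‖ₑ * (χ B + μ B) ^ n ∂Q ∂μ := by
          refine lintegral_mono fun z => ih ?_
          exact (measurable_addOneCost hφ).comp (measurable_const.prodMk measurable_id)
      _ ≤ ∫⁻ z in B, (∫⁻ χ, G (χ + Measure.dirac z) ∂Q + ∫⁻ χ, G χ ∂Q) ∂μ := by
          refine lintegral_mono fun z => ?_
          rw [← lintegral_add_right _ hG]
          refine lintegral_mono fun χ => ?_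
          simp only [G, addOneCost]
          calc _ ≤ (‖φ (χ + Measure.dirac z)‖ₑ + ‖φ χ‖ₑ) * (χ B + μ B) ^ n := by
                gcongr; exact enorm_sub_le
            _ ≤ _ := by
                rw [add_mul]
                gcongr
                exact Measure.le_add_right le_rfl
      _ = ∫⁻ χ, χ B * G χ ∂Q + μ B * ∫⁻ χ, G χ ∂Q := by
          rw [lintegral_add_right _ measurable_const, lintegral_add_dirac hQ hB hμ hG,
            lintegral_const, Measure.restrict_apply_univ, mul_comm (μ B)]
      _ = ∫⁻ χ, ‖φ χ‖ₑ * (χ B + μ B) ^ (n + 1) ∂Q := by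
          rw [← lintegral_const_mul _ hG, ← lintegral_add_right _ (hG.const_mul _)]
          refine lintegral_congr fun χ => ?_
          simp only [G]
          ring

/-- The constant in the local `L¹`-bound for the iterated add-one costs. -/
def localConst (Q : Measure (Measure Z)) (μ : Measure Z) (B : Set Z) (n : ℕ) : ℝ≥0∞ :=
  (∫⁻ χ, ((χ B + μ B) ^ n) ^ (2 : ℝ) ∂Q) ^ (1 / 2 : ℝ)

lemma localConst_lt_top (hQ : IsPoissonLaw Q μ) {B : Set Z}
    (hB : MeasurableSet B) (hμ : μ B ≠ ∞) (n : ℕ) : localConst Q μ B n < ∞ := by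
  refine ENNReal.rpow_lt_top_of_nonneg (by positivity) ?_
  have := hQ.lintegral_pow_lt_top hB hμ _ hμ (n * 2)
  simp_rw [pow_mul] at this
  exact_mod_cast this.ne

/-- By Cauchy–Schwarz. Convergence in `L²(Q)` thus implies convergence of the add-one costs in `L¹`
over sets of finite measure; this is how costs of limits are identified below. -/
lemma lintegral_addCosts_le_eLpNorm [SigmaFinite μ] (hQ : IsPoissonLaw Q μ) {B : Set Z}
    (hB : MeasurableSet B) (hμ : μ B ≠ ∞) (n : ℕ) {φ : Measure Z → ℝ} (hφ : Measurable φ) :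
    ∫⁻ z, ∫⁻ χ, ‖addCosts (config z) φ χ‖ₑ ∂Q ∂(power (μ.restrict B) n) ≤
      eLpNorm φ 2 Q * localConst Q μ B n := by
  have hmB := Measure.measurable_coe hB
  refine (lintegral_addCosts_le hQ hB hμ n hφ).trans ?_
  have := ENNReal.lintegral_mul_le_Lp_mul_Lq Q Real.HolderConjugate.two_two
    (f := fun χ => ‖φ χ‖ₑ) (g := fun χ => (χ B + μ B) ^ n)
    hφ.enorm.aemeasurable ((hmB.add_const _).pow_const n).aemeasurable
  refine this.trans (le_of_eq ?_)
  rw [eLpNorm_eq_lintegral_rpow_enorm_toReal (by norm_num) (by norm_num)]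
  simp [localConst]

/-- Add-one costs only depend on the almost sure equivalence class of a functional. -/
lemma ae_addCosts_congr [SigmaFinite μ] (hQ : IsPoissonLaw Q μ) {φ ψ : Measure Z → ℝ}
    (hφ : Measurable φ) (hψ : Measurable ψ) (h : φ =ᵐ[Q] ψ) (n : ℕ) :
    ∀ᵐ z ∂(power μ n), addCosts (config z) φ =ᵐ[Q] addCosts (config z) ψ := by
  have := hQ.prob
  refine ae_power_of_forall_restrict fun N => ?_
  have h1 := lintegral_addCosts_le hQ (measurableSet_spanningSets μ N)
    (measure_spanningSets_lt_top μ N).ne n (hφ.sub hψ)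
  have h2 : ∫⁻ χ, ‖(φ - ψ) χ‖ₑ * (χ (spanningSets μ N) + μ (spanningSets μ N)) ^ n ∂Q = 0 := by
    rw [← lintegral_zero (μ := Q)]
    refine lintegral_congr_ae ?_
    filter_upwards [h] with χ hχ
    simp [hχ]
  rw [h2, nonpos_iff_eq_zero, lintegral_eq_zero_iff
    (measurable_addCosts_config (hφ.sub hψ) n).enorm.lintegral_prod_right'] at h1
  filter_upwards [h1] with z hz
  rw [Pi.zero_apply, lintegral_eq_zero_iff
    (measurable_addCosts_right (hφ.sub hψ) _).enorm] at hz
  filter_upwards [hz] with χ hχ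
  have h3 := addCosts_sub φ ψ (config z) χ
  simp only [Pi.zero_apply, enorm_eq_zero] at hχ
  change addCosts _ (fun χ => φ χ - ψ χ) χ = 0 at hχ
  rw [hχ] at h3
  linarith

lemma ae_integrable_addCosts [SigmaFinite μ] (hQ : IsPoissonLaw Q μ) {φ : Measure Z → ℝ}
    (hφ : Measurable φ) (h2 : MemLp φ 2 Q) (n : ℕ) :
    ∀ᵐ z ∂(power μ n), Integrable (addCosts (config z) φ) Q := by
  have := hQ.prob
  refine ae_power_of_forall_restrict fun N => ?_
  have h1 := lintegral_addCosts_le_eLpNorm hQ (measurableSet_spanningSets μ N)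
    (measure_spanningSets_lt_top μ N).ne n hφ
  have h3 := h1.trans_lt (ENNReal.mul_lt_top h2.2
    (localConst_lt_top hQ (measurableSet_spanningSets μ N) (measure_spanningSets_lt_top μ N).ne n))
  filter_upwards [ae_lt_top (measurable_addCosts_config hφ n).enorm.lintegral_prod_right' h3.ne]
    with z hz
  exact ⟨(measurable_addCosts_right hφ _).aestronglyMeasurable, hz⟩

end

/-! ### The isometry into the Fock space. -/

section

/-! ### Limits in `L²` -/

section Limits

variable {α : Type*} [MeasurableSpace α] {ν : Measure α}

lemma tendsto_eLpNorm_sub_pair {f : ℕ → α → ℝ} {g : α → ℝ} (hf : ∀ n, AEStronglyMeasurable (f n) ν)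
    (hg : AEStronglyMeasurable g ν)
    (h : Tendsto (fun n => eLpNorm (fun x => f n x - g x) 2 ν) atTop (𝓝 0)) :
    Tendsto (fun p : ℕ × ℕ => eLpNorm (fun x => f p.1 x - f p.2 x) 2 ν) atTop (𝓝 0) := by
  have h0 : Tendsto (Prod.fst : ℕ × ℕ → ℕ) atTop atTop := by
    rw [← prod_atTop_atTop_eq]; exact tendsto_fst
  have h0' : Tendsto (Prod.snd : ℕ × ℕ → ℕ) atTop atTop := by
    rw [← prod_atTop_atTop_eq]; exact tendsto_snd
  have h1 := (h.comp h0).add (h.comp h0')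
  rw [add_zero] at h1
  refine tendsto_of_tendsto_of_tendsto_of_le_of_le tendsto_const_nhds h1 (fun _ => zero_le) ?_
  intro p
  have h2 : (fun x => f p.1 x - f p.2 x) =
      (fun x => f p.1 x - g x) - fun x => f p.2 x - g x := by
    ext x; simp
  simp only [h2, Function.comp_apply]
  exact eLpNorm_sub_le ((hf p.1).sub hg) ((hf p.2).sub hg) (by norm_num)

lemma exists_limit_of_cauchy {f : ℕ → α → ℝ} (hf : ∀ n, MemLp (f n) 2 ν)
    (h : Tendsto (fun p : ℕ × ℕ => eLpNorm (fun x => f p.1 x - f p.2 x) 2 ν) atTop (𝓝 0)) :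
    ∃ g : α → ℝ, Measurable g ∧ MemLp g 2 ν ∧
      Tendsto (fun n => eLpNorm (fun x => f n x - g x) 2 ν) atTop (𝓝 0) := by
  have hc : CauchySeq fun n => (hf n).toLp := by
    rw [Lp.cauchySeq_Lp_iff_cauchySeq_eLpNorm]
    refine h.congr fun p => eLpNorm_congr_ae ?_
    filter_upwards [(hf p.1).coeFn_toLp, (hf p.2).coeFn_toLp] with x h1 h2
    simp [h1, h2]
  obtain ⟨G, hG⟩ := cauchySeq_tendsto_of_complete hc
  refine ⟨G, (Lp.stronglyMeasurable G).measurable, Lp.memLp G, ?_⟩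
  rw [Lp.tendsto_Lp_iff_tendsto_eLpNorm'] at hG
  refine hG.congr fun n => eLpNorm_congr_ae ?_
  filter_upwards [(hf n).coeFn_toLp] with x h1
  simp [h1]

lemma tendsto_eLpNorm_of_sub {f : ℕ → α → ℝ} {g : α → ℝ} (hf : ∀ n, MemLp (f n) 2 ν)
    (hg : MemLp g 2 ν) (h : Tendsto (fun n => eLpNorm (fun x => f n x - g x) 2 ν) atTop (𝓝 0)) :
    Tendsto (fun n => eLpNorm (f n) 2 ν) atTop (𝓝 (eLpNorm g 2 ν)) := by
  have h1 := ((Lp.tendsto_Lp_iff_tendsto_eLpNorm'' (fi := atTop) f hf g hg).2 h).norm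
  simp only [Lp.norm_toLp] at h1
  rw [← ENNReal.tendsto_toReal_iff (fun n => (hf n).2.ne) hg.2.ne]
  exact h1

lemma eLpNorm_eq_of_integral_sq {β : Type*} [MeasurableSpace β] {ρ : Measure β} {f : α → ℝ}
    {g : β → ℝ} (hf : MemLp f 2 ν) (hg : MemLp g 2 ρ) (h : ∫ x, f x ^ 2 ∂ν = ∫ x, g x ^ 2 ∂ρ) :
    eLpNorm f 2 ν = eLpNorm g 2 ρ := by
  rw [hf.eLpNorm_eq_integral_rpow_norm (by norm_num) (by norm_num),
    hg.eLpNorm_eq_integral_rpow_norm (by norm_num) (by norm_num)]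
  simp [h]

end Limits

/-! ### The Fock space -/

variable {Z : Type*} [MeasurableSpace Z] {μ : Measure Z} {Q : Measure (Measure Z)}

/-- The sets of finite configurations which are measurable in terms of the points. -/
instance configMeasurableSpace : MeasurableSpace (Multiset Z) :=
  ⨅ n : ℕ, MeasurableSpace.map (config : (Fin n → Z) → Multiset Z) inferInstance

lemma measurable_config (n : ℕ) : Measurable (config : (Fin n → Z) → Multiset Z) :=
  fun _ hs => MeasurableSpace.measurableSet_iInf.1 hs n

lemma KernelMeasurable.measurable {t : Multiset Z → ℝ} (ht : KernelMeasurable t) :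
    Measurable t := fun _ hs => MeasurableSpace.measurableSet_iInf.2 fun n => ht n hs

lemma measurable_iff_kernelMeasurable {t : Multiset Z → ℝ} : Measurable t ↔ KernelMeasurable t :=
  ⟨fun h n => h.comp (measurable_config n), fun h => h.measurable⟩

/-- The measure `∑ μ^n / n!` on the space of finite configurations. -/
def fock (μ : Measure Z) : Measure (Multiset Z) :=
  Measure.sum fun n : ℕ => (n.factorial : ℝ≥0∞)⁻¹ • (power μ n).map config

lemma ae_fock_iff {p : Multiset Z → Prop} (hp : MeasurableSet {s | p s}) :
    (∀ᵐ s ∂(fock μ), p s) ↔ ∀ n, ∀ᵐ z ∂(power μ n), p (config z) := by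
  rw [fock, Measure.ae_sum_iff' hp]
  refine forall_congr' fun n => ?_
  rw [Measure.ae_ennreal_smul_measure_iff (by simp), ae_map_iff (measurable_config n).aemeasurable hp]

lemma ae_config_of_ae_fock {p : Multiset Z → Prop} (h : ∀ᵐ s ∂(fock μ), p s) (n : ℕ) :
    ∀ᵐ z ∂(power μ n), p (config z) := by
  have h1 := ae_mono (Measure.le_sum (fun n : ℕ => (n.factorial : ℝ≥0∞)⁻¹ • (power μ n).map config) n) h
  have h2 := (Measure.ae_ennreal_smul_measure_iff (by simp)).1 h1
  exact ae_of_ae_map (measurable_config n).aemeasurable h2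

lemma lintegral_fock {t : Multiset Z → ℝ≥0∞} (ht : Measurable t) :
    ∫⁻ s, t s ∂(fock μ) = ∑' n : ℕ, (n.factorial : ℝ≥0∞)⁻¹ * ∫⁻ z, t (config z) ∂(power μ n) := by
  rw [fock, lintegral_sum_measure]
  simp_rw [lintegral_smul_measure, lintegral_map ht (measurable_config _), smul_eq_mul]

lemma integral_smul_map_config {t : Multiset Z → ℝ} (ht : Measurable t) (n : ℕ) :
    ∫ s, t s ∂((n.factorial : ℝ≥0∞)⁻¹ • (power μ n).map config) =
      (n.factorial : ℝ)⁻¹ * ∫ z, t (config z) ∂(power μ n) := by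
  rw [integral_smul_measure,
    integral_map (measurable_config n).aemeasurable ht.aestronglyMeasurable]
  simp

lemma hasSum_integral_fock {t : Multiset Z → ℝ} (hm : Measurable t) (ht : Integrable t (fock μ)) :
    HasSum (fun n : ℕ => (n.factorial : ℝ)⁻¹ * ∫ z, t (config z) ∂(power μ n))
      (∫ s, t s ∂(fock μ)) := by
  have := hasSum_integral_measure ht
  simp_rw [integral_smul_map_config hm] at this
  exact this

lemma eLpNorm_config_le [SigmaFinite μ] {t : Multiset Z → ℝ} (hm : Measurable t) (n : ℕ) :
    eLpNorm (fun z => t (config z)) 2 (power μ n) ≤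
      (n.factorial : ℝ≥0∞) ^ (1 / 2 : ℝ) * eLpNorm t 2 (fock μ) := by
  have h1 : (power μ n).map config ≤ (n.factorial : ℝ≥0∞) • fock μ := by
    have h2 := Measure.le_sum (fun n : ℕ => (n.factorial : ℝ≥0∞)⁻¹ • (power μ n).map config) n
    have h3 : (n.factorial : ℝ≥0∞) • ((n.factorial : ℝ≥0∞)⁻¹ • (power μ n).map config) ≤
      (n.factorial : ℝ≥0∞) • fock μ := by gcongr; exact h2
    rw [smul_smul, ENNReal.mul_inv_cancel (by simp [Nat.factorial_ne_zero]) (by simp), one_smul] at h3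
    exact h3
  have h4 := eLpNorm_mono_measure (p := 2) t h1
  rw [eLpNorm_map_measure hm.aestronglyMeasurable (measurable_config n).aemeasurable,
    eLpNorm_smul_measure_of_ne_top (by norm_num)] at h4
  simpa [Function.comp_def] using h4

/-! ### The Fock space representation -/

lemma prod_map_config (k : Z → ℝ) {n : ℕ} (z : Fin n → Z) :
    ((config z).map k).prod = ∏ l, k (z l) := by
  induction n with
  | zero => simp [config_empty]
  | succ n ih =>
    rw [config_succ, Fin.prod_univ_succ, Multiset.map_cons, Multiset.prod_cons, ih]
    rfl

lemma measurable_prod_map {k : Z → ℝ} (hk : Measurable k) :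
    KernelMeasurable fun s : Multiset Z => (s.map k).prod := fun n => by
  simp_rw [prod_map_config]
  exact Finset.measurable_prod _ fun l _ => hk.comp (measurable_pi_apply l)

lemma integrable_prod_map [SigmaFinite μ] {k : Z → ℝ} (hm : Measurable k) (hk : Integrable k μ) :
    Integrable (fun s : Multiset Z => (s.map k).prod) (fock μ) := by
  have hM := (measurable_prod_map hm).measurable
  refine integrable_sum_measure (fun n => ?_) ?_
  · refine Integrable.smul_measure ?_ (by simp [Nat.factorial_ne_zero])
    rw [integrable_map_measure hM.aestronglyMeasurable (measurable_config n).aemeasurable]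
    simp_rw [Function.comp_def, prod_map_config]
    exact Integrable.fintype_prod (f := fun _ => k) fun _ => hk
  · have : ∀ n : ℕ, ∫ s, ‖(s.map k).prod‖ ∂((n.factorial : ℝ≥0∞)⁻¹ • (power μ n).map config) =
        (∫ z, ‖k z‖ ∂μ) ^ n / n.factorial := fun n => by
      rw [integral_smul_map_config hM.norm, div_eq_inv_mul]
      simp_rw [prod_map_config, norm_prod]
      rw [integral_fintype_prod_eq_prod (fun _ => fun z => ‖k z‖)]
      simp
    simp_rw [this]
    exact Real.summable_pow_div_factorial _

/-- The configurations of size `n` contribute `(∫ k)^n / n!`. -/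
lemma integral_prod_map [SigmaFinite μ] {k : Z → ℝ} (hm : Measurable k) (hk : Integrable k μ) :
    ∫ s : Multiset Z, (s.map k).prod ∂(fock μ) = Real.exp (∫ z, k z ∂μ) := by
  have h := hasSum_integral_fock (measurable_prod_map hm).measurable (integrable_prod_map hm hk)
  rw [← h.tsum_eq, Real.exp_eq_exp_ℝ, NormedSpace.exp_eq_tsum_div]
  refine tsum_congr fun n => ?_
  simp_rw [prod_map_config]
  rw [integral_fintype_prod_eq_prod (fun _ => k)]
  simp [div_eq_inv_mul]

/-- Each cost `D_z` multiplies the exponential functional by `exp(-v(z)) - 1`: exponentials are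
eigenfunctions. -/
lemma addCosts_expo (v : FiniteSet μ →₀ ℝ≥0) (s : Multiset Z) {χ : Measure Z}
    (hχ : ∀ A ∈ v.support, χ A.1 ≠ ∞) :
    addCosts s (expo v) χ = (s.map (expoKernel v)).prod * expo v χ := by
  induction s using Multiset.induction_on generalizing χ with
  | empty => simp
  | cons z s ih =>
    rw [addCosts_cons, addOneCost, ih hχ, ih, expo_add_dirac v hχ, Multiset.map_cons,
      Multiset.prod_cons, expoKernel]
    · ring
    · intro A hA
      simp [hχ A hA]

lemma ae_addCosts_expo (hQ : IsPoissonLaw Q μ) (v : FiniteSet μ →₀ ℝ≥0) (s : Multiset Z) :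
    addCosts s (expo v) =ᵐ[Q] fun χ => (s.map (expoKernel v)).prod * expo v χ := by
  filter_upwards [(ae_ball_iff v.support.countable_toSet).2 fun A _ => hQ.ae_ne_top A.2.1 A.2.2]
    with χ hχ
  exact addCosts_expo v s hχ

lemma addCosts_expoPoly (c : (FiniteSet μ →₀ ℝ≥0) →₀ ℝ) (s : Multiset Z) (χ : Measure Z) :
    addCosts s (expoPoly c) χ = c.sum fun v a => a * addCosts s (expo v) χ := by
  induction s using Multiset.induction_on generalizing χ with
  | empty => simp [expoPoly]
  | cons z s ih =>
    simp only [addCosts_cons, addOneCost, ih, Finsupp.sum, ← Finset.sum_sub_distrib, mul_sub]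

lemma meanCosts_expoPoly (hQ : IsPoissonLaw Q μ) (c : (FiniteSet μ →₀ ℝ≥0) →₀ ℝ) (s : Multiset Z) :
    meanCosts Q (expoPoly c) s =
      c.sum fun v a => a * ((s.map (expoKernel v)).prod * ∫ χ, expo v χ ∂Q) := by
  have := hQ.prob
  simp only [meanCosts, addCosts_expoPoly, Finsupp.sum]
  rw [integral_finsetSum]
  · refine Finset.sum_congr rfl fun v _ => ?_
    rw [integral_const_mul, integral_congr_ae (ae_addCosts_expo hQ v s), integral_const_mul]
  · intro v _
    refine Integrable.const_mul ?_ _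
    rw [integrable_congr (ae_addCosts_expo hQ v s)]
    exact ((memLp_expo v 1).integrable le_rfl).const_mul _

lemma prod_map_mul_prod_map (k l : Z → ℝ) (s : Multiset Z) :
    (s.map k).prod * (s.map l).prod = (s.map fun z => k z * l z).prod :=
  (Multiset.prod_map_mul).symm

/-- Expanding both squares, the claim reduces to pairs `v, w`. With `k_v = exp(-v) - 1`, the
expectation of the product is `exp(∫ k_{v+w})`, the inner product of the mean costs is `exp(∫ k_v +
∫ k_w) exp(∫ k_v k_w)`, and these agree by `expoKernel_add`. -/
lemma eLpNorm_meanCosts_expoPoly [SigmaFinite μ] (hQ : IsPoissonLaw Q μ)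
    (c : (FiniteSet μ →₀ ℝ≥0) →₀ ℝ) : MemLp (meanCosts Q (expoPoly c)) 2 (fock μ) ∧
      eLpNorm (meanCosts Q (expoPoly c)) 2 (fock μ) = eLpNorm (expoPoly c) 2 Q := by
  have := hQ.prob
  have hm : ∀ v w : FiniteSet μ →₀ ℝ≥0, Measurable fun z => expoKernel v z * expoKernel w z :=
    fun v w => (measurable_expoKernel v).mul (measurable_expoKernel w)
  have hi : ∀ v w : FiniteSet μ →₀ ℝ≥0, Integrable (fun z => expoKernel v z * expoKernel w z) μ :=
    fun v w => (memLp_expoKernel v).integrable_mul (memLp_expoKernel w)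
  have h2 : MemLp (meanCosts Q (expoPoly c)) 2 (fock μ) := by
    rw [funext (meanCosts_expoPoly hQ c)]
    refine memLp_finsetSum _ fun v _ => MemLp.const_mul (MemLp.mul_const ?_ _) _
    rw [memLp_two_iff_integrable_sq
      (measurable_prod_map (measurable_expoKernel v)).measurable.aestronglyMeasurable]
    simp_rw [sq, prod_map_mul_prod_map]
    exact integrable_prod_map (hm v v) (hi v v)
  refine ⟨h2, eLpNorm_eq_of_integral_sq h2 (memLp_expoPoly c 2) ?_⟩
  have h3 : ∀ s, meanCosts Q (expoPoly c) s ^ 2 = ∑ v ∈ c.support, ∑ w ∈ c.support,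
      c v * c w * ((∫ χ, expo v χ ∂Q) * ∫ χ, expo w χ ∂Q) *
        (s.map fun z => expoKernel v z * expoKernel w z).prod := fun s => by
    rw [meanCosts_expoPoly hQ, Finsupp.sum, sq, Finset.sum_mul_sum]
    refine Finset.sum_congr rfl fun v _ => Finset.sum_congr rfl fun w _ => ?_
    rw [← prod_map_mul_prod_map]; ring
  have h4 : ∀ χ, expoPoly c χ ^ 2 = ∑ v ∈ c.support, ∑ w ∈ c.support,
      c v * c w * expo (v + w) χ := fun χ => by
    rw [expoPoly, Finsupp.sum, sq, Finset.sum_mul_sum]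
    refine Finset.sum_congr rfl fun v _ => Finset.sum_congr rfl fun w _ => ?_
    rw [expo_add]; ring
  simp_rw [h3, h4]
  rw [integral_finsetSum, integral_finsetSum]
  · refine Finset.sum_congr rfl fun v _ => ?_
    rw [integral_finsetSum, integral_finsetSum]
    · refine Finset.sum_congr rfl fun w _ => ?_
      rw [integral_const_mul, integral_const_mul, integral_prod_map (hm v w) (hi v w),
        integral_expo hQ, integral_expo hQ, integral_expo hQ, mul_assoc, ← Real.exp_add,
        ← Real.exp_add]
      simp_rw [expoKernel_add]
      have h5 := integral_add ((integrable_expoKernel v).add (integrable_expoKernel w)) (hi v w)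
      simp only [Pi.add_apply] at h5
      rw [h5, integral_add (integrable_expoKernel v) (integrable_expoKernel w)]
    · exact fun w _ => ((memLp_expo _ 1).integrable le_rfl).const_mul _
    · exact fun w _ => (integrable_prod_map (hm v w) (hi v w)).const_mul _
  · exact fun v _ => integrable_finsetSum _ fun w _ =>
      ((memLp_expo _ 1).integrable le_rfl).const_mul _
  · exact fun v _ => integrable_finsetSum _ fun w _ =>
      (integrable_prod_map (hm v w) (hi v w)).const_mul _

lemma ae_meanCosts_sub [SigmaFinite μ] (hQ : IsPoissonLaw Q μ) {φ ψ : Measure Z → ℝ}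
    (hφ : Measurable φ) (hψ : Measurable ψ) (hφ2 : MemLp φ 2 Q) (hψ2 : MemLp ψ 2 Q) (n : ℕ) :
    ∀ᵐ z ∂(power μ n), meanCosts Q (fun χ => φ χ - ψ χ) (config z) =
      meanCosts Q φ (config z) - meanCosts Q ψ (config z) := by
  filter_upwards [ae_integrable_addCosts hQ hφ hφ2 n, ae_integrable_addCosts hQ hψ hψ2 n]
    with z h1 h2
  simp only [meanCosts, addCosts_sub]
  exact integral_sub h1 h2

lemma eLpNorm_meanCosts_le [SigmaFinite μ] (hQ : IsPoissonLaw Q μ) {B : Set Z}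
    (hB : MeasurableSet B) (hμ : μ B ≠ ∞) (n : ℕ) {φ : Measure Z → ℝ} (hφ : Measurable φ) :
    eLpNorm (fun z => meanCosts Q φ (config z)) 1 (power (μ.restrict B) n) ≤
      eLpNorm φ 2 Q * localConst Q μ B n := by
  rw [eLpNorm_one_eq_lintegral_enorm]
  refine le_trans (lintegral_mono fun z => ?_) (lintegral_addCosts_le_eLpNorm hQ hB hμ n hφ)
  exact enorm_integral_le_lintegral_enorm _

/-- The Fock space representation of square-integrable Poisson functionals. -/
theorem memLp_meanCosts_and_eLpNorm [SigmaFinite μ] (hQ : IsPoissonLaw Q μ) {φ : Measure Z → ℝ}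
    (hφ : Measurable φ) (h2 : MemLp φ 2 Q) : MemLp (meanCosts Q φ) 2 (fock μ) ∧
      eLpNorm (meanCosts Q φ) 2 (fock μ) = eLpNorm φ 2 Q := by
  have := hQ.prob
  obtain ⟨c, hc⟩ := exists_seq_expoPoly hQ h2
  have hc' : Tendsto (fun n => eLpNorm (fun χ => expoPoly (c n) χ - φ χ) 2 Q) atTop (𝓝 0) := by
    refine hc.congr fun n => ?_
    rw [← eLpNorm_neg]
    congr 1
    ext χ
    simp
  have hsub : ∀ i j, eLpNorm (fun s => meanCosts Q (expoPoly (c i)) s -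
      meanCosts Q (expoPoly (c j)) s) 2 (fock μ) =
      eLpNorm (fun χ => expoPoly (c i) χ - expoPoly (c j) χ) 2 Q := fun i j => by
    have h3 := (eLpNorm_meanCosts_expoPoly hQ (c i - c j)).2
    have h4 : expoPoly (c i - c j) = fun χ => expoPoly (c i) χ - expoPoly (c j) χ := by
      ext χ
      simp only [expoPoly]
      rw [Finsupp.sum_sub_index]
      intros; ring
    rw [← h4, ← h3]
    congr 1
    ext s
    rw [meanCosts_expoPoly hQ, meanCosts_expoPoly hQ, meanCosts_expoPoly hQ,
      Finsupp.sum_sub_index]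
    intros; ring
  have hT := fun n => (eLpNorm_meanCosts_expoPoly hQ (c n)).1
  have hcau := tendsto_eLpNorm_sub_pair (fun n => (measurable_expoPoly (c n)).aestronglyMeasurable)
    hφ.aestronglyMeasurable hc'
  simp_rw [← hsub] at hcau
  obtain ⟨G, hGm, hG2, hG⟩ := exists_limit_of_cauchy hT hcau
  have hTm : Measurable (meanCosts Q φ) := (kernelMeasurable_meanCosts hφ).measurable
  have hTcm : ∀ n, Measurable (meanCosts Q (expoPoly (c n))) := fun n =>
    (kernelMeasurable_meanCosts (measurable_expoPoly _)).measurable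
  -- The mean costs of the approximations converge to `G` in `L²`, by the isometry, and to those of
  -- `φ` in `L¹` on each power of a spanning set, by the local bound. Both imply convergence in
  -- measure, so the limits coincide.
  have hEq : G =ᵐ[fock μ] meanCosts Q φ := by
    refine (ae_fock_iff (measurableSet_eq_fun hGm hTm)).2 fun n =>
      ae_power_of_forall_restrict fun N => ?_
    set B := spanningSets μ N
    have hB : MeasurableSet B := measurableSet_spanningSets μ N
    have hμB : μ B ≠ ∞ := (measure_spanningSets_lt_top μ N).ne
    have hle : power (μ.restrict B) n ≤ power μ n := by
      rw [power_restrict]; exact Measure.restrict_le_self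
    have hcm := measurable_config (Z := Z) n
    refine tendstoInMeasure_ae_unique
      (f := fun j z => meanCosts Q (expoPoly (c j)) (config z)) (u := atTop) ?_ ?_
    · refine tendstoInMeasure_of_tendsto_eLpNorm (p := 2) (by norm_num)
        (fun j => ((hTcm j).comp hcm).aestronglyMeasurable) (hGm.comp hcm).aestronglyMeasurable ?_
      have h5 := ENNReal.Tendsto.const_mul (a := (n.factorial : ℝ≥0∞) ^ (1 / 2 : ℝ)) hG
        (Or.inr (by finiteness))
      rw [mul_zero] at h5
      refine tendsto_of_tendsto_of_tendsto_of_le_of_le tendsto_const_nhds h5 (fun _ => zero_le)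
        fun j => ?_
      exact (eLpNorm_mono_measure _ hle).trans (eLpNorm_config_le ((hTcm j).sub hGm) n)
    · refine tendstoInMeasure_of_tendsto_eLpNorm (p := 1) (by norm_num)
        (fun j => ((hTcm j).comp hcm).aestronglyMeasurable) (hTm.comp hcm).aestronglyMeasurable ?_
      have h5 := ENNReal.Tendsto.mul_const (b := localConst Q μ B n) hc'
        (Or.inr (localConst_lt_top hQ hB hμB n).ne)
      rw [zero_mul] at h5
      refine tendsto_of_tendsto_of_tendsto_of_le_of_le tendsto_const_nhds h5 (fun _ => zero_le)
        fun j => ?_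
      refine le_trans (le_of_eq (eLpNorm_congr_ae ?_)) (eLpNorm_meanCosts_le hQ hB hμB n
        ((measurable_expoPoly (c j)).sub hφ))
      filter_upwards [ae_mono hle (ae_meanCosts_sub hQ (measurable_expoPoly (c j)) hφ
        (memLp_expoPoly _ 2) h2 n)] with z hz
      exact hz.symm
  have hfin : MemLp (meanCosts Q φ) 2 (fock μ) := (memLp_congr_ae hEq).1 hG2
  refine ⟨hfin, ?_⟩
  rw [← eLpNorm_congr_ae hEq]
  have h6 := tendsto_eLpNorm_of_sub hT hG2 hG
  have h7 := tendsto_eLpNorm_of_sub (fun n => memLp_expoPoly (c n) 2) h2 hc'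
  simp_rw [fun n => (eLpNorm_meanCosts_expoPoly hQ (c n)).2] at h6
  exact tendsto_nhds_unique h6 h7

lemma eLpNorm_meanCosts [SigmaFinite μ] (hQ : IsPoissonLaw Q μ) {φ : Measure Z → ℝ}
    (hφ : Measurable φ) (h2 : MemLp φ 2 Q) :
    eLpNorm (meanCosts Q φ) 2 (fock μ) = eLpNorm φ 2 Q :=
  (memLp_meanCosts_and_eLpNorm hQ hφ h2).2

end

/-! ### The Poincaré inequality, without a priori integrability. -/

section

/-! ### The Poincaré inequality -/

lemma lintegral_enorm_sq_eq {α : Type*} [MeasurableSpace α] (f : α → ℝ) (ν : Measure α) :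
    ∫⁻ x, ‖f x‖ₑ ^ 2 ∂ν = eLpNorm f 2 ν ^ 2 := by
  have := eLpNorm_nnreal_pow_eq_lintegral (μ := ν) (f := f) (p := 2) (by norm_num)
  simp only [NNReal.coe_ofNat, ENNReal.coe_ofNat, ENNReal.rpow_two] at this
  exact this.symm

lemma memLp_two_iff_lintegral {α : Type*} [MeasurableSpace α] {f : α → ℝ} {ν : Measure α}
    (hf : AEStronglyMeasurable f ν) : MemLp f 2 ν ↔ ∫⁻ x, ‖f x‖ₑ ^ 2 ∂ν < ∞ := by
  rw [lintegral_enorm_sq_eq, MemLp, and_iff_right hf, ENNReal.pow_lt_top_iff]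
  simp

variable {Z : Type*} [MeasurableSpace Z] {μ : Measure Z} {Q : Measure (Measure Z)} [SigmaFinite μ]

lemma measurable_lintegral_addOneCost [SFinite Q] {φ : Measure Z → ℝ} (hφ : Measurable φ) :
    Measurable fun z => ∫⁻ χ, ‖addOneCost z φ χ‖ₑ ^ 2 ∂Q :=
  ((measurable_addOneCost hφ).enorm.pow_const 2).lintegral_prod_right'

/-- In the Fock space, the part of `φ` of order `n + 1` at `(z, w)` is the part of `D_z φ` of order
`n` at `w`. Replacing the factor `1/(n+1)!` by the larger `1/n!` and summing over `n` gives the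
norms of the `D_z φ`. -/
lemma poincare_of_memLp (hQ : IsPoissonLaw Q μ) {φ : Measure Z → ℝ} (hφ : Measurable φ)
    (h2 : MemLp φ 2 Q) : ∫⁻ χ, ‖φ χ‖ₑ ^ 2 ∂Q ≤
      ‖∫ χ, φ χ ∂Q‖ₑ ^ 2 + ∫⁻ z, ∫⁻ χ, ‖addOneCost z φ χ‖ₑ ^ 2 ∂Q ∂μ := by
  have := hQ.prob
  -- Otherwise `D_z φ` is in `L²` for almost every `z`, so that the isometry applies to it.
  by_cases hI : ∫⁻ z, ∫⁻ χ, ‖addOneCost z φ χ‖ₑ ^ 2 ∂Q ∂μ = ∞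
  · simp [hI]
  have hD : ∀ z, Measurable (addOneCost z φ) := fun z =>
    (measurable_addOneCost hφ).comp (measurable_const.prodMk measurable_id)
  have hm : Measurable (meanCosts Q φ) := (kernelMeasurable_meanCosts hφ).measurable
  have hm' : ∀ z, Measurable (meanCosts Q (addOneCost z φ)) := fun z =>
    (kernelMeasurable_meanCosts (hD z)).measurable
  have hmz : ∀ n, Measurable fun w : Fin n → Z => ‖meanCosts Q φ (config w)‖ₑ ^ 2 := fun n =>
    ((kernelMeasurable_meanCosts hφ n).enorm.pow_const 2)
  have hmc : ∀ n, Measurable fun p : Z × (Fin n → Z) => ‖meanCosts Q φ (p.1 ::ₘ config p.2)‖ₑ ^ 2 :=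
    fun n => ((kernelMeasurable_meanCosts hφ).comp
      ((MeasurableConfig.config measurable_snd).cons measurable_fst)).enorm.pow_const 2
  rw [lintegral_enorm_sq_eq, ← eLpNorm_meanCosts hQ hφ h2, ← lintegral_enorm_sq_eq,
    lintegral_fock (hm.enorm.pow_const 2), tsum_eq_zero_add' ENNReal.summable]
  gcongr ?_ + ?_
  · simp [power, meanCosts]
  calc _ ≤ ∑' n : ℕ, ∫⁻ z, (n.factorial : ℝ≥0∞)⁻¹ *
          ∫⁻ w, ‖meanCosts Q φ (z ::ₘ config w)‖ₑ ^ 2 ∂(power μ n) ∂μ := by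
        refine ENNReal.tsum_le_tsum fun n => ?_
        rw [lintegral_const_mul _ (hmc n).lintegral_prod_right', lintegral_power_succ μ n (hmz _)]
        simp only [config_cons]
        gcongr
        exact Nat.le_succ n
    _ = ∫⁻ z, ∑' n : ℕ, (n.factorial : ℝ≥0∞)⁻¹ *
          ∫⁻ w, ‖meanCosts Q φ (z ::ₘ config w)‖ₑ ^ 2 ∂(power μ n) ∂μ := by
        rw [lintegral_tsum]
        exact fun n => ((hmc n).lintegral_prod_right'.const_mul _).aemeasurable
    _ ≤ _ := by
        refine lintegral_mono_ae ?_
        filter_upwards [ae_lt_top (measurable_lintegral_addOneCost hφ) hI] with z hz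
        have h3 := (memLp_two_iff_lintegral (hD z).aestronglyMeasurable).2 hz
        rw [lintegral_enorm_sq_eq, ← eLpNorm_meanCosts hQ (hD z) h3, ← lintegral_enorm_sq_eq,
          lintegral_fock ((hm' z).enorm.pow_const 2)]
        simp_rw [meanCosts_cons]
        exact le_rfl

/-- Truncation at height `N`. -/
def clip (N : ℝ) (x : ℝ) : ℝ := max (-N) (min N x)

lemma measurable_clip (N : ℝ) : Measurable (clip N) := by
  unfold clip; fun_prop

lemma abs_clip_le {N : ℝ} (hN : 0 ≤ N) (x : ℝ) : |clip N x| ≤ N := by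
  rw [abs_le, clip]
  exact ⟨le_max_left _ _, max_le (by linarith) (min_le_left _ _)⟩

lemma clip_of_abs_le {N x : ℝ} (h : |x| ≤ N) : clip N x = x := by
  rw [abs_le] at h
  rw [clip, min_eq_right h.2, max_eq_right h.1]

lemma abs_clip_sub_clip_le (N x y : ℝ) : |clip N x - clip N y| ≤ |x - y| := by
  have h1 := abs_max_sub_max_le_abs (min N x) (min N y) (-N)
  have h2 := abs_min_sub_min_le_max N x N y
  rw [clip, clip, max_comm (-N), max_comm (-N)]
  refine h1.trans (h2.trans ?_)
  simp

lemma enorm_clip_sub_clip_le (N x y : ℝ) : ‖clip N x - clip N y‖ₑ ≤ ‖x - y‖ₑ := by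
  rw [enorm_le_iff_norm_le]
  exact abs_clip_sub_clip_le N x y

lemma tendsto_clip (x : ℝ) : Tendsto (fun N : ℕ => clip N x) atTop (𝓝 x) := by
  refine tendsto_const_nhds.congr' ?_
  obtain ⟨M, hM⟩ := exists_nat_ge |x|
  filter_upwards [eventually_ge_atTop M] with N hN
  rw [clip_of_abs_le]
  exact hM.trans (by exact_mod_cast hN)

lemma enorm_sq_le_two_mul (x y : ℝ) : ‖x‖ₑ ^ 2 ≤ 2 * ‖x - y‖ₑ ^ 2 + 2 * ‖y‖ₑ ^ 2 := by
  have h : ∀ a : ℝ, ‖a‖ₑ ^ 2 = ENNReal.ofReal (a ^ 2) := fun a => by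
    rw [← sq_abs, ENNReal.ofReal_pow (abs_nonneg a), ← Real.norm_eq_abs, ofReal_norm]
  have h2 : (2 : ℝ≥0∞) = ENNReal.ofReal 2 := by simp
  rw [h, h, h, h2, ← ENNReal.ofReal_mul (by norm_num), ← ENNReal.ofReal_mul (by norm_num),
    ← ENNReal.ofReal_add (by positivity) (by positivity)]
  exact ENNReal.ofReal_le_ofReal (by nlinarith [sq_nonneg (x - 2 * y)])

/-- Truncation makes the functional bounded and, being a contraction, does not increase its add-one
costs; the bound is uniform in `N`. -/
lemma variance_clip_le (hQ : IsPoissonLaw Q μ) {φ : Measure Z → ℝ} (hφ : Measurable φ)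
    {N : ℝ} (hN : 0 ≤ N) (m : ℝ) : ∫⁻ χ, ‖clip N (φ χ) - m‖ₑ ^ 2 ∂Q ≤
      ‖∫ χ, (clip N (φ χ) - m) ∂Q‖ₑ ^ 2 + ∫⁻ z, ∫⁻ χ, ‖addOneCost z φ χ‖ₑ ^ 2 ∂Q ∂μ := by
  have := hQ.prob
  have h1 : Measurable fun χ => clip N (φ χ) - m := ((measurable_clip N).comp hφ).sub_const m
  have h2 : MemLp (fun χ => clip N (φ χ) - m) 2 Q := by
    refine MemLp.of_bound h1.aestronglyMeasurable (N + |m|) (ae_of_all _ fun χ => ?_)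
    exact (norm_sub_le _ _).trans (add_le_add (abs_clip_le hN _) le_rfl)
  refine (poincare_of_memLp hQ h1 h2).trans ?_
  gcongr with z χ
  simp only [addOneCost, sub_sub_sub_cancel_right]
  exact enorm_clip_sub_clip_le _ _ _

/-- The truncations of `φ` have variances bounded by `V`, so only their means could escape to
infinity. They do not: on an event of positive probability where `|φ| ≤ M`, the truncations at `N ≥
M` equal `φ`, and a large mean would force a large variance there. Fatou's lemma concludes. -/
theorem memLp_of_addOneCost (hQ : IsPoissonLaw Q μ) {φ : Measure Z → ℝ} (hφ : Measurable φ)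
    (hI : ∫⁻ z, ∫⁻ χ, ‖addOneCost z φ χ‖ₑ ^ 2 ∂Q ∂μ ≠ ∞) : MemLp φ 2 Q := by
  have := hQ.prob
  set V := ∫⁻ z, ∫⁻ χ, ‖addOneCost z φ χ‖ₑ ^ 2 ∂Q ∂μ
  let E : ℕ → Set (Measure Z) := fun N => {χ | |φ χ| ≤ N}
  have hE : ∀ N, MeasurableSet (E N) := fun N =>
    measurableSet_le (by fun_prop) measurable_const
  obtain ⟨M, hM⟩ : ∃ M, Q (E M) ≠ 0 := by
    by_contra! h
    have h1 : Q (⋃ N, E N) = 0 := measure_iUnion_null h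
    have h2 : ⋃ N, E N = Set.univ :=
      Set.eq_univ_of_forall fun χ => Set.mem_iUnion.2 (exists_nat_ge |φ χ|)
    simp [h2] at h1
  let c : ℕ → ℝ := fun N => ∫ χ, clip N (φ χ) ∂Q
  -- It results from integrating `|c_N|² ≤ 2 |clip - c_N|² + 2 M²` over `E M`.
  let C : ℝ≥0∞ := (2 * V + 2 * (M : ℝ≥0∞) ^ 2) / Q (E M)
  have hC : C ≠ ∞ := ENNReal.div_ne_top (by finiteness) hM
  have hi : ∀ N : ℕ, Integrable (fun χ => clip N (φ χ)) Q := fun N =>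
    Integrable.of_bound ((measurable_clip N).comp hφ).aestronglyMeasurable N
      (ae_of_all _ fun χ => abs_clip_le N.cast_nonneg _)
  have hc : ∀ N ≥ M, ‖c N‖ₑ ^ 2 ≤ C := fun N hN => by
    rw [ENNReal.le_div_iff_mul_le (Or.inl hM) (Or.inl (measure_ne_top _ _))]
    calc ‖c N‖ₑ ^ 2 * Q (E M) = ∫⁻ χ in E M, ‖c N‖ₑ ^ 2 ∂Q := by simp
      _ ≤ ∫⁻ χ in E M, (2 * ‖clip N (φ χ) - c N‖ₑ ^ 2 + 2 * (M : ℝ≥0∞) ^ 2) ∂Q := by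
          refine setLIntegral_mono' (hE M) fun χ hχ => ?_
          have hχ' : |φ χ| ≤ M := hχ
          rw [clip_of_abs_le (hχ'.trans (by exact_mod_cast hN)), enorm_sub_rev]
          refine (enorm_sq_le_two_mul _ (φ χ)).trans ?_
          gcongr
          rw [← ofReal_norm, Real.norm_eq_abs, ← ENNReal.ofReal_natCast]
          exact ENNReal.ofReal_le_ofReal hχ'
      _ ≤ ∫⁻ χ, 2 * ‖clip N (φ χ) - c N‖ₑ ^ 2 ∂Q + ∫⁻ χ, 2 * (M : ℝ≥0∞) ^ 2 ∂Q := by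
          rw [lintegral_add_right _ measurable_const]
          gcongr <;> exact Measure.restrict_le_self
      _ ≤ 2 * V + 2 * (M : ℝ≥0∞) ^ 2 := by
          have hm : Measurable fun χ => ‖clip N (φ χ) - c N‖ₑ ^ 2 :=
            (((measurable_clip N).comp hφ).sub_const _).enorm.pow_const 2
          rw [lintegral_const_mul _ hm]
          simp only [lintegral_const, measure_univ, mul_one]
          gcongr
          refine (variance_clip_le hQ hφ N.cast_nonneg (c N)).trans ?_
          rw [integral_sub (hi N) (integrable_const _)]
          simp [c, V]
  rw [memLp_two_iff_lintegral hφ.aestronglyMeasurable]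
  have h3 : ∀ N ≥ M, ∫⁻ χ, ‖clip N (φ χ)‖ₑ ^ 2 ∂Q ≤ C + V := fun N hN => by
    have := variance_clip_le hQ hφ N.cast_nonneg 0
    simp only [sub_zero] at this
    exact this.trans (add_le_add_left (hc N hN) _)
  calc ∫⁻ χ, ‖φ χ‖ₑ ^ 2 ∂Q = ∫⁻ χ, liminf (fun N : ℕ => ‖clip N (φ χ)‖ₑ ^ 2) atTop ∂Q := by
        refine lintegral_congr fun χ => ?_
        exact (((ENNReal.continuous_pow 2).tendsto _).comp
          ((tendsto_clip (φ χ)).enorm)).liminf_eq.symm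
    _ ≤ liminf (fun N : ℕ => ∫⁻ χ, ‖clip N (φ χ)‖ₑ ^ 2 ∂Q) atTop :=
        lintegral_liminf_le fun N => ((measurable_clip N).comp hφ).enorm.pow_const 2
    _ ≤ C + V := by
        refine liminf_le_of_frequently_le' (Eventually.frequently ?_)
        filter_upwards [eventually_ge_atTop M] with N hN using h3 N hN
    _ < ∞ := by finiteness

end

/-! ### Charlier polynomials and functionals of polynomial growth. -/

section

/-! ### Charlier polynomials -/

lemma prod_range_succ_sub (j : ℕ) (x : ℝ) :
    ∏ i ∈ Finset.range (j + 1), (x - i) = x * ∏ i ∈ Finset.range j, (x - 1 - i) := by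
  rw [Finset.prod_range_succ', mul_comm]
  simp only [Nat.cast_zero, sub_zero, Nat.cast_add, Nat.cast_one]
  congr 1
  exact Finset.prod_congr rfl fun i _ => by ring

lemma prod_range_sub_diff (j : ℕ) (x : ℝ) :
    ∏ i ∈ Finset.range (j + 1), (x + 1 - i) - ∏ i ∈ Finset.range (j + 1), (x - i) =
      (j + 1) * ∏ i ∈ Finset.range j, (x - i) := by
  rw [prod_range_succ_sub, Finset.prod_range_succ]
  simp only [add_sub_cancel_right]
  ring

lemma charlier_zero (t x : ℝ) : charlier 0 t x = 1 := by simp [charlier]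

/-- The difference operator lowers the degree, as differentiation does for powers; this is why an
add-one cost lowers the order of a step integral. -/
lemma charlier_add_one (n : ℕ) (t x : ℝ) :
    charlier n t (x + 1) = charlier n t x + n * charlier (n - 1) t x := by
  rw [← sub_eq_iff_eq_add']
  cases n with
  | zero => simp [charlier_zero]
  | succ n =>
    simp only [charlier]
    rw [Finset.sum_range_succ', Finset.sum_range_succ' _ (n + 1), Nat.choose_zero_right,
      Finset.prod_range_zero, Finset.prod_range_zero, add_sub_add_right_eq_sub,
      ← Finset.sum_sub_distrib, Finset.mul_sum]
    refine Finset.sum_congr rfl fun j _ => ?_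
    rw [← mul_sub, prod_range_sub_diff]
    have h := Nat.add_one_mul_choose_eq n j
    have h' : ((n : ℝ) + 1) * n.choose j = (n + 1).choose (j + 1) * (j + 1) := by
      exact_mod_cast h
    simp only [Nat.add_sub_cancel, Nat.add_sub_add_right, Nat.cast_add, Nat.cast_one]
    linear_combination -(-t) ^ (n - j) * (∏ i ∈ Finset.range j, (x - i)) * h'

/-- The form of the recurrence adapted to the Mecke formula: the factor `x = χ(B)` is absorbed by
adding a point to `B`, which also undoes the shift `x - 1`. -/
lemma charlier_succ (n : ℕ) (t x : ℝ) :
    charlier (n + 1) t x = x * charlier n t (x - 1) - t * charlier n t x := by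
  have h1 : charlier (n + 1) t x = (∑ j ∈ Finset.range (n + 1),
      (n.choose j : ℝ) * (-t) ^ (n - j) * ∏ i ∈ Finset.range (j + 1), (x - i)) +
      (∑ j ∈ Finset.range n,
        (n.choose (j + 1) : ℝ) * (-t) ^ (n - j) * ∏ i ∈ Finset.range (j + 1), (x - i) +
      (-t) ^ (n + 1)) := by
    simp only [charlier]
    rw [Finset.sum_range_succ', ← add_assoc]
    congr 1
    · rw [Finset.sum_range_succ, Finset.sum_range_succ _ n, add_right_comm,
        ← Finset.sum_add_distrib]
      congr 1
      · refine Finset.sum_congr rfl fun j _ => ?_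
        rw [Nat.choose_succ_succ, Nat.add_sub_add_right]
        push_cast
        ring
      · simp
    · simp
  have h2 : charlier n t x = ∑ j ∈ Finset.range n,
      (n.choose (j + 1) : ℝ) * (-t) ^ (n - (j + 1)) * ∏ i ∈ Finset.range (j + 1), (x - i) +
        (-t) ^ n := by
    simp only [charlier]
    rw [Finset.sum_range_succ']
    simp
  rw [h1, h2, sub_eq_add_neg, ← neg_mul, mul_add, charlier, Finset.mul_sum, Finset.mul_sum, pow_succ']
  congr 1
  · refine Finset.sum_congr rfl fun j _ => ?_
    rw [prod_range_succ_sub]; ring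
  · congr 1
    refine Finset.sum_congr rfl fun j hj => ?_
    have : n - j = n - (j + 1) + 1 := by have := Finset.mem_range.1 hj; omega
    rw [this]; ring

lemma prod_range_sub_natCast_nonneg (j x : ℕ) : 0 ≤ ∏ i ∈ Finset.range j, ((x : ℝ) - i) := by
  have := descPochhammer_eval_eq_prod_range (R := ℝ) j x
  rw [← this, descPochhammer_eval_eq_descFactorial]
  positivity

lemma prod_range_sub_natCast_le (j x : ℕ) : ∏ i ∈ Finset.range j, ((x : ℝ) - i) ≤ (x : ℝ) ^ j := by
  have := descPochhammer_eval_eq_prod_range (R := ℝ) j x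
  rw [← this, descPochhammer_eval_eq_descFactorial]
  exact_mod_cast Nat.descFactorial_le_pow x j

/-- Falling factorials are nonnegative at natural numbers, so absolute values may be put on the
coefficients. Changing the sign of `t` amounts to passing from `χ - μ` to `χ + μ`. -/
lemma abs_charlier_le (n : ℕ) (t : ℝ) (x : ℕ) : |charlier n t x| ≤ charlier n (-|t|) x := by
  refine (Finset.abs_sum_le_sum_abs _ _).trans (le_of_eq (Finset.sum_congr rfl fun j _ => ?_))
  rw [abs_mul, abs_mul, abs_pow, abs_neg, neg_neg, abs_of_nonneg (prod_range_sub_natCast_nonneg j x),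
    Nat.abs_cast]

lemma charlier_le_pow (n : ℕ) {t : ℝ} (ht : 0 ≤ t) (x : ℕ) : charlier n (-t) x ≤ (x + t) ^ n := by
  rw [add_pow]
  refine Finset.sum_le_sum fun j _ => ?_
  rw [neg_neg]
  calc _ ≤ (n.choose j : ℝ) * t ^ (n - j) * (x : ℝ) ^ j :=
        mul_le_mul_of_nonneg_left (prod_range_sub_natCast_le j x) (by positivity)
    _ = _ := by ring

lemma measurable_charlier (n : ℕ) (t : ℝ) : Measurable (charlier n t) := by
  unfold charlier; fun_prop

/-! ### The Mecke formula for integrable functionals -/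

variable {Z : Type*} [MeasurableSpace Z] {μ : Measure Z} {Q : Measure (Measure Z)}

lemma measurable_real_apply {B : Set Z} (hB : MeasurableSet B) :
    Measurable fun χ : Measure Z => χ.real B := (Measure.measurable_coe hB).ennreal_toReal

lemma integrable_and_integral_add_dirac [SigmaFinite μ] (hQ : IsPoissonLaw Q μ) {B : Set Z}
    (hB : MeasurableSet B) (hμ : μ B ≠ ∞) {F : Measure Z → ℝ} (hF : Measurable F)
    (hi : Integrable (fun χ => χ.real B * F χ) Q) :
    Integrable (fun p : Z × Measure Z => F (p.2 + Measure.dirac p.1)) ((μ.restrict B).prod Q) ∧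
    ∫ z in B, ∫ χ, F (χ + Measure.dirac z) ∂Q ∂μ = ∫ χ, χ.real B * F χ ∂Q := by
  have := hQ.prob
  have : IsFiniteMeasure (μ.restrict B) := isFiniteMeasure_restrict.2 hμ
  have hlt : ∀ᵐ χ ∂Q, χ B < ∞ := (hQ.ae_ne_top hB hμ).mono fun χ h => h.lt_top
  have h1 : Integrable F (Q.withDensity fun χ => χ B) := by
    rw [integrable_withDensity_iff_integrable_smul₀' (Measure.measurable_coe hB).aemeasurable hlt]
    exact hi
  rw [← map_add_dirac hQ hB hμ, integrable_map_measure hF.aestronglyMeasurable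
    measurable_add_dirac.aemeasurable] at h1
  refine ⟨h1.swap, ?_⟩
  have h2 := integral_withDensity_eq_integral_toReal_smul (Measure.measurable_coe hB) hlt F
  rw [← map_add_dirac hQ hB hμ, integral_map measurable_add_dirac.aemeasurable
    hF.aestronglyMeasurable, ← integral_prod_swap] at h2
  rw [← integral_prod (fun p : Z × Measure Z => F (p.2 + Measure.dirac p.1)) h1.swap]
  exact h2

/-! ### Functionals of polynomial growth -/

/-- A functional which is bounded by a polynomial of the mass of a set of finite measure. -/
def Tame (μ : Measure Z) (Q : Measure (Measure Z)) (G : Measure Z → ℝ) : Prop :=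
  Measurable G ∧ ∃ B, MeasurableSet B ∧ μ B ≠ ∞ ∧ ∃ (C : ℝ) (N : ℕ), 0 ≤ C ∧
    ∀ᵐ χ ∂Q, |G χ| ≤ C * (1 + χ.real B) ^ N

namespace Tame

variable {G G' : Measure Z → ℝ}

lemma const (c : ℝ) : Tame μ Q fun _ => c :=
  ⟨measurable_const, ∅, MeasurableSet.empty, by simp, |c|, 0, abs_nonneg c, by simp⟩

lemma mul (hQ : IsPoissonLaw Q μ) (h : Tame μ Q G) (h' : Tame μ Q G') :
    Tame μ Q fun χ => G χ * G' χ := by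
  obtain ⟨hm, B, hB, hμ, C, N, hC, hG⟩ := h
  obtain ⟨hm', B', hB', hμ', C', N', hC', hG'⟩ := h'
  refine ⟨hm.mul hm', B ∪ B', hB.union hB', (measure_union_lt_top hμ.lt_top hμ'.lt_top).ne,
    C * C', N + N', by positivity, ?_⟩
  filter_upwards [hG, hG', hQ.ae_ne_top hB hμ, hQ.ae_ne_top hB' hμ'] with χ h1 h2 h3 h4
  have h5 : χ (B ∪ B') ≠ ∞ := (measure_union_lt_top h3.lt_top h4.lt_top).ne
  rw [abs_mul, pow_add, mul_mul_mul_comm]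
  refine mul_le_mul (h1.trans ?_) (h2.trans ?_) (abs_nonneg _) (by positivity)
  · gcongr; exact Set.subset_union_left
  · gcongr; exact Set.subset_union_right

lemma prod (hQ : IsPoissonLaw Q μ) {ι : Type*} (s : Finset ι) {G : ι → Measure Z → ℝ}
    (h : ∀ i ∈ s, Tame μ Q (G i)) : Tame μ Q fun χ => ∏ i ∈ s, G i χ := by
  classical
  induction s using Finset.induction_on with
  | empty => simpa using const 1
  | insert i s hi ih =>
    simp_rw [Finset.prod_insert hi]
    exact (h i (Finset.mem_insert_self i s)).mul hQ
      (ih fun j hj => h j (Finset.mem_insert_of_mem hj))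

lemma add (hQ : IsPoissonLaw Q μ) (h : Tame μ Q G) (h' : Tame μ Q G') :
    Tame μ Q fun χ => G χ + G' χ := by
  obtain ⟨hm, B, hB, hμ, C, N, hC, hG⟩ := h
  obtain ⟨hm', B', hB', hμ', C', N', hC', hG'⟩ := h'
  refine ⟨hm.add hm', B ∪ B', hB.union hB', (measure_union_lt_top hμ.lt_top hμ'.lt_top).ne,
    C + C', N + N', by positivity, ?_⟩
  filter_upwards [hG, hG', hQ.ae_ne_top hB hμ, hQ.ae_ne_top hB' hμ'] with χ h1 h2 h3 h4
  have h5 : χ (B ∪ B') ≠ ∞ := (measure_union_lt_top h3.lt_top h4.lt_top).ne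
  have h6 : 1 ≤ 1 + χ.real (B ∪ B') := by simp [measureReal_nonneg]
  rw [add_mul]
  refine (abs_add_le _ _).trans (add_le_add (h1.trans ?_) (h2.trans ?_))
  · refine mul_le_mul_of_nonneg_left (le_trans ?_ (pow_le_pow_right₀ h6 (Nat.le_add_right N N'))) hC
    gcongr; exact Set.subset_union_left
  · refine mul_le_mul_of_nonneg_left (le_trans ?_ (pow_le_pow_right₀ h6 (Nat.le_add_left N' N))) hC'
    gcongr; exact Set.subset_union_right

lemma sum (hQ : IsPoissonLaw Q μ) {ι : Type*} (s : Finset ι) {G : ι → Measure Z → ℝ}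
    (h : ∀ i ∈ s, Tame μ Q (G i)) : Tame μ Q fun χ => ∑ i ∈ s, G i χ := by
  classical
  induction s using Finset.induction_on with
  | empty => simpa using const 0
  | insert i s hi ih =>
    simp_rw [Finset.sum_insert hi]
    exact (h i (Finset.mem_insert_self i s)).add hQ
      (ih fun j hj => h j (Finset.mem_insert_of_mem hj))

lemma memLp (hQ : IsPoissonLaw Q μ) (h : Tame μ Q G) : MemLp G 2 Q := by
  have := hQ.prob
  obtain ⟨hm, B, hB, hμ, C, N, hC, hG⟩ := h
  have h1 : MemLp (fun χ : Measure Z => C * (1 + χ.real B) ^ N) 2 Q := by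
    have hmB := measurable_real_apply hB
    have h2 := (hQ.integrable_comp hB hμ (g := fun x => (C * (1 + x) ^ N) ^ 2) (by fun_prop)).2
    rw [memLp_two_iff_integrable_sq (by fun_prop)]
    refine h2 ?_
    have h3 : ∀ x : ℝ, (C * (1 + x) ^ N) ^ 2 =
        ∑ j ∈ Finset.range (N * 2 + 1), C ^ 2 * ((N * 2).choose j) * x ^ j := fun x => by
      rw [mul_pow, ← pow_mul, add_comm 1 x, add_pow, Finset.mul_sum]
      exact Finset.sum_congr rfl fun j _ => by simp; ring
    simp_rw [h3]
    exact integrable_finsetSum _ fun j _ => (integrable_pow_poisson _ j).const_mul _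
  exact h1.mono hm.aestronglyMeasurable (hG.mono fun χ h => h.trans (le_abs_self _))

end Tame

/-! ### Sums over functions of finite sets -/

lemma count_config {κ : Type*} [DecidableEq κ] {n : ℕ} (α : Fin n → κ) (j : κ) :
    (config α).count j = (Finset.univ.filter fun l => α l = j).card := by
  rw [config, Multiset.count_sum', Finset.card_filter]
  refine Finset.sum_congr rfl fun l _ => ?_
  rw [Multiset.count_singleton]
  simp [eq_comm]

lemma sum_fin_succ {κ : Type*} [Fintype κ] {n : ℕ} (F : (Fin (n + 1) → κ) → ℝ) :
    ∑ α, F α = ∑ j, ∑ β : Fin n → κ, F (Fin.cons j β) := by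
  rw [← (Fin.consEquiv fun _ => κ).sum_comp, Fintype.sum_prod_type]
  rfl

/-- The multiplicity of `j` counts the positions with value `j`; by symmetry each position
contributes as much as the first, to which it is moved by a transposition. -/
lemma sum_count_mul {κ : Type*} [Fintype κ] [DecidableEq κ] {n : ℕ} (F : Multiset κ → ℝ) (j : κ) :
    ∑ α : Fin n → κ, ((config α).count j : ℝ) * F (config α) =
      n * ∑ β : Fin (n - 1) → κ, F (j ::ₘ config β) := by
  cases n with
  | zero => simp [show ∀ z : Fin 0 → κ, config z = 0 from config_empty]
  | succ n =>
    have h1 : ∀ α : Fin (n + 1) → κ, ((config α).count j : ℝ) * F (config α) =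
        ∑ l, if α l = j then F (config α) else 0 := fun α => by
      rw [count_config, Finset.sum_ite, Finset.sum_const_zero, add_zero, Finset.sum_const,
        nsmul_eq_mul]
    simp_rw [h1]
    rw [Finset.sum_comm]
    have h2 : ∀ l : Fin (n + 1), ∑ α : Fin (n + 1) → κ, (if α l = j then F (config α) else 0) =
        ∑ β : Fin n → κ, F (j ::ₘ config β) := fun l => by
      rw [← (Equiv.arrowCongr (Equiv.swap 0 l) (Equiv.refl κ)).sum_comp, sum_fin_succ,
        Finset.sum_comm]
      refine Finset.sum_congr rfl fun β _ => ?_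
      have h3 : ∀ i : κ, config ((Equiv.arrowCongr (Equiv.swap 0 l) (Equiv.refl κ))
          (Fin.cons i β)) = i ::ₘ config β := fun i => by
        have := config_comp_equiv (Equiv.swap 0 l).symm (Fin.cons i β : Fin (n + 1) → κ)
        rw [config_cons] at this
        exact this
      simp_rw [h3]
      simp [Equiv.arrowCongr]
    simp_rw [h2]
    simp

end

/-! ### Calculus of multiple integrals of step kernels. -/

section

variable {Z : Type*} [MeasurableSpace Z]

lemma exists_config_eq {Y : Type*} (m : Multiset Y) :
    ∃ (n : ℕ) (α : Fin n → Y), config α = m := by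
  induction m using Multiset.induction_on with
  | empty => exact ⟨0, Fin.elim0, config_empty _⟩
  | cons y m ih =>
    obtain ⟨n, α, rfl⟩ := ih
    exact ⟨n + 1, Fin.cons y α, config_cons _ _⟩

/-! ### Symmetric step kernels -/

/-- A symmetric step kernel: its coefficients are functions of multisets of indices. -/
structure Step (μ : Measure Z) where
  order : ℕ
  r : ℕ
  B : Fin r → Set Z
  measurableSet : ∀ j, MeasurableSet (B j)
  finite : ∀ j, μ (B j) ≠ ∞
  disjoint : Pairwise (Function.onFun Disjoint B)
  coeff : Multiset (Fin r) → ℝ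

variable {μ : Measure Z} {Q : Measure (Measure Z)}

namespace Step

/-- The indicator of the `j`-th set. -/
def ind (s : Step μ) (j : Fin s.r) (z : Z) : ℝ := (s.B j).indicator (fun _ => (1 : ℝ)) z

/-- The function given by a symmetric step kernel of order `n`. -/
def toFun (s : Step μ) {n : ℕ} (z : Fin n → Z) : ℝ :=
  ∑ α : Fin n → Fin s.r, s.coeff (config α) * ∏ l, s.ind (α l) (z l)

/-- Products of Charlier polynomials with rescaled parameters. -/
def charlierProd (s : Step μ) (c : ℝ) (m : Multiset (Fin s.r)) (χ : Measure Z) : ℝ :=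
  ∏ j, charlier (m.count j) (c * μ.real (s.B j)) (χ.real (s.B j))

/-- The multiple integral of a step kernel, with the parameter `c` in front of `μ`: this is the
integral with respect to `χ - c μ`. -/
def value (s : Step μ) (c : ℝ) (χ : Measure Z) : ℝ :=
  ∑ α : Fin s.order → Fin s.r, s.coeff (config α) * s.charlierProd c (config α) χ

/-- The kernel `order * s(z, ·)`. -/
def deriv (s : Step μ) (z : Z) : Step μ :=
  { s with
    order := s.order - 1
    coeff := fun m => s.order * ∑ j, s.ind j z * s.coeff (j ::ₘ m) }

/-- The step kernel with the absolute values of the coefficients. -/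
def abs (s : Step μ) : Step μ := { s with coeff := fun m => |s.coeff m| }

lemma measurable_ind (s : Step μ) (j : Fin s.r) : Measurable (s.ind j) :=
  measurable_const.indicator (s.measurableSet j)

lemma measurable_charlierProd (s : Step μ) (c : ℝ) (m : Multiset (Fin s.r)) :
    Measurable (s.charlierProd c m) :=
  Finset.measurable_prod _ fun j _ =>
    (measurable_charlier _ _).comp (measurable_real_apply (s.measurableSet j))

lemma measurable_value (s : Step μ) (c : ℝ) : Measurable (s.value c) :=
  Finset.measurable_sum _ fun _ _ => (s.measurable_charlierProd c _).const_mul _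

lemma ind_of_mem {s : Step μ} {j : Fin s.r} {z : Z} (hz : z ∈ s.B j) : s.ind j z = 1 := by
  simp [ind, hz]

lemma ind_of_notMem {s : Step μ} {j : Fin s.r} {z : Z} (hz : z ∉ s.B j) : s.ind j z = 0 := by
  simp [ind, hz]

lemma ind_eq_ite {s : Step μ} {j : Fin s.r} {z : Z} (hz : z ∈ s.B j) (i : Fin s.r) :
    s.ind i z = if i = j then 1 else 0 := by
  split_ifs with h
  · rw [h, ind_of_mem hz]
  · exact ind_of_notMem fun hi => Set.disjoint_left.1 (s.disjoint h) hi hz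

lemma real_add_dirac (s : Step μ) {χ : Measure Z} (hχ : ∀ j, χ (s.B j) ≠ ∞) (z : Z) (j : Fin s.r) :
    (χ + Measure.dirac z).real (s.B j) = χ.real (s.B j) + s.ind j z := by
  rw [measureReal_add_apply (hχ j) (by simp)]
  congr 1
  by_cases hz : z ∈ s.B j
  · rw [ind_of_mem hz, measureReal_def, Measure.dirac_apply_of_mem hz, ENNReal.toReal_one]
  · rw [ind_of_notMem hz, measureReal_def, Measure.dirac_apply' z (s.measurableSet j)]
    simp [hz]

/-- The sets are disjoint, so the new point changes at most one of the factors, by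
`charlier_add_one`. -/
lemma charlierProd_add_dirac (s : Step μ) (c : ℝ) (m : Multiset (Fin s.r)) {χ : Measure Z}
    (hχ : ∀ j, χ (s.B j) ≠ ∞) (z : Z) : s.charlierProd c m (χ + Measure.dirac z) =
      s.charlierProd c m χ + ∑ j, s.ind j z * (m.count j * s.charlierProd c (m.erase j) χ) := by
  simp only [charlierProd, s.real_add_dirac hχ]
  by_cases h : ∃ j, z ∈ s.B j
  · obtain ⟨j, hj⟩ := h
    simp_rw [ind_eq_ite hj]
    rw [Finset.sum_eq_single j (by simp +contextual) (by simp),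
      ← Finset.mul_prod_erase _ _ (Finset.mem_univ j), ← Finset.mul_prod_erase _ _ (Finset.mem_univ j),
      ← Finset.mul_prod_erase _ _ (Finset.mem_univ j)]
    have h1 : ∀ F : Fin s.r → ℝ → ℝ, ∏ i ∈ Finset.univ.erase j,
        F i (χ.real (s.B i) + if i = j then 1 else 0) =
        ∏ i ∈ Finset.univ.erase j, F i (χ.real (s.B i)) := fun F =>
      Finset.prod_congr rfl fun i hi => by simp [Finset.ne_of_mem_erase hi]
    have h2 : ∏ i ∈ Finset.univ.erase j,
        charlier ((m.erase j).count i) (c * μ.real (s.B i)) (χ.real (s.B i)) =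
        ∏ i ∈ Finset.univ.erase j, charlier (m.count i) (c * μ.real (s.B i)) (χ.real (s.B i)) :=
      Finset.prod_congr rfl fun i hi => by
        rw [Multiset.count_erase_of_ne (Finset.ne_of_mem_erase hi)]
    rw [h1 fun i => charlier (m.count i) (c * μ.real (s.B i)), h2, if_pos rfl, charlier_add_one,
      Multiset.count_erase_self]
    ring
  · push Not at h
    have : ∀ j, s.ind j z = 0 := fun j => ind_of_notMem (h j)
    simp [this]

/-- This is `D_z I_n(f) = n I_{n-1}(f(z, ·))`, pointwise in `χ` and for each parameter `c`; the
multiplicities produced by the Charlier polynomials are summed by `sum_count_mul`. -/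
lemma value_add_dirac (s : Step μ) (c : ℝ) {χ : Measure Z} (hχ : ∀ j, χ (s.B j) ≠ ∞) (z : Z) :
    s.value c (χ + Measure.dirac z) = s.value c χ + (s.deriv z).value c χ := by
  have h1 : (s.deriv z).value c χ = ∑ j, s.ind j z * (s.order *
      ∑ β : Fin (s.order - 1) → Fin s.r, s.coeff (j ::ₘ config β) * s.charlierProd c (config β) χ) := by
    change ∑ β : Fin (s.order - 1) → Fin s.r, (s.order * ∑ j, s.ind j z * s.coeff (j ::ₘ config β)) *
      s.charlierProd c (config β) χ = _
    simp_rw [Finset.mul_sum, Finset.sum_mul]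
    rw [Finset.sum_comm]
    refine Finset.sum_congr rfl fun j _ => Finset.sum_congr rfl fun β _ => by ring
  have h2 : ∀ j, s.order * ∑ β : Fin (s.order - 1) → Fin s.r,
      s.coeff (j ::ₘ config β) * s.charlierProd c (config β) χ =
      ∑ α : Fin s.order → Fin s.r, ((config α).count j : ℝ) *
        (s.coeff (config α) * s.charlierProd c ((config α).erase j) χ) := fun j => by
    rw [sum_count_mul fun m => s.coeff m * s.charlierProd c (m.erase j) χ]
    simp
  rw [h1]
  simp_rw [h2]
  simp only [value, s.charlierProd_add_dirac c _ hχ, mul_add, Finset.sum_add_distrib,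
    Finset.mul_sum]
  congr 1
  rw [Finset.sum_comm]
  exact Finset.sum_congr rfl fun j _ => Finset.sum_congr rfl fun α _ => by ring

lemma charlierProd_cons (s : Step μ) (c : ℝ) (j : Fin s.r) (m : Multiset (Fin s.r)) (χ : Measure Z) :
    s.charlierProd c (j ::ₘ m) χ = χ.real (s.B j) *
      (charlier (m.count j) (c * μ.real (s.B j)) (χ.real (s.B j) - 1) *
        ∏ i ∈ Finset.univ.erase j, charlier (m.count i) (c * μ.real (s.B i)) (χ.real (s.B i))) -
      c * μ.real (s.B j) * s.charlierProd c m χ := by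
  simp only [charlierProd]
  rw [← Finset.mul_prod_erase _ _ (Finset.mem_univ j), ← Finset.mul_prod_erase _
    (fun i => charlier (m.count i) (c * μ.real (s.B i)) (χ.real (s.B i))) (Finset.mem_univ j),
    Multiset.count_cons_self, charlier_succ]
  have h2 : ∏ i ∈ Finset.univ.erase j,
      charlier ((j ::ₘ m).count i) (c * μ.real (s.B i)) (χ.real (s.B i)) =
      ∏ i ∈ Finset.univ.erase j, charlier (m.count i) (c * μ.real (s.B i)) (χ.real (s.B i)) :=
    Finset.prod_congr rfl fun i hi => by
      rw [Multiset.count_cons_of_ne (Finset.ne_of_mem_erase hi)]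
  rw [h2]
  ring

/-! ### Bounds -/

lemma ae_nat (hQ : IsPoissonLaw Q μ) (s : Step μ) :
    ∀ᵐ χ ∂Q, ∀ j, ∃ x : ℕ, χ.real (s.B j) = (x : ℝ) := by
  rw [ae_all_iff]
  intro j
  filter_upwards [hQ.ae_nat (s.measurableSet j) (s.finite j)] with χ hχ
  obtain ⟨x, hx⟩ := hχ
  exact ⟨x, by simp [measureReal_def, hx]⟩

lemma ae_ne_top (hQ : IsPoissonLaw Q μ) (s : Step μ) : ∀ᵐ χ ∂Q, ∀ j, χ (s.B j) ≠ ∞ := by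
  rw [ae_all_iff]
  exact fun j => hQ.ae_ne_top (s.measurableSet j) (s.finite j)

/-- Domination by the integral of the absolute value of the kernel with respect to `χ + μ`. All the
`L¹` bounds for products come from this inequality. -/
lemma abs_value_le_abs (s : Step μ) {χ : Measure Z} (hχ : ∀ j, ∃ x : ℕ, χ.real (s.B j) = (x : ℝ)) :
    |s.value 1 χ| ≤ s.abs.value (-1) χ := by
  refine (Finset.abs_sum_le_sum_abs _ _).trans (Finset.sum_le_sum fun α _ => ?_)
  rw [abs_mul]
  refine mul_le_mul_of_nonneg_left ?_ (abs_nonneg _)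
  rw [charlierProd, charlierProd, Finset.abs_prod]
  refine Finset.prod_le_prod (fun _ _ => abs_nonneg _) fun j _ => ?_
  obtain ⟨x, hx⟩ := hχ j
  have := abs_charlier_le ((config α).count j) (1 * μ.real (s.B j)) x
  rw [one_mul, abs_of_nonneg (measureReal_nonneg (μ := μ) (s := s.B j)), ← hx] at this
  change |charlier _ (1 * μ.real (s.B j)) _| ≤ charlier _ (-1 * μ.real (s.B j)) _
  rwa [one_mul, neg_one_mul]

lemma abs_charlierProd_le (s : Step μ) (c : ℝ) {χ : Measure Z}
    (hχ : ∀ j, ∃ x : ℕ, χ.real (s.B j) = (x : ℝ)) {n : ℕ} (α : Fin n → Fin s.r) :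
    |s.charlierProd c (config α) χ| ≤ ∏ l, (χ.real (s.B (α l)) + |c| * μ.real (s.B (α l))) := by
  rw [← prod_map_config (fun j => χ.real (s.B j) + |c| * μ.real (s.B j)) α,
    Finset.prod_multiset_map_count, charlierProd, Finset.abs_prod]
  rw [Finset.prod_subset (Finset.subset_univ (config α).toFinset)]
  · refine Finset.prod_le_prod (fun _ _ => abs_nonneg _) fun j _ => ?_
    obtain ⟨x, hx⟩ := hχ j
    rw [hx]
    refine (abs_charlier_le _ _ x).trans ?_
    have := charlier_le_pow ((config α).count j) (abs_nonneg (c * μ.real (s.B j))) x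
    rwa [abs_mul, abs_of_nonneg (measureReal_nonneg (μ := μ) (s := s.B j))] at this ⊢
  · intro j _ hj
    rw [Multiset.mem_toFinset] at hj
    simp [Multiset.count_eq_zero_of_notMem hj]

lemma sum_real_le (s : Step μ) {χ : Measure Z} {B : Set Z} (hB : ∀ j, s.B j ⊆ B) (hχ : χ B ≠ ∞) :
    ∑ j, χ.real (s.B j) ≤ χ.real B := by
  rw [← measureReal_biUnion_finset (fun i _ j _ h => s.disjoint h) (fun j _ => s.measurableSet j)
    (fun j _ => measure_ne_top_of_subset (hB j) hχ)]
  exact measureReal_mono (Set.iUnion₂_subset fun j _ => hB j) hχ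

lemma abs_value_le (s : Step μ) (c : ℝ) {M : ℝ} (hM0 : 0 ≤ M)
    (hM : ∀ m, m.card = s.order → |s.coeff m| ≤ M) {B : Set Z}
    (hB : ∀ j, s.B j ⊆ B) (hμ : μ B ≠ ∞) {χ : Measure Z} (hχB : χ B ≠ ∞)
    (hχ : ∀ j, ∃ x : ℕ, χ.real (s.B j) = (x : ℝ)) :
    |s.value c χ| ≤ M * (χ.real B + |c| * μ.real B) ^ s.order := by
  calc |s.value c χ| ≤ ∑ α : Fin s.order → Fin s.r,
          M * ∏ l, (χ.real (s.B (α l)) + |c| * μ.real (s.B (α l))) := by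
        refine (Finset.abs_sum_le_sum_abs _ _).trans (Finset.sum_le_sum fun α _ => ?_)
        rw [abs_mul]
        exact mul_le_mul (hM _ (by simp)) (s.abs_charlierProd_le c hχ α) (abs_nonneg _) hM0
    _ = M * (∑ j, (χ.real (s.B j) + |c| * μ.real (s.B j))) ^ s.order := by
        rw [← Finset.mul_sum, Fintype.sum_pow]
    _ ≤ _ := by
        rw [Finset.sum_add_distrib, ← Finset.mul_sum]
        gcongr
        · exact s.sum_real_le hB hχB
        · exact s.sum_real_le hB hμ

/-- The union of the sets of a step kernel. -/
def support (s : Step μ) : Set Z := ⋃ j, s.B j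

lemma subset_support (s : Step μ) (j : Fin s.r) : s.B j ⊆ s.support := Set.subset_iUnion _ j

lemma measurableSet_support (s : Step μ) : MeasurableSet s.support :=
  MeasurableSet.iUnion s.measurableSet

lemma measure_support_ne_top (s : Step μ) : μ s.support ≠ ∞ := by
  refine ((measure_iUnion_le _).trans_lt ?_).ne
  rw [tsum_fintype]
  exact ENNReal.sum_lt_top.2 fun j _ => (s.finite j).lt_top

lemma tame_charlierProd (s : Step μ) (hQ : IsPoissonLaw Q μ) (c : ℝ) (m : Multiset (Fin s.r)) :
    Tame μ Q (s.charlierProd c m) := by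
  obtain ⟨n, α, rfl⟩ := exists_config_eq m
  refine ⟨s.measurable_charlierProd c _, s.support, s.measurableSet_support,
    s.measure_support_ne_top, (1 + |c| * μ.real s.support) ^ n, n, by positivity, ?_⟩
  filter_upwards [ae_nat hQ s, hQ.ae_ne_top s.measurableSet_support s.measure_support_ne_top]
    with χ h1 h2
  refine (s.abs_charlierProd_le c h1 α).trans ?_
  rw [← mul_pow]
  calc _ ≤ ∏ _l : Fin n, (χ.real s.support + |c| * μ.real s.support) := by
        refine Finset.prod_le_prod (fun _ _ => by positivity) fun l _ => ?_
        have h3 := measureReal_mono (μ := χ) (s.subset_support (α l)) h2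
        have h4 := measureReal_mono (μ := μ) (s.subset_support (α l)) s.measure_support_ne_top
        gcongr
    _ ≤ _ := by
        rw [Finset.prod_const, Finset.card_univ, Fintype.card_fin]
        have h3 : 0 ≤ χ.real s.support * (|c| * μ.real s.support) := by positivity
        have h4 : 0 ≤ |c| * μ.real s.support := by positivity
        have h5 : 0 ≤ χ.real s.support := by positivity
        refine pow_le_pow_left₀ (by positivity) ?_ n
        nlinarith

lemma tame_value (s : Step μ) (hQ : IsPoissonLaw Q μ) (c : ℝ) : Tame μ Q (s.value c) :=
  Tame.sum hQ _ fun _ _ => (Tame.const _).mul hQ (s.tame_charlierProd hQ c _)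

/-! ### Integration by parts -/

/-- Integration by parts for one Charlier product. By `charlier_succ`, raising the multiplicity of
`j` gives `χ(B_j) R - c μ(B_j) C`, with `C` the original product. The Mecke formula turns the first
term into `R G` at `χ + δ_z` with `z ∈ B_j`, and the second is the integral of `c C G` over `B_j`.
-/
lemma integrable_and_integral_ind [SigmaFinite μ] (s : Step μ) (hQ : IsPoissonLaw Q μ) (c : ℝ)
    {G : Measure Z → ℝ} (hG : Measurable G) (hG2 : MemLp G 2 Q) (j : Fin s.r)
    (m : Multiset (Fin s.r)) :
    Integrable (fun p : Z × Measure Z => s.ind j p.1 *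
      (s.charlierProd c m p.2 * (G (p.2 + Measure.dirac p.1) - c * G p.2))) (μ.prod Q) ∧
    ∫ p, s.ind j p.1 * (s.charlierProd c m p.2 * (G (p.2 + Measure.dirac p.1) - c * G p.2))
      ∂(μ.prod Q) = ∫ χ, s.charlierProd c (j ::ₘ m) χ * G χ ∂Q := by
  have := hQ.prob
  have : IsFiniteMeasure (μ.restrict (s.B j)) := isFiniteMeasure_restrict.2 (s.finite j)
  -- The argument of the `j`-th factor is shifted by `-1`, so that `R(χ + δ_z)` is the original
  -- Charlier product at `χ` when `z ∈ B_j`.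
  let R : Measure Z → ℝ := fun χ =>
    charlier (m.count j) (c * μ.real (s.B j)) (χ.real (s.B j) - 1) *
      ∏ i ∈ Finset.univ.erase j, charlier (m.count i) (c * μ.real (s.B i)) (χ.real (s.B i))
  have hR : Measurable R := by
    refine ((measurable_charlier _ _).comp
      ((measurable_real_apply (s.measurableSet j)).sub_const 1)).mul ?_
    exact Finset.measurable_prod _ fun i _ =>
      (measurable_charlier _ _).comp (measurable_real_apply (s.measurableSet i))
  have hRm : ∀ χ, s.charlierProd c (j ::ₘ m) χ = χ.real (s.B j) * R χ -
      c * μ.real (s.B j) * s.charlierProd c m χ := s.charlierProd_cons c j m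
  have h1 : Integrable (fun χ => s.charlierProd c (j ::ₘ m) χ * G χ) Q :=
    ((s.tame_charlierProd hQ c _).memLp hQ).integrable_mul hG2
  have h2 : Integrable (fun χ => s.charlierProd c m χ * G χ) Q :=
    ((s.tame_charlierProd hQ c _).memLp hQ).integrable_mul hG2
  have h3 : ∀ χ, χ.real (s.B j) * (R χ * G χ) = s.charlierProd c (j ::ₘ m) χ * G χ +
      c * μ.real (s.B j) * (s.charlierProd c m χ * G χ) := fun χ => by rw [hRm]; ring
  have h4 : Integrable (fun χ => χ.real (s.B j) * (R χ * G χ)) Q := by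
    simp_rw [h3]
    exact h1.add (h2.const_mul _)
  obtain ⟨h5, h6⟩ := integrable_and_integral_add_dirac hQ (s.measurableSet j) (s.finite j)
    (hR.mul hG) h4
  simp only [Pi.mul_apply] at h5 h6
  have h7 : ∀ᵐ p ∂((μ.restrict (s.B j)).prod Q), R (p.2 + Measure.dirac p.1) * G (p.2 + Measure.dirac p.1) -
      c * (s.charlierProd c m p.2 * G p.2) =
      s.charlierProd c m p.2 * (G (p.2 + Measure.dirac p.1) - c * G p.2) := by
    filter_upwards [Measure.quasiMeasurePreserving_snd.ae (ae_ne_top hQ s),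
      Measure.quasiMeasurePreserving_fst.ae (ae_restrict_mem (s.measurableSet j))] with p hp hz
    have : R (p.2 + Measure.dirac p.1) = s.charlierProd c m p.2 := by
      simp only [R, charlierProd, s.real_add_dirac hp, ind_eq_ite hz]
      rw [← Finset.mul_prod_erase _ (fun i => charlier (m.count i) (c * μ.real (s.B i))
        (p.2.real (s.B i))) (Finset.mem_univ j)]
      congr 1
      · simp
      · exact Finset.prod_congr rfl fun i hi => by simp [Finset.ne_of_mem_erase hi]
    rw [this]; ring
  have h8 : Integrable (fun p : Z × Measure Z => c * (s.charlierProd c m p.2 * G p.2))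
      ((μ.restrict (s.B j)).prod Q) := (h2.comp_snd _).const_mul c
  have h9 : Integrable (fun p : Z × Measure Z => s.charlierProd c m p.2 *
      (G (p.2 + Measure.dirac p.1) - c * G p.2)) ((μ.restrict (s.B j)).prod Q) :=
    (h5.sub h8).congr h7
  have h10 : (fun p : Z × Measure Z => s.ind j p.1 *
      (s.charlierProd c m p.2 * (G (p.2 + Measure.dirac p.1) - c * G p.2))) =
      (s.B j ×ˢ Set.univ).indicator fun p => s.charlierProd c m p.2 *
        (G (p.2 + Measure.dirac p.1) - c * G p.2) := by
    ext p
    by_cases hp : p.1 ∈ s.B j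
    · simp [ind_of_mem hp, hp]
    · simp [ind_of_notMem hp, hp]
  have h11 : (μ.prod Q).restrict (s.B j ×ˢ Set.univ) = (μ.restrict (s.B j)).prod Q := by
    rw [← Measure.prod_restrict, Measure.restrict_univ]
  have hms : MeasurableSet (s.B j ×ˢ (Set.univ : Set (Measure Z))) :=
    (s.measurableSet j).prod MeasurableSet.univ
  rw [h10, integrable_indicator_iff hms, IntegrableOn, integral_indicator hms, h11]
  refine ⟨h9, ?_⟩
  rw [← integral_congr_ae h7, integral_sub h5 h8, integral_prod _ h5, h6, integral_const_mul,
    integral_prod _ (h2.comp_snd _)]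
  simp only [integral_const, smul_eq_mul]
  simp_rw [h3]
  rw [integral_add h1 (h2.const_mul _), integral_const_mul]
  simp [measureReal_def]
  ring

lemma mul_sum_fin {κ : Type*} [Fintype κ] (n : ℕ) (F : Multiset κ → ℝ) :
    (n : ℝ) * ∑ α : Fin n → κ, F (config α) =
      n * ∑ j, ∑ β : Fin (n - 1) → κ, F (j ::ₘ config β) := by
  cases n with
  | zero => simp
  | succ n => rw [sum_fin_succ]; simp

lemma deriv_value (s : Step μ) (c : ℝ) (z : Z) (χ : Measure Z) : (s.deriv z).value c χ =
    ∑ j, ∑ β : Fin (s.order - 1) → Fin s.r, s.order * s.coeff (j ::ₘ config β) *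
      (s.ind j z * s.charlierProd c (config β) χ) := by
  change ∑ β : Fin (s.order - 1) → Fin s.r, (s.order * ∑ j, s.ind j z * s.coeff (j ::ₘ config β)) *
    s.charlierProd c (config β) χ = _
  simp_rw [Finset.mul_sum, Finset.sum_mul]
  rw [Finset.sum_comm]
  exact Finset.sum_congr rfl fun j _ => Finset.sum_congr rfl fun β _ => by ring

/-- Integration by parts. -/
lemma integral_value_mul [SigmaFinite μ] (s : Step μ) (hQ : IsPoissonLaw Q μ) (c : ℝ)
    {G : Measure Z → ℝ} (hG : Measurable G) (hG2 : MemLp G 2 Q) :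
    s.order * ∫ χ, s.value c χ * G χ ∂Q =
      ∫ z, ∫ χ, (s.deriv z).value c χ * (G (χ + Measure.dirac z) - c * G χ) ∂Q ∂μ := by
  have := hQ.prob
  have h1 := fun j m => s.integrable_and_integral_ind hQ c hG hG2 j m
  have h2 : ∀ p : Z × Measure Z, (s.deriv p.1).value c p.2 * (G (p.2 + Measure.dirac p.1) - c * G p.2) =
      ∑ j, ∑ β : Fin (s.order - 1) → Fin s.r, s.order * s.coeff (j ::ₘ config β) *
        (s.ind j p.1 * (s.charlierProd c (config β) p.2 *
          (G (p.2 + Measure.dirac p.1) - c * G p.2))) := fun p => by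
    rw [deriv_value, Finset.sum_mul]
    refine Finset.sum_congr rfl fun j _ => ?_
    rw [Finset.sum_mul]
    exact Finset.sum_congr rfl fun β _ => by ring
  have h3 : ∀ m, Integrable (fun χ => s.charlierProd c m χ * G χ) Q := fun m =>
    ((s.tame_charlierProd hQ c _).memLp hQ).integrable_mul hG2
  rw [← integral_prod (fun p : Z × Measure Z =>
    (s.deriv p.1).value c p.2 * (G (p.2 + Measure.dirac p.1) - c * G p.2))]
  · simp_rw [h2]
    rw [integral_finsetSum]
    · simp only [value, Finset.sum_mul]
      rw [integral_finsetSum]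
      · simp_rw [mul_assoc, integral_const_mul]
        rw [mul_sum_fin s.order fun m => s.coeff m * ∫ χ, s.charlierProd c m χ * G χ ∂Q,
          Finset.mul_sum]
        refine Finset.sum_congr rfl fun j _ => ?_
        rw [integral_finsetSum, Finset.mul_sum]
        · refine Finset.sum_congr rfl fun β _ => ?_
          rw [integral_const_mul, integral_const_mul, (h1 j _).2]
        · exact fun β _ => ((h1 j _).1.const_mul _).const_mul _
      · exact fun α _ => by
          simp_rw [mul_assoc]
          exact (h3 _).const_mul _
    · exact fun j _ => integrable_finsetSum _ fun β _ => (h1 j _).1.const_mul _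
  · simp_rw [h2]
    exact integrable_finsetSum _ fun j _ => integrable_finsetSum _ fun β _ =>
      (h1 j _).1.const_mul _

/-- Integration by parts against `G = 1` with `c = 1`: the bracket `G(χ + δ_z) - G(χ)` vanishes. -/
lemma integral_value_one [SigmaFinite μ] (s : Step μ) (hQ : IsPoissonLaw Q μ) (hs : s.order ≠ 0) :
    ∫ χ, s.value 1 χ ∂Q = 0 := by
  have := hQ.prob
  have := s.integral_value_mul hQ 1 (G := fun _ => 1) measurable_const (memLp_const 1)
  simpa [hs] using this

/-! ### The kernel of a step integral -/

/-- Measures which are finite on the sets of a step kernel. -/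
def Finite (s : Step μ) (χ : Measure Z) : Prop := ∀ j, χ (s.B j) ≠ ∞

lemma Finite.add_dirac {s : Step μ} {χ : Measure Z} (h : s.Finite χ) (z : Z) :
    s.Finite (χ + Measure.dirac z) := fun j => by simp [h j]

lemma addCosts_value_cons (s : Step μ) (c : ℝ) {χ : Measure Z} (h : s.Finite χ) (z : Z)
    (w : Multiset Z) : addCosts (z ::ₘ w) (s.value c) χ = addCosts w ((s.deriv z).value c) χ := by
  rw [addCosts_cons']
  induction w using Multiset.induction_on generalizing χ with
  | empty => simp [addOneCost, s.value_add_dirac c h]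
  | cons y w ih =>
    rw [addCosts_cons, addCosts_cons, addOneCost, addOneCost, ih h, ih (h.add_dirac y)]

/-- The kernel of the multiple integral of a step kernel, as a function of configurations. -/
def kernel (s : Step μ) (w : Multiset Z) : ℝ :=
  if w.card = s.order then addCosts w (s.value 1) 0 else 0

lemma value_of_order_eq_zero (s : Step μ) (h : s.order = 0) (c : ℝ) (χ : Measure Z) :
    s.value c χ = s.coeff 0 := by
  have : ∀ n, n = 0 → ∑ α : Fin n → Fin s.r, s.coeff (config α) * s.charlierProd c (config α) χ =
      s.coeff 0 := by
    rintro n rfl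
    simp [show ∀ z : Fin 0 → Fin s.r, config z = 0 from config_empty, charlierProd, charlier_zero]
  exact this _ h

lemma finite_zero (s : Step μ) : s.Finite 0 := fun j => by simp

lemma kernel_deriv (s : Step μ) (z : Z) (w : Multiset Z) :
    (s.deriv z).kernel w = s.kernel (z ::ₘ w) := by
  rw [kernel, kernel, ← s.addCosts_value_cons 1 s.finite_zero, Multiset.card_cons]
  change (if w.card = s.order - 1 then _ else _) = _
  -- At order zero the truncated subtraction leaves the order at zero, but the factor `s.order` in
  -- the coefficients makes the derivative vanish.
  by_cases h : s.order = 0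
  · have h1 : (s.deriv z).value 1 = fun _ => 0 := by
      ext χ
      rw [value_of_order_eq_zero _ (by simp [deriv, h])]
      simp [deriv, h]
    have h2 : addCosts w (fun _ : Measure Z => (0 : ℝ)) = fun _ => 0 := by
      induction w using Multiset.induction_on with
      | empty => simp
      | cons y w ih => rw [addCosts_cons, ih]; ext; simp [addOneCost]
    rw [s.addCosts_value_cons 1 s.finite_zero, h1, h2]
    simp
  · congr 1
    simp only [eq_iff_iff]
    omega

lemma kernel_eq_zero (s : Step μ) {w : Multiset Z} (h : w.card ≠ s.order) : s.kernel w = 0 :=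
  if_neg h

/-- Each cost lowers the order by one, so `order` costs leave a constant, independent of `χ` and of
`c`. This justifies defining `kernel` by evaluation at the zero measure. -/
lemma addCosts_value_of_card (s : Step μ) (c : ℝ) {χ : Measure Z} (h : s.Finite χ) {w : Multiset Z}
    (hw : w.card = s.order) : addCosts w (s.value c) χ = s.kernel w := by
  induction w using Multiset.induction_on generalizing s with
  | empty =>
    rw [kernel, if_pos hw, addCosts_zero, addCosts_zero, value_of_order_eq_zero _ hw.symm,
      value_of_order_eq_zero _ hw.symm]
  | cons z w ih =>
    rw [s.addCosts_value_cons c h, ← kernel_deriv]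
    refine ih (s.deriv z) h ?_
    rw [Multiset.card_cons] at hw
    simp [deriv, ← hw]

lemma toFun_deriv (s : Step μ) (z : Z) {n : ℕ} (w : Fin n → Z) : (s.deriv z).toFun w =
    s.order * s.toFun (Fin.cons z w : Fin (n + 1) → Z) := by
  change ∑ β : Fin n → Fin s.r, (s.order * ∑ j, s.ind j z * s.coeff (j ::ₘ config β)) *
    ∏ l, s.ind (β l) (w l) = _
  rw [toFun, sum_fin_succ, Finset.mul_sum]
  simp_rw [Finset.mul_sum, Finset.sum_mul, Fin.prod_univ_succ, config_cons, Fin.cons_zero,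
    Fin.cons_succ]
  rw [Finset.sum_comm]
  exact Finset.sum_congr rfl fun j _ => Finset.sum_congr rfl fun β _ => by ring

lemma kernel_config (s : Step μ) {n : ℕ} (hn : s.order = n) (z : Fin n → Z) :
    s.kernel (config z) = n.factorial * s.toFun z := by
  induction n generalizing s with
  | zero =>
    rw [← s.addCosts_value_of_card 1 s.finite_zero (by simp [hn]), config_empty, addCosts_zero,
      value_of_order_eq_zero _ hn]
    simp [toFun, show ∀ z : Fin 0 → Fin s.r, config z = 0 from config_empty]
  | succ n ih =>
    rw [config_succ, ← kernel_deriv, ih _ (by simp [deriv, hn]), toFun_deriv, hn,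
      Nat.factorial_succ]
    push_cast
    rw [show (Fin.cons (z 0) (Fin.tail z) : Fin (n + 1) → Z) = z from Fin.cons_self_tail z]
    ring

lemma measurable_toFun (s : Step μ) (n : ℕ) : Measurable (s.toFun : (Fin n → Z) → ℝ) :=
  Finset.measurable_sum _ fun _ _ => (Finset.measurable_prod _ fun l _ =>
    (s.measurable_ind _).comp (measurable_pi_apply l)).const_mul _

lemma measurable_kernel (s : Step μ) : Measurable s.kernel := by
  rw [measurable_iff_kernelMeasurable]
  intro n
  by_cases h : s.order = n
  · simp_rw [s.kernel_config h]
    exact (s.measurable_toFun n).const_mul _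
  · have : ∀ z : Fin n → Z, s.kernel (config z) = 0 := fun z =>
      s.kernel_eq_zero (by simpa [eq_comm] using h)
    simp_rw [this]
    exact measurable_const

lemma toFun_eq_of_mem (s : Step μ) {n : ℕ} {z : Fin n → Z} {α : Fin n → Fin s.r}
    (h : ∀ l, z l ∈ s.B (α l)) : s.toFun z = s.coeff (config α) := by
  rw [toFun, Finset.sum_eq_single α]
  · rw [Finset.prod_eq_one fun l _ => ind_of_mem (h l), mul_one]
  · intro β _ hβ
    obtain ⟨l, hl⟩ := Function.ne_iff.1 hβ
    rw [Finset.prod_eq_zero (Finset.mem_univ l), mul_zero]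
    rw [ind_eq_ite (h l), if_neg hl]
  · simp

lemma toFun_eq_zero (s : Step μ) {n : ℕ} {z : Fin n → Z} (h : ∃ l, ∀ j, z l ∉ s.B j) :
    s.toFun z = 0 := by
  obtain ⟨l, hl⟩ := h
  refine Finset.sum_eq_zero fun β _ => ?_
  have h : s.ind (β l) (z l) = 0 := ind_of_notMem (hl _)
  rw [Finset.prod_eq_zero (Finset.mem_univ l) h, mul_zero]

/-- Costs of lower order leave a centred step integral of positive order, and costs of higher order
leave zero. -/
lemma meanCosts_value [SigmaFinite μ] (s : Step μ) (hQ : IsPoissonLaw Q μ) (w : Multiset Z) :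
    meanCosts Q (s.value 1) w = s.kernel w := by
  have := hQ.prob
  induction w using Multiset.induction_on generalizing s with
  | empty =>
    by_cases h : s.order = 0
    · rw [← s.addCosts_value_of_card 1 s.finite_zero (by simp [h])]
      simp [meanCosts, value_of_order_eq_zero _ h]
    · rw [s.kernel_eq_zero (by simpa [eq_comm] using h)]
      simpa [meanCosts] using s.integral_value_one hQ h
  | cons z w ih =>
    rw [← kernel_deriv, ← ih, meanCosts, meanCosts]
    refine integral_congr_ae ?_
    filter_upwards [ae_ne_top hQ s] with χ hχ
    exact s.addCosts_value_cons 1 hχ z w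

end Step

end

/-! ### Words, the product rule, and moments of step integrals. -/

section

/-! ### Words of non-empty sets -/

section Expansion

variable {ι : Type*} [Fintype ι] [DecidableEq ι]

lemma sum_cellIndex (F : Finset ι → ℝ) (h : F ∅ = 0) :
    ∑ S : CellIndex ι, F S.1 = ∑ S : Finset ι, F S := by
  have h1 : ∑ S : CellIndex ι, F S.1 =
      ∑ S ∈ Finset.univ.filter fun S : Finset ι => S.Nonempty, F S :=
    (Finset.sum_subtype _ (by simp) F).symm
  rw [h1, ← Finset.sum_filter_add_sum_filter_not Finset.univ (fun S : Finset ι => S.Nonempty) F]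
  simp [Finset.not_nonempty_iff_eq_empty, Finset.filter_eq', h]

lemma prod_add_eq_sum (X Y : ι → ℝ) :
    ∏ i, (X i + Y i) = ∑ S : Finset ι, ∏ i, if i ∈ S then Y i else X i := by
  simp_rw [add_comm (X _)]
  rw [Finset.prod_add, Finset.powerset_univ]
  refine Finset.sum_congr rfl fun S _ => ?_
  rw [Finset.prod_ite, ← Finset.compl_eq_univ_sdiff]
  congr 2 <;> ext i <;> simp

lemma prod_add_sub_prod (X Y : ι → ℝ) :
    ∏ i, (X i + Y i) - ∏ i, X i = ∑ S : CellIndex ι, ∏ i, if i ∈ S.1 then Y i else X i := by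
  rw [prod_add_eq_sum, ← Finset.add_sum_erase _ _ (Finset.mem_univ ∅)]
  simp only [Finset.notMem_empty, if_false, add_sub_cancel_left]
  rw [← Finset.sum_subtype (p := fun S : Finset ι => S.Nonempty) (Finset.univ.erase ∅)
    (fun S => by simp [Finset.nonempty_iff_ne_empty]) (fun S => ∏ i, if i ∈ S then Y i else X i)]

/-- The weight of a letter: `a` for a singleton, and `1` otherwise. -/
def weight (a : ℝ) (S : Finset ι) : ℝ := if S.card = 1 then a else 1

/-- The integrand of the integration by parts in row `i₀`, with `X` the integrals and `Y` their
add-one costs. The subtracted product only affects the term `S = {i₀}`, which gets the weight `1 -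
c`. -/
lemma mul_prod_add_sub (X Y : ι → ℝ) (i₀ : ι) (c : ℝ) :
    Y i₀ * (∏ i ∈ Finset.univ.erase i₀, (X i + Y i) - c * ∏ i ∈ Finset.univ.erase i₀, X i) =
      ∑ S : CellIndex ι, if i₀ ∈ S.1 then
        weight (1 - c) S.1 * ∏ i, (if i ∈ S.1 then Y i else X i) else 0 := by
  rw [sum_cellIndex (fun S => if i₀ ∈ S then
    weight (1 - c) S * ∏ i, (if i ∈ S then Y i else X i) else 0) (by simp)]
  -- With the value `0` at `i₀`, only the sets `S` containing `i₀` survive in the expansion.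
  let X' : ι → ℝ := fun i => if i = i₀ then 0 else X i
  have h1 : Y i₀ * ∏ i ∈ Finset.univ.erase i₀, (X i + Y i) = ∏ i, (X' i + Y i) := by
    rw [← Finset.mul_prod_erase _ _ (Finset.mem_univ i₀)]
    congr 1
    · simp [X']
    · exact Finset.prod_congr rfl fun i hi => by simp [X', Finset.ne_of_mem_erase hi]
  have h2 : ∀ S : Finset ι, (∏ i, if i ∈ S then Y i else X' i) =
      if i₀ ∈ S then ∏ i, (if i ∈ S then Y i else X i) else 0 := fun S => by
    split_ifs with h
    · refine Finset.prod_congr rfl fun i _ => ?_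
      by_cases hi : i ∈ S
      · simp [hi]
      · have : i ≠ i₀ := fun h' => hi (h' ▸ h)
        simp [hi, X', this]
    · exact Finset.prod_eq_zero (Finset.mem_univ i₀) (by simp [h, X'])
  have h3 : Y i₀ * ∏ i ∈ Finset.univ.erase i₀, X i =
      ∑ S : Finset ι, if S = {i₀} then ∏ i, (if i ∈ S then Y i else X i) else 0 := by
    rw [Finset.sum_ite_eq' Finset.univ ({i₀} : Finset ι)]
    rw [if_pos (Finset.mem_univ _), ← Finset.mul_prod_erase _ _ (Finset.mem_univ i₀)]
    congr 1
    · simp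
    · exact Finset.prod_congr rfl fun i hi => by simp [Finset.ne_of_mem_erase hi]
  rw [mul_sub, mul_left_comm, h1, h3, prod_add_eq_sum, Finset.mul_sum, ← Finset.sum_sub_distrib]
  refine Finset.sum_congr rfl fun S _ => ?_
  rw [h2]
  by_cases hS : S = {i₀}
  · subst hS
    simp only [Finset.mem_singleton, if_true, weight, Finset.card_singleton]
    ring
  · rw [if_neg hS]
    by_cases h : i₀ ∈ S
    · have : S.card ≠ 1 := fun h' => by
        obtain ⟨j, rfl⟩ := Finset.card_eq_one.1 h'
        rw [Finset.mem_singleton] at h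
        exact hS (by rw [h])
      simp [h, weight, this]
    · simp [h]

end Expansion

variable {Z : Type*} [MeasurableSpace Z] {ι : Type*} [Fintype ι] [DecidableEq ι]

/-- The points `z_l` whose letter `W_l` contains `i`. -/
def ev {Y L : Type*} [Fintype L] (W : L → CellIndex ι) (w : L → Y) (i : ι) : Multiset Y :=
  ∑ l, if i ∈ (W l).1 then {w l} else 0

lemma ev_zero {Y : Type*} (W : Fin 0 → CellIndex ι) (w : Fin 0 → Y) (i : ι) : ev W w i = 0 := rfl

lemma ev_cons {Y : Type*} {r : ℕ} (S : CellIndex ι) (W : Fin r → CellIndex ι) (y : Y)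
    (w : Fin r → Y) (i : ι) : ev (Fin.cons S W : Fin (r + 1) → CellIndex ι) (Fin.cons y w) i =
      if i ∈ S.1 then y ::ₘ ev W w i else ev W w i := by
  rw [ev, Fin.sum_univ_succ]
  simp only [Fin.cons_zero, Fin.cons_succ]
  split_ifs with h
  · rfl
  · rw [zero_add]; rfl

lemma card_ev {Y L : Type*} [Fintype L] (W : L → CellIndex ι) (w : L → Y) (i : ι) :
    (ev W w i).card = (Finset.univ.filter fun l => i ∈ (W l).1).card := by
  rw [ev, Multiset.card_sum, Finset.card_filter]
  refine Finset.sum_congr rfl fun l _ => ?_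
  split_ifs <;> simp

lemma mem_ev {Y : Type*} {r : ℕ} {W : Fin r → CellIndex ι} {w : Fin r → Y} {i : ι} {y : Y} :
    y ∈ ev W w i ↔ ∃ l, i ∈ (W l).1 ∧ w l = y := by
  rw [ev, Multiset.mem_sum]
  refine ⟨fun ⟨l, _, hl⟩ => ⟨l, ?_⟩, fun ⟨l, h, hl⟩ => ⟨l, Finset.mem_univ l, by simp [h, hl]⟩⟩
  split_ifs at hl with h
  · exact ⟨h, (Multiset.mem_singleton.1 hl).symm⟩
  · simp at hl

lemma ev_comp_perm {Y : Type*} {r : ℕ} (W : Fin r → CellIndex ι) (w : Fin r → Y) (i : ι)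
    (p : Equiv.Perm (Fin r)) : ev (W ∘ p) (w ∘ p) i = ev W w i :=
  Equiv.sum_comp p fun l => if i ∈ (W l).1 then ({w l} : Multiset Y) else 0

lemma measurableConfig_ev {r : ℕ} (W : Fin r → CellIndex ι) (i : ι) :
    MeasurableConfig fun w : Fin r → Z => ev W w i := by
  refine MeasurableConfig.sum _ fun l _ => ?_
  by_cases h : i ∈ (W l).1
  · simp only [h, if_true]
    exact MeasurableConfig.zero.cons (measurable_pi_apply l)
  · simp only [h, if_false]
    exact MeasurableConfig.zero

/-- The product rule for add-one costs. -/
lemma addCosts_prod (ψ : ι → Measure Z → ℝ) {q : ℕ} (z : Fin q → Z) (χ : Measure Z) :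
    addCosts (config z) (fun χ => ∏ i, ψ i χ) χ =
      ∑ W : Fin q → CellIndex ι, ∏ i, addCosts (ev W z i) (ψ i) χ := by
  induction q generalizing χ with
  | zero => simp [ev_zero]
  | succ q ih =>
    rw [config_succ, addCosts_cons, addOneCost, ih, ih, sum_fin_succ, ← Finset.sum_sub_distrib,
      Finset.sum_comm]
    refine Finset.sum_congr rfl fun W _ => ?_
    have h1 : ∀ i, addCosts (ev W (Fin.tail z) i) (ψ i) (χ + Measure.dirac (z 0)) =
        addCosts (ev W (Fin.tail z) i) (ψ i) χ +
          addOneCost (z 0) (addCosts (ev W (Fin.tail z) i) (ψ i)) χ := fun i => by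
      simp [addOneCost]
    simp_rw [h1]
    rw [prod_add_sub_prod]
    refine Finset.sum_congr rfl fun S _ => Finset.prod_congr rfl fun i _ => ?_
    conv_rhs => rw [← Fin.cons_self_tail z, ev_cons]
    split_ifs with h
    · rw [addCosts_cons]
    · rfl

/-! ### Bounded kernels -/

/-- A bounded kernel, which vanishes unless all the points are in a set of finite measure. -/
def NiceKernel (μ : Measure Z) (τ : Multiset Z → ℝ) : Prop :=
  Measurable τ ∧ ∃ B, MeasurableSet B ∧ μ B ≠ ∞ ∧ ∃ M : ℝ, ∀ w, |τ w| ≤ M ∧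
    (τ w ≠ 0 → ∀ z ∈ w, z ∈ B)

/-- The kernels in which the variable `z` is fixed, for the indices in `S`. -/
def shift (S : Finset ι) (z : Z) (τ : ι → Multiset Z → ℝ) (i : ι) (w : Multiset Z) : ℝ :=
  if i ∈ S then τ i (z ::ₘ w) else τ i w

lemma shift_ev {S : CellIndex ι} {z : Z} {τ : ι → Multiset Z → ℝ} {r : ℕ} (W : Fin r → CellIndex ι)
    (w : Fin r → Z) (i : ι) : shift S.1 z τ i (ev W w i) =
      τ i (ev (Fin.cons S W : Fin (r + 1) → CellIndex ι) (Fin.cons z w) i) := by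
  rw [ev_cons, shift]
  split_ifs <;> rfl

variable {μ : Measure Z} {Q : Measure (Measure Z)}

lemma measurable_prod_ev {τ : ι → Multiset Z → ℝ} (h : ∀ i, Measurable (τ i)) {r : ℕ}
    (W : Fin r → CellIndex ι) : Measurable fun w : Fin r → Z => ∏ i, τ i (ev W w i) :=
  Finset.measurable_prod _ fun i _ =>
    (measurable_iff_kernelMeasurable.1 (h i)).comp (measurableConfig_ev W i)

/-- Every letter is non-empty, so every point is an argument of some kernel, and the product
vanishes outside a box of finite measure. -/
lemma integrable_prod_ev [SigmaFinite μ] {τ : ι → Multiset Z → ℝ} (h : ∀ i, NiceKernel μ (τ i))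
    {r : ℕ} (W : Fin r → CellIndex ι) :
    Integrable (fun w : Fin r → Z => ∏ i, τ i (ev W w i)) (power μ r) := by
  choose hm B hB hμ M hM using h
  let C : Set (Fin r → Z) := Set.univ.pi fun _ => ⋃ i, B i
  have hBU : μ (⋃ i, B i) < ∞ := by
    refine (measure_iUnion_le _).trans_lt ?_
    rw [tsum_fintype]
    exact ENNReal.sum_lt_top.2 fun j _ => (hμ j).lt_top
  have hC : MeasurableSet C := MeasurableSet.univ_pi fun _ => MeasurableSet.iUnion hB
  have hμC : power μ r C ≠ ∞ := by
    rw [Measure.pi_pi]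
    exact ENNReal.prod_ne_top fun _ _ => hBU.ne
  have h1 : ∀ w : Fin r → Z, ‖∏ i, τ i (ev W w i)‖ ≤ C.indicator (fun _ => ∏ i, M i) w := fun w => by
    by_cases hw : w ∈ C
    · rw [Set.indicator_of_mem hw, norm_prod]
      exact Finset.prod_le_prod (fun _ _ => norm_nonneg _) fun i _ => (hM i _).1
    · rw [Set.indicator_of_notMem hw, norm_le_zero_iff]
      by_contra h0
      have h0 := Finset.prod_ne_zero_iff.1 h0
      refine hw fun l _ => ?_
      obtain ⟨i, hi⟩ := (W l).2
      exact Set.mem_iUnion.2 ⟨i, (hM i _).2 (h0 i (Finset.mem_univ i)) _ (mem_ev.2 ⟨l, hi, rfl⟩)⟩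
  refine Integrable.mono' ((integrable_indicator_iff hC).2 (integrableOn_const hμC)) 
    (measurable_prod_ev hm W).aestronglyMeasurable (ae_of_all _ h1)

/-- The contribution of the words of length `r` to the moments. -/
def wordSum (μ : Measure Z) (a : ℝ) (r : ℕ) (τ : ι → Multiset Z → ℝ) : ℝ :=
  ∑ W : Fin r → CellIndex ι, (∏ l, weight a (W l).1) * ∫ w, ∏ i, τ i (ev W w i) ∂(power μ r)

/-- The moment functional: the expectation of the product of the multiple integrals with respect
to `η - (1 - a) μ` with kernels `τ i`. -/
def moment (μ : Measure Z) (a : ℝ) (N : ℕ) (τ : ι → Multiset Z → ℝ) : ℝ :=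
  ∑ r ∈ Finset.range (N + 1), (r.factorial : ℝ)⁻¹ * wordSum μ a r τ

lemma integral_power_comp_perm [SigmaFinite μ] {r : ℕ} (p : Equiv.Perm (Fin r))
    (f : (Fin r → Z) → ℝ) : ∫ w, f (w ∘ p) ∂(power μ r) = ∫ w, f w ∂(power μ r) := by
  have h := measurePreserving_piCongrLeft (fun _ : Fin r => μ) p.symm
  refine Eq.trans ?_ (h.integral_comp (MeasurableEquiv.measurableEmbedding _) f)
  refine integral_congr_ae (ae_of_all _ fun w => congrArg f (funext fun l => ?_))
  simp [MeasurableEquiv.coe_piCongrLeft, Equiv.piCongrLeft_apply]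

/-- Only words in which exactly `n` letters contain `i₀` contribute, so multiplication by `n` marks
one such letter. By invariance under permutations it may be put in the first of the `r + 1` places,
and its point is then integrated separately. -/
lemma wordSum_succ [SigmaFinite μ] (a : ℝ) (r : ℕ) {τ : ι → Multiset Z → ℝ}
    (hτ : ∀ i, NiceKernel μ (τ i)) (i₀ : ι) {n : ℕ} (hn : ∀ w, τ i₀ w ≠ 0 → w.card = n) :
    (∀ S : CellIndex ι, Integrable (fun z => wordSum μ a r (shift S.1 z τ)) μ) ∧
    n * wordSum μ a (r + 1) τ = (r + 1) * ∑ S : CellIndex ι, if i₀ ∈ S.1 then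
      weight a S.1 * ∫ z, wordSum μ a r (shift S.1 z τ) ∂μ else 0 := by
  have hm : ∀ i, Measurable (τ i) := fun i => (hτ i).1
  have hint := fun W : Fin (r + 1) → CellIndex ι => integrable_prod_ev hτ W
  have hjoint : ∀ (S : CellIndex ι) (W : Fin r → CellIndex ι),
      Integrable (fun p : Z × (Fin r → Z) => ∏ i, shift S.1 p.1 τ i (ev W p.2 i))
        (μ.prod (power μ r)) := fun S W => by
    have := (measurePreserving_cons μ r).integrable_comp_of_integrable (hint (Fin.cons S W))
    simpa only [Function.comp_def, shift_ev] using this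
  have hz : ∀ S : CellIndex ι, Integrable (fun z => wordSum μ a r (shift S.1 z τ)) μ := fun S =>
    integrable_finsetSum _ fun W _ => (hjoint S W).integral_prod_left.const_mul _
  refine ⟨hz, ?_⟩
  let F : (Fin (r + 1) → CellIndex ι) → ℝ := fun W =>
    (∏ l, weight a (W l).1) * ∫ w, ∏ i, τ i (ev W w i) ∂(power μ (r + 1))
  have h1 : ∀ W, n * F W = ∑ l, if i₀ ∈ (W l).1 then F W else 0 := fun W => by
    rw [Finset.sum_ite, Finset.sum_const_zero, add_zero, Finset.sum_const, nsmul_eq_mul]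
    by_cases h : (Finset.univ.filter fun l => i₀ ∈ (W l).1).card = n
    · rw [h]
    · have : F W = 0 := by
        have h0 : ∀ w : Fin (r + 1) → Z, ∏ i, τ i (ev W w i) = 0 := fun w => by
          refine Finset.prod_eq_zero (Finset.mem_univ i₀) ?_
          by_contra h'
          exact h ((card_ev W w i₀).symm.trans (hn _ h'))
        simp [F, h0]
      rw [this, mul_zero, mul_zero]
  have h2 : ∀ (W : Fin (r + 1) → CellIndex ι) (p : Equiv.Perm (Fin (r + 1))), F (W ∘ p) = F W :=
    fun W p => by
      simp only [F, Function.comp_apply]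
      rw [Equiv.prod_comp p fun l => weight a (W l).1, ← integral_power_comp_perm p]
      simp_rw [ev_comp_perm]
  have h3 : ∀ l, (∑ W, if i₀ ∈ (W l).1 then F W else 0) =
      ∑ S : CellIndex ι, ∑ W : Fin r → CellIndex ι, if i₀ ∈ S.1 then F (Fin.cons S W) else 0 := by
    intro l
    rw [← (Equiv.arrowCongr (Equiv.swap 0 l) (Equiv.refl (CellIndex ι))).sum_comp, sum_fin_succ]
    refine Finset.sum_congr rfl fun S _ => Finset.sum_congr rfl fun W _ => ?_
    have h4 : (Equiv.arrowCongr (Equiv.swap 0 l) (Equiv.refl (CellIndex ι)))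
        (Fin.cons S W : Fin (r + 1) → CellIndex ι) = (Fin.cons S W : Fin (r + 1) → CellIndex ι) ∘
          (Equiv.swap 0 l).symm := rfl
    rw [h4, h2]
    simp
  have h5 : ∀ (S : CellIndex ι) (W : Fin r → CellIndex ι), F (Fin.cons S W) = weight a S.1 *
      ((∏ l, weight a (W l).1) * ∫ z, ∫ w, ∏ i, shift S.1 z τ i (ev W w i) ∂(power μ r) ∂μ) := by
    intro S W
    simp only [F]
    rw [Fin.prod_univ_succ, integral_power_succ μ r (measurable_prod_ev hm _) (hint _), mul_assoc]
    simp only [Fin.cons_zero, Fin.cons_succ, shift_ev]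
  have h6 : ∀ S : CellIndex ι, ∫ z, wordSum μ a r (shift S.1 z τ) ∂μ = ∑ W : Fin r → CellIndex ι,
      (∏ l, weight a (W l).1) * ∫ z, ∫ w, ∏ i, shift S.1 z τ i (ev W w i) ∂(power μ r) ∂μ := by
    intro S
    simp only [wordSum]
    rw [integral_finsetSum _ fun W _ => (hjoint S W).integral_prod_left.const_mul _]
    simp_rw [integral_const_mul]
  calc n * wordSum μ a (r + 1) τ = ∑ W, n * F W := by rw [wordSum, Finset.mul_sum]
    _ = ∑ l : Fin (r + 1), ∑ W, if i₀ ∈ (W l).1 then F W else 0 := by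
        simp_rw [h1]; rw [Finset.sum_comm]
    _ = _ := by
        simp_rw [h3]
        rw [Finset.sum_const, Finset.card_univ, Fintype.card_fin, nsmul_eq_mul]
        push_cast
        congr 1
        refine Finset.sum_congr rfl fun S _ => ?_
        split_ifs
        · simp_rw [h5]
          rw [h6, Finset.mul_sum]
        · simp

/-- The same recursion as the one for expectations in `Step.order_mul_integral_prod`. The factor `r
+ 1` of `wordSum_succ` turns `1/(r+1)!` into `1/r!`, and the empty word contributes nothing: either
`n = 0`, or the kernel of row `i₀` vanishes at the empty configuration. -/
lemma mul_moment_succ [SigmaFinite μ] (a : ℝ) (N : ℕ) {τ : ι → Multiset Z → ℝ}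
    (hτ : ∀ i, NiceKernel μ (τ i)) (i₀ : ι) {n : ℕ} (hn : ∀ w, τ i₀ w ≠ 0 → w.card = n) :
    n * moment μ a (N + 1) τ = ∫ z, ∑ S : CellIndex ι, (if i₀ ∈ S.1 then
      weight a S.1 * moment μ a N (shift S.1 z τ) else 0) ∂μ := by
  have h := fun r => wordSum_succ a r hτ i₀ hn
  have h0 : n * wordSum μ a 0 τ = 0 := by
    rw [mul_eq_zero]
    by_cases h0 : n = 0
    · simp [h0]
    · right
      have : τ i₀ 0 = 0 := by
        by_contra h'
        exact h0 (hn 0 h').symm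
      refine Finset.sum_eq_zero fun W _ => ?_
      have h1 : ∀ w : Fin 0 → Z, ∏ i, τ i (ev W w i) = 0 := fun w =>
        Finset.prod_eq_zero (Finset.mem_univ i₀) (by rw [ev_zero, this])
      simp [h1]
  have hi : ∀ S : CellIndex ι, Integrable (fun z => moment μ a N (shift S.1 z τ)) μ := fun S =>
    integrable_finsetSum _ fun r _ => ((h r).1 S).const_mul _
  rw [integral_finsetSum]
  · rw [moment, Finset.sum_range_succ', mul_add, mul_left_comm _ _ (wordSum μ a 0 τ), h0, mul_zero,
      add_zero, Finset.mul_sum]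
    have h1 : ∀ r : ℕ, n * (((r + 1).factorial : ℝ)⁻¹ * wordSum μ a (r + 1) τ) =
        ∑ S : CellIndex ι, if i₀ ∈ S.1 then weight a S.1 * ((r.factorial : ℝ)⁻¹ *
          ∫ z, wordSum μ a r (shift S.1 z τ) ∂μ) else 0 := fun r => by
      rw [mul_left_comm, (h r).2, ← mul_assoc, Nat.factorial_succ]
      have : (((r + 1) * r.factorial : ℕ) : ℝ)⁻¹ * (r + 1) = (r.factorial : ℝ)⁻¹ := by
        have : (r : ℝ) + 1 ≠ 0 := by positivity
        push_cast
        field_simp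
      rw [this, Finset.mul_sum]
      refine Finset.sum_congr rfl fun S _ => ?_
      split_ifs
      · ring
      · simp
    simp_rw [h1]
    rw [Finset.sum_comm]
    refine Finset.sum_congr rfl fun S _ => ?_
    split_ifs
    · rw [integral_const_mul]
      simp only [moment]
      rw [integral_finsetSum _ fun r _ => ((h r).1 S).const_mul _, Finset.mul_sum]
      simp_rw [integral_const_mul]
    · simp
  · intro S _
    split_ifs
    · exact (hi S).const_mul _
    · exact integrable_zero _ _ _

/-! ### Moments of step integrals -/

namespace Step

lemma niceKernel (s : Step μ) : NiceKernel μ s.kernel := by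
  refine ⟨s.measurable_kernel, s.support, s.measurableSet_support, s.measure_support_ne_top,
    s.order.factorial * ∑ α : Fin s.order → Fin s.r, |s.coeff (config α)|, fun w => ?_⟩
  have hn : 0 ≤ ∑ α : Fin s.order → Fin s.r, |s.coeff (config α)| :=
    Finset.sum_nonneg fun _ _ => abs_nonneg _
  obtain ⟨n, z, rfl⟩ := exists_config_eq w
  by_cases h : s.order = n
  · subst h
    rw [s.kernel_config rfl]
    constructor
    · rw [abs_mul, Nat.abs_cast]
      gcongr
      refine (Finset.abs_sum_le_sum_abs _ _).trans (Finset.sum_le_sum fun α _ => ?_)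
      rw [abs_mul]
      refine mul_le_of_le_one_right (abs_nonneg _) ?_
      rw [Finset.abs_prod]
      refine Finset.prod_le_one (fun _ _ => abs_nonneg _) fun l _ => ?_
      by_cases hz : z l ∈ s.B (α l)
      · simp [ind_of_mem hz]
      · simp [ind_of_notMem hz]
    · intro h0 y hy
      obtain ⟨l, _, hl⟩ := Multiset.mem_sum.1 hy
      rw [Multiset.mem_singleton] at hl
      by_contra hy'
      refine h0 ?_
      rw [s.toFun_eq_zero ⟨l, fun j hj => hy' ?_⟩, mul_zero]
      exact Set.mem_iUnion.2 ⟨j, hl ▸ hj⟩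
  · rw [s.kernel_eq_zero (by simpa [eq_comm] using h)]
    exact ⟨by simpa using by positivity, fun h => absurd rfl h⟩

/-- Differentiation of the step kernels with indices in `S`. -/
def derivs (S : Finset ι) (z : Z) (s : ι → Step μ) (i : ι) : Step μ :=
  if i ∈ S then (s i).deriv z else s i

lemma kernel_derivs (S : Finset ι) (z : Z) (s : ι → Step μ) :
    (fun i => (derivs S z s i).kernel) = shift S z fun i => (s i).kernel := by
  ext i w
  rw [derivs, shift]
  split_ifs
  · exact (s i).kernel_deriv z w
  · rfl

/-- Integration by parts of the factor `i₀` against the product of the other factors, whose value at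
`χ + δ_z` is expanded by `mul_prod_add_sub`. -/
lemma order_mul_integral_prod [SigmaFinite μ] (hQ : IsPoissonLaw Q μ) (s : ι → Step μ) (c : ℝ)
    (i₀ : ι) : (s i₀).order * ∫ χ, ∏ i, (s i).value c χ ∂Q =
      ∫ z, ∑ S : CellIndex ι, (if i₀ ∈ S.1 then weight (1 - c) S.1 *
        ∫ χ, ∏ i, (derivs S.1 z s i).value c χ ∂Q else 0) ∂μ := by
  have := hQ.prob
  have hG : Tame μ Q fun χ => ∏ i ∈ Finset.univ.erase i₀, (s i).value c χ :=
    Tame.prod hQ _ fun i _ => (s i).tame_value hQ c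
  have hsplit : ∀ χ, ∏ i, (s i).value c χ = (s i₀).value c χ *
      ∏ i ∈ Finset.univ.erase i₀, (s i).value c χ := fun χ =>
    (Finset.mul_prod_erase _ (fun i => (s i).value c χ) (Finset.mem_univ i₀)).symm
  rw [integral_congr_ae (ae_of_all _ hsplit), (s i₀).integral_value_mul hQ c hG.1 (hG.memLp hQ)]
  refine integral_congr_ae (ae_of_all _ fun z => ?_)
  have hi : ∀ S : CellIndex ι, Integrable (fun χ => ∏ i, (derivs S.1 z s i).value c χ) Q := fun S =>
    ((Tame.prod hQ _ fun i _ => (derivs S.1 z s i).tame_value hQ c).memLp hQ).integrable (by norm_num)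
  have h1 : ∫ χ, ((s i₀).deriv z).value c χ *
      (∏ i ∈ Finset.univ.erase i₀, (s i).value c (χ + Measure.dirac z) -
        c * ∏ i ∈ Finset.univ.erase i₀, (s i).value c χ) ∂Q =
      ∫ χ, ∑ S : CellIndex ι, (if i₀ ∈ S.1 then weight (1 - c) S.1 *
        ∏ i, (derivs S.1 z s i).value c χ else 0) ∂Q := by
    refine integral_congr_ae ?_
    filter_upwards [ae_all_iff.2 fun i => ae_ne_top hQ (s i)] with χ hχ
    simp_rw [fun i => (s i).value_add_dirac c (hχ i) z]
    rw [mul_prod_add_sub (fun i => (s i).value c χ) (fun i => ((s i).deriv z).value c χ)]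
    refine Finset.sum_congr rfl fun S _ => ?_
    split_ifs
    · congr 1
      refine Finset.prod_congr rfl fun i _ => ?_
      rw [derivs]
      split_ifs <;> rfl
    · rfl
  refine h1.trans ?_
  rw [integral_finsetSum]
  · refine Finset.sum_congr rfl fun S _ => ?_
    split_ifs
    · rw [integral_const_mul]
    · simp
  · intro S _
    split_ifs
    · exact (hi S).const_mul _
    · exact integrable_zero _ _ _

lemma moment_of_order_eq_zero [SigmaFinite μ] (a : ℝ) (N : ℕ) (s : ι → Step μ)
    (h : ∀ i, (s i).order = 0) :
    moment μ a N (fun i => (s i).kernel) = ∏ i, (s i).coeff 0 := by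
  have h0 : wordSum μ a 0 (fun i => (s i).kernel) = ∏ i, (s i).coeff 0 := by
    have : ∀ i, (s i).kernel 0 = (s i).coeff 0 := fun i => by
      rw [kernel, if_pos (by simp [h i]), addCosts_zero, value_of_order_eq_zero _ (h i)]
    simp [wordSum, ev_zero, this, power, measureReal_def]
  rw [moment, Finset.sum_eq_single 0]
  · simp [h0]
  · intro r _ hr
    rw [wordSum, Finset.sum_eq_zero, mul_zero]
    intro W _
    obtain ⟨i, hi⟩ := (W ⟨0, by omega⟩).2
    have : ∀ w : Fin r → Z, ∏ i, (s i).kernel (ev W w i) = 0 := fun w => by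
      refine Finset.prod_eq_zero (Finset.mem_univ i) ((s i).kernel_eq_zero ?_)
      rw [h i]
      intro h0
      rw [Multiset.card_eq_zero] at h0
      have : w ⟨0, by omega⟩ ∈ ev W w i := mem_ev.2 ⟨_, hi, rfl⟩
      rw [h0] at this
      simp at this
    simp [this]
  · simp

/-- The moments of the multiple integrals of step kernels. -/
theorem integral_prod_value [SigmaFinite μ] (hQ : IsPoissonLaw Q μ) (c : ℝ) (N : ℕ)
    (s : ι → Step μ) (hN : ∑ i, (s i).order ≤ N) :
    ∫ χ, ∏ i, (s i).value c χ ∂Q = moment μ (1 - c) N fun i => (s i).kernel := by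
  have := hQ.prob
  by_cases h : ∀ i, (s i).order = 0
  · rw [moment_of_order_eq_zero _ _ _ h]
    simp [fun i => (s i).value_of_order_eq_zero (h i)]
  push Not at h
  obtain ⟨i₀, h0⟩ := h
  -- Both sides, multiplied by the non-zero order of the row `i₀`, satisfy the same recursion, in
  -- which the order of row `i₀` drops. When all the orders are zero both sides are the product of
  -- the constants.
  induction N generalizing s i₀ with
  | zero =>
    have := Finset.single_le_sum (f := fun i => (s i).order) (fun _ _ => Nat.zero_le _)
      (Finset.mem_univ i₀)
    omega
  | succ N ih =>
    have h1 : ∀ z, ∀ S : CellIndex ι, i₀ ∈ S.1 → ∫ χ, ∏ i, (derivs S.1 z s i).value c χ ∂Q =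
        moment μ (1 - c) N (shift S.1 z fun i => (s i).kernel) := fun z S hS => by
      have h2 : ∑ i, (derivs S.1 z s i).order ≤ N := by
        have : ∑ i, (derivs S.1 z s i).order < ∑ i, (s i).order := by
          refine Finset.sum_lt_sum (fun i _ => ?_) ⟨i₀, Finset.mem_univ i₀, ?_⟩
          · rw [derivs]
            split_ifs
            · exact Nat.sub_le _ _
            · exact le_rfl
          · rw [derivs, if_pos hS]
            exact Nat.sub_lt (Nat.pos_of_ne_zero h0) one_pos
        omega
      rw [← kernel_derivs]
      by_cases h : ∀ i, (derivs S.1 z s i).order = 0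
      · rw [moment_of_order_eq_zero _ _ _ h]
        simp [fun i => (derivs S.1 z s i).value_of_order_eq_zero (h i)]
      · push Not at h
        obtain ⟨i₁, h3⟩ := h
        exact ih _ h2 i₁ h3
    have h4 := order_mul_integral_prod hQ s c i₀
    have h5 := mul_moment_succ (1 - c) N (τ := fun i => (s i).kernel) (fun i => (s i).niceKernel) i₀
      (n := (s i₀).order) fun w hw => by
        by_contra h'
        exact hw ((s i₀).kernel_eq_zero h')
    have h6 : ((s i₀).order : ℝ) ≠ 0 := by exact_mod_cast h0
    refine mul_left_cancel₀ h6 (h4.trans (Eq.trans ?_ h5.symm))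
    refine integral_congr_ae (ae_of_all _ fun z => Finset.sum_congr rfl fun S _ => ?_)
    split_ifs with hS
    · rw [h1 z S hS]
    · rfl

end Step

end

/-! ### Null sets under projections, and density of step kernels. -/

section

/-! ### Coordinate projections -/

variable {Z : Type*} [MeasurableSpace Z] {μ : Measure Z} {Q : Measure (Measure Z)}

lemma measurePreserving_comp_equiv [SigmaFinite μ] {α β : Type*} [Fintype α] [Fintype β]
    (e : α ≃ β) : MeasurePreserving (fun (w : β → Z) => w ∘ e) (Measure.pi fun _ : β => μ)
      (Measure.pi fun _ : α => μ) := by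
  have h := measurePreserving_piCongrLeft (fun _ : α => μ) e.symm
  convert h using 1
  ext w l
  simp [MeasurableEquiv.coe_piCongrLeft, Equiv.piCongrLeft_apply]

/-- Since `μ` need not have mass one, a projection does not preserve the product measures, but it
does pull null sets back to null sets. This is all that is used to evaluate almost everywhere
defined kernels along words. -/
lemma quasiMeasurePreserving_comp_injective [SigmaFinite μ] {α β : Type*} [Fintype α] [Fintype β]
    {e : α → β} (he : Function.Injective e) :
    Measure.QuasiMeasurePreserving (fun (w : β → Z) => w ∘ e) (Measure.pi fun _ : β => μ)
      (Measure.pi fun _ : α => μ) := by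
  classical
  have h1 := measurePreserving_piEquivPiSubtypeProd (fun _ : β => μ) (fun b => b ∈ Set.range e)
  let _ : Fintype ↥(Set.range e) := Subtype.fintype fun b => b ∈ Set.range e
  have h2 := measurePreserving_comp_equiv (μ := μ) (Equiv.ofInjective e he)
  have h3 := h2.quasiMeasurePreserving.comp
    ((Measure.quasiMeasurePreserving_fst).comp h1.quasiMeasurePreserving)
  exact h3

lemma exists_ev_eq {ι Y : Type*} [Fintype ι] [DecidableEq ι] {r : ℕ} (W : Fin r → CellIndex ι)
    (i : ι) : ∃ (n : ℕ) (e : Fin n → Fin r), Function.Injective e ∧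
      ∀ w : Fin r → Y, ev W w i = config (w ∘ e) := by
  let T : Finset (Fin r) := Finset.univ.filter fun l => i ∈ (W l).1
  refine ⟨T.card, T.orderEmbOfFin rfl, (T.orderEmbOfFin rfl).injective, fun w => ?_⟩
  rw [ev, ← Finset.sum_filter, config]
  change ∑ l ∈ T, ({w l} : Multiset Y) = ∑ j, {w (T.orderEmbOfFin rfl j)}
  rw [← Finset.sum_coe_sort]
  exact ((T.orderIsoOfFin rfl).toEquiv.sum_comp fun x : T => ({w x} : Multiset Y)).symm

lemma ae_ev_of_ae_fock [SigmaFinite μ] {ι : Type*} [Fintype ι] [DecidableEq ι]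
    {p : Multiset Z → Prop} (h : ∀ᵐ s ∂(fock μ), p s) {r : ℕ} (W : Fin r → CellIndex ι) (i : ι) :
    ∀ᵐ w ∂(power μ r), p (ev W w i) := by
  obtain ⟨n, e, he, hw⟩ := exists_ev_eq (Y := Z) W i
  simp_rw [hw]
  exact (quasiMeasurePreserving_comp_injective he).ae (ae_config_of_ae_fock h n)

lemma exists_perm_of_config_eq {κ : Type*} [DecidableEq κ] {n : ℕ} {α β : Fin n → κ}
    (h : config α = config β) : ∃ p : Equiv.Perm (Fin n), β ∘ p = α := by
  have h1 : ∀ j, Nonempty ({l // α l = j} ≃ {l // β l = j}) := fun j => by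
    rw [← Fintype.card_eq, Fintype.card_subtype, Fintype.card_subtype, ← count_config,
      ← count_config, h]
  exact ⟨Equiv.ofFiberEquiv fun j => (h1 j).some, funext fun l => Equiv.ofFiberEquiv_map _ l⟩

lemma eLpNorm_fun_sub_comm {α : Type*} [MeasurableSpace α] (f g : α → ℝ) (ν : Measure α) :
    eLpNorm (fun x => f x - g x) 2 ν = eLpNorm (fun x => g x - f x) 2 ν :=
  eLpNorm_sub_comm f g 2 ν

/-! ### Dominated convergence in `L²` -/

lemma tendsto_eLpNorm_sub_of_dominated {α : Type*} [MeasurableSpace α] {ν : Measure α}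
    {f : ℕ → α → ℝ} {g G : α → ℝ} (hf : ∀ n, AEStronglyMeasurable (f n) ν)
    (hg : AEStronglyMeasurable g ν) (hG : MemLp G 2 ν) (hfG : ∀ n, ∀ᵐ x ∂ν, |f n x| ≤ G x)
    (h : ∀ᵐ x ∂ν, Tendsto (fun n => f n x) atTop (𝓝 (g x))) :
    Tendsto (fun n => eLpNorm (fun x => f n x - g x) 2 ν) atTop (𝓝 0) := by
  have hgG : ∀ᵐ x ∂ν, |g x| ≤ G x := by
    filter_upwards [h, ae_all_iff.2 hfG] with x h1 h2
    exact le_of_tendsto h1.abs (Eventually.of_forall h2)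
  have h1 : Tendsto (fun n => ∫⁻ x, ‖f n x - g x‖ₑ ^ 2 ∂ν) atTop (𝓝 (∫⁻ _, 0 ∂ν)) := by
    refine tendsto_lintegral_of_dominated_convergence' (fun x => ‖2 * G x‖ₑ ^ 2) (fun n => ?_)
      (fun n => ?_) ?_ ?_
    · exact ((hf n).sub hg).enorm.pow_const 2
    · filter_upwards [hfG n, hgG] with x h1 h2
      gcongr
      rw [enorm_le_iff_norm_le, Real.norm_eq_abs, Real.norm_eq_abs]
      calc |f n x - g x| ≤ |f n x| + |g x| := abs_sub _ _
        _ ≤ 2 * G x := by linarith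
        _ ≤ _ := le_abs_self _
    · exact ((memLp_two_iff_lintegral (hG.const_mul 2).aestronglyMeasurable).1 (hG.const_mul 2)).ne
    · filter_upwards [h] with x hx
      have h3 : Tendsto (fun n => f n x - g x) atTop (𝓝 0) := by simpa using hx.sub_const (g x)
      have h4 := ((ENNReal.continuous_pow 2).tendsto _).comp h3.enorm
      simpa [Function.comp_def] using h4
  simp only [lintegral_zero, lintegral_enorm_sq_eq] at h1
  have h2 := h1.ennrpow_const (1 / 2 : ℝ)
  have h3 : ∀ x : ℝ≥0∞, (x ^ 2) ^ (1 / 2 : ℝ) = x := fun x => by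
    rw [← ENNReal.rpow_natCast, ← ENNReal.rpow_mul]; norm_num
  simp only [h3] at h2
  rwa [ENNReal.zero_rpow_of_pos (by norm_num)] at h2

/-! ### Density of step kernels -/

section Density

variable [SigmaFinite μ] {k : ℕ}

/-- Step kernels need disjoint sets: all the sides of all the boxes are cut into common cells, and
the products of sums of cell indicators are multiplied out. -/
lemma exists_stepKernel {T : Type*} [Fintype T] (A : T → Fin k → Set Z)
    (hA : ∀ t l, MeasurableSet (A t l)) (hμ : ∀ t l, μ (A t l) ≠ ∞) (c : T → ℝ) :
    ∃ s : StepKernel μ k, ∀ z, s.toFun z =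
      ∑ t, c t * ∏ l, (A t l).indicator (fun _ => (1 : ℝ)) (z l) := by
  classical
  let C := CellIndex (T × Fin k)
  let A' : T × Fin k → Set Z := fun x => A x.1 x.2
  let e : Fin (Fintype.card C) ≃ C := (Fintype.equivFin C).symm
  refine ⟨⟨Fintype.card C, fun j => cell A' (e j).1, fun j => measurableSet_cell (fun x => hA _ _) _,
    fun j => measure_cell_ne_top (fun x => hμ _ _) (e j).2, fun i j hij =>
      pairwise_disjoint_cell (e.injective.ne hij),
    fun α => ∑ t, c t * ∏ l, if (t, l) ∈ (e (α l)).1 then 1 else 0⟩, fun z => ?_⟩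
  rw [StepKernel.toFun]
  simp_rw [Finset.sum_mul]
  rw [Finset.sum_comm]
  refine Finset.sum_congr rfl fun t _ => ?_
  have h1 : ∀ l, (A t l).indicator (fun _ => (1 : ℝ)) (z l) = ∑ j : Fin (Fintype.card C),
      (if (t, l) ∈ (e j).1 then 1 else 0) * (cell A' (e j).1).indicator (fun _ => (1 : ℝ)) (z l) := by
    intro l
    rw [show A t l = A' (t, l) from rfl, indicator_eq_sum_cell A' (t, l), ← e.sum_comp]
    exact Finset.sum_congr rfl fun j _ => by split_ifs <;> simp
  simp_rw [h1]
  rw [Finset.prod_univ_sum, Fintype.piFinset_univ, Finset.mul_sum]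
  refine Finset.sum_congr rfl fun α _ => ?_
  rw [Finset.prod_mul_distrib]
  ring

lemma measurable_stepKernel_toFun (s : StepKernel μ k) : Measurable s.toFun :=
  Finset.measurable_sum _ fun _ _ => (Finset.measurable_prod _ fun _ _ =>
    (measurable_const.indicator (s.measurableSet _)).comp (measurable_pi_apply _)).const_mul _

lemma exists_stepKernel_add (s s' : StepKernel μ k) :
    ∃ u : StepKernel μ k, u.toFun = fun z => s.toFun z + s'.toFun z := by
  obtain ⟨u, hu⟩ := exists_stepKernel (μ := μ)
    (Sum.elim (fun α : Fin k → Fin s.r => fun l => s.B (α l))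
      (fun α : Fin k → Fin s'.r => fun l => s'.B (α l)))
    (by rintro (t | t) l; exacts [s.measurableSet _, s'.measurableSet _])
    (by rintro (t | t) l; exacts [s.finite _, s'.finite _]) (Sum.elim s.coeff s'.coeff)
  exact ⟨u, funext fun z => by rw [hu, Fintype.sum_sum_type]; rfl⟩

lemma exists_stepKernel_smul (c : ℝ) (s : StepKernel μ k) :
    ∃ u : StepKernel μ k, u.toFun = fun z => c * s.toFun z :=
  ⟨{ s with coeff := fun α => c * s.coeff α }, funext fun z => by
    simp [StepKernel.toFun, Finset.mul_sum, mul_assoc]⟩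

/-- Approximability by step kernels in `L²`. -/
def StepApprox (μ : Measure Z) (f : (Fin k → Z) → ℝ) : Prop :=
  AEStronglyMeasurable f (power μ k) ∧ ∀ ε : ℝ≥0∞, ε ≠ 0 →
    ∃ s : StepKernel μ k, eLpNorm (fun z => f z - s.toFun z) 2 (power μ k) ≤ ε

lemma eLpNorm_sub_le_add {α : Type*} [MeasurableSpace α] {ν : Measure α} {f g h : α → ℝ}
    (hf : AEStronglyMeasurable f ν) (hg : AEStronglyMeasurable g ν)
    (hh : AEStronglyMeasurable h ν) : eLpNorm (fun x => f x - h x) 2 ν ≤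
      eLpNorm (fun x => f x - g x) 2 ν + eLpNorm (fun x => g x - h x) 2 ν := by
  have h1 : (fun x => f x - h x) = (fun x => f x - g x) + fun x => g x - h x := by ext x; simp
  rw [h1]
  exact eLpNorm_add_le (hf.sub hg) (hg.sub hh) (by norm_num)

lemma StepApprox.of_approx {f : (Fin k → Z) → ℝ} (hf : AEStronglyMeasurable f (power μ k))
    (h : ∀ ε : ℝ≥0∞, ε ≠ 0 → ∃ g, StepApprox μ g ∧
      eLpNorm (fun z => f z - g z) 2 (power μ k) ≤ ε) : StepApprox μ f := by
  refine ⟨hf, fun ε hε => ?_⟩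
  obtain ⟨g, hg, h1⟩ := h (ε / 2) (ENNReal.half_pos hε).ne'
  obtain ⟨s, hs⟩ := hg.2 (ε / 2) (ENNReal.half_pos hε).ne'
  refine ⟨s, (eLpNorm_sub_le_add hf hg.1
    (measurable_stepKernel_toFun s).aestronglyMeasurable).trans ?_⟩
  exact (add_le_add h1 hs).trans (ENNReal.add_halves ε).le

lemma StepApprox.of_tendsto {f : (Fin k → Z) → ℝ} (hf : AEStronglyMeasurable f (power μ k))
    {g : ℕ → (Fin k → Z) → ℝ} (hg : ∀ n, StepApprox μ (g n))
    (h : Tendsto (fun n => eLpNorm (fun z => g n z - f z) 2 (power μ k)) atTop (𝓝 0)) :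
    StepApprox μ f := by
  refine StepApprox.of_approx hf fun ε hε => ?_
  obtain ⟨n, hn⟩ := ((tendsto_order.1 h).2 ε (pos_iff_ne_zero.2 hε)).exists
  refine ⟨g n, hg n, ?_⟩
  rw [eLpNorm_fun_sub_comm]
  exact hn.le

lemma StepApprox.of_eq {f : (Fin k → Z) → ℝ} {s : StepKernel μ k} (h : s.toFun = f) :
    StepApprox μ f :=
  ⟨h ▸ (measurable_stepKernel_toFun s).aestronglyMeasurable, fun ε _ => ⟨s, by simp [h]⟩⟩

lemma StepApprox.add {f g : (Fin k → Z) → ℝ} (hf : StepApprox μ f) (hg : StepApprox μ g) :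
    StepApprox μ fun z => f z + g z := by
  refine ⟨hf.1.add hg.1, fun ε hε => ?_⟩
  obtain ⟨s, hs⟩ := hf.2 (ε / 2) (ENNReal.half_pos hε).ne'
  obtain ⟨s', hs'⟩ := hg.2 (ε / 2) (ENNReal.half_pos hε).ne'
  obtain ⟨u, hu⟩ := exists_stepKernel_add s s'
  refine ⟨u, ?_⟩
  have h1 : (fun z => f z + g z - u.toFun z) =
      (fun z => f z - s.toFun z) + fun z => g z - s'.toFun z := by
    ext z; simp [hu]; ring
  rw [h1]
  refine (eLpNorm_add_le (hf.1.sub (measurable_stepKernel_toFun s).aestronglyMeasurable)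
    (hg.1.sub (measurable_stepKernel_toFun s').aestronglyMeasurable) (by norm_num)).trans ?_
  exact (add_le_add hs hs').trans (ENNReal.add_halves ε).le

lemma StepApprox.neg {f : (Fin k → Z) → ℝ} (hf : StepApprox μ f) : StepApprox μ fun z => -f z := by
  refine ⟨hf.1.neg, fun ε hε => ?_⟩
  obtain ⟨s, hs⟩ := hf.2 ε hε
  obtain ⟨u, hu⟩ := exists_stepKernel_smul (-1) s
  refine ⟨u, ?_⟩
  have h1 : (fun z => -f z - u.toFun z) = -fun z => f z - s.toFun z := by
    ext z; simp [hu]; ring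
  rwa [h1, eLpNorm_neg]

lemma stepApprox_pi (A : Fin k → Set Z) (hA : ∀ l, MeasurableSet (A l)) (hμ : ∀ l, μ (A l) ≠ ∞)
    (c : ℝ) : StepApprox μ ((Set.univ.pi A).indicator fun _ => c) := by
  obtain ⟨s, hs⟩ := exists_stepKernel (μ := μ) (fun _ : Unit => A) (fun _ => hA) (fun _ => hμ)
    (fun _ => c)
  refine StepApprox.of_eq (s := s) (funext fun z => ?_)
  rw [hs]
  by_cases hz : z ∈ Set.univ.pi A
  · rw [Set.indicator_of_mem hz]
    simp [fun l => Set.indicator_of_mem (hz l trivial) (fun _ => (1 : ℝ))]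
  · rw [Set.indicator_of_notMem hz]
    simp only [Set.mem_univ_pi, not_forall] at hz
    obtain ⟨l, hl⟩ := hz
    have h0 : ∏ l, (A l).indicator (fun _ => (1 : ℝ)) (z l) = 0 :=
      Finset.prod_eq_zero (Finset.mem_univ l) (by simp [hl])
    simp [h0]

/-- A π-λ argument inside the box `B^k`, whose finite measure makes complements and countable
disjoint unions stay in `L²`. -/
lemma stepApprox_inter_pi {B : Set Z} (hB : MeasurableSet B) (hμ : μ B ≠ ∞) (c : ℝ)
    {S : Set (Fin k → Z)} (hS : MeasurableSet S) :
    StepApprox μ ((S ∩ Set.univ.pi fun _ => B).indicator fun _ => c) := by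
  have hBk : MeasurableSet (Set.univ.pi fun _ : Fin k => B) := MeasurableSet.univ_pi fun _ => hB
  have hL : MemLp ((Set.univ.pi fun _ : Fin k => B).indicator fun _ => |c|) 2 (power μ k) := by
    refine memLp_indicator_const 2 hBk _ (Or.inr ?_)
    rw [Measure.pi_pi]
    exact ENNReal.prod_ne_top fun _ _ => hμ
  refine MeasurableSpace.induction_on_inter (C := fun S _ =>
    StepApprox μ ((S ∩ Set.univ.pi fun _ => B).indicator fun _ => c)) generateFrom_pi.symm
    isPiSystem_pi ?_ ?_ ?_ ?_ S hS
  · simp only [Set.empty_inter, Set.indicator_empty]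
    exact StepApprox.of_eq (s := ⟨0, Fin.elim0, fun j => j.elim0, fun j => j.elim0,
      fun j => j.elim0, fun _ => 0⟩) (by ext; simp [StepKernel.toFun])
  · rintro _ ⟨A, hA, rfl⟩
    rw [← Set.pi_inter_distrib]
    refine stepApprox_pi _ (fun l => (hA l trivial).inter hB) (fun l => ?_) c
    exact measure_ne_top_of_subset Set.inter_subset_right hμ
  · intro S hS ih
    have h := (stepApprox_pi (fun _ : Fin k => B) (fun _ => hB) (fun _ => hμ) c).add ih.neg
    convert h using 2 with z
    by_cases h1 : z ∈ S <;> by_cases h2 : z ∈ Set.univ.pi fun _ : Fin k => B <;>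
      simp [Set.indicator, h1, h2]
  · intro S hd hS ih
    have h1 : ∀ n, StepApprox μ fun z => ∑ i ∈ Finset.range n,
        (S i ∩ Set.univ.pi fun _ => B).indicator (fun _ => c) z := fun n => by
      induction n with
      | zero =>
        exact StepApprox.of_eq (s := ⟨0, Fin.elim0, fun j => j.elim0, fun j => j.elim0,
          fun j => j.elim0, fun _ => 0⟩) (by ext; simp [StepKernel.toFun])
      | succ n ihn =>
        simp_rw [Finset.sum_range_succ]
        exact ihn.add (ih n)
    have h2 : ∀ n z, ∑ i ∈ Finset.range n, (S i ∩ Set.univ.pi fun _ => B).indicator (fun _ => c) z =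
        ((⋃ i ∈ Finset.range n, S i) ∩ Set.univ.pi fun _ => B).indicator (fun _ => c) z :=
      fun n z => by
        rw [Set.iUnion₂_inter, Finset.indicator_biUnion_apply]
        exact fun i _ j _ hij => (hd hij).mono Set.inter_subset_left Set.inter_subset_left
    refine StepApprox.of_tendsto ?_ h1 (tendsto_eLpNorm_sub_of_dominated (fun n => (h1 n).1) ?_ hL
      (fun n => ae_of_all _ fun z => ?_) (ae_of_all _ fun z => ?_))
    · exact (measurable_const.indicator
        ((MeasurableSet.iUnion hS).inter hBk)).aestronglyMeasurable
    · exact (measurable_const.indicator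
        ((MeasurableSet.iUnion hS).inter hBk)).aestronglyMeasurable
    · rw [h2]
      by_cases h3 : z ∈ (⋃ i ∈ Finset.range n, S i) ∩ Set.univ.pi fun _ : Fin k => B
      · rw [Set.indicator_of_mem h3, Set.indicator_of_mem h3.2]
      · rw [Set.indicator_of_notMem h3, abs_zero]
        exact Set.indicator_nonneg (fun _ _ => abs_nonneg c) z
    · simp_rw [h2]
      refine tendsto_const_nhds.congr' ?_
      have h5 : ∀ T : Set (Fin k → Z), (T ∩ Set.univ.pi fun _ => B).indicator (fun _ => c) z =
          T.indicator (fun _ => (Set.univ.pi fun _ => B).indicator (fun _ => c) z) z := fun T => by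
        by_cases hT : z ∈ T <;> by_cases hb : z ∈ Set.univ.pi fun _ : Fin k => B <;>
          simp only [Set.indicator, Set.mem_inter_iff, hT, hb, and_self, and_false, false_and,
            if_true, if_false]
      by_cases h3 : z ∈ ⋃ i, S i
      · obtain ⟨i, hi⟩ := Set.mem_iUnion.1 h3
        filter_upwards [eventually_gt_atTop i] with n hn
        have h4 : z ∈ ⋃ i ∈ Finset.range n, S i :=
          Set.mem_biUnion (Finset.mem_coe.2 (Finset.mem_range.2 hn)) hi
        rw [h5, h5, Set.indicator_of_mem h3, Set.indicator_of_mem h4]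
      · refine Eventually.of_forall fun n => ?_
        have h4 : z ∉ ⋃ i ∈ Finset.range n, S i := fun h =>
          h3 (Set.iUnion₂_subset_iUnion _ _ h)
        beta_reduce
        rw [h5, h5, Set.indicator_of_notMem h3, Set.indicator_of_notMem h4]

lemma stepApprox_of_memLp {f : (Fin k → Z) → ℝ} (hf : MemLp f 2 (power μ k)) : StepApprox μ f := by
  suffices h : ∀ (c : ℝ) ⦃S : Set (Fin k → Z)⦄, MeasurableSet S → power μ k S < ∞ →
      ∀ {ε : ℝ≥0∞}, ε ≠ 0 → ∃ g : (Fin k → Z) → ℝ,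
        eLpNorm (g - S.indicator fun _ => c) 2 (power μ k) ≤ ε ∧ StepApprox μ g by
    refine StepApprox.of_approx hf.1 fun ε hε => ?_
    obtain ⟨g, hg, hgP⟩ := hf.induction_dense (by norm_num) (StepApprox μ) h
      (fun f g hf hg => hf.add hg) (fun f hf => hf.1) hε
    exact ⟨g, hgP, hg⟩
  intro c S hS hμS ε hε
  refine ⟨S.indicator fun _ => c, by simp, StepApprox.of_tendsto (g := fun N => (S ∩ Set.univ.pi fun _ =>
    spanningSets μ N).indicator fun _ => c) ?_ (fun N => stepApprox_inter_pi
      (measurableSet_spanningSets μ N) (measure_spanningSets_lt_top μ N).ne c hS) ?_⟩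
  · exact (measurable_const.indicator hS).aestronglyMeasurable
  refine tendsto_eLpNorm_sub_of_dominated (G := S.indicator fun _ => |c|) (fun N => ?_) ?_
    (memLp_indicator_const 2 hS _ (Or.inr hμS.ne)) (fun N => ae_of_all _ fun z => ?_)
    (ae_of_all _ fun z => ?_)
  · exact (measurable_const.indicator (hS.inter
      (MeasurableSet.univ_pi fun _ => measurableSet_spanningSets μ N))).aestronglyMeasurable
  · exact (measurable_const.indicator hS).aestronglyMeasurable
  · by_cases h1 : z ∈ S <;> by_cases h2 : z ∈ Set.univ.pi fun _ : Fin k => spanningSets μ N <;>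
      simp [Set.indicator, h1, h2]
  · refine tendsto_const_nhds.congr' ?_
    have : z ∈ ⋃ N, (Set.univ.pi fun _ : Fin k => spanningSets μ N) := by
      rw [iUnion_pi_spanningSets]; trivial
    obtain ⟨M, hM⟩ := Set.mem_iUnion.1 this
    filter_upwards [eventually_ge_atTop M] with N hN
    have h2 : z ∈ Set.univ.pi fun _ : Fin k => spanningSets μ N := fun l hl =>
      monotone_spanningSets μ hN (hM l hl)
    by_cases h1 : z ∈ S
    · rw [Set.indicator_of_mem h1, Set.indicator_of_mem (Set.mem_inter h1 h2)]
    · rw [Set.indicator_of_notMem h1, Set.indicator_of_notMem fun h => h1 h.1]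

lemma exists_seq_stepKernel {f : (Fin k → Z) → ℝ} (hf : MemLp f 2 (power μ k)) :
    ∃ s : ℕ → StepKernel μ k,
      Tendsto (fun n => eLpNorm (fun z => (s n).toFun z - f z) 2 (power μ k)) atTop (𝓝 0) := by
  have h := (stepApprox_of_memLp hf).2
  choose s hs using fun n : ℕ => h ((n + 1 : ℕ) : ℝ≥0∞)⁻¹ (by simp)
  refine ⟨s, tendsto_of_tendsto_of_tendsto_of_le_of_le tendsto_const_nhds
    ((tendsto_add_atTop_iff_nat 1).2 ENNReal.tendsto_inv_nat_nhds_zero) (fun _ => zero_le)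
    fun n => ?_⟩
  rw [eLpNorm_fun_sub_comm]
  exact hs n

end Density

end

/-! ### Multiple integrals as functionals with one kernel. -/

section

variable {Z : Type*} [MeasurableSpace Z] {μ : Measure Z} {Q : Measure (Measure Z)}

/-! ### Symmetrization of step kernels -/

namespace StepKernel

variable {k : ℕ} (s : StepKernel μ k)

/-- The symmetrized coefficients. -/
def symCoeff (α : Fin k → Fin s.r) : ℝ :=
  (k.factorial : ℝ)⁻¹ * ∑ p : Equiv.Perm (Fin k), s.coeff (α ∘ p)

lemma symCoeff_comp (α : Fin k → Fin s.r) (p : Equiv.Perm (Fin k)) :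
    s.symCoeff (α ∘ p) = s.symCoeff α := by
  rw [symCoeff, symCoeff, ← Equiv.sum_comp (Equiv.mulLeft p) (fun q : Equiv.Perm (Fin k) => s.coeff (α ∘ q))]
  rfl

open Classical in
/-- The symmetrization of a step kernel. -/
def toStep : Step μ where
  order := k
  r := s.r
  B := s.B
  measurableSet := s.measurableSet
  finite := s.finite
  disjoint := s.disjoint
  coeff m := if h : ∃ α : Fin k → Fin s.r, config α = m then s.symCoeff h.choose else 0

lemma toStep_coeff_config (α : Fin k → Fin s.r) : s.toStep.coeff (config α) = s.symCoeff α := by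
  have h : ∃ β : Fin k → Fin s.r, config β = config α := ⟨α, rfl⟩
  have h1 : s.toStep.coeff (config α) = s.symCoeff h.choose := dif_pos h
  obtain ⟨p, hp⟩ := exists_perm_of_config_eq h.choose_spec
  rw [h1, ← hp, symCoeff_comp]

/-- The Charlier product of a box depends only on the multiset of its sides, so averaging the
coefficients over permutations does not change the integral. -/
lemma toStep_value (χ : Measure Z) : s.toStep.value 1 χ = s.integral χ := by
  change ∑ α : Fin k → Fin s.r, s.toStep.coeff (config α) * s.toStep.charlierProd 1 (config α) χ = _
  simp_rw [toStep_coeff_config, symCoeff, mul_assoc, Finset.sum_mul]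
  rw [← Finset.mul_sum, Finset.sum_comm]
  have h1 : ∀ p : Equiv.Perm (Fin k), ∑ α : Fin k → Fin s.r,
      s.coeff (α ∘ p) * s.toStep.charlierProd 1 (config α) χ = s.integral χ := fun p => by
    rw [StepKernel.integral, ← (Equiv.arrowCongr p (Equiv.refl (Fin s.r))).sum_comp]
    refine Finset.sum_congr rfl fun α _ => ?_
    have h2 : (Equiv.arrowCongr p (Equiv.refl (Fin s.r))) α = α ∘ p.symm := rfl
    have h3 : (α ∘ p.symm) ∘ p = α := by ext; simp
    have h4 : s.toStep.charlierProd 1 (config (α ∘ p.symm)) χ = s.toStep.charlierProd 1 (config α) χ :=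
      congrArg (fun m => s.toStep.charlierProd 1 m χ) (config_comp_equiv p.symm α)
    rw [h2, h3]
    refine (congrArg (s.coeff α * ·) h4).trans (congrArg (s.coeff α * ·) ?_)
    refine Finset.prod_congr rfl fun j _ => ?_
    change Fin s.r at j
    have h5 := count_config α j
    change charlier (Multiset.count j (config α)) (1 * _) _ = _
    simp only [h5, one_mul]
    rfl
  simp_rw [h1]
  rw [Finset.sum_const, Finset.card_univ, Fintype.card_perm, Fintype.card_fin, nsmul_eq_mul,
    inv_mul_cancel_left₀ (by positivity)]

lemma toStep_toFun (z : Fin k → Z) : s.toStep.toFun z = sym s.toFun z := by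
  change ∑ α : Fin k → Fin s.r, s.toStep.coeff (config α) * ∏ l, s.toStep.ind (α l) (z l) = _
  simp_rw [toStep_coeff_config, symCoeff, mul_assoc, Finset.sum_mul]
  rw [← Finset.mul_sum, Finset.sum_comm, sym]
  congr 1
  refine Finset.sum_congr rfl fun p _ => ?_
  rw [StepKernel.toFun, ← (Equiv.arrowCongr p (Equiv.refl (Fin s.r))).sum_comp]
  refine Finset.sum_congr rfl fun α _ => ?_
  have h2 : (Equiv.arrowCongr p (Equiv.refl (Fin s.r))) α = α ∘ p.symm := rfl
  have h3 : (α ∘ p.symm) ∘ p = α := by ext; simp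
  rw [h2, h3, ← Equiv.prod_comp p]
  congr 1
  refine Finset.prod_congr rfl fun j _ => ?_
  simp [Step.ind, toStep]

end StepKernel

/-! ### Symmetrization in `L²` -/

section Sym

variable [SigmaFinite μ] {k : ℕ}

lemma memLp_comp_perm {f : (Fin k → Z) → ℝ} (hf : MemLp f 2 (power μ k))
    (p : Equiv.Perm (Fin k)) : MemLp (fun z => f (fun l => z (p l))) 2 (power μ k) :=
  hf.comp_measurePreserving (measurePreserving_comp_equiv p)

lemma memLp_sym {f : (Fin k → Z) → ℝ} (hf : MemLp f 2 (power μ k)) :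
    MemLp (sym f) 2 (power μ k) :=
  (memLp_finsetSum _ fun p _ => memLp_comp_perm hf p).const_mul _

lemma eLpNorm_sym_le {f : (Fin k → Z) → ℝ} (hf : AEStronglyMeasurable f (power μ k)) :
    eLpNorm (sym f) 2 (power μ k) ≤ eLpNorm f 2 (power μ k) := by
  have h1 : ∀ p : Equiv.Perm (Fin k), AEStronglyMeasurable (fun z : Fin k → Z => f fun l => z (p l))
      (power μ k) := fun p => hf.comp_measurePreserving (measurePreserving_comp_equiv p)
  have h2 : ∀ p : Equiv.Perm (Fin k), eLpNorm (fun z : Fin k → Z => f fun l => z (p l)) 2 (power μ k) =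
      eLpNorm f 2 (power μ k) := fun p =>
    eLpNorm_comp_measurePreserving hf (measurePreserving_comp_equiv p)
  have h3 : sym f = (k.factorial : ℝ)⁻¹ • ∑ p : Equiv.Perm (Fin k), fun z => f fun l => z (p l) := by
    ext z
    simp [sym]
  rw [h3, eLpNorm_const_smul]
  calc _ ≤ ‖(k.factorial : ℝ)⁻¹‖ₑ * ∑ _p : Equiv.Perm (Fin k), eLpNorm f 2 (power μ k) := by
        gcongr
        refine (eLpNorm_sum_le (fun p _ => h1 p) (by norm_num)).trans (le_of_eq ?_)
        exact Finset.sum_congr rfl fun p _ => h2 p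
    _ = _ := by
        rw [Finset.sum_const, Finset.card_univ, Fintype.card_perm, Fintype.card_fin, nsmul_eq_mul,
          ← mul_assoc, enorm_inv (by positivity)]
        have : ‖(k.factorial : ℝ)‖ₑ = k.factorial := by
          rw [← ofReal_norm, Real.norm_natCast, ENNReal.ofReal_natCast]
        rw [this, ENNReal.inv_mul_cancel (by simp [Nat.factorial_ne_zero]) (by simp), one_mul]

lemma sym_sub (f g : (Fin k → Z) → ℝ) (z : Fin k → Z) :
    sym (fun z => f z - g z) z = sym f z - sym g z := by
  simp [sym, Finset.sum_sub_distrib, mul_sub]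

lemma sym_eq_self {f : (Fin k → Z) → ℝ} (hf : ∀ (p : Equiv.Perm (Fin k)) z, f (fun l => z (p l)) = f z)
    (z : Fin k → Z) : sym f z = f z := by
  rw [sym, Finset.sum_congr rfl fun p _ => hf p z, Finset.sum_const, Finset.card_univ,
    Fintype.card_perm, Fintype.card_fin, nsmul_eq_mul, inv_mul_cancel_left₀ (by positivity)]

lemma IsAESymmetric.sym_ae_eq {f : (Fin k → Z) → ℝ} (hf : IsAESymmetric μ f) :
    sym f =ᵐ[power μ k] f := by
  filter_upwards [ae_all_iff.2 hf] with z hz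
  rw [sym, Finset.sum_congr rfl fun p _ => hz p, Finset.sum_const, Finset.card_univ,
    Fintype.card_perm, Fintype.card_fin, nsmul_eq_mul, inv_mul_cancel_left₀ (by positivity)]

end Sym

/-! ### Limits of multiple integrals of step kernels -/

lemma eLpNorm_fock_of_card [SigmaFinite μ] {t : Multiset Z → ℝ} (ht : Measurable t) {k : ℕ}
    (hk : ∀ s, s.card ≠ k → t s = 0) : eLpNorm t 2 (fock μ) =
      ((k.factorial : ℝ≥0∞)⁻¹) ^ (1 / 2 : ℝ) * eLpNorm (fun z => t (config z)) 2 (power μ k) := by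
  have h3 : ∀ x : ℝ≥0∞, (x ^ 2) ^ (1 / 2 : ℝ) = x := fun x => by
    rw [← ENNReal.rpow_natCast, ← ENNReal.rpow_mul]; norm_num
  have h1 : eLpNorm t 2 (fock μ) ^ 2 =
      (k.factorial : ℝ≥0∞)⁻¹ * eLpNorm (fun z => t (config z)) 2 (power μ k) ^ 2 := by
    rw [← lintegral_enorm_sq_eq, ← lintegral_enorm_sq_eq, lintegral_fock (ht.enorm.pow_const 2),
      tsum_eq_single k]
    intro n hn
    have : ∀ z : Fin n → Z, t (config z) = 0 := fun z => hk _ (by simpa using hn)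
    simp [this]
  rw [← h3 (eLpNorm t 2 (fock μ)), h1, ENNReal.mul_rpow_of_nonneg _ _ (by norm_num), h3]

/-- `ψ` is in the chaos of order `k`, and its kernel is `t` (in the normalization where `t` is `k!`
times the integrand). -/
structure HasKernel (Q : Measure (Measure Z)) (μ : Measure Z) (k : ℕ) (t : Multiset Z → ℝ)
    (ψ : Measure Z → ℝ) : Prop where
  measurable : Measurable ψ
  memLp : MemLp ψ 2 Q
  measurable_kernel : Measurable t
  eq_zero : ∀ s, s.card ≠ k → t s = 0
  meanCosts_eq : ∀ᵐ s ∂(fock μ), meanCosts Q ψ s = t s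

namespace Step

variable [SigmaFinite μ]

lemma memLp_value (s : Step μ) (hQ : IsPoissonLaw Q μ) (c : ℝ) : MemLp (s.value c) 2 Q :=
  (s.tame_value hQ c).memLp hQ

/-- The two kernels may use different families of sets. Comparing the integrals through their mean
costs in the Fock space avoids a common refinement. -/
lemma eLpNorm_value_sub (s s' : Step μ) (hQ : IsPoissonLaw Q μ) {k : ℕ} (h : s.order = k)
    (h' : s'.order = k) : eLpNorm (fun χ => s.value 1 χ - s'.value 1 χ) 2 Q =
      ((k.factorial : ℝ≥0∞)⁻¹) ^ (1 / 2 : ℝ) * ‖(k.factorial : ℝ)‖ₑ *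
        eLpNorm (fun z => s.toFun z - s'.toFun z) 2 (power μ k) := by
  have := hQ.prob
  have h1 : meanCosts Q (fun χ => s.value 1 χ - s'.value 1 χ) =ᵐ[fock μ]
      fun w => s.kernel w - s'.kernel w := by
    rw [EventuallyEq, ae_fock_iff]
    · intro n
      filter_upwards [ae_meanCosts_sub hQ (s.measurable_value 1) (s'.measurable_value 1)
        (s.memLp_value hQ 1) (s'.memLp_value hQ 1) n] with z hz
      rw [hz, s.meanCosts_value hQ, s'.meanCosts_value hQ]
    · exact measurableSet_eq_fun (kernelMeasurable_meanCosts ((s.measurable_value 1).sub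
        (s'.measurable_value 1))).measurable (s.measurable_kernel.sub s'.measurable_kernel)
  have e := eLpNorm_meanCosts hQ (φ := fun χ => s.value 1 χ - s'.value 1 χ)
    ((s.measurable_value 1).sub (s'.measurable_value 1))
    ((s.memLp_value hQ 1).sub (s'.memLp_value hQ 1))
  rw [← e, eLpNorm_congr_ae h1, eLpNorm_fock_of_card (t := fun w => s.kernel w - s'.kernel w)
    (s.measurable_kernel.sub s'.measurable_kernel) (k := k) fun w hw => by
      rw [s.kernel_eq_zero (by rwa [h]), s'.kernel_eq_zero (by rwa [h']), sub_zero]]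
  simp_rw [s.kernel_config h, s'.kernel_config h', ← mul_sub]
  rw [mul_assoc]
  congr 1
  exact eLpNorm_const_smul (k.factorial : ℝ) (fun z => s.toFun z - s'.toFun z) 2 (power μ k)

/-- Multiple integrals of step kernels which converge in `L²` converge. -/
theorem exists_limit (hQ : IsPoissonLaw Q μ) {k : ℕ} (s : ℕ → Step μ) (hs : ∀ n, (s n).order = k)
    {f : (Fin k → Z) → ℝ} (hf : MemLp f 2 (power μ k))
    (h : Tendsto (fun n => eLpNorm (fun z => (s n).toFun z - f z) 2 (power μ k)) atTop (𝓝 0)) :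
    ∃ ψ, Measurable ψ ∧ MemLp ψ 2 Q ∧
      Tendsto (fun n => eLpNorm (fun χ => (s n).value 1 χ - ψ χ) 2 Q) atTop (𝓝 0) ∧
      (∀ᵐ z ∂(power μ k), meanCosts Q ψ (config z) = k.factorial * f z) ∧
      ∀ n, n ≠ k → ∀ᵐ z ∂(power μ n), meanCosts Q ψ (config z) = 0 := by
  have := hQ.prob
  have h1 := tendsto_eLpNorm_sub_pair (fun n => ((s n).measurable_toFun k).aestronglyMeasurable) hf.1 h
  have h2 : Tendsto (fun p : ℕ × ℕ => eLpNorm (fun χ => (s p.1).value 1 χ - (s p.2).value 1 χ) 2 Q)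
      atTop (𝓝 0) := by
    simp_rw [fun p : ℕ × ℕ => (s p.1).eLpNorm_value_sub (s p.2) hQ (hs p.1) (hs p.2)]
    have := ENNReal.Tendsto.const_mul (a := ((k.factorial : ℝ≥0∞)⁻¹) ^ (1 / 2 : ℝ) *
      ‖(k.factorial : ℝ)‖ₑ) h1 (Or.inr ?_)
    · simpa using this
    · refine ENNReal.mul_ne_top (ENNReal.rpow_ne_top_of_nonneg (by norm_num) ?_) (by simp)
      exact ENNReal.inv_ne_top.2 (by simp [Nat.factorial_ne_zero])
  obtain ⟨ψ, hψ, hψ2, hlim⟩ := exists_limit_of_cauchy (fun n => (s n).memLp_value hQ 1) h2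
  refine ⟨ψ, hψ, hψ2, hlim, ?_⟩
  -- The isometry transports the convergence of the integrals to each order `n`, where the mean
  -- costs of the limit are then identified by uniqueness of limits in measure.
  have h3 : ∀ n, Tendsto (fun j => eLpNorm (fun z : Fin n → Z => (s j).kernel (config z) -
      meanCosts Q ψ (config z)) 2 (power μ n)) atTop (𝓝 0) := fun n => by
    have hm : ∀ j, Measurable (meanCosts Q fun χ => (s j).value 1 χ - ψ χ) := fun j =>
      (kernelMeasurable_meanCosts (((s j).measurable_value 1).sub hψ)).measurable
    have h4 : ∀ j, eLpNorm (fun z : Fin n → Z => (s j).kernel (config z) -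
        meanCosts Q ψ (config z)) 2 (power μ n) ≤
        (n.factorial : ℝ≥0∞) ^ (1 / 2 : ℝ) * eLpNorm (fun χ => (s j).value 1 χ - ψ χ) 2 Q := fun j => by
      have e := eLpNorm_meanCosts hQ (φ := fun χ => (s j).value 1 χ - ψ χ)
        (((s j).measurable_value 1).sub hψ) (((s j).memLp_value hQ 1).sub hψ2)
      rw [← e]
      refine le_trans (le_of_eq (eLpNorm_congr_ae ?_)) (eLpNorm_config_le (hm j) n)
      filter_upwards [ae_meanCosts_sub hQ ((s j).measurable_value 1) hψ ((s j).memLp_value hQ 1)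
        hψ2 n] with z hz
      rw [hz, (s j).meanCosts_value hQ]
    have h5 := ENNReal.Tendsto.const_mul (a := (n.factorial : ℝ≥0∞) ^ (1 / 2 : ℝ)) hlim
      (Or.inr (by finiteness))
    rw [mul_zero] at h5
    exact tendsto_of_tendsto_of_tendsto_of_le_of_le tendsto_const_nhds h5 (fun _ => zero_le) h4
  have hTm : ∀ n, Measurable fun z : Fin n → Z => meanCosts Q ψ (config z) := fun n =>
    kernelMeasurable_meanCosts hψ n
  have hunique : ∀ n (g : (Fin n → Z) → ℝ), AEStronglyMeasurable g (power μ n) →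
      Tendsto (fun j => eLpNorm (fun z : Fin n → Z => (s j).kernel (config z) - g z) 2 (power μ n))
        atTop (𝓝 0) → (fun z => meanCosts Q ψ (config z)) =ᵐ[power μ n] g := fun n g hg hlim' => by
    have hk : ∀ j, AEStronglyMeasurable (fun z : Fin n → Z => (s j).kernel (config z)) (power μ n) :=
      fun j => ((s j).measurable_kernel.comp (measurable_config n)).aestronglyMeasurable
    exact tendstoInMeasure_ae_unique
      (tendstoInMeasure_of_tendsto_eLpNorm (by norm_num) hk (hTm n).aestronglyMeasurable (h3 n))
      (tendstoInMeasure_of_tendsto_eLpNorm (by norm_num) hk hg hlim')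
  constructor
  · refine hunique k _ (hf.1.const_mul _) ?_
    have h6 := ENNReal.Tendsto.const_mul (a := ‖(k.factorial : ℝ)‖ₑ) h (Or.inr (by simp))
    rw [mul_zero] at h6
    refine h6.congr fun j => ?_
    simp_rw [(s j).kernel_config (hs j), ← mul_sub]
    exact (eLpNorm_const_smul (k.factorial : ℝ) (fun z => (s j).toFun z - f z) 2 (power μ k)).symm
  · intro n hn
    refine hunique n (fun _ => 0) aestronglyMeasurable_const ?_
    refine tendsto_const_nhds.congr fun j => ?_
    have : ∀ z : Fin n → Z, (s j).kernel (config z) = 0 := fun z =>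
      (s j).kernel_eq_zero (by rw [hs j]; simpa using hn)
    simp [this]

end Step

/-- The kernel obtained from the mean add-one costs. -/
lemma exists_hasKernel [SigmaFinite μ] (hQ : IsPoissonLaw Q μ) {k : ℕ} {ψ : Measure Z → ℝ}
    (hψ : Measurable ψ) (h2 : MemLp ψ 2 Q)
    (h : ∀ n, n ≠ k → ∀ᵐ z ∂(power μ n), meanCosts Q ψ (config z) = 0) :
    HasKernel Q μ k (fun s => if s.card = k then meanCosts Q ψ s else 0) ψ := by
  have := hQ.prob
  have hT := (kernelMeasurable_meanCosts (Q := Q) hψ)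
  have hm : Measurable fun s : Multiset Z => if s.card = k then meanCosts Q ψ s else 0 := by
    rw [measurable_iff_kernelMeasurable]
    intro n
    by_cases hn : n = k
    · have h1 : ∀ z : Fin n → Z, (config z).card = k := fun z => by simpa using hn
      simpa only [h1, if_true] using hT n
    · simp [hn]
  refine ⟨hψ, h2, hm, fun s hs => if_neg hs, ?_⟩
  rw [ae_fock_iff (measurableSet_eq_fun hT.measurable hm)]
  intro n
  by_cases hn : n = k
  · simp [hn]
  · filter_upwards [h n hn] with z hz
    simp [hz]

/-! ### Multiple Wiener–Itô integrals -/

variable {Ω : Type*} [MeasurableSpace Ω] {P : Measure Ω} {η : Ω → Measure Z}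

lemma tendsto_sym [SigmaFinite μ] {k : ℕ} {f : (Fin k → Z) → ℝ} (hf : MemLp f 2 (power μ k))
    {s : ℕ → StepKernel μ k}
    (h : Tendsto (fun n => eLpNorm (fun z => (s n).toFun z - f z) 2 (power μ k)) atTop (𝓝 0)) :
    Tendsto (fun n => eLpNorm (fun z => (s n).toStep.toFun z - sym f z) 2 (power μ k))
      atTop (𝓝 0) := by
  refine tendsto_of_tendsto_of_tendsto_of_le_of_le tendsto_const_nhds h (fun _ => zero_le) fun n => ?_
  simp_rw [StepKernel.toStep_toFun, ← sym_sub]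
  exact eLpNorm_sym_le ((measurable_stepKernel_toFun (s n)).aestronglyMeasurable.sub hf.1)

lemma exists_isMultipleIntegral [SigmaFinite μ] [IsProbabilityMeasure P]
    (hη : IsPoissonRandomMeasure η μ P) {k : ℕ} {f : (Fin k → Z) → ℝ}
    (hf : MemLp f 2 (power μ k)) : ∃ F, IsMultipleIntegral η μ P f F := by
  obtain ⟨s, hs⟩ := exists_seq_stepKernel hf
  obtain ⟨ψ, hψ, hψ2, hlim, -, -⟩ := Step.exists_limit hη.isPoissonLaw (fun n => (s n).toStep)
    (fun _ => rfl) (memLp_sym hf) (tendsto_sym hf hs)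
  refine ⟨fun ω => ψ (η ω), hψ2.comp_measurePreserving ⟨hη.measurable, rfl⟩, s, hs, ?_⟩
  refine hlim.congr fun n => ?_
  simp_rw [StepKernel.toStep_value]
  exact (eLpNorm_comp_measurePreserving (ν := P.map η) (g := fun χ => (s n).integral χ - ψ χ)
    (by
      simp_rw [← StepKernel.toStep_value]
      exact (((s n).toStep.measurable_value 1).sub hψ).aestronglyMeasurable)
    ⟨hη.measurable, rfl⟩).symm

lemma isMultipleIntegral_multipleIntegral [SigmaFinite μ] [IsProbabilityMeasure P]
    (hη : IsPoissonRandomMeasure η μ P) {k : ℕ} {f : (Fin k → Z) → ℝ}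
    (hf : MemLp f 2 (power μ k)) : IsMultipleIntegral η μ P f (multipleIntegral η μ P f) :=
  Classical.epsilon_spec (exists_isMultipleIntegral hη hf)

/-- A multiple integral is a functional of the Poisson measure with only one non-zero kernel. -/
theorem IsMultipleIntegral.exists_hasKernel [SigmaFinite μ] [IsProbabilityMeasure P]
    (hη : IsPoissonRandomMeasure η μ P) {k : ℕ} {f : (Fin k → Z) → ℝ}
    (hf : MemLp f 2 (power μ k)) {F : Ω → ℝ} (hF : IsMultipleIntegral η μ P f F) :
    ∃ t ψ, HasKernel (P.map η) μ k t ψ ∧ F =ᵐ[P] (fun ω => ψ (η ω)) ∧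
      ∀ᵐ z ∂(power μ k), t (config z) = k.factorial * sym f z := by
  obtain ⟨hF2, s, hs, hlimF⟩ := hF
  obtain ⟨ψ, hψ, hψ2, hlim, hk, h0⟩ := Step.exists_limit hη.isPoissonLaw (fun n => (s n).toStep)
    (fun _ => rfl) (memLp_sym hf) (tendsto_sym hf hs)
  refine ⟨_, ψ, PoissonChaos.exists_hasKernel hη.isPoissonLaw hψ hψ2 h0, ?_, ?_⟩
  · have hm : ∀ n, Measurable (s n).integral := fun n => by
      rw [← funext (s n).toStep_value]
      exact (s n).toStep.measurable_value 1
    have h1 : ∀ n, AEStronglyMeasurable (fun ω => (s n).integral (η ω)) P := fun n =>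
      ((hm n).comp hη.measurable).aestronglyMeasurable
    have h2 : Tendsto (fun n => eLpNorm (fun ω => (s n).integral (η ω) - ψ (η ω)) 2 P) atTop
        (𝓝 0) := by
      refine hlim.congr fun n => ?_
      simp_rw [StepKernel.toStep_value]
      exact (eLpNorm_comp_measurePreserving (ν := P.map η) (g := fun χ => (s n).integral χ - ψ χ)
        ((hm n).sub hψ).aestronglyMeasurable ⟨hη.measurable, rfl⟩).symm
    exact tendstoInMeasure_ae_unique
      (tendstoInMeasure_of_tendsto_eLpNorm (by norm_num) h1 hF2.1 hlimF)
      (tendstoInMeasure_of_tendsto_eLpNorm (by norm_num) h1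
        (hψ.comp hη.measurable).aestronglyMeasurable h2)
  · filter_upwards [hk] with z hz
    simp [hz]

end

/-! ### Add-one costs of elements of a chaos, and the descent in the order. -/

section

variable {Z : Type*} [MeasurableSpace Z] {μ : Measure Z} {Q : Measure (Measure Z)}

/-! ### Concatenation of configurations -/

lemma config_sumElim {Y : Type*} {d n : ℕ} (z : Fin d → Y) (w : Fin n → Y) :
    config (Sum.elim z w ∘ finSumFinEquiv.symm) = config z + config w := by
  have h := Equiv.sum_comp finSumFinEquiv.symm fun l => ({Sum.elim z w l} : Multiset Y)
  rw [Fintype.sum_sum_type] at h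
  exact h

lemma ae_ae_of_ae_sum [SigmaFinite μ] {α β : Type*} [Fintype α] [Fintype β]
    {p : (α ⊕ β → Z) → Prop} (h : ∀ᵐ v ∂(Measure.pi fun _ : α ⊕ β => μ), p v) :
    ∀ᵐ z ∂(Measure.pi fun _ : α => μ), ∀ᵐ w ∂(Measure.pi fun _ : β => μ), p (Sum.elim z w) := by
  have h1 := (measurePreserving_sumPiEquivProdPi_symm
    (fun _ : α ⊕ β => μ)).quasiMeasurePreserving.ae h
  filter_upwards [Measure.ae_ae_of_ae_prod h1] with z hz
  filter_upwards [hz] with w hw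
  convert hw using 1
  ext l
  cases l <;> rfl

lemma ae_config_add [SigmaFinite μ] {p : Multiset Z → Prop} (h : ∀ᵐ s ∂(fock μ), p s) (d : ℕ) :
    ∀ᵐ z ∂(power μ d), ∀ n, ∀ᵐ w ∂(power μ n), p (config z + config w) := by
  refine ae_all_iff.2 fun n => ?_
  have h1 := (measurePreserving_comp_equiv (μ := μ)
    (finSumFinEquiv (m := d) (n := n)).symm).quasiMeasurePreserving.ae (ae_config_of_ae_fock h (d + n))
  filter_upwards [ae_ae_of_ae_sum h1] with z hz
  filter_upwards [hz] with w hw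
  rwa [config_sumElim] at hw

/-! ### Add-one costs of elements of a chaos -/

section Uniqueness

variable [SigmaFinite μ]

/-- Injectivity of the Fock space isometry. -/
lemma ae_eq_of_meanCosts (hQ : IsPoissonLaw Q μ) {φ ψ : Measure Z → ℝ} (hφ : Measurable φ)
    (hψ : Measurable ψ) (hφ2 : MemLp φ 2 Q) (hψ2 : MemLp ψ 2 Q)
    (h : ∀ n, ∀ᵐ z ∂(power μ n), meanCosts Q φ (config z) = meanCosts Q ψ (config z)) :
    φ =ᵐ[Q] ψ := by
  have := hQ.prob
  have h1 := eLpNorm_meanCosts hQ (hφ.sub hψ) (hφ2.sub hψ2)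
  have h2 : meanCosts Q (φ - ψ) =ᵐ[fock μ] 0 := by
    rw [EventuallyEq, ae_fock_iff]
    · intro n
      filter_upwards [h n, ae_meanCosts_sub hQ hφ hψ hφ2 hψ2 n] with z h1 h2
      rw [Pi.zero_apply, ← sub_eq_zero.2 h1, ← h2]
      rfl
    · exact measurableSet_eq_fun (kernelMeasurable_meanCosts (hφ.sub hψ)).measurable measurable_const
  rw [eLpNorm_congr_ae h2, eLpNorm_zero, eq_comm, eLpNorm_eq_zero_iff (hφ2.sub hψ2).1 (by norm_num)] at h1
  filter_upwards [h1] with χ hχ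
  exact sub_eq_zero.1 hχ

namespace HasKernel

variable {k : ℕ} {t : Multiset Z → ℝ} {ψ : Measure Z → ℝ}

lemma ae_config (h : HasKernel Q μ k t ψ) (n : ℕ) :
    ∀ᵐ z ∂(power μ n), meanCosts Q ψ (config z) = t (config z) :=
  ae_config_of_ae_fock h.meanCosts_eq n

lemma memLp_kernel (h : HasKernel Q μ k t ψ) (hQ : IsPoissonLaw Q μ) (n : ℕ) :
    MemLp (fun z => t (config z)) 2 (power μ n) := by
  have := hQ.prob
  have h1 : MemLp (fun z => meanCosts Q ψ (config z)) 2 (power μ n) := by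
    have hm := kernelMeasurable_meanCosts (Q := Q) h.measurable
    refine ⟨(hm n).aestronglyMeasurable, (eLpNorm_config_le hm.measurable n).trans_lt ?_⟩
    rw [eLpNorm_meanCosts hQ h.measurable h.memLp]
    exact ENNReal.mul_lt_top (by finiteness) h.memLp.2
  exact h1.ae_eq (h.ae_config n)

lemma ae_eq (h : HasKernel Q μ k t ψ) (hQ : IsPoissonLaw Q μ) {t' : Multiset Z → ℝ}
    {ψ' : Measure Z → ℝ} (h' : HasKernel Q μ k t' ψ')
    (ht : ∀ᵐ z ∂(power μ k), t (config z) = t' (config z)) : ψ =ᵐ[Q] ψ' := by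
  refine ae_eq_of_meanCosts hQ h.measurable h'.measurable h.memLp h'.memLp fun n => ?_
  by_cases hn : n = k
  · subst hn
    filter_upwards [h.ae_config n, h'.ae_config n, ht] with z h1 h2 h3
    rw [h1, h2, h3]
  · filter_upwards [h.ae_config n, h'.ae_config n] with z h1 h2
    rw [h1, h2, h.eq_zero _ (by simpa using hn), h'.eq_zero _ (by simpa using hn)]

/-- Step kernels which converge to the kernel of `ψ` have multiple integrals which converge to
`ψ`. -/
lemma tendsto_value (h : HasKernel Q μ k t ψ) (hQ : IsPoissonLaw Q μ) {s : ℕ → Step μ}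
    (hs : ∀ n, (s n).order = k) (hlim : Tendsto (fun n => eLpNorm (fun z => (s n).toFun z -
      (k.factorial : ℝ)⁻¹ * t (config z)) 2 (power μ k)) atTop (𝓝 0)) :
    Tendsto (fun n => eLpNorm (fun χ => (s n).value 1 χ - ψ χ) 2 Q) atTop (𝓝 0) := by
  obtain ⟨ψ', hψ', hψ2, hl, hk, hn⟩ := Step.exists_limit hQ s hs
    ((h.memLp_kernel hQ k).const_mul _) hlim
  have h' := exists_hasKernel hQ hψ' hψ2 hn
  have h1 : ψ =ᵐ[Q] ψ' := by
    refine h.ae_eq hQ h' ?_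
    filter_upwards [hk] with z hz
    rw [if_pos (by simp), hz, mul_inv_cancel_left₀ (by positivity)]
  refine hl.congr fun n => eLpNorm_congr_ae ?_
  filter_upwards [h1] with χ hχ
  rw [hχ]

lemma exists_seq_step (h : HasKernel Q μ k t ψ) (hQ : IsPoissonLaw Q μ) :
    ∃ s : ℕ → Step μ, (∀ n, (s n).order = k) ∧
      Tendsto (fun n => eLpNorm (fun z => (s n).toFun z - (k.factorial : ℝ)⁻¹ * t (config z)) 2
        (power μ k)) atTop (𝓝 0) := by
  have hf := (h.memLp_kernel hQ k).const_mul (k.factorial : ℝ)⁻¹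
  obtain ⟨s, hs⟩ := exists_seq_stepKernel hf
  refine ⟨fun n => (s n).toStep, fun _ => rfl, ?_⟩
  have h2 := sym_eq_self (f := fun z : Fin k → Z => (k.factorial : ℝ)⁻¹ * t (config z)) fun p z => by
    rw [show (fun l => z (p l)) = z ∘ p from rfl, config_comp_equiv]
  exact (tendsto_sym hf hs).congr fun n => by simp only [h2]

end HasKernel

lemma Step.addCosts_value_of_lt (s : Step μ) (c : ℝ) {χ : Measure Z} (h : s.Finite χ)
    {w : Multiset Z} (hw : s.order < w.card) : addCosts w (s.value c) χ = 0 := by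
  induction w using Multiset.induction_on generalizing s with
  | empty => simp at hw
  | cons z w ih =>
    rw [s.addCosts_value_cons c h]
    by_cases h0 : w = 0
    · subst h0
      have h1 : s.order = 0 := by simpa using hw
      rw [addCosts_zero, value_of_order_eq_zero _ (by simp [Step.deriv, h1])]
      simp [Step.deriv, h1]
    · refine ih (s.deriv z) h ?_
      have := Multiset.card_pos.2 h0
      rw [Multiset.card_cons] at hw
      simp only [Step.deriv]
      omega

/-- For step integrals of order `k`, more than `k` costs give zero; the local `L¹` bound passes this
to the limit. -/
lemma HasKernel.addCosts_ae_eq_zero {k : ℕ} {t : Multiset Z → ℝ} {ψ : Measure Z → ℝ}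
    (h : HasKernel Q μ k t ψ) (hQ : IsPoissonLaw Q μ) {d : ℕ} (hd : k < d) :
    ∀ᵐ z ∂(power μ d), addCosts (config z) ψ =ᵐ[Q] 0 := by
  have := hQ.prob
  obtain ⟨s, hs, hlim⟩ := h.exists_seq_step hQ
  have hv := h.tendsto_value hQ hs hlim
  refine ae_power_of_forall_restrict fun N => ?_
  have hB := measurableSet_spanningSets μ N
  have hμ := (measure_spanningSets_lt_top μ N).ne
  have h0 : ∫⁻ z, ∫⁻ χ, ‖addCosts (config z) ψ χ‖ₑ ∂Q
      ∂(power (μ.restrict (spanningSets μ N)) d) ≤ 0 := by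
    have h1 := ENNReal.Tendsto.mul_const hv
      (Or.inr (localConst_lt_top hQ hB hμ d).ne)
    rw [zero_mul] at h1
    refine ge_of_tendsto' h1 fun n => ?_
    refine le_trans (le_of_eq ?_) (lintegral_addCosts_le_eLpNorm hQ hB hμ d
      (((s n).measurable_value 1).sub h.measurable))
    refine lintegral_congr fun z => lintegral_congr_ae ?_
    filter_upwards [(s n).ae_ne_top hQ] with χ hχ
    have h2 := addCosts_sub ((s n).value 1) ψ (config z) χ
    rw [(s n).addCosts_value_of_lt 1 hχ (by simpa [hs n] using hd), zero_sub] at h2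
    rw [h2, enorm_neg]
  rw [nonpos_iff_eq_zero, lintegral_eq_zero_iff
    (measurable_addCosts_config h.measurable d).enorm.lintegral_prod_right'] at h0
  filter_upwards [h0] with z hz
  rw [Pi.zero_apply, lintegral_eq_zero_iff (measurable_addCosts_right h.measurable _).enorm] at hz
  filter_upwards [hz] with χ hχ
  simpa using hχ

/-! ### Square-integrability of add-one costs -/

lemma measurable_lintegral_addCosts [SFinite Q] {φ : Measure Z → ℝ} (hφ : Measurable φ) (n : ℕ) :
    Measurable fun z : Fin n → Z => ∫⁻ χ, ‖addCosts (config z) φ χ‖ₑ ^ 2 ∂Q :=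
  ((measurable_addCosts_config hφ n).enorm.pow_const 2).lintegral_prod_right'

lemma lintegral_addCosts_succ [SFinite Q] {φ : Measure Z → ℝ} (hφ : Measurable φ) (d : ℕ) :
    ∫⁻ z, ∫⁻ χ, ‖addCosts (config z) φ χ‖ₑ ^ 2 ∂Q ∂(power μ (d + 1)) =
      ∫⁻ z, ∫⁻ y, ∫⁻ χ, ‖addOneCost y (addCosts (config z) φ) χ‖ₑ ^ 2 ∂Q ∂μ ∂(power μ d) := by
  rw [lintegral_power_succ μ d (measurable_lintegral_addCosts hφ _), lintegral_lintegral_swap]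
  · simp_rw [config_cons, addCosts_cons]
  · exact ((measurable_lintegral_addCosts (Q := Q) hφ (d + 1)).comp
      (measurePreserving_cons μ d).measurable).aemeasurable

/-- Descending induction on the order. If the costs of order `d + 1` are square-integrable, then for
almost every `z` the functional `D_z φ` of order `d` is in `L²` by `memLp_of_addOneCost`. The
Poincaré inequality then bounds its second moment by the square of its mean, integrable by
assumption, plus the contribution of order `d + 1`. -/
theorem lintegral_addCosts_ne_top (hQ : IsPoissonLaw Q μ) {φ : Measure Z → ℝ} (hφ : Measurable φ)
    {N : ℕ} (hN : ∫⁻ z, ∫⁻ χ, ‖addCosts (config z) φ χ‖ₑ ^ 2 ∂Q ∂(power μ N) ≠ ∞) {d : ℕ}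
    (hd : d ≤ N)
    (h : ∀ q, d ≤ q → q < N → MemLp (fun z => meanCosts Q φ (config z)) 2 (power μ q)) :
    ∫⁻ z, ∫⁻ χ, ‖addCosts (config z) φ χ‖ₑ ^ 2 ∂Q ∂(power μ d) ≠ ∞ := by
  have := hQ.prob
  induction hd using Nat.decreasingInduction with
  | self => exact hN
  | of_succ d hd ih =>
    have ih := ih fun q h1 h2 => h q (by omega) h2
    rw [lintegral_addCosts_succ hφ] at ih
    have hm : Measurable fun z : Fin d → Z =>
        ∫⁻ y, ∫⁻ χ, ‖addOneCost y (addCosts (config z) φ) χ‖ₑ ^ 2 ∂Q ∂μ := by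
      have h1 : Measurable fun p : (Fin d → Z) × Z =>
          ∫⁻ χ, ‖addCosts (p.2 ::ₘ config p.1) φ χ‖ₑ ^ 2 ∂Q := by
        have h2 := (measurable_lintegral_addCosts (Q := Q) hφ (d + 1)).comp
          ((measurePreserving_cons μ d).measurable.comp measurable_swap)
        simpa only [Function.comp_def, config_cons, Prod.fst_swap, Prod.snd_swap] using h2
      simpa only [addCosts_cons] using h1.lintegral_prod_right'
    have h1 : ∀ᵐ z ∂(power μ d), ∫⁻ χ, ‖addCosts (config z) φ χ‖ₑ ^ 2 ∂Q ≤
        ‖meanCosts Q φ (config z)‖ₑ ^ 2 +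
          ∫⁻ y, ∫⁻ χ, ‖addOneCost y (addCosts (config z) φ) χ‖ₑ ^ 2 ∂Q ∂μ := by
      filter_upwards [ae_lt_top hm ih] with z hz
      have hz' := measurable_addCosts_right hφ (config z)
      exact poincare_of_memLp hQ hz' (memLp_of_addOneCost hQ hz' hz.ne)
    refine ne_top_of_le_ne_top ?_ (lintegral_mono_ae h1)
    rw [lintegral_add_right _ hm]
    have h2 := h d le_rfl hd
    exact ENNReal.add_ne_top.2 ⟨((memLp_two_iff_lintegral h2.1).1 h2).ne, ih⟩

lemma ae_memLp_addCosts (hQ : IsPoissonLaw Q μ) {φ : Measure Z → ℝ} (hφ : Measurable φ) {d : ℕ}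
    (h : ∫⁻ z, ∫⁻ χ, ‖addCosts (config z) φ χ‖ₑ ^ 2 ∂Q ∂(power μ d) ≠ ∞) :
    ∀ᵐ z ∂(power μ d), MemLp (addCosts (config z) φ) 2 Q := by
  have := hQ.prob
  filter_upwards [ae_lt_top (measurable_lintegral_addCosts hφ d) h] with z hz
  exact (memLp_two_iff_lintegral (measurable_addCosts_right hφ _).aestronglyMeasurable).2 hz

/-- The add-one costs of an element of a chaos. -/
theorem HasKernel.addCosts {k : ℕ} {t : Multiset Z → ℝ} {ψ : Measure Z → ℝ}
    (h : HasKernel Q μ k t ψ) (hQ : IsPoissonLaw Q μ) (d : ℕ) : ∀ᵐ z ∂(power μ d),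
      HasKernel Q μ (k - d) (fun s => t (config z + s)) (addCosts (config z) ψ) := by
  have := hQ.prob
  have h1 : ∀ᵐ z ∂(power μ d), MemLp (PoissonChaos.addCosts (config z) ψ) 2 Q := by
    -- Beyond order `k` the costs vanish. Up to order `k`, the descent starts from order `k + 1`,
    -- where the second moments are zero, and the means are the kernel, which is in `L²`.
    rcases lt_or_ge k d with hd | hd
    · filter_upwards [h.addCosts_ae_eq_zero hQ hd] with z hz
      exact (memLp_congr_ae hz).2 (MemLp.zero (ε := ℝ))
    · refine ae_memLp_addCosts hQ h.measurable (lintegral_addCosts_ne_top hQ h.measurable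
        (N := k + 1) ?_ (by omega) fun q _ _ => (h.memLp_kernel hQ q).ae_eq ?_)
      · rw [lintegral_congr_ae (g := fun _ => 0)]
        · simp
        · filter_upwards [h.addCosts_ae_eq_zero hQ (Nat.lt_succ_self k)] with z hz
          rw [lintegral_congr_ae (g := fun _ => 0)]
          · simp
          · filter_upwards [hz] with χ hχ
            simp [hχ]
      · filter_upwards [h.ae_config q] with z hz using hz.symm
  filter_upwards [h1, ae_config_add h.meanCosts_eq d] with z hz hz'
  have hm := measurable_addCosts_right h.measurable (config z)
  have ht : Measurable fun s => t (config z + s) :=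
    measurable_iff_kernelMeasurable.2
      ((measurable_iff_kernelMeasurable.1 h.measurable_kernel).add_left (config z))
  refine ⟨hm, hz, ht, fun s hs => h.eq_zero _ ?_, ?_⟩
  · rw [Multiset.card_add, card_config, Fintype.card_fin]
    omega
  · rw [ae_fock_iff (measurableSet_eq_fun (kernelMeasurable_meanCosts hm).measurable ht)]
    intro n
    filter_upwards [hz' n] with w hw
    rw [← hw, meanCosts, meanCosts, add_comm, addCosts_add]

lemma HasKernel.addCosts_ev {ι : Type*} [Fintype ι] [DecidableEq ι] {k : ℕ} {t : Multiset Z → ℝ}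
    {ψ : Measure Z → ℝ} (h : HasKernel Q μ k t ψ) (hQ : IsPoissonLaw Q μ) {q : ℕ}
    (W : Fin q → CellIndex ι) (i : ι) : ∀ᵐ z ∂(power μ q),
      HasKernel Q μ (k - (ev W z i).card) (fun s => t (ev W z i + s))
        (PoissonChaos.addCosts (ev W z i) ψ) := by
  obtain ⟨n, e, he, hw⟩ := exists_ev_eq (Y := Z) W i
  simp_rw [hw, card_config, Fintype.card_fin]
  exact (quasiMeasurePreserving_comp_injective he).ae (h.addCosts hQ n)

/-- An element of the chaos of order zero is constant. -/
lemma HasKernel.ae_eq_const {t : Multiset Z → ℝ} {ψ : Measure Z → ℝ} (h : HasKernel Q μ 0 t ψ)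
    (hQ : IsPoissonLaw Q μ) : ψ =ᵐ[Q] fun _ => t 0 := by
  have := hQ.prob
  have h0 : ∀ s : Multiset Z, s ≠ 0 → PoissonChaos.addCosts s (fun _ : Measure Z => t 0) = 0 := by
    intro s hs
    induction s using Multiset.induction_on with
    | empty => exact absurd rfl hs
    | cons z s ih =>
      rw [addCosts_cons]
      by_cases h1 : s = 0
      · subst h1
        ext χ
        simp [addOneCost]
      · rw [ih h1]
        ext χ
        simp [addOneCost]
  refine ae_eq_of_meanCosts hQ h.measurable measurable_const h.memLp (memLp_const _) fun n => ?_
  filter_upwards [h.ae_config n] with z hz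
  rw [hz]
  by_cases hn : n = 0
  · subst hn
    simp [config_empty, meanCosts]
  · rw [h.eq_zero _ (by simpa using hn), meanCosts, h0 _ (by
      rw [← Multiset.card_pos, card_config, Fintype.card_fin]; omega)]
    simp

end Uniqueness

end

/-! ### Uniform approximation of functionals with bounded kernels. -/

section

variable {Z : Type*} [MeasurableSpace Z] {μ : Measure Z} {Q : Measure (Measure Z)}

/-! ### Approximation by bounded kernels -/

lemma mem_config {Y : Type*} {n : ℕ} {z : Fin n → Y} {y : Y} : y ∈ config z ↔ ∃ l, z l = y := by
  simp [config, Multiset.mem_sum, eq_comm]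

lemma measurableSet_forall_mem {B : Set Z} (hB : MeasurableSet B) :
    MeasurableSet {w : Multiset Z | ∀ z ∈ w, z ∈ B} := by
  refine MeasurableSpace.measurableSet_iInf.2 fun n => ?_
  change MeasurableSet (config ⁻¹' {w : Multiset Z | ∀ z ∈ w, z ∈ B})
  have h : (config ⁻¹' {w : Multiset Z | ∀ z ∈ w, z ∈ B} : Set (Fin n → Z)) =
      Set.univ.pi fun _ => B := by
    ext z
    simp [mem_config]
  rw [h]
  exact MeasurableSet.univ_pi fun _ => hB

namespace NiceKernel

open Classical in
lemma indicator {B : Set Z} (hB : MeasurableSet B) (hμ : μ B ≠ ∞) {c : ℝ} (hc : 0 ≤ c) :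
    NiceKernel μ fun w => if ∀ z ∈ w, z ∈ B then c else 0 := by
  refine ⟨Measurable.ite (measurableSet_forall_mem hB) measurable_const measurable_const,
    B, hB, hμ, c, fun w => ?_⟩
  beta_reduce
  split_ifs with h
  · exact ⟨(abs_of_nonneg hc).le, fun _ => h⟩
  · simpa using hc

end NiceKernel

namespace Step

variable (s : Step μ)

lemma toFun_abs {n : ℕ} (z : Fin n → Z) : s.abs.toFun z = |s.toFun z| := by
  by_cases h : ∃ α : Fin n → Fin s.r, ∀ l, z l ∈ s.B (α l)
  · obtain ⟨α, hα⟩ := h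
    have h1 : s.abs.toFun z = s.abs.coeff (config α) := s.abs.toFun_eq_of_mem hα
    rw [h1, s.toFun_eq_of_mem hα]
    rfl
  · have h1 : ∃ l, ∀ j, z l ∉ s.B j := by
      by_contra! h'
      exact h ⟨fun l => (h' l).choose, fun l => (h' l).choose_spec⟩
    have h2 : s.abs.toFun z = 0 := s.abs.toFun_eq_zero h1
    rw [h2, s.toFun_eq_zero h1, abs_zero]

lemma kernel_abs (w : Multiset Z) : s.abs.kernel w = |s.kernel w| := by
  obtain ⟨n, z, rfl⟩ := exists_config_eq w
  by_cases hn : s.order = n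
  · rw [s.kernel_config hn, s.abs.kernel_config hn, toFun_abs, abs_mul, Nat.abs_cast]
  · have h1 : (config z).card ≠ s.order := by simpa [eq_comm] using hn
    rw [s.kernel_eq_zero h1, s.abs.kernel_eq_zero h1, abs_zero]

/-- The step kernel with coefficients clipped at `M`, restricted to a set. -/
def restrict {B : Set Z} (hB : MeasurableSet B) (M : ℝ) : Step μ :=
  { s with
    B := fun j => s.B j ∩ B
    measurableSet := fun j => (s.measurableSet j).inter hB
    finite := fun j => ne_top_of_le_ne_top (s.finite j) (measure_mono Set.inter_subset_left)
    disjoint := fun _ _ hij =>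
      (s.disjoint hij).mono Set.inter_subset_left Set.inter_subset_left
    coeff := fun m => clip M (s.coeff m) }

lemma toFun_restrict_of_mem {B : Set Z} (hB : MeasurableSet B) {M : ℝ} (hM : 0 ≤ M) {n : ℕ}
    {z : Fin n → Z} (hz : ∀ l, z l ∈ B) : (s.restrict hB M).toFun z = clip M (s.toFun z) := by
  by_cases h : ∃ α : Fin n → Fin s.r, ∀ l, z l ∈ s.B (α l)
  · obtain ⟨α, hα⟩ := h
    have h1 : (s.restrict hB M).toFun z = (s.restrict hB M).coeff (config α) :=
      (s.restrict hB M).toFun_eq_of_mem fun l => ⟨hα l, hz l⟩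
    rw [h1, s.toFun_eq_of_mem hα]
    rfl
  · have h1 : ∃ l, ∀ j, z l ∉ s.B j := by
      by_contra! h'
      exact h ⟨fun l => (h' l).choose, fun l => (h' l).choose_spec⟩
    have h2 : (s.restrict hB M).toFun z = 0 :=
      (s.restrict hB M).toFun_eq_zero (h1.imp fun l hl j hj => hl j hj.1)
    rw [h2, s.toFun_eq_zero h1, clip_of_abs_le (by simpa using hM)]

lemma toFun_restrict_of_notMem {B : Set Z} (hB : MeasurableSet B) (M : ℝ) {n : ℕ}
    {z : Fin n → Z} {l : Fin n} (hz : z l ∉ B) : (s.restrict hB M).toFun z = 0 :=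
  (s.restrict hB M).toFun_eq_zero ⟨l, fun _ hj => hz hj.2⟩

lemma abs_kernel_le {M : ℝ} (hM0 : 0 ≤ M) (hM : ∀ m, |s.coeff m| ≤ M) (w : Multiset Z) :
    |s.kernel w| ≤ s.order.factorial * M := by
  obtain ⟨n, z, rfl⟩ := exists_config_eq w
  by_cases hn : s.order = n
  · subst hn
    rw [s.kernel_config rfl, abs_mul, Nat.abs_cast]
    gcongr
    by_cases h : ∃ α : Fin s.order → Fin s.r, ∀ l, z l ∈ s.B (α l)
    · obtain ⟨α, hα⟩ := h
      rw [s.toFun_eq_of_mem hα]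
      exact hM _
    · have h1 : ∃ l, ∀ j, z l ∉ s.B j := by
        by_contra! h'
        exact h ⟨fun l => (h' l).choose, fun l => (h' l).choose_spec⟩
      rw [s.toFun_eq_zero h1]
      simpa using hM0
  · rw [s.kernel_eq_zero (by simpa [eq_comm] using hn), abs_zero]
    positivity

lemma kernel_eq_zero_of_notMem {B : Set Z} (hB : ∀ j, s.B j ⊆ B) {w : Multiset Z}
    (h : ¬ ∀ z ∈ w, z ∈ B) : s.kernel w = 0 := by
  obtain ⟨n, z, rfl⟩ := exists_config_eq w
  by_cases hn : s.order = n
  · push Not at h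
    obtain ⟨y, hy, hyB⟩ := h
    obtain ⟨l, rfl⟩ := mem_config.1 hy
    rw [s.kernel_config hn, s.toFun_eq_zero ⟨l, fun j hj => hyB (hB j hj)⟩, mul_zero]
  · exact s.kernel_eq_zero (by simpa [eq_comm] using hn)

end Step

variable [SigmaFinite μ]

lemma exists_subseq_ae_tendsto {α : Type*} [MeasurableSpace α] {ν : Measure α} {f : ℕ → α → ℝ}
    {g : α → ℝ} (hf : ∀ n, AEStronglyMeasurable (f n) ν) (hg : AEStronglyMeasurable g ν)
    (h : Tendsto (fun n => eLpNorm (fun x => f n x - g x) 2 ν) atTop (𝓝 0)) :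
    ∃ ns : ℕ → ℕ, StrictMono ns ∧ ∀ᵐ x ∂ν, Tendsto (fun n => f (ns n) x) atTop (𝓝 (g x)) :=
  (tendstoInMeasure_of_tendsto_eLpNorm (by norm_num) hf hg h).exists_seq_tendsto_ae

/-- A bounded sequence of step kernels with a common support. -/
structure HasKernel.NiceApprox (Q : Measure (Measure Z)) (μ : Measure Z) (k : ℕ)
    (τ : Multiset Z → ℝ) (ψ : Measure Z → ℝ) (s : ℕ → Step μ) (B : Set Z) (M : ℝ) : Prop where
  order : ∀ n, (s n).order = k
  measurableSet : MeasurableSet B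
  finite : μ B ≠ ∞
  nonneg : 0 ≤ M
  subset : ∀ n j, (s n).B j ⊆ B
  abs_coeff_le : ∀ n m, |(s n).coeff m| ≤ M
  tendsto_kernel : ∀ᵐ w ∂(fock μ), Tendsto (fun n => (s n).kernel w) atTop (𝓝 (τ w))
  tendsto_value : ∀ᵐ χ ∂Q, Tendsto (fun n => (s n).value 1 χ) atTop (𝓝 (ψ χ))

/-- The kernel is bounded by `M` and vanishes outside `B`, so clipping the coefficients of
approximating step kernels at `M` and intersecting their sets with `B` does not increase the `L²`
distance. Two successive subsequences give almost everywhere convergence of the kernels and of the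
integrals. -/
theorem HasKernel.exists_niceApprox {k : ℕ} {τ : Multiset Z → ℝ} {ψ : Measure Z → ℝ}
    (h : HasKernel Q μ k τ ψ) (hτ : NiceKernel μ τ) (hQ : IsPoissonLaw Q μ) :
    ∃ s B M, NiceApprox Q μ k τ ψ s B M := by
  obtain ⟨hm, B, hB, hμ, M, hM⟩ := hτ
  have hM0 : 0 ≤ M := (abs_nonneg _).trans (hM 0).1
  obtain ⟨s, hs, hlim⟩ := h.exists_seq_step hQ
  set f : (Fin k → Z) → ℝ := fun z => (k.factorial : ℝ)⁻¹ * τ (config z)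
  have hfm : Measurable f := (hm.comp (measurable_config k)).const_mul _
  have hfM : ∀ z, |f z| ≤ M := fun z => by
    rw [abs_mul, abs_inv, Nat.abs_cast]
    refine (mul_le_of_le_one_left (abs_nonneg _) ?_).trans (hM _).1
    exact inv_le_one_of_one_le₀ (by exact_mod_cast Nat.factorial_pos k)
  let s1 : ℕ → Step μ := fun n => (s n).restrict hB M
  have hs1 : ∀ n, (s1 n).order = k := hs
  have hlim1 : Tendsto (fun n => eLpNorm (fun z => (s1 n).toFun z - f z) 2 (power μ k)) atTop
      (𝓝 0) := by
    refine tendsto_of_tendsto_of_tendsto_of_le_of_le tendsto_const_nhds hlim (fun _ => zero_le)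
      fun n => eLpNorm_mono fun z => ?_
    rw [Real.norm_eq_abs, Real.norm_eq_abs]
    change _ ≤ |(s n).toFun z - f z|
    by_cases hz : ∀ l, z l ∈ B
    · have h1 := abs_clip_sub_clip_le M ((s n).toFun z) (f z)
      rwa [clip_of_abs_le (hfM z), ← (s n).toFun_restrict_of_mem hB hM0 hz] at h1
    · push Not at hz
      obtain ⟨l, hl⟩ := hz
      have h0 : f z = 0 := by
        by_contra h0
        exact hl ((hM (config z)).2 (right_ne_zero_of_mul h0) _ (mem_config.2 ⟨l, rfl⟩))
      rw [(s n).toFun_restrict_of_notMem hB M hl, h0]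
      simp
  have hv := h.tendsto_value hQ hs1 hlim1
  obtain ⟨n1, hn1, h1⟩ := exists_subseq_ae_tendsto
    (fun n => ((s1 n).measurable_toFun k).aestronglyMeasurable) hfm.aestronglyMeasurable hlim1
  obtain ⟨n2, hn2, h2⟩ := exists_subseq_ae_tendsto
    (fun n => ((s1 (n1 n)).measurable_value 1).aestronglyMeasurable)
    h.measurable.aestronglyMeasurable (hv.comp hn1.tendsto_atTop)
  refine ⟨fun n => s1 (n1 (n2 n)), B, M, fun n => hs1 _, hB, hμ, hM0,
    fun n j => Set.inter_subset_right, fun n m => abs_clip_le hM0 _, ?_, h2⟩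
  rw [ae_fock_iff (measurableSet_tendsto_fun (fun n => (s1 _).measurable_kernel) hm)]
  intro n
  by_cases hn : n = k
  · subst hn
    filter_upwards [h1] with z hz
    have h3 := (hz.comp hn2.tendsto_atTop).const_mul (n.factorial : ℝ)
    rw [mul_inv_cancel_left₀ (by positivity)] at h3
    exact h3.congr fun j => ((s1 _).kernel_config (hs1 _) z).symm
  · refine ae_of_all _ fun z => tendsto_const_nhds.congr fun j => ?_
    rw [h.eq_zero _ (by simpa using hn), (s1 _).kernel_eq_zero (by rw [hs1]; simpa using hn)]

end

/-! ### Expectations of products of multiple integrals. -/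

section

variable {Z : Type*} [MeasurableSpace Z] {μ : Measure Z} {Q : Measure (Measure Z)}
  {ι : Type*} [Fintype ι] [DecidableEq ι]

/-! ### Moments of products of multiple integrals -/

/-- The products of the kernels along all words are integrable. -/
def WordIntegrable (μ : Measure Z) (τ : ι → Multiset Z → ℝ) : Prop :=
  ∀ (r : ℕ) (W : Fin r → CellIndex ι), Integrable (fun w : Fin r → Z => ∏ i, τ i (ev W w i)) (power μ r)

lemma WordIntegrable.abs {τ : ι → Multiset Z → ℝ} (h : WordIntegrable μ τ) :
    WordIntegrable μ fun i w => |τ i w| := fun r W => by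
  simpa only [Finset.abs_prod] using (h r W).abs

lemma tendsto_moment [SigmaFinite μ] (a : ℝ) (N : ℕ) {τ : ℕ → ι → Multiset Z → ℝ}
    {τ' g : ι → Multiset Z → ℝ} (hm : ∀ n i, Measurable (τ n i)) (hg : WordIntegrable μ g)
    (hle : ∀ n i w, |τ n i w| ≤ g i w)
    (hlim : ∀ i, ∀ᵐ s ∂(fock μ), Tendsto (fun n => τ n i s) atTop (𝓝 (τ' i s))) :
    Tendsto (fun n => moment μ a N (τ n)) atTop (𝓝 (moment μ a N τ')) := by
  refine tendsto_finsetSum _ fun r _ => Tendsto.const_mul _ ?_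
  refine tendsto_finsetSum _ fun W _ => Tendsto.const_mul _ ?_
  refine tendsto_integral_of_dominated_convergence (fun w => ∏ i, g i (ev W w i))
    (fun n => (measurable_prod_ev (hm n) W).aestronglyMeasurable) (hg r W) (fun n => ?_) ?_
  · refine ae_of_all _ fun w => ?_
    rw [norm_prod]
    exact Finset.prod_le_prod (fun _ _ => norm_nonneg _) fun i _ => hle n i _
  · filter_upwards [ae_all_iff.2 fun i => ae_ev_of_ae_fock (hlim i) W i] with w hw
    exact tendsto_finsetProd _ fun i _ => hw i

lemma lintegral_enorm_le_of_tendsto {α : Type*} [MeasurableSpace α] {ν : Measure α}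
    {f : ℕ → α → ℝ} {g : α → ℝ} {C : ℕ → ℝ} {c : ℝ} (hf : ∀ n, Measurable (f n))
    (h : ∀ᵐ x ∂ν, Tendsto (fun n => f n x) atTop (𝓝 (g x)))
    (hC : ∀ n, ∫⁻ x, ‖f n x‖ₑ ∂ν ≤ ENNReal.ofReal (C n)) (hc : Tendsto C atTop (𝓝 c)) :
    ∫⁻ x, ‖g x‖ₑ ∂ν ≤ ENNReal.ofReal c := by
  have h1 : ∫⁻ x, ‖g x‖ₑ ∂ν ≤ liminf (fun n => ∫⁻ x, ‖f n x‖ₑ ∂ν) atTop := by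
    refine le_trans (le_of_eq (lintegral_congr_ae ?_))
      (lintegral_liminf_le fun n => (hf n).enorm)
    filter_upwards [h] with x hx using hx.enorm.liminf_eq.symm
  refine h1.trans ?_
  have h2 := (ENNReal.continuous_ofReal.tendsto c).comp hc
  rw [← h2.liminf_eq]
  exact liminf_le_liminf (Eventually.of_forall hC)

variable [SigmaFinite μ]

section Nice

variable {k : ι → ℕ} {τ : ι → Multiset Z → ℝ} {ψ : ι → Measure Z → ℝ} {s : ι → ℕ → Step μ}
  {B : ι → Set Z} {M : ι → ℝ}

open Classical in
lemma tendsto_moment_step (a : ℝ) (N : ℕ)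
    (h : ∀ i, HasKernel.NiceApprox Q μ (k i) (τ i) (ψ i) (s i) (B i) (M i)) :
    Tendsto (fun n => moment μ a N fun i => (s i n).kernel) atTop (𝓝 (moment μ a N τ)) ∧
    Tendsto (fun n => moment μ a N fun i => (s i n).abs.kernel) atTop
      (𝓝 (moment μ a N fun i w => |τ i w|)) := by
  let g : ι → Multiset Z → ℝ := fun i w =>
    if ∀ z ∈ w, z ∈ B i then ((k i).factorial : ℝ) * M i else 0
  have hg : WordIntegrable μ g := fun r W => integrable_prod_ev (fun i =>
    NiceKernel.indicator (h i).measurableSet (h i).finite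
      (mul_nonneg (Nat.cast_nonneg _) (h i).nonneg)) W
  have hle : ∀ n i w, |(s i n).kernel w| ≤ g i w := fun n i w => by
    by_cases hw : ∀ z ∈ w, z ∈ B i
    · have h1 := (s i n).abs_kernel_le (h i).nonneg ((h i).abs_coeff_le n) w
      rw [(h i).order] at h1
      simpa only [g, if_pos hw] using h1
    · rw [(s i n).kernel_eq_zero_of_notMem ((h i).subset n) hw]
      simp [g, hw]
  refine ⟨tendsto_moment a N (fun n i => (s i n).measurable_kernel) hg hle
    fun i => (h i).tendsto_kernel, tendsto_moment a N (fun n i => (s i n).abs.measurable_kernel) hg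
      (fun n i w => ?_) fun i => ?_⟩
  · rw [Step.kernel_abs, abs_abs]
    exact hle n i w
  · filter_upwards [(h i).tendsto_kernel] with w hw
    simp_rw [Step.kernel_abs]
    exact hw.abs

/-- Each step integral is dominated by the integral of its absolute kernel with respect to `χ + μ`,
that is, with `c = -1`, whose moments have the weight `1 - c = 2` on singleton letters; Fatou's
lemma passes to the limit. -/
lemma lintegral_prod_le_of_niceApprox (hQ : IsPoissonLaw Q μ) {N : ℕ} (hN : ∑ i, k i ≤ N)
    (h : ∀ i, HasKernel.NiceApprox Q μ (k i) (τ i) (ψ i) (s i) (B i) (M i)) :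
    ∫⁻ χ, ‖∏ i, ψ i χ‖ₑ ∂Q ≤ ENNReal.ofReal (moment μ 2 N fun i w => |τ i w|) := by
  have := hQ.prob
  refine lintegral_enorm_le_of_tendsto (f := fun n χ => ∏ i, (s i n).value 1 χ)
    (fun n => Finset.measurable_prod _ fun i _ => (s i n).measurable_value 1) ?_ (fun n => ?_)
    (tendsto_moment_step 2 N h).2
  · filter_upwards [ae_all_iff.2 fun i => (h i).tendsto_value] with χ hχ
    exact tendsto_finsetProd _ fun i _ => hχ i
  · have h1 := Step.integral_prod_value hQ (-1) N (fun i => (s i n).abs)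
      (by simpa [Step.abs, (h _).order] using hN)
    rw [show (1 : ℝ) - -1 = 2 by norm_num] at h1
    have h2 : ∀ᵐ χ ∂Q, |∏ i, (s i n).value 1 χ| ≤ ∏ i, (s i n).abs.value (-1) χ := by
      filter_upwards [ae_all_iff.2 fun i => (s i n).ae_nat hQ] with χ hχ
      rw [Finset.abs_prod]
      exact Finset.prod_le_prod (fun _ _ => abs_nonneg _) fun i _ => (s i n).abs_value_le_abs (hχ i)
    have h3 : Integrable (fun χ => ∏ i, (s i n).abs.value (-1) χ) Q :=
      ((Tame.prod hQ _ fun i _ => (s i n).abs.tame_value hQ (-1)).memLp hQ).integrable one_le_two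
    rw [← h1, ofReal_integral_eq_lintegral_ofReal h3
      (h2.mono fun χ hχ => (abs_nonneg _).trans hχ)]
    refine lintegral_mono_ae ?_
    filter_upwards [h2] with χ hχ
    rw [← ofReal_norm]
    exact ENNReal.ofReal_le_ofReal hχ

/-- The uniform bound on the coefficients and the common support dominate the step integrals by
powers of `χ(B_i) + μ(B_i)`. At `c = 1` the singleton letters get weight zero. -/
lemma integral_prod_of_niceApprox (hQ : IsPoissonLaw Q μ) {N : ℕ} (hN : ∑ i, k i ≤ N)
    (h : ∀ i, HasKernel.NiceApprox Q μ (k i) (τ i) (ψ i) (s i) (B i) (M i)) :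
    ∫ χ, ∏ i, ψ i χ ∂Q = moment μ 0 N τ := by
  have := hQ.prob
  let G : ι → Measure Z → ℝ := fun i χ => M i * (χ.real (B i) + μ.real (B i)) ^ k i
  have hG : ∀ i, Tame μ Q (G i) := fun i => by
    refine ⟨(((measurable_real_apply (h i).measurableSet).add_const _).pow_const _).const_mul _,
      B i, (h i).measurableSet, (h i).finite, M i * (1 + μ.real (B i)) ^ k i, k i, ?_,
      ae_of_all _ fun χ => ?_⟩
    · have := (h i).nonneg
      positivity
    · have h0 := (h i).nonneg
      rw [abs_of_nonneg (by positivity), mul_assoc, ← mul_pow]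
      have h1 : 0 ≤ χ.real (B i) * μ.real (B i) := by positivity
      refine mul_le_mul_of_nonneg_left (pow_le_pow_left₀ (by positivity) ?_ _) h0
      nlinarith [measureReal_nonneg (μ := χ) (s := B i), measureReal_nonneg (μ := μ) (s := B i)]
  have h1 : ∀ n, ∀ᵐ χ ∂Q, ‖∏ i, (s i n).value 1 χ‖ ≤ ∏ i, G i χ := fun n => by
    filter_upwards [ae_all_iff.2 fun i => (s i n).ae_nat hQ,
      ae_all_iff.2 fun i => hQ.ae_ne_top (h i).measurableSet (h i).finite] with χ h1 h2
    rw [norm_prod]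
    refine Finset.prod_le_prod (fun _ _ => norm_nonneg _) fun i _ => ?_
    have h3 := (s i n).abs_value_le 1 (h i).nonneg (fun m _ => (h i).abs_coeff_le n m)
      ((h i).subset n) (h i).finite (h2 i) (h1 i)
    simpa [G, (h i).order] using h3
  have h2 := tendsto_integral_of_dominated_convergence (fun χ => ∏ i, G i χ)
    (fun n => (Finset.measurable_prod _ fun i _ =>
      (s i n).measurable_value 1).aestronglyMeasurable)
    (((Tame.prod hQ _ fun i _ => hG i).memLp hQ).integrable one_le_two) h1
    (f := fun χ => ∏ i, ψ i χ) (by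
      filter_upwards [ae_all_iff.2 fun i => (h i).tendsto_value] with χ hχ
      exact tendsto_finsetProd _ fun i _ => hχ i)
  refine tendsto_nhds_unique h2 ((tendsto_moment_step 0 N h).1.congr fun n => ?_)
  have h3 := Step.integral_prod_value hQ 1 N (fun i => s i n) (by simpa [(h _).order] using hN)
  rw [h3, sub_self]

end Nice

/-! ### Truncation of kernels -/

lemma exists_hasKernel_of_memLp (hQ : IsPoissonLaw Q μ) {k : ℕ} {t : Multiset Z → ℝ}
    (hm : Measurable t) (h0 : ∀ s, s.card ≠ k → t s = 0)
    (h2 : MemLp (fun z => t (config z)) 2 (power μ k)) : ∃ ψ, HasKernel Q μ k t ψ := by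
  have := hQ.prob
  have hf := h2.const_mul (k.factorial : ℝ)⁻¹
  obtain ⟨s, hs⟩ := exists_seq_stepKernel hf
  have h3 := sym_eq_self (f := fun z : Fin k → Z => (k.factorial : ℝ)⁻¹ * t (config z)) fun p z => by
    rw [show (fun l => z (p l)) = z ∘ p from rfl, config_comp_equiv]
  obtain ⟨ψ, hψ, hψ2, -, hk, hn⟩ := Step.exists_limit hQ (fun n => (s n).toStep) (fun _ => rfl) hf
    ((tendsto_sym hf hs).congr fun n => by simp only [h3])
  refine ⟨ψ, hψ, hψ2, hm, h0, ?_⟩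
  rw [ae_fock_iff (measurableSet_eq_fun (kernelMeasurable_meanCosts hψ).measurable hm)]
  intro n
  by_cases hnk : n = k
  · subst hnk
    filter_upwards [hk] with z hz
    rw [hz, mul_inv_cancel_left₀ (by positivity)]
  · filter_upwards [hn n hnk] with z hz
    rw [hz, h0 _ (by simpa using hnk)]

namespace HasKernel

variable {k : ℕ} {t t' : Multiset Z → ℝ} {ψ ψ' : Measure Z → ℝ}

lemma sub (h : HasKernel Q μ k t ψ) (h' : HasKernel Q μ k t' ψ') (hQ : IsPoissonLaw Q μ) :
    HasKernel Q μ k (fun w => t w - t' w) (fun χ => ψ χ - ψ' χ) := by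
  have := hQ.prob
  have hm : Measurable fun w => t w - t' w := h.measurable_kernel.sub h'.measurable_kernel
  have hm' : Measurable fun χ => ψ χ - ψ' χ := h.measurable.sub h'.measurable
  refine ⟨h.measurable.sub h'.measurable, h.memLp.sub h'.memLp, hm,
    fun s hs => by rw [h.eq_zero s hs, h'.eq_zero s hs, sub_zero], ?_⟩
  rw [ae_fock_iff (measurableSet_eq_fun
    (kernelMeasurable_meanCosts hm').measurable hm)]
  intro n
  filter_upwards [ae_meanCosts_sub hQ h.measurable h'.measurable h.memLp h'.memLp n,
    h.ae_config n, h'.ae_config n] with z h1 h2 h3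
  rw [← h2, ← h3, ← h1]

lemma eLpNorm_eq (h : HasKernel Q μ k t ψ) (hQ : IsPoissonLaw Q μ) : eLpNorm ψ 2 Q =
    ((k.factorial : ℝ≥0∞)⁻¹) ^ (1 / 2 : ℝ) * eLpNorm (fun z => t (config z)) 2 (power μ k) := by
  rw [← eLpNorm_meanCosts hQ h.measurable h.memLp, eLpNorm_congr_ae h.meanCosts_eq,
    eLpNorm_fock_of_card h.measurable_kernel h.eq_zero]

open Classical in
/-- Every element of a chaos is the limit of elements whose kernels are truncations of its kernel. -/
theorem exists_truncations (h : HasKernel Q μ k t ψ) (hQ : IsPoissonLaw Q μ) :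
    ∃ (τ : ℕ → Multiset Z → ℝ) (ψ' : ℕ → Measure Z → ℝ),
      (∀ n, HasKernel Q μ k (τ n) (ψ' n)) ∧ (∀ n, NiceKernel μ (τ n)) ∧
      (∀ n w, τ n w = t w ∨ τ n w = 0) ∧ (∀ w, Tendsto (fun n => τ n w) atTop (𝓝 (t w))) ∧
      ∀ᵐ χ ∂Q, Tendsto (fun n => ψ' n χ) atTop (𝓝 (ψ χ)) := by
  let τ : ℕ → Multiset Z → ℝ := fun n w =>
    if |t w| ≤ n ∧ ∀ z ∈ w, z ∈ spanningSets μ n then t w else 0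
  have hm := h.measurable_kernel
  have hτm : ∀ n, Measurable (τ n) := fun n =>
    Measurable.ite ((measurableSet_le hm.abs measurable_const).inter
      (measurableSet_forall_mem (measurableSet_spanningSets μ n))) hm measurable_const
  have hτ : ∀ n w, τ n w = t w ∨ τ n w = 0 := fun n w => by
    by_cases h : |t w| ≤ n ∧ ∀ z ∈ w, z ∈ spanningSets μ n
    · exact Or.inl (if_pos h)
    · exact Or.inr (if_neg h)
  have hle : ∀ n w, |τ n w| ≤ |t w| := fun n w => by
    rcases hτ n w with h | h <;> simp [h]
  have hnice : ∀ n, NiceKernel μ (τ n) := fun n => by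
    refine ⟨hτm n, spanningSets μ n, measurableSet_spanningSets μ n,
      (measure_spanningSets_lt_top μ n).ne, n, fun w => ?_⟩
    by_cases h : |t w| ≤ n ∧ ∀ z ∈ w, z ∈ spanningSets μ n
    · simp only [τ, if_pos h]
      exact ⟨h.1, fun _ => h.2⟩
    · simp [τ, if_neg h]
  have hlim : ∀ w, Tendsto (fun n => τ n w) atTop (𝓝 (t w)) := fun w => by
    refine tendsto_const_nhds.congr' ?_
    obtain ⟨n0, hn0⟩ := exists_nat_ge |t w|
    obtain ⟨m, z, rfl⟩ := exists_config_eq w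
    filter_upwards [eventually_ge_atTop n0,
      eventually_ge_atTop (∑ l, spanningSetsIndex μ (z l))] with n h1 h2
    refine (if_pos ⟨hn0.trans (by exact_mod_cast h1), fun y hy => ?_⟩).symm
    obtain ⟨l, rfl⟩ := mem_config.1 hy
    exact monotone_spanningSets μ ((Finset.single_le_sum
      (f := fun i => spanningSetsIndex μ (z i)) (fun _ _ => Nat.zero_le _)
      (Finset.mem_univ l)).trans h2) (mem_spanningSetsIndex μ (z l))
  have h2 := h.memLp_kernel hQ k
  have hex : ∀ n, ∃ ψ', HasKernel Q μ k (τ n) ψ' := fun n =>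
    exists_hasKernel_of_memLp hQ (hτm n) (fun s hs => by
      rcases hτ n s with h' | h'
      · rw [h', h.eq_zero s hs]
      · exact h') (h2.mono ((hτm n).comp (measurable_config k)).aestronglyMeasurable
        (ae_of_all _ fun z => hle n _))
  choose ψ' hψ' using hex
  have h3 : Tendsto (fun n => eLpNorm (fun χ => ψ' n χ - ψ χ) 2 Q) atTop (𝓝 0) := by
    have h4 := tendsto_eLpNorm_sub_of_dominated (ν := power μ k) (f := fun n z => τ n (config z))
      (g := fun z => t (config z)) (G := fun z => |t (config z)|)
      (fun n => ((hτm n).comp (measurable_config k)).aestronglyMeasurable) h2.1 h2.abs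
      (fun n => ae_of_all _ fun z => hle n _) (ae_of_all _ fun z => hlim _)
    have h5 := ENNReal.Tendsto.const_mul (a := ((k.factorial : ℝ≥0∞)⁻¹) ^ (1 / 2 : ℝ)) h4
      (Or.inr (ENNReal.rpow_ne_top_of_nonneg (by norm_num)
        (ENNReal.inv_ne_top.2 (by simp [Nat.factorial_ne_zero]))))
    rw [mul_zero] at h5
    exact h5.congr fun n => (((hψ' n).sub h hQ).eLpNorm_eq hQ).symm
  obtain ⟨ns, hns, hae⟩ := exists_subseq_ae_tendsto
    (fun n => (hψ' n).measurable.aestronglyMeasurable) h.measurable.aestronglyMeasurable h3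
  exact ⟨fun n => τ (ns n), fun n => ψ' (ns n), fun n => hψ' _, fun n => hnice _, fun n => hτ _,
    fun w => (hlim w).comp hns.tendsto_atTop, hae⟩

end HasKernel

/-! ### The product formula -/

section Product

variable {k : ι → ℕ} {t : ι → Multiset Z → ℝ} {ψ : ι → Measure Z → ℝ}

lemma lintegral_prod_le_of_niceKernel (hQ : IsPoissonLaw Q μ) {N : ℕ} (hN : ∑ i, k i ≤ N)
    (h : ∀ i, HasKernel Q μ (k i) (t i) (ψ i)) (ht : ∀ i, NiceKernel μ (t i)) :
    ∫⁻ χ, ‖∏ i, ψ i χ‖ₑ ∂Q ≤ ENNReal.ofReal (moment μ 2 N fun i w => |t i w|) := by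
  choose s B M hs using fun i => (h i).exists_niceApprox (ht i) hQ
  exact lintegral_prod_le_of_niceApprox hQ hN hs

lemma integral_prod_of_niceKernel (hQ : IsPoissonLaw Q μ) {N : ℕ} (hN : ∑ i, k i ≤ N)
    (h : ∀ i, HasKernel Q μ (k i) (t i) (ψ i)) (ht : ∀ i, NiceKernel μ (t i)) :
    ∫ χ, ∏ i, ψ i χ ∂Q = moment μ 0 N t := by
  choose s B M hs using fun i => (h i).exists_niceApprox (ht i) hQ
  exact integral_prod_of_niceApprox hQ hN hs

lemma WordIntegrable.mono {τ g : ι → Multiset Z → ℝ} (hg : WordIntegrable μ g)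
    (hm : ∀ i, Measurable (τ i)) (h : ∀ i w, |τ i w| ≤ |g i w|) : WordIntegrable μ τ := fun r W => by
  refine (hg r W).mono (measurable_prod_ev hm W).aestronglyMeasurable (ae_of_all _ fun w => ?_)
  rw [norm_prod, norm_prod]
  exact Finset.prod_le_prod (fun _ _ => norm_nonneg _) fun i _ => h i _

/-- Fatou's lemma along truncations of the kernels; word integrability is what makes the right-hand
sides converge. -/
lemma lintegral_prod_le (hQ : IsPoissonLaw Q μ) {N : ℕ} (hN : ∑ i, k i ≤ N)
    (h : ∀ i, HasKernel Q μ (k i) (t i) (ψ i)) (ht : WordIntegrable μ t) :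
    ∫⁻ χ, ‖∏ i, ψ i χ‖ₑ ∂Q ≤ ENNReal.ofReal (moment μ 2 N fun i w => |t i w|) := by
  choose τ ψ' h1 h2 h3 h4 h5 using fun i => (h i).exists_truncations hQ
  refine lintegral_enorm_le_of_tendsto (f := fun n χ => ∏ i, ψ' i n χ)
    (fun n => Finset.measurable_prod _ fun i _ => (h1 i n).measurable) ?_
    (fun n => lintegral_prod_le_of_niceKernel hQ hN (fun i => h1 i n) fun i => h2 i n)
    (tendsto_moment 2 N (fun n i => (h1 i n).measurable_kernel.abs) ht.abs (fun n i w => ?_)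
      fun i => ae_of_all _ fun w => (h4 i w).abs)
  · filter_upwards [ae_all_iff.2 h5] with χ hχ
    exact tendsto_finsetProd _ fun i _ => hχ i
  · rcases h3 i n w with h | h <;> simp [h]

lemma moment_eq_zero (a : ℝ) (N : ℕ) (i₀ : ι) (h : ∀ w, t i₀ w = 0) : moment μ a N t = 0 := by
  refine Finset.sum_eq_zero fun r _ => ?_
  rw [wordSum, Finset.sum_eq_zero, mul_zero]
  intro W _
  have : ∀ w : Fin r → Z, ∏ i, t i (ev W w i) = 0 := fun w =>
    Finset.prod_eq_zero (Finset.mem_univ i₀) (h _)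
  simp [this]

/-- The expectation of a product of multiple integrals whose kernels satisfy the integrability
condition. -/
theorem integral_prod (hQ : IsPoissonLaw Q μ) {N : ℕ} (hN : ∑ i, k i ≤ N)
    (h : ∀ i, HasKernel Q μ (k i) (t i) (ψ i)) (ht : WordIntegrable μ t) :
    Integrable (fun χ => ∏ i, ψ i χ) Q ∧ ∫ χ, ∏ i, ψ i χ ∂Q = moment μ 0 N t := by
  have hm : Measurable fun χ => ∏ i, ψ i χ := Finset.measurable_prod _ fun i _ => (h i).measurable
  have hI : ∀ {t : ι → Multiset Z → ℝ} {ψ : ι → Measure Z → ℝ}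
      (_ : ∀ i, HasKernel Q μ (k i) (t i) (ψ i)) (_ : WordIntegrable μ t),
      Integrable (fun χ => ∏ i, ψ i χ) Q := fun h ht =>
    ⟨(Finset.measurable_prod _ fun i _ => (h i).measurable).aestronglyMeasurable,
      (lintegral_prod_le hQ hN h ht).trans_lt ENNReal.ofReal_lt_top⟩
  refine ⟨hI h ht, ?_⟩
  choose τ ψ' h1 h2 h3 h4 h5 using fun i => (h i).exists_truncations hQ
  have hle : ∀ n i w, |τ i n w| ≤ |t i w| := fun n i w => by
    rcases h3 i n w with h | h <;> simp [h]
  have hle' : ∀ n i w, |t i w - τ i n w| ≤ |t i w| := fun n i w => by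
    rcases h3 i n w with h | h <;> simp [h]
  have hlim : Tendsto (fun n => ∫ χ, ∏ i, ψ' i n χ ∂Q) atTop (𝓝 (moment μ 0 N t)) := by
    refine (tendsto_moment 0 N (fun n i => (h1 i n).measurable_kernel) ht.abs
      (fun n i w => hle n i w) fun i => ae_of_all _ (h4 i)).congr fun n => ?_
    exact (integral_prod_of_niceKernel hQ hN (fun i => h1 i n) fun i => h2 i n).symm
  refine tendsto_nhds_unique ?_ hlim
  refine tendsto_integral_of_L1 _ hm.aestronglyMeasurable (Eventually.of_forall fun n =>
    hI (fun i => h1 i n) (ht.mono (fun i => (h1 i n).measurable_kernel) fun i w => hle n i w)) ?_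
  -- The difference between the product and its truncation is expanded over the non-empty sets `S`
  -- of factors that are replaced by their errors. Each term is bounded in `L¹` by a moment with
  -- weight `2` that contains an error kernel, and tends to zero by domination.
  let κ : CellIndex ι → ℕ → ι → Multiset Z → ℝ := fun S n i w =>
    if i ∈ S.1 then t i w - τ i n w else τ i n w
  let ξ : CellIndex ι → ℕ → ι → Measure Z → ℝ := fun S n i χ =>
    if i ∈ S.1 then ψ i χ - ψ' i n χ else ψ' i n χ
  have hκξ : ∀ S n i, HasKernel Q μ (k i) (κ S n i) (ξ S n i) := fun S n i => by
    by_cases hi : i ∈ S.1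
    · simpa only [κ, ξ, if_pos hi] using (h i).sub (h1 i n) hQ
    · simpa only [κ, ξ, if_neg hi] using h1 i n
  have hκ : ∀ S n i w, |κ S n i w| ≤ |t i w| := fun S n i w => by
    by_cases hi : i ∈ S.1
    · simpa only [κ, if_pos hi] using hle' n i w
    · simpa only [κ, if_neg hi] using hle n i w
  have hS : ∀ S, Tendsto (fun n => moment μ 2 N fun i w => |κ S n i w|) atTop (𝓝 0) := fun S => by
    obtain ⟨i₀, hi₀⟩ := S.2
    have h6 := tendsto_moment (μ := μ) 2 N (τ := fun n i w => |κ S n i w|)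
      (τ' := fun i w => if i ∈ S.1 then 0 else |t i w|)
      (fun n i => (hκξ S n i).measurable_kernel.abs) ht.abs
      (fun n i w => by rw [abs_abs]; exact hκ S n i w) fun i => ae_of_all _ fun w => ?_
    · rwa [moment_eq_zero 2 N i₀ fun w => if_pos hi₀] at h6
    · by_cases hi : i ∈ S.1
      · simp only [κ, if_pos hi]
        simpa using ((h4 i w).const_sub (t i w)).abs
      · simp only [κ, if_neg hi]
        exact (h4 i w).abs
  have h7 : Tendsto (fun n => ∑ S, ENNReal.ofReal (moment μ 2 N fun i w => |κ S n i w|)) atTop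
      (𝓝 (∑ _S : CellIndex ι, 0)) := by
    refine tendsto_finsetSum _ fun S _ => ?_
    have := (ENNReal.continuous_ofReal.tendsto 0).comp (hS S)
    rwa [ENNReal.ofReal_zero] at this
  rw [Finset.sum_const_zero] at h7
  refine tendsto_of_tendsto_of_tendsto_of_le_of_le tendsto_const_nhds h7 (fun _ => zero_le)
    fun n => ?_
  have h8 : ∀ χ, ‖∏ i, ψ' i n χ - ∏ i, ψ i χ‖ₑ ≤ ∑ S, ‖∏ i, ξ S n i χ‖ₑ := fun χ => by
    have h9 := prod_add_sub_prod (fun i => ψ' i n χ) fun i => ψ i χ - ψ' i n χ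
    simp only [add_sub_cancel] at h9
    rw [← enorm_neg, neg_sub, h9]
    exact enorm_sum_le _ _
  refine (lintegral_mono h8).trans ?_
  rw [lintegral_finsetSum _ fun S _ =>
    (Finset.measurable_prod _ fun i _ => (hκξ S n i).measurable).enorm]
  exact Finset.sum_le_sum fun S _ => lintegral_prod_le hQ hN (hκξ S n)
    (ht.mono (fun i => (hκξ S n i).measurable_kernel) (hκ S n))

end Product

end

/-! ### Words, labelled diagrams, and partitions. -/

section

/-! ### Labelled diagrams -/

section Labelling

variable {ι L Y : Type*} [Fintype ι] [DecidableEq ι] [Fintype L] [DecidableEq L] {k : ι → ℕ}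

/-- A labelled diagram: the positions in each row have different labels, and every label is used. -/
def IsLabelling (k : ι → ℕ) (J : (i : ι) → Fin (k i) → L) : Prop :=
  (∀ i, Function.Injective (J i)) ∧ ∀ b, ∃ i l, J i l = b

/-- The word of a labelled diagram: its letters are the sets of the rows in which a given label
occurs. -/
def word (J : {J : (i : ι) → Fin (k i) → L // IsLabelling k J}) (b : L) : CellIndex ι :=
  ⟨Finset.univ.filter fun i => ∃ l, J.1 i l = b, by
    obtain ⟨i, l, h⟩ := J.2.2 b
    exact ⟨i, by simpa using ⟨l, h⟩⟩⟩

lemma mem_word {J : {J : (i : ι) → Fin (k i) → L // IsLabelling k J}} {b : L} {i : ι} :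
    i ∈ (word J b).1 ↔ ∃ l, J.1 i l = b := by
  simp [word]

lemma config_comp_eq_ev {n : ℕ} {j : Fin n → L} (hj : Function.Injective j) {W : L → CellIndex ι}
    {i : ι} (h : ∀ b, i ∈ (W b).1 ↔ ∃ l, j l = b) (v : L → Y) : config (v ∘ j) = ev W v i := by
  have h1 : Finset.univ.filter (fun b => i ∈ (W b).1) = Finset.univ.map ⟨j, hj⟩ := by
    ext b
    simp [h]
  rw [ev, ← Finset.sum_filter, h1, Finset.sum_map]
  rfl

lemma config_comp_labelling (J : {J : (i : ι) → Fin (k i) → L // IsLabelling k J}) (v : L → Y)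
    (i : ι) : config (v ∘ J.1 i) = ev (word J) v i :=
  config_comp_eq_ev (J.2.1 i) (fun _ => mem_word) v

lemma ev_sumElim {L' : Type*} [Fintype L'] (W : L → CellIndex ι) (W' : L' → CellIndex ι)
    (v : L → Y) (v' : L' → Y) (i : ι) :
    ev (Sum.elim W W') (Sum.elim v v') i = ev W v i + ev W' v' i :=
  Fintype.sum_sum_type _

lemma exists_injective_of_card {n : ℕ} {S : Finset L} (h : S.card = n) :
    ∃ j : Fin n → L, Function.Injective j ∧ ∀ b, b ∈ S ↔ ∃ l, j l = b := by
  have e := (S.equivFinOfCardEq h).symm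
  exact ⟨fun l => (e l).1, Subtype.val_injective.comp e.injective, fun b =>
    ⟨fun hb => ⟨e.symm ⟨b, hb⟩, by simp⟩, fun ⟨l, hl⟩ => hl ▸ (e l).2⟩⟩

lemma exists_labelling {W : L → CellIndex ι}
    (h : ∀ i, (Finset.univ.filter fun b => i ∈ (W b).1).card = k i) :
    ∃ J : {J : (i : ι) → Fin (k i) → L // IsLabelling k J}, word J = W := by
  choose J hJ hW using fun i => exists_injective_of_card (h i)
  refine ⟨⟨J, hJ, fun b => ?_⟩, funext fun b => Subtype.ext (Finset.ext fun i => ?_)⟩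
  · obtain ⟨i, hi⟩ := (W b).2
    obtain ⟨l, hl⟩ := (hW i b).1 (by simpa using hi)
    exact ⟨i, l, hl⟩
  · rw [mem_word]
    simpa using (hW i b).symm

-- A labelled diagram with a given word amounts to a bijection, for each row, between its positions
-- and the letters that contain it.
open Classical in
lemma card_labelling {W : L → CellIndex ι}
    (h : ∀ i, (Finset.univ.filter fun b => i ∈ (W b).1).card = k i) :
    (Finset.univ.filter fun J : {J : (i : ι) → Fin (k i) → L // IsLabelling k J} =>
      word J = W).card = ∏ i, (k i).factorial := by
  rw [← Fintype.card_subtype]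
  have e : {J : {J : (i : ι) → Fin (k i) → L // IsLabelling k J} // word J = W} ≃
      ((i : ι) → Fin (k i) ≃ {b // i ∈ (W b).1}) :=
    { toFun := fun J i => Equiv.ofBijective
        (fun l => ⟨J.1.1 i l, (congrArg (fun W' : L → CellIndex ι => i ∈ (W' (J.1.1 i l)).1) J.2).mp
          (mem_word.2 ⟨l, rfl⟩)⟩)
        ⟨fun l l' hl => J.1.2.1 i (Subtype.ext_iff.1 hl), fun b => by
          obtain ⟨l, hl⟩ := mem_word.1
            ((congrArg (fun W' : L → CellIndex ι => i ∈ (W' b.1).1) J.2).mpr b.2)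
          exact ⟨l, Subtype.ext hl⟩⟩
      invFun := fun e => ⟨⟨fun i l => (e i l).1, fun i => Subtype.val_injective.comp (e i).injective,
        fun b => by
          obtain ⟨i, hi⟩ := (W b).2
          exact ⟨i, (e i).symm ⟨b, hi⟩, by simp⟩⟩, by
        refine funext fun b => Subtype.ext (Finset.ext fun i => ?_)
        rw [mem_word]
        exact ⟨fun ⟨l, hl⟩ => hl ▸ (e i l).2, fun hi => ⟨(e i).symm ⟨b, hi⟩, by simp⟩⟩⟩
      left_inv := fun J => rfl
      right_inv := fun e => by
        ext i l
        rfl }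
  rw [Fintype.card_congr e, Fintype.card_pi]
  refine Finset.prod_congr rfl fun i _ => ?_
  have h1 : Fintype.card (Fin (k i)) = Fintype.card {b // i ∈ (W b).1} := by
    rw [Fintype.card_fin, Fintype.card_subtype, h]
  rw [Fintype.card_equiv (Fintype.equivOfCardEq h1), Fintype.card_fin]

open Classical in
/-- Summation over labelled diagrams and summation over words. -/
theorem sum_word (F : (L → CellIndex ι) → ℝ)
    (hF : ∀ W, (∃ i, (Finset.univ.filter fun b => i ∈ (W b).1).card ≠ k i) → F W = 0) :
    ∑ J : {J : (i : ι) → Fin (k i) → L // IsLabelling k J}, F (word J) =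
      (∏ i, ((k i).factorial : ℝ)) * ∑ W, F W := by
  rw [← Finset.sum_fiberwise Finset.univ word, Finset.mul_sum]
  refine Finset.sum_congr rfl fun W _ => ?_
  rw [Finset.sum_congr rfl fun J hJ => by rw [(Finset.mem_filter.1 hJ).2], Finset.sum_const,
    nsmul_eq_mul]
  by_cases h : ∃ i, (Finset.univ.filter fun b => i ∈ (W b).1).card ≠ k i
  · rw [hF W h, mul_zero, mul_zero]
  · push Not at h
    rw [card_labelling h]
    push_cast
    rfl

end Labelling

/-! ### Diagrams and labelled diagrams -/

section Diagram

variable {m : ℕ} {k : Fin m → ℕ} {L : Type*} [Fintype L] [DecidableEq L]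

/-- The block of a position. -/
def blockOf (σ : Diagram k) (i : Fin m) (l : Fin (k i)) : {b // b ∈ σ.parts} :=
  ⟨σ.part (finSigmaFinEquiv ⟨i, l⟩), σ.part_mem.2 (Finset.mem_univ _)⟩

lemma exists_blockOf_eq (σ : Diagram k) (b : {b // b ∈ σ.parts}) : ∃ i l, blockOf σ i l = b := by
  obtain ⟨j, hj⟩ := σ.nonempty_of_mem_parts b.2
  obtain ⟨⟨i, l⟩, rfl⟩ := finSigmaFinEquiv.surjective j
  exact ⟨i, l, Subtype.ext (σ.part_eq_of_mem b.2 hj)⟩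

lemma isNonFlat_iff {σ : Diagram k} :
    IsNonFlat k σ ↔ ∀ i, Function.Injective (blockOf σ i) := by
  constructor
  · intro h i l l' hl
    have hp : σ.part (finSigmaFinEquiv ⟨i, l⟩) = σ.part (finSigmaFinEquiv ⟨i, l'⟩) :=
      congrArg Subtype.val hl
    have h1 := Finset.card_le_one.1 (h _ (blockOf σ i l).2 i) (finSigmaFinEquiv ⟨i, l⟩)
      (Finset.mem_inter.2 ⟨σ.mem_part (Finset.mem_univ _), by simp⟩) (finSigmaFinEquiv ⟨i, l'⟩)
      (Finset.mem_inter.2 ⟨by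
        change _ ∈ σ.part _
        rw [hp]
        exact σ.mem_part (Finset.mem_univ _), by simp⟩)
    simpa using h1
  · intro h b hb i
    refine Finset.card_le_one.2 fun x hx y hy => ?_
    rw [Finset.mem_inter, Finset.mem_image] at hx hy
    obtain ⟨hx, l, -, rfl⟩ := hx
    obtain ⟨hy, l', -, rfl⟩ := hy
    rw [h i (Subtype.ext ((σ.part_eq_of_mem hb hx).trans (σ.part_eq_of_mem hb hy).symm))]

lemma isLabelling_blockOf {σ : Diagram k} (hσ : IsNonFlat k σ) (ε : {b // b ∈ σ.parts} ≃ L) :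
    IsLabelling k fun i l => ε (blockOf σ i l) :=
  ⟨fun i => ε.injective.comp (isNonFlat_iff.1 hσ i), fun b => by
    obtain ⟨i, l, h⟩ := exists_blockOf_eq σ (ε.symm b)
    exact ⟨i, l, by simp [h]⟩⟩

/-- The blocks are the fibres of the labelling: they are indexed by the labels because every label
is used, and injectivity on rows makes the partition non-flat. -/
lemma exists_diagram {J : (i : Fin m) → Fin (k i) → L} (hJ : IsLabelling k J) :
    ∃ σ : Diagram k, IsNonFlat k σ ∧ ∃ ε : {b // b ∈ σ.parts} ≃ L,
      ∀ i l, J i l = ε (blockOf σ i l) := by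
  let j : Fin (∑ i, k i) → L := fun x => J (finSigmaFinEquiv.symm x).1 (finSigmaFinEquiv.symm x).2
  have hj : ∀ i l, j (finSigmaFinEquiv ⟨i, l⟩) = J i l := fun i l => by
    simp only [j]
    rw [Equiv.symm_apply_apply]
  let σ : Diagram k := Finpartition.ofSetoid (Setoid.ker j)
  have hσ : ∀ i l i' l', blockOf σ i l = blockOf σ i' l' ↔ J i l = J i' l' := fun i l i' l' => by
    rw [← hj, ← hj, blockOf, blockOf, Subtype.mk.injEq,
      ← σ.mem_part_iff_part_eq_part (Finset.mem_univ _) (Finset.mem_univ _),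
      Finpartition.mem_part_ofSetoid_iff_rel]
    exact eq_comm
  choose pi pl hp using exists_blockOf_eq σ
  let ε : {b // b ∈ σ.parts} ≃ L := Equiv.ofBijective (fun b => J (pi b) (pl b))
    ⟨fun b b' h => by
      rw [← hσ, hp, hp] at h
      exact h, fun x => by
      obtain ⟨i, l, h⟩ := hJ.2 x
      refine ⟨blockOf σ i l, ?_⟩
      rw [← h, ← hσ, hp]⟩
  have hε : ∀ i l, J i l = ε (blockOf σ i l) := fun i l => ((hσ _ _ _ _).1 (hp _)).symm
  refine ⟨σ, isNonFlat_iff.2 fun i l l' h => hJ.1 i ((hσ _ _ _ _).1 h), ε, hε⟩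

open Classical in
/-- Summation over labelled diagrams and summation over diagrams. -/
theorem sum_diagram (G : ((i : Fin m) → Fin (k i) → L) → ℝ) :
    ∑ J : {J : (i : Fin m) → Fin (k i) → L // IsLabelling k J}, G J.1 =
      ∑ σ ∈ (Finset.univ : Finset (Diagram k)).filter (IsNonFlat k),
        ∑ ε : {b // b ∈ σ.parts} ≃ L, G fun i l => ε (blockOf σ i l) := by
  rw [Finset.sum_sigma']
  symm
  refine Finset.sum_bij (fun x hx => ⟨fun i l => x.2 (blockOf x.1 i l),
    isLabelling_blockOf (Finset.mem_filter.1 (Finset.mem_sigma.1 hx).1).2 x.2⟩)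
    (fun _ _ => Finset.mem_univ _) ?_ ?_ fun _ _ => rfl
  · rintro ⟨σ, ε⟩ _ ⟨σ', ε'⟩ _ h
    have h1 : ∀ i l, ε (blockOf σ i l) = ε' (blockOf σ' i l) := fun i l =>
      congrFun (congrFun (Subtype.ext_iff.1 h) i) l
    have h2 : ∀ x, σ.part x = σ'.part x := fun x => by
      ext y
      rw [σ.mem_part_iff_part_eq_part (Finset.mem_univ _) (Finset.mem_univ _),
        σ'.mem_part_iff_part_eq_part (Finset.mem_univ _) (Finset.mem_univ _)]
      obtain ⟨⟨i, l⟩, rfl⟩ := finSigmaFinEquiv.surjective x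
      obtain ⟨⟨i', l'⟩, rfl⟩ := finSigmaFinEquiv.surjective y
      have h3 : ∀ σ : Diagram k, σ.part (finSigmaFinEquiv ⟨i', l'⟩) =
          σ.part (finSigmaFinEquiv ⟨i, l⟩) ↔ blockOf σ i' l' = blockOf σ i l := fun σ => by
        rw [blockOf, blockOf, Subtype.mk.injEq]
      rw [h3, h3, ← ε.apply_eq_iff_eq, ← ε'.apply_eq_iff_eq, h1, h1]
    have h4 : σ = σ' := by
      refine Finpartition.ext (Finset.ext fun b => ?_)
      constructor
      · intro hb
        obtain ⟨x, hx⟩ := σ.nonempty_of_mem_parts hb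
        rw [← σ.part_eq_of_mem hb hx, h2]
        exact σ'.part_mem.2 (Finset.mem_univ _)
      · intro hb
        obtain ⟨x, hx⟩ := σ'.nonempty_of_mem_parts hb
        rw [← σ'.part_eq_of_mem hb hx, ← h2]
        exact σ.part_mem.2 (Finset.mem_univ _)
    subst h4
    refine Sigma.ext rfl (heq_of_eq (Equiv.ext fun b => ?_))
    obtain ⟨i, l, rfl⟩ := exists_blockOf_eq σ b
    exact h1 i l
  · rintro ⟨J, hJ⟩ _
    obtain ⟨σ, hσ, ε, hε⟩ := exists_diagram hJ
    exact ⟨⟨σ, ε⟩, by simpa using hσ, Subtype.ext (funext fun i => funext fun l => (hε i l).symm)⟩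

/-- A block of a non-flat diagram meets each row at most once, so its elements correspond to the
rows that it meets. -/
lemma card_word_blockOf {σ : Diagram k} (hσ : IsNonFlat k σ) (ε : {b // b ∈ σ.parts} ≃ L) (x : L) :
    (word ⟨_, isLabelling_blockOf hσ ε⟩ x).1.card = (ε.symm x).1.card := by
  refine (Finset.card_bij (fun j _ => (finSigmaFinEquiv.symm j).1) ?_ ?_ ?_).symm
  · intro j hj
    rw [mem_word]
    refine ⟨(finSigmaFinEquiv.symm j).2, ?_⟩
    rw [← ε.eq_symm_apply, blockOf, Subtype.ext_iff]
    refine (σ.part_eq_iff_mem (ε.symm x).2).2 ?_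
    simpa using hj
  · intro j hj j' hj' h
    obtain ⟨⟨i, l⟩, rfl⟩ := finSigmaFinEquiv.surjective j
    obtain ⟨⟨i', l'⟩, rfl⟩ := finSigmaFinEquiv.surjective j'
    simp only [Equiv.symm_apply_apply] at h
    subst h
    rw [isNonFlat_iff.1 hσ i (Subtype.ext ((σ.part_eq_of_mem (ε.symm x).2 hj).trans
      (σ.part_eq_of_mem (ε.symm x).2 hj').symm))]
  · intro i hi
    obtain ⟨l, hl⟩ := mem_word.1 hi
    refine ⟨finSigmaFinEquiv ⟨i, l⟩, ?_, by simp⟩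
    rw [← ε.eq_symm_apply] at hl
    rw [← σ.part_eq_iff_mem (ε.symm x).2]
    exact congrArg Subtype.val hl

/-! ### Free and integrated blocks -/

/-- A labelling of the blocks, from labellings of the free and of the integrated blocks. -/
def joinLabels {q r : ℕ} {σ : Diagram k} {A : Finset (Finset (Fin (∑ i, k i)))}
    (e : FreeBlock σ A ≃ Fin q) (e' : IntegratedBlock σ A ≃ Fin r) :
    {b // b ∈ σ.parts} ≃ Fin q ⊕ Fin r :=
  (Equiv.sumCompl fun b : {b // b ∈ σ.parts} => b.1 ∈ A ∪ singletons σ).symm.trans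
    (Equiv.sumCongr e e')

lemma joinLabels_of_mem {q r : ℕ} {σ : Diagram k} {A : Finset (Finset (Fin (∑ i, k i)))}
    (e : FreeBlock σ A ≃ Fin q) (e' : IntegratedBlock σ A ≃ Fin r) (b : FreeBlock σ A) :
    joinLabels e e' b.1 = Sum.inl (e b) := by
  have h : (Equiv.sumCompl fun b : {b // b ∈ σ.parts} => b.1 ∈ A ∪ singletons σ).symm b.1 =
      Sum.inl b := by
    rw [Equiv.symm_apply_eq]
    rfl
  rw [joinLabels, Equiv.trans_apply, h]
  rfl

lemma joinLabels_of_notMem {q r : ℕ} {σ : Diagram k} {A : Finset (Finset (Fin (∑ i, k i)))}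
    (e : FreeBlock σ A ≃ Fin q) (e' : IntegratedBlock σ A ≃ Fin r) (b : IntegratedBlock σ A) :
    joinLabels e e' b.1 = Sum.inr (e' b) := by
  have h : (Equiv.sumCompl fun b : {b // b ∈ σ.parts} => b.1 ∈ A ∪ singletons σ).symm b.1 =
      Sum.inr b := by
    rw [Equiv.symm_apply_eq]
    rfl
  rw [joinLabels, Equiv.trans_apply, h]
  rfl

lemma joinLabels_injective {q r : ℕ} {σ : Diagram k} {A : Finset (Finset (Fin (∑ i, k i)))}
    {e₁ e₂ : FreeBlock σ A ≃ Fin q} {e₁' e₂' : IntegratedBlock σ A ≃ Fin r}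
    (h : joinLabels e₁ e₁' = joinLabels e₂ e₂') : e₁ = e₂ ∧ e₁' = e₂' := by
  refine ⟨Equiv.ext fun b => ?_, Equiv.ext fun b => ?_⟩
  · have := congrArg (fun ε => ε b.1) h
    simpa only [joinLabels_of_mem, Sum.inl.injEq] using this
  · have := congrArg (fun ε => ε b.1) h
    simpa only [joinLabels_of_notMem, Sum.inr.injEq] using this

lemma exists_joinLabels {q r : ℕ} {σ : Diagram k} {A : Finset (Finset (Fin (∑ i, k i)))}
    (ε : {b // b ∈ σ.parts} ≃ Fin q ⊕ Fin r)
    (h : ∀ b, (∃ x, ε b = Sum.inl x) ↔ b.1 ∈ A ∪ singletons σ) :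
    ∃ (e : FreeBlock σ A ≃ Fin q) (e' : IntegratedBlock σ A ≃ Fin r), joinLabels e e' = ε := by
  have h' : ∀ b : IntegratedBlock σ A, ∃ x, ε b.1 = Sum.inr x := fun b => by
    have hb := b.2
    rw [← h] at hb
    rcases hx : ε b.1 with x | x
    · exact absurd ⟨x, hx⟩ hb
    · exact ⟨x, rfl⟩
  choose f hf using fun b : FreeBlock σ A => (h b.1).2 b.2
  choose g hg using h'
  refine ⟨Equiv.ofBijective f ⟨fun b b' hb => ?_, fun x => ?_⟩,
    Equiv.ofBijective g ⟨fun b b' hb => ?_, fun x => ?_⟩, Equiv.ext fun b => ?_⟩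
  · exact Subtype.ext (ε.injective (by rw [hf, hf, hb]))
  · have hb : ε (ε.symm (Sum.inl x)) = Sum.inl x := by simp
    exact ⟨⟨ε.symm (Sum.inl x), (h _).1 ⟨x, hb⟩⟩, Sum.inl_injective (by rw [← hf, hb])⟩
  · exact Subtype.ext (ε.injective (by rw [hg, hg, hb]))
  · have hb : ε (ε.symm (Sum.inr x)) = Sum.inr x := by simp
    refine ⟨⟨ε.symm (Sum.inr x), fun hx => ?_⟩, Sum.inr_injective (by rw [← hg, hb])⟩
    obtain ⟨y, hy⟩ := (h _).2 hx
    rw [hb] at hy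
    cases hy
  · by_cases hb : b.1 ∈ A ∪ singletons σ
    · rw [joinLabels_of_mem _ _ ⟨b, hb⟩, hf ⟨b, hb⟩]
      rfl
    · rw [joinLabels_of_notMem _ _ ⟨b, hb⟩, hg ⟨b, hb⟩]
      rfl

lemma mem_singletons_or_bigBlocks {σ : Diagram k} (b : {b // b ∈ σ.parts}) :
    b.1 ∈ singletons σ ∨ b.1 ∈ bigBlocks σ := by
  have h := (σ.nonempty_of_mem_parts b.2).card_pos
  simp only [singletons, bigBlocks, Finset.mem_filter, b.2, true_and]
  omega

lemma notMem_singletons_of_mem_bigBlocks {σ : Diagram k} {b : Finset (Fin (∑ i, k i))}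
    (h : b ∈ bigBlocks σ) : b ∉ singletons σ := fun h' => by
  simp only [singletons, bigBlocks, Finset.mem_filter] at h h'
  omega

open Classical in
/-- Summation over the labellings in which the integrated blocks have at least two elements. -/
theorem sum_joinLabels (q r : ℕ) (σ : Diagram k)
    (g : ({b // b ∈ σ.parts} ≃ Fin q ⊕ Fin r) → ℝ) :
    ∑ ε : {b // b ∈ σ.parts} ≃ Fin q ⊕ Fin r,
      (if ∀ x, 2 ≤ (ε.symm (Sum.inr x)).1.card then g ε else 0) =
      ∑ A ∈ (bigBlocks σ).powerset, ∑ e : FreeBlock σ A ≃ Fin q,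
        ∑ e' : IntegratedBlock σ A ≃ Fin r, g (joinLabels e e') := by
  rw [← Finset.sum_filter]
  -- It recovers `A` from the labelling, as the set of the big blocks with a free label; the
  -- condition on the integrated labels forces all the singletons to be free.
  let S : ({b // b ∈ σ.parts} ≃ Fin q ⊕ Fin r) → Finset (Finset (Fin (∑ i, k i))) := fun ε =>
    (bigBlocks σ).filter fun b => ∃ (hb : b ∈ σ.parts) (x : Fin q), ε ⟨b, hb⟩ = Sum.inl x
  rw [← Finset.sum_fiberwise_of_maps_to (t := (bigBlocks σ).powerset) (g := S)
    fun ε _ => Finset.mem_powerset.2 (Finset.filter_subset _ _)]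
  refine Finset.sum_congr rfl fun A hA => ?_
  rw [← Fintype.sum_prod_type' fun (e : FreeBlock σ A ≃ Fin q) (e' : IntegratedBlock σ A ≃ Fin r) => g (joinLabels e e')]
  rw [Finset.mem_powerset] at hA
  symm
  refine Finset.sum_bij (fun p _ => joinLabels p.1 p.2) ?_ ?_ ?_ fun _ _ => rfl
  · rintro ⟨e, e'⟩ -
    have h1 : ∀ b, (∃ x, joinLabels e e' b = Sum.inl x) ↔ b.1 ∈ A ∪ singletons σ := fun b => by
      by_cases hb : b.1 ∈ A ∪ singletons σ
      · simp only [hb, iff_true]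
        exact ⟨_, joinLabels_of_mem e e' ⟨b, hb⟩⟩
      · rw [joinLabels_of_notMem e e' ⟨b, hb⟩]
        simp [hb]
    simp only [Finset.mem_filter, Finset.mem_univ, true_and]
    constructor
    · intro x
      have h2 := h1 ((joinLabels e e').symm (Sum.inr x))
      rw [Equiv.apply_symm_apply] at h2
      have h3 : ((joinLabels e e').symm (Sum.inr x)).1 ∉ singletons σ := fun h =>
        by simpa using h2.2 (Finset.mem_union_right _ h)
      have h4 := (mem_singletons_or_bigBlocks _).resolve_left h3
      exact (Finset.mem_filter.1 h4).2
    · ext b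
      simp only [S, Finset.mem_filter]
      constructor
      · rintro ⟨hb, hb', hx⟩
        exact (Finset.mem_union.1 ((h1 ⟨b, hb'⟩).1 hx)).resolve_right
          (notMem_singletons_of_mem_bigBlocks hb)
      · intro hb
        have hb' := (Finset.mem_filter.1 (hA hb)).1
        exact ⟨hA hb, hb', (h1 ⟨b, hb'⟩).2 (Finset.mem_union_left _ hb)⟩
  · rintro ⟨e₁, e₁'⟩ - ⟨e₂, e₂'⟩ - h
    obtain ⟨rfl, rfl⟩ := joinLabels_injective h
    rfl
  · intro ε hε
    simp only [Finset.mem_filter, Finset.mem_univ, true_and] at hε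
    obtain ⟨h1, h2⟩ := hε
    obtain ⟨e, e', h⟩ := exists_joinLabels (A := A) ε fun b => by
      rw [← h2, Finset.mem_union]
      constructor
      · intro hx
        rcases mem_singletons_or_bigBlocks b with hb | hb
        · exact Or.inr hb
        · exact Or.inl (Finset.mem_filter.2 ⟨hb, b.2, hx⟩)
      · rintro (hb | hb)
        · exact (Finset.mem_filter.1 hb).2.2
        · rcases hx : ε b with x | x
          · exact ⟨x, rfl⟩
          · have h3 := h1 x
            rw [← hx, Equiv.symm_apply_apply] at h3
            have h4 := (Finset.mem_filter.1 hb).2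
            omega
    exact ⟨⟨e, e'⟩, by simp, h⟩

end Diagram

end

/-! ### Costs of maximal order, the criterion for square-integrability, and chaos expansions. -/

section

variable {Z : Type*} [MeasurableSpace Z] {μ : Measure Z} [SigmaFinite μ] {Q : Measure (Measure Z)}

/-! ### Tensor products -/

lemma measurePreserving_sigmaUncurry {ι : Type*} [Fintype ι] (k : ι → ℕ) :
    MeasurePreserving (fun (u : (i : ι) → Fin (k i) → Z) (x : Σ i, Fin (k i)) => u x.1 x.2)
      (Measure.pi fun i => power μ (k i)) (Measure.pi fun _ => μ) := by
  have hm : Measurable fun (u : (i : ι) → Fin (k i) → Z) (x : Σ i, Fin (k i)) => u x.1 x.2 :=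
    measurable_pi_lambda _ fun x => (measurable_pi_apply x.2).comp (measurable_pi_apply x.1)
  refine ⟨hm, (Measure.pi_eq fun s hs => ?_).symm⟩
  rw [Measure.map_apply hm (MeasurableSet.univ_pi hs)]
  have h1 : (fun (u : (i : ι) → Fin (k i) → Z) (x : Σ i, Fin (k i)) => u x.1 x.2) ⁻¹'
      Set.univ.pi s = Set.univ.pi fun i => Set.univ.pi fun l => s ⟨i, l⟩ := by
    ext u
    simp [Set.mem_pi, Sigma.forall]
  rw [h1, Measure.pi_pi]
  simp_rw [Measure.pi_pi]
  exact (Fintype.prod_sigma fun x : Σ i, Fin (k i) => μ (s x)).symm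

lemma memLp_tensor {m : ℕ} {k : Fin m → ℕ} {f : (i : Fin m) → (Fin (k i) → Z) → ℝ}
    (hf : ∀ i, MemLp (f i) 2 (power μ (k i))) : MemLp (tensor k f) 2 (power μ (∑ i, k i)) := by
  have h1 := measurePreserving_comp_equiv (μ := μ) (finSigmaFinEquiv (n := k))
  have h2 : ∀ i, AEStronglyMeasurable (fun v : Fin (∑ i, k i) → Z =>
      f i fun l => v (finSigmaFinEquiv ⟨i, l⟩)) (power μ (∑ i, k i)) := fun i =>
    (hf i).1.comp_quasiMeasurePreserving (quasiMeasurePreserving_comp_injective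
      (e := fun l => finSigmaFinEquiv ⟨i, l⟩) fun l l' h => by simpa using h)
  have h3 : AEStronglyMeasurable (tensor k f) (power μ (∑ i, k i)) :=
    Finset.aestronglyMeasurable_fun_prod _ fun i _ => h2 i
  rw [memLp_two_iff_integrable_sq h3]
  have h4 : Integrable (fun u : (i : Fin m) → Fin (k i) → Z => ∏ i, f i (u i) ^ 2)
      (Measure.pi fun i => power μ (k i)) :=
    Integrable.fintype_prod_dep fun i => (memLp_two_iff_integrable_sq (hf i).1).1 (hf i)
  let e : ((i : Fin m) → Fin (k i) → Z) ≃ᵐ ((Σ i, Fin (k i)) → Z) :=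
    (MeasurableEquiv.piCurry fun (i : Fin m) (_ : Fin (k i)) => Z).symm
  have h5 : MeasurePreserving e (Measure.pi fun i => power μ (k i)) (Measure.pi fun _ => μ) :=
    measurePreserving_sigmaUncurry k
  have h6 : Integrable (fun u : (Σ i, Fin (k i)) → Z => ∏ i, f i (fun l => u ⟨i, l⟩) ^ 2)
      (Measure.pi fun _ => μ) :=
    (h5.integrable_comp_emb e.measurableEmbedding).1 h4
  refine (h1.integrable_comp h6.1).2 h6 |>.congr (ae_of_all _ fun v => ?_)
  simp [tensor, Finset.prod_pow]

lemma ae_kernel_eq {ι L : Type*} [Fintype ι] [Fintype L] {k : ι → ℕ} {t : ι → Multiset Z → ℝ}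
    {f : (i : ι) → (Fin (k i) → Z) → ℝ}
    (hf : ∀ i, ∀ᵐ z ∂(power μ (k i)), t i (config z) = (k i).factorial * f i z) :
    ∀ᵐ v ∂(Measure.pi fun _ : L => μ), ∀ i (j : Fin (k i) → L), Function.Injective j →
      t i (config (v ∘ j)) = (k i).factorial * f i (v ∘ j) := by
  refine ae_all_iff.2 fun i => ?_
  classical
  refine ae_all_iff.2 fun j => ?_
  by_cases hj : Function.Injective j
  · filter_upwards [(quasiMeasurePreserving_comp_injective hj).ae (hf i)] with v hv _ using hv
  · exact ae_of_all _ fun v h => absurd h hj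

open Classical in
/-- The sum of the products of the kernels along the words of maximal length. -/
lemma ae_sum_word_eq_sym_tensor {m : ℕ} {k : Fin m → ℕ} {f : (i : Fin m) → (Fin (k i) → Z) → ℝ}
    {t : Fin m → Multiset Z → ℝ} (ht : ∀ i s, s.card ≠ k i → t i s = 0)
    (hf : ∀ i, ∀ᵐ z ∂(power μ (k i)), t i (config z) = (k i).factorial * f i z) :
    ∀ᵐ z ∂(power μ (∑ i, k i)), ∑ W : Fin (∑ i, k i) → CellIndex (Fin m), ∏ i, t i (ev W z i) =
      (∑ i, k i).factorial * sym (tensor k f) z := by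
  filter_upwards [ae_kernel_eq (L := Fin (∑ i, k i)) hf] with z hz
  have h0 : (∏ i, ((k i).factorial : ℝ)) ≠ 0 :=
    Finset.prod_ne_zero_iff.2 fun i _ => by positivity
  refine mul_left_cancel₀ h0 ?_
  have h1 := sum_word (k := k) (L := Fin (∑ i, k i)) (fun W => ∏ i, t i (ev W z i))
    fun W ⟨i, hi⟩ => Finset.prod_eq_zero (Finset.mem_univ i) (ht i _ (by rwa [card_ev]))
  rw [← h1, sym, mul_inv_cancel_left₀ (by positivity), Finset.mul_sum]
  symm
  -- With as many labels as positions, a labelled diagram is a permutation of the positions.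
  refine Finset.sum_bij (fun p _ => ⟨fun i l => p (finSigmaFinEquiv ⟨i, l⟩), fun i l l' h => by
    simpa using h, fun b => ?_⟩) (fun _ _ => Finset.mem_univ _) ?_ ?_ ?_
  · exact ⟨(finSigmaFinEquiv.symm (p.symm b)).1, (finSigmaFinEquiv.symm (p.symm b)).2, by simp⟩
  · intro p _ p' _ h
    ext x
    obtain ⟨⟨i, l⟩, rfl⟩ := finSigmaFinEquiv.surjective x
    exact congrArg Fin.val (congrFun (congrFun (Subtype.ext_iff.1 h) i) l)
  · rintro ⟨J, hJ⟩ _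
    let j : Fin (∑ i, k i) → Fin (∑ i, k i) := fun x =>
      J (finSigmaFinEquiv.symm x).1 (finSigmaFinEquiv.symm x).2
    have hj : Function.Surjective j := fun b => by
      obtain ⟨i, l, h⟩ := hJ.2 b
      refine ⟨finSigmaFinEquiv ⟨i, l⟩, ?_⟩
      simp only [j]
      rw [Equiv.symm_apply_apply]
      exact h
    refine ⟨Equiv.ofBijective j (Finite.injective_iff_surjective.2 hj |>.bijective_of_finite),
      Finset.mem_univ _, Subtype.ext (funext fun i => funext fun l => ?_)⟩
    simp only [Equiv.ofBijective_apply, j]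
    rw [Equiv.symm_apply_apply]
  · intro p _
    rw [tensor, ← Finset.prod_mul_distrib]
    refine Finset.prod_congr rfl fun i _ => ?_
    rw [← config_comp_labelling]
    exact (hz i _ fun l l' h => by simpa using h).symm

/-! ### Iterated add-one costs of a product of multiple integrals -/

section Products

variable {ι : Type*} [Fintype ι] [DecidableEq ι] {k : ι → ℕ} {t : ι → Multiset Z → ℝ}
  {ψ : ι → Measure Z → ℝ}

lemma ae_hasKernel_addCosts (hQ : IsPoissonLaw Q μ) (h : ∀ i, HasKernel Q μ (k i) (t i) (ψ i))
    (q : ℕ) : ∀ᵐ z ∂(power μ q), ∀ (W : Fin q → CellIndex ι) i,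
      HasKernel Q μ (k i - (ev W z i).card) (fun s => t i (ev W z i + s))
        (addCosts (ev W z i) (ψ i)) :=
  ae_all_iff.2 fun W => ae_all_iff.2 fun i => (h i).addCosts_ev hQ W i

lemma le_sum_card_ev {Y : Type*} {q : ℕ} (W : Fin q → CellIndex ι) (z : Fin q → Y) :
    q ≤ ∑ i, (ev W z i).card := by
  simp_rw [card_ev, Finset.card_filter]
  rw [Finset.sum_comm]
  calc q = ∑ _l : Fin q, 1 := by simp
    _ ≤ _ := Finset.sum_le_sum fun l _ => by
      rw [← Finset.card_filter, Finset.filter_univ_mem]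
      exact (W l).2.card_pos

/-- The iterated add-one costs of maximal order are deterministic. -/
theorem ae_addCosts_prod_eq_const (hQ : IsPoissonLaw Q μ)
    (h : ∀ i, HasKernel Q μ (k i) (t i) (ψ i)) {q : ℕ} (hq : ∑ i, k i ≤ q) :
    ∀ᵐ z ∂(power μ q), addCosts (config z) (fun χ => ∏ i, ψ i χ) =ᵐ[Q]
      fun _ => ∑ W : Fin q → CellIndex ι, ∏ i, t i (ev W z i) := by
  filter_upwards [ae_hasKernel_addCosts hQ h q] with z hz
  have h1 : ∀ W : Fin q → CellIndex ι, ∀ᵐ χ ∂Q,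
      ∏ i, addCosts (ev W z i) (ψ i) χ = ∏ i, t i (ev W z i) := fun W => by
    have h2 : ∀ i, k i ≤ (ev W z i).card →
        ∀ᵐ χ ∂Q, addCosts (ev W z i) (ψ i) χ = t i (ev W z i) := fun i hi => by
      have h3 := hz W i
      rw [Nat.sub_eq_zero_of_le hi] at h3
      have h4 := h3.ae_eq_const hQ
      simp only [add_zero] at h4
      exact h4
    -- A factor that receives too many points vanishes. Otherwise, as each point goes to at least
    -- one factor and there are at least `K` points, every factor receives exactly `k_i` of them and
    -- is constant.
    by_cases hi : ∃ i, k i < (ev W z i).card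
    · obtain ⟨i, hi⟩ := hi
      filter_upwards [h2 i hi.le] with χ hχ
      have h0 : t i (ev W z i) = 0 := (h i).eq_zero _ hi.ne'
      rw [Finset.prod_eq_zero (Finset.mem_univ i) (hχ.trans h0),
        Finset.prod_eq_zero (Finset.mem_univ i) h0]
    · push Not at hi
      have h4 : ∀ i ∈ Finset.univ, (ev W z i).card = k i :=
        (Finset.sum_eq_sum_iff_of_le fun i _ => hi i).1
          (le_antisymm (Finset.sum_le_sum fun i _ => hi i) (hq.trans (le_sum_card_ev W z)))
      filter_upwards [ae_all_iff.2 fun i => h2 i (h4 i (Finset.mem_univ i)).ge] with χ hχ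
      exact Finset.prod_congr rfl fun i _ => hχ i
  filter_upwards [ae_all_iff.2 h1] with χ hχ
  rw [addCosts_prod]
  exact Finset.sum_congr rfl fun W _ => hχ W

lemma sum_word_eq_zero {Y : Type*} {t : ι → Multiset Y → ℝ}
    (h : ∀ i s, s.card ≠ k i → t i s = 0) {q : ℕ} (hq : ∑ i, k i < q)
    (z : Fin q → Y) : ∑ W : Fin q → CellIndex ι, ∏ i, t i (ev W z i) = 0 := by
  refine Finset.sum_eq_zero fun W _ => ?_
  obtain ⟨i, -, hi⟩ := Finset.exists_lt_of_sum_lt (hq.trans_le (le_sum_card_ev W z))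
  exact Finset.prod_eq_zero (Finset.mem_univ i) (h i _ hi.ne')

end Products

lemma memLp_meanCosts_config (hQ : IsPoissonLaw Q μ) {φ : Measure Z → ℝ} (hφ : Measurable φ)
    (h2 : MemLp φ 2 Q) (n : ℕ) : MemLp (fun z => meanCosts Q φ (config z)) 2 (power μ n) := by
  have := hQ.prob
  have hm := kernelMeasurable_meanCosts (Q := Q) hφ
  refine ⟨(hm n).aestronglyMeasurable, (eLpNorm_config_le hm.measurable n).trans_lt ?_⟩
  rw [eLpNorm_meanCosts hQ hφ h2]
  exact ENNReal.mul_lt_top (by finiteness) h2.2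

section Main

variable {m : ℕ} {k : Fin m → ℕ} {f : (i : Fin m) → (Fin (k i) → Z) → ℝ}
  {t : Fin m → Multiset Z → ℝ} {ψ : Fin m → Measure Z → ℝ} {φ : Measure Z → ℝ}

lemma ae_meanCosts_top (hQ : IsPoissonLaw Q μ) (h : ∀ i, HasKernel Q μ (k i) (t i) (ψ i))
    (hf : ∀ i, ∀ᵐ z ∂(power μ (k i)), t i (config z) = (k i).factorial * f i z)
    (hφ : Measurable φ) (hφψ : φ =ᵐ[Q] fun χ => ∏ i, ψ i χ) :
    ∀ᵐ z ∂(power μ (∑ i, k i)), addCosts (config z) φ =ᵐ[Q]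
      fun _ => (∑ i, k i).factorial * sym (tensor k f) z := by
  have hψ : Measurable fun χ => ∏ i, ψ i χ := Finset.measurable_prod _ fun i _ => (h i).measurable
  filter_upwards [ae_addCosts_congr hQ hφ hψ hφψ _, ae_addCosts_prod_eq_const hQ h le_rfl,
    ae_sum_word_eq_sym_tensor (fun i => (h i).eq_zero) hf] with z h1 h2 h3
  rw [← h3]
  exact h1.trans h2

lemma ae_meanCosts_eq_zero (hQ : IsPoissonLaw Q μ) (h : ∀ i, HasKernel Q μ (k i) (t i) (ψ i))
    (hφ : Measurable φ) (hφψ : φ =ᵐ[Q] fun χ => ∏ i, ψ i χ) {q : ℕ} (hq : ∑ i, k i < q) :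
    ∀ᵐ z ∂(power μ q), meanCosts Q φ (config z) = 0 := by
  have hψ : Measurable fun χ => ∏ i, ψ i χ := Finset.measurable_prod _ fun i _ => (h i).measurable
  filter_upwards [ae_addCosts_congr hQ hφ hψ hφψ _, ae_addCosts_prod_eq_const hQ h hq.le] with z h1 h2
  rw [meanCosts, integral_congr_ae (h1.trans h2), sum_word_eq_zero (fun i => (h i).eq_zero) hq]
  simp

/-- The characterization of the square-integrability of a product of multiple integrals. -/
theorem memLp_iff_meanCosts (hQ : IsPoissonLaw Q μ) (h : ∀ i, HasKernel Q μ (k i) (t i) (ψ i))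
    (hf2 : ∀ i, MemLp (f i) 2 (power μ (k i)))
    (hf : ∀ i, ∀ᵐ z ∂(power μ (k i)), t i (config z) = (k i).factorial * f i z)
    (hφ : Measurable φ) (hφψ : φ =ᵐ[Q] fun χ => ∏ i, ψ i χ) (hK : 1 ≤ ∑ i, k i) :
    MemLp φ 2 Q ↔ ∀ q, 1 ≤ q → q < ∑ i, k i →
      (∀ᵐ z ∂(power μ q), Integrable (addCosts (config z) φ) Q) ∧
        MemLp (fun z => meanCosts Q φ (config z)) 2 (power μ q) := by
  have := hQ.prob
  refine ⟨fun h2 q _ _ => ⟨ae_integrable_addCosts hQ hφ h2 q, memLp_meanCosts_config hQ hφ h2 q⟩,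
    fun h2 => ?_⟩
  have h3 : ∫⁻ z, ∫⁻ χ, ‖addCosts (config z) φ χ‖ₑ ^ 2 ∂Q ∂(power μ (∑ i, k i)) ≠ ∞ := by
    have h4 := (memLp_sym (memLp_tensor hf2)).const_mul ((∑ i, k i).factorial : ℝ)
    refine ne_top_of_le_ne_top ((memLp_two_iff_lintegral h4.1).1 h4).ne (le_of_eq ?_)
    refine lintegral_congr_ae ?_
    filter_upwards [ae_meanCosts_top hQ h hf hφ hφψ] with z hz
    rw [lintegral_congr_ae (g := fun _ => ‖(∑ i, k i).factorial * sym (tensor k f) z‖ₑ ^ 2)]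
    · simp
    · filter_upwards [hz] with χ hχ
      rw [hχ]
  -- The descent stops at order `1`, since nothing is assumed on the mean of `φ` itself; the last
  -- step is `memLp_of_addOneCost`.
  have h5 := lintegral_addCosts_ne_top hQ hφ h3 hK fun q h1 h2' => (h2 q h1 h2').2
  rw [lintegral_addCosts_succ hφ 0] at h5
  refine memLp_of_addOneCost hQ hφ ?_
  simpa [power, config_empty] using h5

end Main

/-! ### Chaos expansions -/

lemma addCosts_sum {κ : Type*} (s : Finset κ) (ψ : κ → Measure Z → ℝ) (c : ℝ) (w : Multiset Z)
    (χ : Measure Z) : addCosts w (fun χ => c + ∑ q ∈ s, ψ q χ) χ =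
      (if w.card = 0 then c else 0) + ∑ q ∈ s, addCosts w (ψ q) χ := by
  induction w using Multiset.induction_on generalizing χ with
  | empty => simp
  | cons z w ih =>
    simp [addCosts_cons, addOneCost, ih]

lemma ae_meanCosts_sum (hQ : IsPoissonLaw Q μ) {K : ℕ} (c : ℝ) {τ : ℕ → Multiset Z → ℝ}
    {ψ : ℕ → Measure Z → ℝ} (h : ∀ q ∈ Finset.Icc 1 K, HasKernel Q μ q (τ q) (ψ q)) (n : ℕ) :
    ∀ᵐ z ∂(power μ n), meanCosts Q (fun χ => c + ∑ q ∈ Finset.Icc 1 K, ψ q χ) (config z) =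
      if n = 0 then c else if n ≤ K then τ n (config z) else 0 := by
  have := hQ.prob
  have h1 : ∀ᵐ z ∂(power μ n), ∀ q ∈ Finset.Icc 1 K,
      Integrable (addCosts (config z) (ψ q)) Q ∧ meanCosts Q (ψ q) (config z) = τ q (config z) := by
    refine (ae_ball_iff (Finset.Icc 1 K).countable_toSet).2 fun q hq => ?_
    exact (ae_integrable_addCosts hQ (h q hq).measurable (h q hq).memLp n).and ((h q hq).ae_config n)
  filter_upwards [h1] with z hz
  have h2 : ∀ q ∈ Finset.Icc 1 K, meanCosts Q (ψ q) (config z) =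
      if n = q then τ n (config z) else 0 := fun q hq => by
    rw [(hz q hq).2]
    split_ifs with hn
    · exact congrFun (congrArg τ hn.symm) _
    · exact (h q hq).eq_zero _ (by simpa using hn)
  have h3 : meanCosts Q (fun χ => c + ∑ q ∈ Finset.Icc 1 K, ψ q χ) (config z) =
      (if n = 0 then c else 0) + ∑ q ∈ Finset.Icc 1 K, meanCosts Q (ψ q) (config z) := by
    simp only [meanCosts, addCosts_sum, card_config, Fintype.card_fin]
    rw [integral_add (integrable_const _) (integrable_finsetSum _ fun q hq => (hz q hq).1),
      integral_finsetSum _ fun q hq => (hz q hq).1, integral_const, probReal_univ, one_smul]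
  rw [h3, Finset.sum_congr rfl h2, Finset.sum_ite_eq]
  by_cases hn : n = 0
  · simp [hn]
  · simp [hn, Nat.one_le_iff_ne_zero]

section Expansion

variable {Ω : Type*} [MeasurableSpace Ω] {P : Measure Ω} [IsProbabilityMeasure P]
  {η : Ω → Measure Z} {Φ : Ω → ℝ} {φ : Measure Z → ℝ} {K : ℕ} {h : (q : ℕ) → (Fin q → Z) → ℝ}

lemma ae_map_eq_iff (hη : Measurable η) {φ ψ : Measure Z → ℝ} (hφ : Measurable φ)
    (hψ : Measurable ψ) : φ =ᵐ[P.map η] ψ ↔ (fun ω => φ (η ω)) =ᵐ[P] fun ω => ψ (η ω) :=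
  ae_map_iff hη.aemeasurable (measurableSet_eq_fun hφ hψ)

lemma exists_hasKernel_multipleIntegral (hη : IsPoissonRandomMeasure η μ P)
    (hh : ∀ q, 1 ≤ q → q ≤ K → MemLp (h q) 2 (power μ q) ∧ IsAESymmetric μ (h q)) :
    ∃ (τ : ℕ → Multiset Z → ℝ) (ψ : ℕ → Measure Z → ℝ), ∀ q ∈ Finset.Icc 1 K,
      HasKernel (P.map η) μ q (τ q) (ψ q) ∧
      multipleIntegral η μ P (h q) =ᵐ[P] (fun ω => ψ q (η ω)) ∧
      ∀ᵐ z ∂(power μ q), τ q (config z) = q.factorial * h q z := by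
  have h1 : ∀ q, ∃ (τ : Multiset Z → ℝ) (ψ : Measure Z → ℝ), q ∈ Finset.Icc 1 K →
      HasKernel (P.map η) μ q τ ψ ∧ multipleIntegral η μ P (h q) =ᵐ[P] (fun ω => ψ (η ω)) ∧
      ∀ᵐ z ∂(power μ q), τ (config z) = q.factorial * h q z := fun q => by
    by_cases hq : q ∈ Finset.Icc 1 K
    · have hq' := Finset.mem_Icc.1 hq
      obtain ⟨h2, h3⟩ := hh q hq'.1 hq'.2
      obtain ⟨τ, ψ, h4, h5, h6⟩ :=
        (isMultipleIntegral_multipleIntegral hη h2).exists_hasKernel hη h2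
      refine ⟨τ, ψ, fun _ => ⟨h4, h5, ?_⟩⟩
      filter_upwards [h6, h3.sym_ae_eq] with z h7 h8
      rw [h7, h8]
    · exact ⟨0, 0, fun h => absurd h hq⟩
  choose τ ψ h2 using h1
  exact ⟨τ, ψ, h2⟩

/-- The kernels of a chaos expansion are given by the mean add-one costs. -/
theorem IsChaosExpansion.ae_meanCosts_eq (hη : IsPoissonRandomMeasure η μ P)
    (hφ : IsRepresentative η P Φ φ) (hh : IsChaosExpansion η μ P Φ K h) {q : ℕ} (hq1 : 1 ≤ q)
    (hqK : q ≤ K) : ∀ᵐ z ∂(power μ q), meanCosts (P.map η) φ (config z) = q.factorial * h q z := by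
  have hQ := hη.isPoissonLaw
  obtain ⟨τ, ψ, hψ⟩ := exists_hasKernel_multipleIntegral hη hh.1
  have hm : Measurable fun χ => (∫ ω', Φ ω' ∂P) + ∑ q ∈ Finset.Icc 1 K, ψ q χ :=
    measurable_const.add (Finset.measurable_sum _ fun q hq => (hψ q hq).1.measurable)
  have h1 : φ =ᵐ[P.map η] fun χ => (∫ ω', Φ ω' ∂P) + ∑ q ∈ Finset.Icc 1 K, ψ q χ := by
    rw [ae_map_eq_iff hη.measurable hφ.1 hm]
    filter_upwards [hφ.2, hh.2, (ae_ball_iff (Finset.Icc 1 K).countable_toSet).2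
      fun q hq => (hψ q hq).2.1] with ω h1 h2 h3
    rw [← h1, h2]
    exact congrArg _ (Finset.sum_congr rfl h3)
  filter_upwards [ae_addCosts_congr hQ hφ.1 hm h1 q,
    ae_meanCosts_sum hQ (∫ ω', Φ ω' ∂P) (fun q hq => (hψ q hq).1) q,
    (hψ q (Finset.mem_Icc.2 ⟨hq1, hqK⟩)).2.2] with z h2 h3 h4
  rw [meanCosts, integral_congr_ae h2, ← h4]
  exact Eq.trans h3 (by simp [hqK, Nat.one_le_iff_ne_zero.1 hq1])

/-- A square-integrable functional whose mean add-one costs of high order vanish has a finite chaos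
expansion. -/
theorem exists_isChaosExpansion (hη : IsPoissonRandomMeasure η μ P)
    (hφ : IsRepresentative η P Φ φ) (h2 : MemLp φ 2 (P.map η))
    (h0 : ∀ n, K < n → ∀ᵐ z ∂(power μ n), meanCosts (P.map η) φ (config z) = 0) :
    ∃ h, IsChaosExpansion η μ P Φ K h := by
  have hQ := hη.isPoissonLaw
  have := hQ.prob
  let h : (q : ℕ) → (Fin q → Z) → ℝ := fun q z =>
    (q.factorial : ℝ)⁻¹ * meanCosts (P.map η) φ (config z)
  have hh : ∀ q, 1 ≤ q → q ≤ K → MemLp (h q) 2 (power μ q) ∧ IsAESymmetric μ (h q) :=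
    fun q _ _ => ⟨(memLp_meanCosts_config hQ hφ.1 h2 q).const_mul _, fun p => ae_of_all _ fun z => by
      simp only [h]
      rw [show (fun l => z (p l)) = z ∘ p from rfl, config_comp_equiv]⟩
  obtain ⟨τ, ψ, hψ⟩ := exists_hasKernel_multipleIntegral hη hh
  refine ⟨h, hh, ?_⟩
  have hm : Measurable fun χ => (∫ ω', Φ ω' ∂P) + ∑ q ∈ Finset.Icc 1 K, ψ q χ :=
    measurable_const.add (Finset.measurable_sum _ fun q hq => (hψ q hq).1.measurable)
  have hm2 : MemLp (fun χ => ∑ q ∈ Finset.Icc 1 K, ψ q χ) 2 (P.map η) :=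
    memLp_finsetSum _ fun q hq => (hψ q hq).1.memLp
  have hm3 : MemLp (fun χ => (∫ ω', Φ ω' ∂P) + ∑ q ∈ Finset.Icc 1 K, ψ q χ) 2 (P.map η) :=
    (memLp_const (∫ ω', Φ ω' ∂P)).add hm2
  have hc : ∫ ω', Φ ω' ∂P = ∫ χ, φ χ ∂(P.map η) := by
    rw [integral_map hη.measurable.aemeasurable hφ.1.aestronglyMeasurable]
    exact integral_congr_ae hφ.2
  -- All the mean costs agree: at order zero by the choice of the constant, from `1` to `K` by the
  -- choice of `h`, and beyond `K` because both vanish.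
  have h1 : φ =ᵐ[P.map η] fun χ => (∫ ω', Φ ω' ∂P) + ∑ q ∈ Finset.Icc 1 K, ψ q χ := by
    refine ae_eq_of_meanCosts hQ hφ.1 hm h2 hm3 fun n => ?_
    have h3 := ae_meanCosts_sum hQ (∫ ω', Φ ω' ∂P) (fun q hq => (hψ q hq).1) n
    by_cases hn : n = 0
    · subst hn
      filter_upwards [h3] with z hz
      rw [hz, if_pos rfl, hc]
      simp [meanCosts]
    · by_cases hnK : n ≤ K
      · filter_upwards [h3, (hψ n (Finset.mem_Icc.2 ⟨by omega, hnK⟩)).2.2] with z hz h4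
        rw [hz, if_neg hn, if_pos hnK, h4, mul_inv_cancel_left₀ (by positivity)]
      · filter_upwards [h3, h0 n (by omega)] with z hz h4
        rw [hz, if_neg hn, if_neg hnK, h4]
  rw [ae_map_eq_iff hη.measurable hφ.1 hm] at h1
  filter_upwards [hφ.2, h1, (ae_ball_iff (Finset.Icc 1 K).countable_toSet).2
    fun q hq => (hψ q hq).2.1] with ω h4 h5 h6
  rw [h4, h5]
  exact congrArg _ (Finset.sum_congr rfl fun q hq => (h6 q hq).symm)

end Expansion

end

/-! ### The local integrability condition and the diagram kernels. -/

section

variable {Z : Type*} [MeasurableSpace Z] {μ : Measure Z} {Q : Measure (Measure Z)}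

/-! ### Sections of kernels -/

/-- A section of a kernel along `j` is the whole kernel evaluated along one injection into the fixed
and the remaining points together. Which arguments are fixed then no longer matters, because
configurations ignore the order. -/
lemma exists_fixVariables_eq {q n : ℕ} {L : Type*} (S : Finset (Fin q)) {j : Fin (n - S.card) → L}
    (hj : Function.Injective j) (hS : S.card ≤ n) : ∃ j' : Fin n → Fin q ⊕ L,
      Function.Injective j' ∧ (∀ b, b ∈ S ↔ ∃ l, j' l = Sum.inl b) ∧
      (∀ b, (∃ l, j l = b) ↔ ∃ l, j' l = Sum.inr b) ∧
      ∀ (g : (Fin n → Z) → ℝ) (z : Fin q → Z) (w : L → Z),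
        fixVariables g S z (w ∘ j) = g (Sum.elim z w ∘ j') := by
  let j' : Fin n → Fin q ⊕ L := fun l =>
    if h : l.1 < S.card then Sum.inl (S.orderEmbOfFin rfl ⟨l.1, h⟩)
    else Sum.inr (j ⟨l.1 - S.card, by omega⟩)
  have h1 : ∀ l (h : l.1 < S.card), j' l = Sum.inl (S.orderEmbOfFin rfl ⟨l.1, h⟩) :=
    fun l h => dif_pos h
  have h2 : ∀ l (h : ¬ l.1 < S.card), j' l = Sum.inr (j ⟨l.1 - S.card, by omega⟩) :=
    fun l h => dif_neg h
  refine ⟨j', fun l l' h => ?_, fun b => ⟨fun hb => ?_, ?_⟩, fun b => ⟨?_, ?_⟩, fun g z w => ?_⟩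
  · by_cases hl : l.1 < S.card <;> by_cases hl' : l'.1 < S.card
    · rw [h1 l hl, h1 l' hl', Sum.inl.injEq, (S.orderEmbOfFin rfl).injective.eq_iff,
        Fin.mk.injEq] at h
      exact Fin.ext h
    · rw [h1 l hl, h2 l' hl'] at h
      cases h
    · rw [h2 l hl, h1 l' hl'] at h
      cases h
    · rw [h2 l hl, h2 l' hl', Sum.inr.injEq, hj.eq_iff, Fin.mk.injEq] at h
      exact Fin.ext (by omega)
  · have h3 : b ∈ Set.range (S.orderEmbOfFin rfl) := by
      rw [Finset.range_orderEmbOfFin]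
      exact hb
    obtain ⟨x, rfl⟩ := h3
    exact ⟨⟨x.1, x.2.trans_le hS⟩, h1 _ x.2⟩
  · rintro ⟨l, hl⟩
    by_cases h : l.1 < S.card
    · rw [h1 l h, Sum.inl.injEq] at hl
      rw [← hl]
      exact S.orderEmbOfFin_mem rfl _
    · rw [h2 l h] at hl
      cases hl
  · rintro ⟨l, rfl⟩
    refine ⟨⟨l.1 + S.card, by omega⟩, ?_⟩
    rw [h2 _ (by simp)]
    simp
  · rintro ⟨l, hl⟩
    by_cases h : l.1 < S.card
    · rw [h1 l h] at hl
      cases hl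
    · rw [h2 l h, Sum.inr.injEq] at hl
      exact ⟨_, hl⟩
  · refine congrArg g (funext fun l => ?_)
    rw [Function.comp_apply]
    by_cases h : l.1 < S.card
    · rw [h1 l h, dif_pos h, Sum.elim_inl]
    · rw [h2 l h, dif_neg h, Sum.elim_inr, Function.comp_apply]

lemma integrable_power_zero (g : (Fin 0 → Z) → ℝ) : Integrable g (power μ 0) := by
  have h : g = fun _ => g Fin.elim0 := funext fun z => congrArg g (Subsingleton.elim _ _)
  have : IsFiniteMeasure (power μ 0) := by
    rw [power, Measure.pi_of_empty]
    infer_instance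
  rw [h]
  exact integrable_const _

variable [SigmaFinite μ] {m : ℕ} {k : Fin m → ℕ} {f : (i : Fin m) → (Fin (k i) → Z) → ℝ}
  {t : Fin m → Multiset Z → ℝ}

lemma ae_ae_kernel_eq (q : ℕ)
    (hf : ∀ i, ∀ᵐ z ∂(power μ (k i)), t i (config z) = (k i).factorial * f i z) :
    ∀ᵐ z ∂(power μ q), ∀ r : ℕ, ∀ᵐ w ∂(power μ r), ∀ i (j : Fin (k i) → Fin q ⊕ Fin r),
      Function.Injective j →
        t i (config (Sum.elim z w ∘ j)) = (k i).factorial * f i (Sum.elim z w ∘ j) :=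
  ae_all_iff.2 fun _ => ae_ae_of_ae_sum (ae_kernel_eq hf)

lemma card_positions {Y : Type*} {q : ℕ} (W : Fin q → CellIndex (Fin m)) (z : Fin q → Y)
    (i : Fin m) : (positions (fun l => (W l).1) i).card = (ev W z i).card := by
  rw [card_ev, positions]

/-- The local integrability condition, in terms of words. -/
theorem ConditionALoc.ae_wordIntegrable (hA : ConditionALoc μ k f)
    (ht : ∀ i s, s.card ≠ k i → t i s = 0)
    (hf : ∀ i, ∀ᵐ z ∂(power μ (k i)), t i (config z) = (k i).factorial * f i z) {q : ℕ} (hq1 : 1 ≤ q) (hqK : q < ∑ i, k i) :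
    ∀ᵐ z ∂(power μ q), ∀ W₀ : Fin q → CellIndex (Fin m),
      WordIntegrable μ fun i s => t i (ev W₀ z i + s) := by
  have h1 : ∀ᵐ z ∂(power μ q), ∀ W₀ : Fin q → CellIndex (Fin m),
      (∀ i, (positions (fun l => (W₀ l).1) i).card ≤ k i) →
        ConditionA μ (fun i => k i - (positions (fun l => (W₀ l).1) i).card)
          (fun i => fixVariables (f i) (positions (fun l => (W₀ l).1) i) z) := by
    refine ae_all_iff.2 fun W₀ => ?_
    by_cases h : ∀ i, (positions (fun l => (W₀ l).1) i).card ≤ k i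
    · filter_upwards [hA q hq1 hqK (fun l => (W₀ l).1) (fun l => (W₀ l).2) h] with z hz _ using hz
    · exact ae_of_all _ fun z h' => absurd h' h
  filter_upwards [h1, ae_ae_kernel_eq q hf] with z hz hz' W₀ r W
  -- If some row does not receive exactly `k_i` points, fixed and integrated ones together, the
  -- integrand is zero.
  by_cases hc : ∃ i, (positions (fun l => (W₀ l).1) i).card +
      (Finset.univ.filter fun b => i ∈ (W b).1).card ≠ k i
  · obtain ⟨i, hi⟩ := hc
    have h2 : ∀ w : Fin r → Z, ∏ i, t i (ev W₀ z i + ev W w i) = 0 := fun w =>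
      Finset.prod_eq_zero (Finset.mem_univ i) (ht i _ (by
        rwa [Multiset.card_add, ← card_positions, card_ev]))
    simp [h2]
  push Not at hc
  have hcW : ∀ i, (Finset.univ.filter fun b => i ∈ (W b).1).card =
      k i - (positions (fun l => (W₀ l).1) i).card := fun i => by
    rw [← hc i, Nat.add_sub_cancel_left]
  rcases hz W₀ fun i => by rw [← hc i]; exact Nat.le_add_right _ _ with h0 | ⟨-, h0⟩
  -- All the variables are already fixed, so no non-empty letter can remain.
  · have hr : r = 0 := by
      by_contra hr
      have l : Fin r := ⟨0, Nat.pos_of_ne_zero hr⟩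
      obtain ⟨i, hi⟩ := (W l).2
      have h2 := hcW i
      have h0' : k i - (positions (fun l => (W₀ l).1) i).card = 0 := h0 i
      rw [h0', Finset.card_eq_zero] at h2
      exact absurd (Finset.mem_filter.2 ⟨Finset.mem_univ l, hi⟩) (h2 ▸ Finset.notMem_empty l)
    subst hr
    exact integrable_power_zero _
  -- The remaining word comes from a labelled non-flat diagram `σ` of the sections, and the product
  -- along the word is, up to the factorials, the tensor product of the sections with variables
  -- identified by `σ`.
  · obtain ⟨J, hJ⟩ := exists_labelling hcW
    obtain ⟨σ, hσ, ε, hε⟩ := exists_diagram J.2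
    choose j hj hj1 hj2 hj3 using fun i => exists_fixVariables_eq (Z := Z)
      (positions (fun l => (W₀ l).1) i) (n := k i) (J.2.1 i)
      (by rw [← hc i]; exact Nat.le_add_right _ _)
    have h2 := ((measurePreserving_comp_equiv (μ := μ) ε).integrable_comp (h0 σ hσ).1).2 (h0 σ hσ)
    refine (h2.const_mul (∏ i, ((k i).factorial : ℝ))).congr ?_
    filter_upwards [hz' r] with w hw
    have h3 : identify (fun i => k i - (positions (fun l => (W₀ l).1) i).card)
        (fun i => fixVariables (f i) (positions (fun l => (W₀ l).1) i) z) σ (w ∘ ε) =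
        ∏ i, fixVariables (f i) (positions (fun l => (W₀ l).1) i) z (w ∘ J.1 i) := by
      rw [identify, tensor]
      refine Finset.prod_congr rfl fun i _ =>
        congrArg (fixVariables (f i) (positions (fun l => (W₀ l).1) i) z) (funext fun l => ?_)
      rw [Function.comp_apply, Function.comp_apply, hε]
      rfl
    rw [Function.comp_apply, h3, ← Finset.prod_mul_distrib]
    refine Finset.prod_congr rfl fun i _ => ?_
    rw [hj3, ← hw i _ (hj i), ← ev_sumElim, config_comp_eq_ev (hj i) (W := Sum.elim W₀ W)]
    rintro (b | b)
    · rw [← hj1 i b]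
      simp [positions]
    · have h4 := mem_word (J := J) (b := b) (i := i)
      rw [hJ] at h4
      rw [← hj2 i b]
      exact h4

/-- The means of the add-one costs of a product of multiple integrals. -/
theorem ae_meanCosts_prod (hQ : IsPoissonLaw Q μ) {ψ : Fin m → Measure Z → ℝ}
    (h : ∀ i, HasKernel Q μ (k i) (t i) (ψ i)) {φ : Measure Z → ℝ} (hφ : Measurable φ)
    (hφψ : φ =ᵐ[Q] fun χ => ∏ i, ψ i χ) {q : ℕ}
    (hW : ∀ᵐ z ∂(power μ q), ∀ W₀ : Fin q → CellIndex (Fin m),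
      WordIntegrable μ fun i s => t i (ev W₀ z i + s)) :
    ∀ᵐ z ∂(power μ q), Integrable (addCosts (config z) φ) Q ∧
      meanCosts Q φ (config z) = ∑ W₀ : Fin q → CellIndex (Fin m),
        moment μ 0 (∑ i, k i) fun i s => t i (ev W₀ z i + s) := by
  have hψ : Measurable fun χ => ∏ i, ψ i χ := Finset.measurable_prod _ fun i _ => (h i).measurable
  filter_upwards [ae_addCosts_congr hQ hφ hψ hφψ q, ae_hasKernel_addCosts hQ h q, hW]
    with z h1 h2 h3
  have h4 : addCosts (config z) φ =ᵐ[Q] fun χ => ∑ W₀ : Fin q → CellIndex (Fin m),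
      ∏ i, addCosts (ev W₀ z i) (ψ i) χ := by
    filter_upwards [h1] with χ hχ
    rw [hχ, addCosts_prod]
  have h5 := fun W₀ => integral_prod hQ (N := ∑ i, k i)
    (Finset.sum_le_sum fun i _ => Nat.sub_le _ _) (h2 W₀) (h3 W₀)
  refine ⟨(integrable_congr h4).2 (integrable_finsetSum _ fun W₀ _ => (h5 W₀).1), ?_⟩
  rw [meanCosts, integral_congr_ae h4, integral_finsetSum _ fun W₀ _ => (h5 W₀).1]
  exact Finset.sum_congr rfl fun W₀ _ => (h5 W₀).2

/-! ### Integrated diagrams -/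

lemma splitKernel_comp {q r : ℕ} {σ : Diagram k} {A : Finset (Finset (Fin (∑ i, k i)))}
    (f : (i : Fin m) → (Fin (k i) → Z) → ℝ) (e : FreeBlock σ A ≃ Fin q)
    (e' : IntegratedBlock σ A ≃ Fin r) (z : Fin q → Z) (w : Fin r → Z) :
    splitKernel k f σ A (fun b => z (e b)) (w ∘ e') =
      ∏ i, f i (Sum.elim z w ∘ fun l => joinLabels e e' (blockOf σ i l)) := by
  rw [splitKernel, identify, tensor]
  refine Finset.prod_congr rfl fun i _ => congrArg (f i) (funext fun l => ?_)
  change (if hb : (blockOf σ i l).1 ∈ A ∪ singletons σ then z (e ⟨blockOf σ i l, hb⟩)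
    else w (e' ⟨blockOf σ i l, hb⟩)) = Sum.elim z w (joinLabels e e' (blockOf σ i l))
  by_cases hb : (blockOf σ i l).1 ∈ A ∪ singletons σ
  · rw [dif_pos hb, joinLabels_of_mem e e' ⟨_, hb⟩, Sum.elim_inl]
  · rw [dif_neg hb, joinLabels_of_notMem e e' ⟨_, hb⟩, Sum.elim_inr]

lemma card_freeBlock {σ : Diagram k} {A : Finset (Finset (Fin (∑ i, k i)))}
    (hA : A ⊆ bigBlocks σ) : Fintype.card (FreeBlock σ A) = A.card + (singletons σ).card := by
  have h1 : ∀ b, b ∈ A ∪ singletons σ → b ∈ σ.parts := fun b hb => by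
    rcases Finset.mem_union.1 hb with hb | hb
    · exact (Finset.mem_filter.1 (hA hb)).1
    · exact (Finset.mem_filter.1 hb).1
  rw [Fintype.card_congr (Equiv.subtypeSubtypeEquivSubtype fun {b} => h1 b), Fintype.card_coe,
    Finset.card_union_of_disjoint]
  exact Finset.disjoint_left.2 fun b hb => notMem_singletons_of_mem_bigBlocks (hA hb)

lemma card_add_card_integratedBlock (σ : Diagram k) (A : Finset (Finset (Fin (∑ i, k i)))) :
    Fintype.card (FreeBlock σ A) + Fintype.card (IntegratedBlock σ A) ≤ ∑ i, k i := by
  have h1 := Fintype.card_congr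
    (Equiv.sumCompl fun b : {b // b ∈ σ.parts} => b.1 ∈ A ∪ singletons σ)
  rw [Fintype.card_sum] at h1
  refine h1.le.trans ?_
  rw [Fintype.card_coe]
  simpa using σ.card_parts_le_card

/-- The integrals in the definition of the diagram kernels converge absolutely. -/
theorem ConditionALoc.ae_integrable_splitKernel (hA : ConditionALoc μ k f)
    (ht : ∀ i s, s.card ≠ k i → t i s = 0)
    (hf : ∀ i, ∀ᵐ z ∂(power μ (k i)), t i (config z) = (k i).factorial * f i z) {σ : Diagram k} (hσ : IsNonFlat k σ)
    {A : Finset (Finset (Fin (∑ i, k i)))} (hAσ : A ⊆ bigBlocks σ)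
    (hq : 1 ≤ A.card + (singletons σ).card) :
    ∀ᵐ x ∂(Measure.pi fun _ : FreeBlock σ A => μ),
      Integrable (splitKernel k f σ A x) (Measure.pi fun _ : IntegratedBlock σ A => μ) := by
  have e := Fintype.equivFinOfCardEq (card_freeBlock hAσ)
  have e' := Fintype.equivFin (IntegratedBlock σ A)
  generalize hr : Fintype.card (IntegratedBlock σ A) = r at e'
  generalize hq' : A.card + (singletons σ).card = q at e hq
  have h1 : ∀ᵐ z ∂(power μ q), Integrable (fun w : Fin r → Z =>
      ∏ i, f i (Sum.elim z w ∘ fun l => joinLabels e e' (blockOf σ i l))) (power μ r) := by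
    rcases lt_or_ge q (∑ i, k i) with hqK | hqK
    · filter_upwards [hA.ae_wordIntegrable ht hf hq hqK, ae_ae_kernel_eq q hf] with z h2 h3
      let J : {J : (i : Fin m) → Fin (k i) → Fin q ⊕ Fin r // IsLabelling k J} :=
        ⟨_, isLabelling_blockOf hσ (joinLabels e e')⟩
      have h4 := (h2 (word J ∘ Sum.inl) r (word J ∘ Sum.inr)).const_mul
        (∏ i, ((k i).factorial : ℝ))⁻¹
      refine h4.congr ?_
      filter_upwards [h3 r] with w hw
      rw [inv_mul_eq_iff_eq_mul₀ (Finset.prod_ne_zero_iff.2 fun i _ => by positivity),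
        ← Finset.prod_mul_distrib]
      refine Finset.prod_congr rfl fun i _ => ?_
      rw [← hw i _ (J.2.1 i), config_comp_labelling J, ← ev_sumElim, Sum.elim_comp_inl_inr]
    -- The local condition only concerns `q < K`; for `q ≥ K` there is no block left to integrate.
    · have h2 := card_add_card_integratedBlock σ A
      rw [card_freeBlock hAσ] at h2
      obtain rfl : r = 0 := by omega
      exact ae_of_all _ fun z => integrable_power_zero _
  have h2 := (measurePreserving_comp_equiv (μ := μ) e.symm).quasiMeasurePreserving.ae h1
  filter_upwards [h2] with x hx
  simp_rw [← splitKernel_comp] at hx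
  have h3 := (measurePreserving_comp_equiv (μ := μ) e'.symm).integrable_comp_of_integrable hx
  refine h3.congr (ae_of_all _ fun y => ?_)
  simp [Function.comp_def]

/-! ### The diagram kernels -/

/-- At weight zero, exactly the words without integrated singleton letters survive; this is where
the restriction to integrated blocks of size at least two comes from. -/
lemma prod_weight_word {q r : ℕ}
    (J : {J : (i : Fin m) → Fin (k i) → Fin q ⊕ Fin r // IsLabelling k J}) :
    ∏ x, weight 0 (word J (Sum.inr x)).1 =
      if ∀ x, 2 ≤ (word J (Sum.inr x)).1.card then 1 else 0 := by
  split_ifs with h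
  · refine Finset.prod_eq_one fun x _ => if_neg ?_
    have := h x
    omega
  · push Not at h
    obtain ⟨x, hx⟩ := h
    refine Finset.prod_eq_zero (Finset.mem_univ x) (if_pos ?_)
    have := (word J (Sum.inr x)).2.card_pos
    omega

-- The fixed word and the integrated word are concatenated into a word over `Fin q ⊕ Fin r`. The `∏
-- k_i!` labelled diagrams of each word cancel the factorials in the kernels, and a labelled diagram
-- is a diagram with separately numbered free and integrated blocks.
open Classical in
lemma sum_wordSum_eq {q r : ℕ} (ht : ∀ i s, s.card ≠ k i → t i s = 0) {z : Fin q → Z}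
    (hz : ∀ᵐ w ∂(power μ r), ∀ i (j : Fin (k i) → Fin q ⊕ Fin r), Function.Injective j →
      t i (config (Sum.elim z w ∘ j)) = (k i).factorial * f i (Sum.elim z w ∘ j)) :
    ∑ W₀ : Fin q → CellIndex (Fin m), wordSum μ 0 r (fun i s => t i (ev W₀ z i + s)) =
      ∑ σ ∈ (Finset.univ : Finset (Diagram k)).filter (IsNonFlat k),
        ∑ A ∈ (bigBlocks σ).powerset, ∑ e : FreeBlock σ A ≃ Fin q,
          Fintype.card (IntegratedBlock σ A ≃ Fin r) *
            ∫ y, splitKernel k f σ A (fun b => z (e b)) y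
              ∂(Measure.pi fun _ : IntegratedBlock σ A => μ) := by
  let F : (Fin q ⊕ Fin r → CellIndex (Fin m)) → ℝ := fun W =>
    (∏ x, weight 0 (W (Sum.inr x)).1) * ∫ w, ∏ i, t i (ev W (Sum.elim z w) i) ∂(power μ r)
  let c : ℝ := ∏ i, ((k i).factorial : ℝ)
  have hc : c ≠ 0 := Finset.prod_ne_zero_iff.2 fun i _ => by positivity
  let G : ((i : Fin m) → Fin (k i) → Fin q ⊕ Fin r) → ℝ := fun J =>
    ∫ w, ∏ i, f i (Sum.elim z w ∘ J i) ∂(power μ r)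
  have h1 : ∑ W₀ : Fin q → CellIndex (Fin m), wordSum μ 0 r (fun i s => t i (ev W₀ z i + s)) =
      ∑ W, F W := by
    rw [← (Equiv.sumArrowEquivProdArrow (Fin q) (Fin r) (CellIndex (Fin m))).symm.sum_comp,
      Fintype.sum_prod_type]
    refine Finset.sum_congr rfl fun W₀ _ => Finset.sum_congr rfl fun W _ => ?_
    have h2 : (Equiv.sumArrowEquivProdArrow (Fin q) (Fin r) (CellIndex (Fin m))).symm (W₀, W) =
      Sum.elim W₀ W := rfl
    simp only [F, h2, ev_sumElim, Sum.elim_inr]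
  have h2 : ∀ J : {J : (i : Fin m) → Fin (k i) → Fin q ⊕ Fin r // IsLabelling k J},
      F (word J) = c * ((if ∀ x, 2 ≤ (word J (Sum.inr x)).1.card then 1 else 0) * G J.1) :=
    fun J => by
    have h3 : ∫ w, ∏ i, t i (ev (word J) (Sum.elim z w) i) ∂(power μ r) = c * G J.1 := by
      rw [← integral_const_mul]
      refine integral_congr_ae ?_
      filter_upwards [hz] with w hw
      rw [← Finset.prod_mul_distrib]
      refine Finset.prod_congr rfl fun i _ => ?_
      rw [← hw i _ (J.2.1 i), config_comp_labelling J]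
    simp only [F]
    rw [prod_weight_word, h3]
    ring
  have h3 := sum_word (k := k) F fun W ⟨i, hi⟩ => by
    have : ∀ w : Fin r → Z, ∏ i, t i (ev W (Sum.elim z w) i) = 0 := fun w =>
      Finset.prod_eq_zero (Finset.mem_univ i) (ht i _ (by rwa [card_ev]))
    simp [F, this]
  -- The extension by zero makes the summand a function of all families of maps, as `sum_diagram`
  -- requires.
  let G' : ((i : Fin m) → Fin (k i) → Fin q ⊕ Fin r) → ℝ := fun J =>
    if hJ : IsLabelling k J then
      (if ∀ x, 2 ≤ (word ⟨J, hJ⟩ (Sum.inr x)).1.card then 1 else 0) * G J else 0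
  have h4 : ∀ J : {J : (i : Fin m) → Fin (k i) → Fin q ⊕ Fin r // IsLabelling k J},
      F (word J) = c * G' J.1 := fun J => by
    simp only [G']
    rw [h2, dif_pos J.2]
  rw [h1]
  refine mul_left_cancel₀ hc (h3.symm.trans ?_)
  simp_rw [h4]
  rw [← Finset.mul_sum, sum_diagram G']
  congr 1
  refine Finset.sum_congr rfl fun σ hσ => ?_
  have hσ' := (Finset.mem_filter.1 hσ).2
  have h5 : ∀ ε : {b // b ∈ σ.parts} ≃ Fin q ⊕ Fin r, G' (fun i l => ε (blockOf σ i l)) =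
      if ∀ x, 2 ≤ (ε.symm (Sum.inr x)).1.card then G fun i l => ε (blockOf σ i l) else 0 :=
    fun ε => by
    simp only [G']
    rw [dif_pos (isLabelling_blockOf hσ' ε)]
    simp only [card_word_blockOf hσ' ε, ite_mul, one_mul, zero_mul]
  simp_rw [h5]
  rw [sum_joinLabels q r σ fun ε => G fun i l => ε (blockOf σ i l)]
  refine Finset.sum_congr rfl fun A _ => Finset.sum_congr rfl fun e _ => ?_
  have h6 : ∀ e' : IntegratedBlock σ A ≃ Fin r, G (fun i l => joinLabels e e' (blockOf σ i l)) =
      ∫ y, splitKernel k f σ A (fun b => z (e b)) y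
        ∂(Measure.pi fun _ : IntegratedBlock σ A => μ) := fun e' => by
    let E : (Fin r → Z) ≃ᵐ (IntegratedBlock σ A → Z) :=
      (MeasurableEquiv.piCongrLeft (fun _ : Fin r => Z) e').symm
    have h7 : MeasurePreserving (E : (Fin r → Z) → IntegratedBlock σ A → Z) (power μ r)
        (Measure.pi fun _ => μ) := measurePreserving_comp_equiv (μ := μ) e'
    rw [← h7.integral_comp E.measurableEmbedding]
    refine integral_congr_ae (ae_of_all _ fun w => ?_)
    exact (splitKernel_comp f e e' z w).symm
  simp_rw [h6]
  rw [Finset.sum_const, Finset.card_univ, nsmul_eq_mul]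

open Classical in
/-- The diagram kernels, in terms of the moments of the shifted kernels. -/
theorem ae_sum_moment_eq (ht : ∀ i s, s.card ≠ k i → t i s = 0)
    (hf : ∀ i, ∀ᵐ z ∂(power μ (k i)), t i (config z) = (k i).factorial * f i z) (q : ℕ) :
    ∀ᵐ z ∂(power μ q), ∑ W₀ : Fin q → CellIndex (Fin m),
      moment μ 0 (∑ i, k i) (fun i s => t i (ev W₀ z i + s)) =
        q.factorial * diagramKernel μ k f q z := by
  filter_upwards [ae_ae_kernel_eq q hf] with z hz
  simp only [moment]
  rw [Finset.sum_comm]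
  simp_rw [← Finset.mul_sum, sum_wordSum_eq ht (hz _), Finset.mul_sum]
  rw [Finset.sum_comm, diagramKernel, Finset.mul_sum]
  refine Finset.sum_congr rfl fun σ _ => ?_
  rw [Finset.sum_comm, Finset.mul_sum, Finset.sum_filter]
  refine Finset.sum_congr rfl fun A hA => ?_
  rw [Finset.mem_powerset] at hA
  rw [Finset.sum_comm]
  split_ifs with hq
  · rw [H, mul_inv_cancel_left₀ (by positivity)]
    refine Finset.sum_congr rfl fun e _ => ?_
    -- Only the length `r` equal to the number of integrated blocks contributes, and their `r!`
    -- numberings cancel the factor `1/r!` in `moment`.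
    rw [Finset.sum_eq_single (Fintype.card (IntegratedBlock σ A))]
    · rw [Fintype.card_equiv (Fintype.equivFin _), ← mul_assoc, inv_mul_cancel₀ (by positivity),
        one_mul]
    · intro r _ hr
      have : IsEmpty (IntegratedBlock σ A ≃ Fin r) :=
        ⟨fun e' => hr (by simpa using (Fintype.card_congr e').symm)⟩
      simp
    · intro h
      have := card_add_card_integratedBlock σ A
      simp only [Finset.mem_range] at h
      omega
  · have : IsEmpty (FreeBlock σ A ≃ Fin q) :=
      ⟨fun e => hq (by rw [← card_freeBlock hA, Fintype.card_congr e, Fintype.card_fin])⟩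
    simp

end

/-! ### Passage from the law of `η` to random variables. -/

section

variable {Ω Z : Type*} [MeasurableSpace Ω] [MeasurableSpace Z] {P : Measure Ω}
  [IsProbabilityMeasure P] {μ : Measure Z} [SigmaFinite μ] {η : Ω → Measure Z}

/-! ### Products of multiple integrals -/

lemma IsRepresentative.memLp_iff (hη : Measurable η) {F : Ω → ℝ} {φ : Measure Z → ℝ}
    (hφ : IsRepresentative η P F φ) : MemLp F 2 P ↔ MemLp φ 2 (P.map η) := by
  rw [memLp_congr_ae hφ.2,
    memLp_map_measure_iff hφ.1.aestronglyMeasurable hη.aemeasurable]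
  rfl

lemma hasSquareIntegrableMeanCosts_iff (hη : Measurable η) {φ : Measure Z → ℝ}
    (hφ : Measurable φ) {K : ℕ} : HasSquareIntegrableMeanCosts η μ P φ K ↔
      ∀ q, 1 ≤ q → q < K → (∀ᵐ z ∂(power μ q), Integrable (addCosts (config z) φ) (P.map η)) ∧
        MemLp (fun z => meanCosts (P.map η) φ (config z)) 2 (power μ q) := by
  have h1 : ∀ w : Multiset Z, Integrable (addCosts w φ) (P.map η) ↔
      Integrable (fun ω => addCosts w φ (η ω)) P := fun w =>
    integrable_map_measure (measurable_addCosts_right hφ w).aestronglyMeasurable hη.aemeasurable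
  have h2 : ∀ w : Multiset Z, meanCosts (P.map η) φ w = ∫ ω, addCosts w φ (η ω) ∂P := fun w =>
    integral_map hη.aemeasurable (measurable_addCosts_right hφ w).aestronglyMeasurable
  simp only [HasSquareIntegrableMeanCosts, iteratedAddOneCost_eq, h1, h2]

variable {m : ℕ} {k : Fin m → ℕ} {f : (i : Fin m) → (Fin (k i) → Z) → ℝ}

lemma exists_hasKernel_family (hη : IsPoissonRandomMeasure η μ P)
    (hf : ∀ i, MemLp (f i) 2 (power μ (k i))) (hsym : ∀ i, IsAESymmetric μ (f i)) :
    ∃ (t : Fin m → Multiset Z → ℝ) (ψ : Fin m → Measure Z → ℝ),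
      (∀ i, HasKernel (P.map η) μ (k i) (t i) (ψ i)) ∧
      IsRepresentative η P (productOfIntegrals η μ P k f) (fun χ => ∏ i, ψ i χ) ∧
      ∀ i, ∀ᵐ z ∂(power μ (k i)), t i (config z) = (k i).factorial * f i z := by
  choose t ψ h1 h2 h3 using fun i =>
    (isMultipleIntegral_multipleIntegral hη (hf i)).exists_hasKernel hη (hf i)
  refine ⟨t, ψ, h1, ⟨Finset.measurable_prod _ fun i _ => (h1 i).measurable, ?_⟩, fun i => ?_⟩
  · filter_upwards [ae_all_iff.2 h2] with ω hω
    exact Finset.prod_congr rfl fun i _ => hω i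
  · filter_upwards [h3 i, (hsym i).sym_ae_eq] with z h4 h5
    rw [h4, h5]

end

end PoissonChaos

end

theorem theorem1p2 {Ω Z : Type*} [MeasurableSpace Ω] [MeasurableSpace Z]
    (P : Measure Ω) [IsProbabilityMeasure P] (μ : Measure Z) [SigmaFinite μ]
    (η : Ω → Measure Z) (hη : PoissonChaos.IsPoissonRandomMeasure η μ P)
    {m : ℕ} (hm : 2 ≤ m) (k : Fin m → ℕ) (hk : ∀ i, 1 ≤ k i)
    (f : (i : Fin m) → (Fin (k i) → Z) → ℝ)
    (hf : ∀ i, MemLp (f i) 2 (PoissonChaos.power μ (k i)))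
    (hsym : ∀ i, PoissonChaos.IsAESymmetric μ (f i)) :
    let Φ : Ω → ℝ := PoissonChaos.productOfIntegrals η μ P k f
    let K : ℕ := ∑ i, k i
    -- the integrals exist, and their product has a representative
    (∀ i, PoissonChaos.IsMultipleIntegral η μ P (f i)
      (PoissonChaos.multipleIntegral η μ P (f i))) ∧
    (∃ φ, PoissonChaos.IsRepresentative η P Φ φ) ∧
    -- square-integrability in terms of add-one costs, whatever the representative
    (∀ φ, PoissonChaos.IsRepresentative η P Φ φ →
      (MemLp Φ 2 P ↔ PoissonChaos.HasSquareIntegrableMeanCosts η μ P φ K)) ∧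
    -- the finite chaos expansion and its top kernel
    (MemLp Φ 2 P →
      (∃ h, PoissonChaos.IsChaosExpansion η μ P Φ K h) ∧
      ∀ h, PoissonChaos.IsChaosExpansion η μ P Φ K h →
        h K =ᵐ[PoissonChaos.power μ K] PoissonChaos.sym (PoissonChaos.tensor k f)) ∧
    -- the local integrability condition and the diagram kernels
    (PoissonChaos.ConditionALoc μ k f →
      -- the integrals that define the kernels `h_q` converge absolutely
      (∀ σ : PoissonChaos.Diagram k, PoissonChaos.IsNonFlat k σ →
        ∀ A ⊆ PoissonChaos.bigBlocks σ, 1 ≤ A.card + (PoissonChaos.singletons σ).card →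
          ∀ᵐ x ∂(Measure.pi fun _ : PoissonChaos.FreeBlock σ A => μ),
            Integrable (PoissonChaos.splitKernel k f σ A x)
              (Measure.pi fun _ : PoissonChaos.IntegratedBlock σ A => μ)) ∧
      -- square-integrability in terms of the diagram kernels
      (MemLp Φ 2 P ↔ ∀ q, 1 ≤ q → q < K →
        MemLp (PoissonChaos.diagramKernel μ k f q) 2 (PoissonChaos.power μ q)) ∧
      -- the kernels of the chaos expansion
      (MemLp Φ 2 P → ∀ h, PoissonChaos.IsChaosExpansion η μ P Φ K h → ∀ q, 1 ≤ q → q < K →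
        h q =ᵐ[PoissonChaos.power μ q] PoissonChaos.diagramKernel μ k f q)) := by
  intro Φ K
  have hη' := hη.measurable
  have hQ := hη.isPoissonLaw
  have := hQ.prob
  obtain ⟨t, ψ, h1, hφ₀, h3⟩ := PoissonChaos.exists_hasKernel_family hη hf hsym
  have hK : 1 ≤ K := by
    -- One row already gives `K ≥ 1`, which is all that the descent in the order needs.
    have i : Fin m := ⟨0, by omega⟩
    exact (hk i).trans (Finset.single_le_sum (fun _ _ => Nat.zero_le _) (Finset.mem_univ i))
  have hφψ : ∀ φ, PoissonChaos.IsRepresentative η P Φ φ → φ =ᵐ[P.map η] fun χ => ∏ i, ψ i χ :=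
    fun φ hφ => (PoissonChaos.ae_map_eq_iff hη' hφ.1 hφ₀.1).2 (hφ.2.symm.trans hφ₀.2)
  have hcosts := PoissonChaos.memLp_iff_meanCosts hQ h1 hf h3 hφ₀.1 Filter.EventuallyEq.rfl hK
  refine ⟨fun i => PoissonChaos.isMultipleIntegral_multipleIntegral hη (hf i), ⟨_, hφ₀⟩,
    fun φ hφ => ?_, fun h2 => ⟨?_, fun h hh => ?_⟩, fun hA => ⟨fun σ hσ A hAσ hq => ?_, ?_⟩⟩
  · rw [PoissonChaos.hasSquareIntegrableMeanCosts_iff hη' hφ.1, hφ.memLp_iff hη']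
    exact PoissonChaos.memLp_iff_meanCosts hQ h1 hf h3 hφ.1 (hφψ φ hφ) hK
  · exact PoissonChaos.exists_isChaosExpansion hη hφ₀ ((hφ₀.memLp_iff hη').1 h2) fun n hn =>
      PoissonChaos.ae_meanCosts_eq_zero hQ h1 hφ₀.1 Filter.EventuallyEq.rfl hn
  · filter_upwards [hh.ae_meanCosts_eq hη hφ₀ hK le_rfl,
      PoissonChaos.ae_meanCosts_top hQ h1 h3 hφ₀.1 Filter.EventuallyEq.rfl] with z h4 h5
    rw [PoissonChaos.meanCosts, integral_congr_ae h5, integral_const, probReal_univ, one_smul] at h4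
    exact (mul_left_cancel₀ (Nat.cast_ne_zero.2 (Nat.factorial_ne_zero _)) h4).symm
  · exact hA.ae_integrable_splitKernel (fun i => (h1 i).eq_zero) h3 hσ hAσ hq
  -- The core of Part II: under the local condition the costs are integrable and `E D^{(q)} Φ = q!
  -- h_q`. So (ii) reduces to (iii), and comparison with the mean costs of an expansion identifies
  -- its kernels.
  · have h4 : ∀ q, 1 ≤ q → q < K → ∀ᵐ z ∂(PoissonChaos.power μ q),
        Integrable (PoissonChaos.addCosts (PoissonChaos.config z) fun χ => ∏ i, ψ i χ) (P.map η) ∧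
        PoissonChaos.meanCosts (P.map η) (fun χ => ∏ i, ψ i χ) (PoissonChaos.config z) =
          q.factorial * PoissonChaos.diagramKernel μ k f q z := fun q hq1 hqK => by
      filter_upwards [PoissonChaos.ae_meanCosts_prod hQ h1 hφ₀.1 Filter.EventuallyEq.rfl
        (hA.ae_wordIntegrable (fun i => (h1 i).eq_zero) h3 hq1 hqK),
        PoissonChaos.ae_sum_moment_eq (fun i => (h1 i).eq_zero) h3 q] with z h5 h6
      exact ⟨h5.1, h5.2.trans h6⟩
    refine ⟨?_, fun h2 h hh q hq1 hqK => ?_⟩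
    · rw [hφ₀.memLp_iff hη', hcosts]
      refine forall_congr' fun q => forall_congr' fun hq1 => forall_congr' fun hqK => ?_
      rw [and_iff_right ((h4 q hq1 hqK).mono fun _ h => h.1),
        memLp_congr_ae ((h4 q hq1 hqK).mono fun _ h => h.2)]
      refine ⟨fun h => ?_, fun h => h.const_mul _⟩
      have h5 := h.const_mul (q.factorial : ℝ)⁻¹
      simpa only [inv_mul_cancel_left₀ (Nat.cast_ne_zero (R := ℝ).2 q.factorial_ne_zero)] using h5
    · filter_upwards [hh.ae_meanCosts_eq hη hφ₀ hq1 hqK.le, h4 q hq1 hqK] with z h5 h6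
      exact mul_left_cancel₀ (Nat.cast_ne_zero.2 (Nat.factorial_ne_zero _)) (h5.symm.trans h6.2)
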